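/- Let $(V,\omega)$ be a real symplectic vector space of dimension $2n$ with a compatible complex structure $J$, so that $g(v,w)=\omega(v,Jw)$ is a Euclidean inner product; equivalently, $V$ is a complex Hermitian vector space of dimension $n$, with $g$ and $\omega$ the real and imaginary parts of the inner product (linear in the second variable) and $J=i$. Let $U=U(V)\cong U(n)$. Identify $V^*=V$ via $g$, and let $U$ act on functions by $(uf)(x)=f(u^{-1}x)$. For $\lambda\neq 0$ let $\#_\lambda$ be the Moyal product on Schwartz functions, $$(f\#_\lambda g)(x)=\frac{1}{(\lambda\pi)^{2n}}\iint e^{\frac{2i}{\lambda}\omega(a,b)}f(x+a)\,g(x+b)\,da\,db ,$$ so that linear functions satisfy $[v,w]_{\#_\lambda}=i\lambda\,\omega(v,w)$. Let $C^*(V,\lambda\omega)$ be the $C^*$-completion of the Schwartz functions with this product, i.e. the norm closure of the operators of left multiplication $f\#_\lambda(\cdot)$ on $L^2(V)$. For $\lambda=0$ let $C^*(V,0)=C^*(V)=C_0(V^*)$ be the completion of the Schwartz functions with pointwise product (equivalently, of the convolution algebra, by Fourier transform). Let $\Gamma$ be the $C^*$-algebra of continuous sections of the continuous field $\{C^*(V,\lambda\omega)\}_{\lambda\in[0,1]}$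 generated by the Schwartz functions as constant sections, and let $\mathrm{ev}_\lambda\colon\Gamma\to C^*(V,\lambda\omega)$ be the evaluation maps. For a $C^*$-algebra $A$ with an action of $U$, $K_0^U(A)$ denotes the kernel of $K_0^U(A^+)\to K_0^U(\mathbb C)$, where $A^+$ is $A$ with a unit adjoined and $K_0^U(A^+)$ is the Grothendieck group of $U$-invariant idempotents in the algebras $A^+\otimes\mathrm{End}(W)$, $W$ a finite-dimensional continuous representation of $U$. Let $\Lambda=\Lambda^\bullet V=\Lambda^+\oplus\Lambda^-$ be the complex exterior algebra with its even-odd grading, and let $c(z)=\varepsilon_z+\iota_z$ be the sum of exterior multiplication by $z\in V$ and its adjoint. The Bott generator is $$\beta=[e_\beta]-\left[\begin{bmatrix}0&0\\0&1\end{bmatrix}\right]\in K^0_U(V^*)=K_0^U(C^*(V)),\qquad e_\beta(z)=\frac{1}{1+\|z\|^2}\begin{bmatrix}1&c(z)\\c(z)&\|z\|^2\end{bmatrix}.$$ Let $H$ be the Bargmann–Fock space (realized as the space of functions in $L^2(V)$ of the form $F(x)e^{-\|x\|^2}$ with $F$ antiholomorphic, i.e. a holomorphic function on the conjugate space $V^{0,1}$,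 on which $C^*(V,\omega)$ acts by left Moyal multiplication). **Proposition.** 1. The map $(\mathrm{ev}_0)_*\colon K_0^U(\Gamma)\to K_0^U(C^*(V))$ is bijective, so that the deformation determines a map $$(\mathrm{ev}_1)_*\circ(\mathrm{ev}_0)_*^{-1}\colon\; K^0_U(V^*)=K_0^U(C^*(V))\to K_0^U(C^*(V,\omega)).$$ 2. The Bargmann–Fock representation of $C^*(V,\omega)$ on $H$ determines an isomorphism $K_0^U(C^*(V,\omega))\cong R[U]$ onto the (additive group of the) representation ring: it is the unique homomorphism that, for each finite-dimensional continuous representation $W$ of $U$, maps the class of a $U$-invariant idempotent $p\in C^*(V,\omega)\otimes\mathrm{End}(W)$ to the class of the representation of $U$ on the range of $p$ in $H\otimes W$. 3. The composition $K^0_U(V^*)\to K_0^U(C^*(V,\omega))\cong R[U]= R[U(n)]$ maps the Bott generator $\beta$ to the class of the trivial (one-dimensional) representation of $U(n)$. -/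

import Mathlib

open MeasureTheory Matrix
open scoped SchwartzMap ZeroAtInfty ENNReal

namespace WeylBott

noncomputable section

/-! ## Equivariant `K`-theory of unital algebras -/

section KTheory

set_option linter.unusedSectionVars false

variable {G : Type*} [Group G] [TopologicalSpace G]
variable {B : Type*} [Ring B] [Algebra ℂ B] {B' : Type*} [Ring B'] [Algebra ℂ B']
  {B'' : Type*} [Ring B''] [Algebra ℂ B'']

/-- A scalar matrix regarded as a matrix over the complex algebra `B`. -/
def scal (B : Type*) [Ring B] [Algebra ℂ B] {ι κ : Type} (m : Matrix ι κ ℂ) : Matrix ι κ B :=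
  m.map (algebraMap ℂ B)

/-- A cycle for `K_0^G(B)`, where `G` acts on the unital algebra `B` through `β`: a continuous
finite-dimensional representation `ρ` of `G` on `W = ℂ^ι`, and a `G`-invariant idempotent `e` of
`B ⊗ End(W)`.  The action of `g` on `B ⊗ End(W)` is `β g ⊗ Ad (ρ g)`, so that invariance
of `e` reads `ρ(g) β_g(e) ρ(g)⁻¹ = e`. -/
structure Cycle (β : G →* (B →ₐ[ℂ] B)) where
  ι : Type
  [fintype : Fintype ι]
  [decEq : DecidableEq ι]
  ρ : G →* Matrix ι ι ℂ
  continuous_ρ : Continuous ρ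
  e : Matrix ι ι B
  idem : e * e = e
  invariant : ∀ g, scal B (ρ g) * e.map (β g) = e * scal B (ρ g)

attribute [instance] Cycle.fintype Cycle.decEq

namespace Cycle

variable {β : G →* (B →ₐ[ℂ] B)} {β' : G →* (B' →ₐ[ℂ] B')} {β'' : G →* (B'' →ₐ[ℂ] B'')}

/-- Equivalence of invariant idempotents: `e = x y` and `f = y x` for `G`-invariant
`x ∈ B ⊗ Hom(W', W)` and `y ∈ B ⊗ Hom(W, W')`. -/
def Equivalent (c d : Cycle β) : Prop :=
  ∃ (x : Matrix c.ι d.ι B) (y : Matrix d.ι c.ι B),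
    (∀ g, scal B (c.ρ g) * x.map (β g) = x * scal B (d.ρ g)) ∧
    (∀ g, scal B (d.ρ g) * y.map (β g) = y * scal B (c.ρ g)) ∧
    x * y = c.e ∧ y * x = d.e

/-- Direct sum of cycles. -/
def sum (c d : Cycle β) : Cycle β where
  ι := c.ι ⊕ d.ι
  ρ :=
    { toFun := fun g => fromBlocks (c.ρ g) 0 0 (d.ρ g)
      map_one' := by simp
      map_mul' := fun g h => by simp [fromBlocks_multiply] }
  continuous_ρ := by
    have hc := c.continuous_ρ
    have hd := d.continuous_ρ
    exact Continuous.matrix_fromBlocks hc continuous_const continuous_const hd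
  e := fromBlocks c.e 0 0 d.e
  idem := by simp [fromBlocks_multiply, c.idem, d.idem]
  invariant := fun g => by
    have hc := c.invariant g
    have hd := d.invariant g
    simp only [scal, MonoidHom.coe_mk, OneHom.coe_mk, fromBlocks_map] at hc hd ⊢
    rw [fromBlocks_multiply, fromBlocks_multiply]
    simp [hc, hd]

theorem map_invariant {φ : B →ₐ[ℂ] B'} {g : G} (hφ : ∀ b, φ (β g b) = β' g (φ b))
    {ι κ : Type} [Fintype ι] [Fintype κ] {r : Matrix ι ι ℂ} {s : Matrix κ κ ℂ} {x : Matrix ι κ B}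
    (h : scal B r * x.map (β g) = x * scal B s) :
    scal B' r * (x.map φ).map (β' g) = x.map φ * scal B' s := by
  have h1 := congrArg (fun m => m.map φ) h
  simp only [Matrix.map_mul] at h1
  convert h1 using 2
  · ext i j; simp [scal]
  · ext i j; simp [hφ]
  · ext i j; simp [scal]

/-- Push-forward of a cycle under an equivariant homomorphism. -/
def map (φ : B →ₐ[ℂ] B') (hφ : ∀ g b, φ (β g b) = β' g (φ b)) (c : Cycle β) : Cycle β' where
  ι := c.ι
  ρ := c.ρ
  continuous_ρ := c.continuous_ρ
  e := c.e.map φ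
  idem := by rw [← Matrix.map_mul, c.idem]
  invariant := fun g => map_invariant (hφ g) (c.invariant g)

theorem Equivalent.map {c d : Cycle β} (h : c.Equivalent d) (φ : B →ₐ[ℂ] B')
    (hφ : ∀ g b, φ (β g b) = β' g (φ b)) : (c.map φ hφ).Equivalent (d.map φ hφ) := by
  obtain ⟨x, y, hx, hy, hxy, hyx⟩ := h
  refine ⟨x.map φ, y.map φ, fun g => map_invariant (hφ g) (hx g),
    fun g => map_invariant (hφ g) (hy g), ?_, ?_⟩
  · change x.map φ * y.map φ = c.e.map φ
    rw [← Matrix.map_mul, hxy]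
  · change y.map φ * x.map φ = d.e.map φ
    rw [← Matrix.map_mul, hyx]

theorem map_sum (φ : B →ₐ[ℂ] B') (hφ : ∀ g b, φ (β g b) = β' g (φ b)) (c d : Cycle β) :
    (c.sum d).map φ hφ = (c.map φ hφ).sum (d.map φ hφ) := by
  have : (fromBlocks c.e 0 0 d.e).map φ = fromBlocks (c.e.map φ) 0 0 (d.e.map φ) := by
    simp [fromBlocks_map]
  simp only [map, sum]
  congr 1

theorem map_map (φ : B →ₐ[ℂ] B') (hφ : ∀ g b, φ (β g b) = β' g (φ b))
    (ψ : B' →ₐ[ℂ] B'') (hψ : ∀ g b, ψ (β' g b) = β'' g (ψ b))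
    (h : ∀ g b, (ψ.comp φ) (β g b) = β'' g ((ψ.comp φ) b)) (c : Cycle β) :
    (c.map φ hφ).map ψ hψ = c.map (ψ.comp φ) h := rfl

end Cycle

/-- The relations of the Grothendieck group: equivalent cycles are identified, and direct sum
becomes addition. -/
def K0Relations (β : G →* (B →ₐ[ℂ] B)) : AddSubgroup (FreeAbelianGroup (Cycle β)) :=
  AddSubgroup.closure
    ({x | ∃ c d : Cycle β, c.Equivalent d ∧
        x = FreeAbelianGroup.of c - FreeAbelianGroup.of d} ∪
      {x | ∃ c d : Cycle β,
        x = FreeAbelianGroup.of (c.sum d) - (FreeAbelianGroup.of c + FreeAbelianGroup.of d)})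

/-- `K_0^G(B)` for a unital algebra `B` with `G`-action `β`: the Grothendieck group of the monoid
of equivalence classes of `G`-invariant idempotents in the algebras `B ⊗ End(W)`, presented by
generators and relations. -/
def K0 (β : G →* (B →ₐ[ℂ] B)) : Type _ := FreeAbelianGroup (Cycle β) ⧸ K0Relations β

instance (β : G →* (B →ₐ[ℂ] B)) : AddCommGroup (K0 β) :=
  inferInstanceAs (AddCommGroup (FreeAbelianGroup (Cycle β) ⧸ K0Relations β))

/-- The class of a cycle. -/
def K0.cls {β : G →* (B →ₐ[ℂ] B)} (c : Cycle β) : K0 β :=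
  QuotientAddGroup.mk' (K0Relations β) (FreeAbelianGroup.of c)

section
variable {β : G →* (B →ₐ[ℂ] B)} {β' : G →* (B' →ₐ[ℂ] B')} {β'' : G →* (B'' →ₐ[ℂ] B'')}

theorem K0.cls_eq_of_equivalent {c d : Cycle β} (h : c.Equivalent d) : K0.cls c = K0.cls d := by
  refine (QuotientAddGroup.eq_iff_sub_mem (N := K0Relations β)).2 ?_
  exact AddSubgroup.subset_closure (Or.inl ⟨c, d, h, rfl⟩)

theorem K0.cls_sum (c d : Cycle β) : K0.cls (c.sum d) = K0.cls c + K0.cls d := by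
  refine (QuotientAddGroup.eq_iff_sub_mem (N := K0Relations β)).2 ?_
  exact AddSubgroup.subset_closure (Or.inr ⟨c, d, rfl⟩)

/-- The homomorphism `K_0^G(B) → K_0^G(B')` induced by an equivariant unital homomorphism. -/
def K0.map (φ : B →ₐ[ℂ] B') (hφ : ∀ g b, φ (β g b) = β' g (φ b)) : K0 β →+ K0 β' :=
  QuotientAddGroup.lift (K0Relations β)
    (FreeAbelianGroup.lift fun c : Cycle β => K0.cls (c.map φ hφ)) (by
      rw [K0Relations, AddSubgroup.closure_le]
      rintro x (⟨c, d, h, rfl⟩ | ⟨c, d, rfl⟩)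
      · simp [AddMonoidHom.mem_ker, K0.cls_eq_of_equivalent (h.map φ hφ)]
      · simp [AddMonoidHom.mem_ker, Cycle.map_sum, K0.cls_sum])

theorem K0.map_cls (φ : B →ₐ[ℂ] B') (hφ : ∀ g b, φ (β g b) = β' g (φ b)) (c : Cycle β) :
    K0.map φ hφ (K0.cls c) = K0.cls (c.map φ hφ) := by
  change FreeAbelianGroup.lift (fun c : Cycle β => K0.cls (c.map φ hφ)) (FreeAbelianGroup.of c) = _
  simp

theorem K0.hom_ext {H : Type*} [AddCommGroup H] {f g : K0 β →+ H}
    (h : ∀ c, f (K0.cls c) = g (K0.cls c)) : f = g := by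
  refine QuotientAddGroup.addMonoidHom_ext _ ?_
  ext c
  exact h c

theorem K0.map_map (φ : B →ₐ[ℂ] B') (hφ : ∀ g b, φ (β g b) = β' g (φ b))
    (ψ : B' →ₐ[ℂ] B'') (hψ : ∀ g b, ψ (β' g b) = β'' g (ψ b))
    (h : ∀ g b, (ψ.comp φ) (β g b) = β'' g ((ψ.comp φ) b)) (x : K0 β) :
    K0.map ψ hψ (K0.map φ hφ x) = K0.map (ψ.comp φ) h x := by
  have : (K0.map ψ hψ).comp (K0.map φ hφ) = K0.map (ψ.comp φ) h := by
    refine K0.hom_ext fun c => ?_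
    rw [AddMonoidHom.comp_apply, K0.map_cls, K0.map_cls, K0.map_cls, Cycle.map_map]
  exact DFunLike.congr_fun this x

end

/-! ## Equivariant `K`-theory of `C*`-algebras -/

variable {A : Type*} [NonUnitalCStarAlgebra A] {A' : Type*} [NonUnitalCStarAlgebra A']

/-- The unital extension `A⁺ → A'⁺` of a homomorphism, where `A⁺ = ℂ ⊕ A` is `A` with a unit
adjoined. -/
def unitMap (φ : A →⋆ₙₐ[ℂ] A') : Unitization ℂ A →ₐ[ℂ] Unitization ℂ A' :=
  (Unitization.starMap φ).toAlgHom

theorem unitMap_fst (φ : A →⋆ₙₐ[ℂ] A') (x : Unitization ℂ A) : (unitMap φ x).fst = x.fst := by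
  induction x with
  | inl_add_inr r a => simp [unitMap, Unitization.algebraMap_eq_inl]

theorem unitMap_snd (φ : A →⋆ₙₐ[ℂ] A') (x : Unitization ℂ A) :
    (unitMap φ x).snd = φ x.snd := by
  induction x with
  | inl_add_inr r a => simp [unitMap, Unitization.algebraMap_eq_inl]

/-- The action of `G` on `A⁺` given by an action of `G` on `A`. -/
def unitAct (α : G →* (A →⋆ₙₐ[ℂ] A)) : G →* (Unitization ℂ A →ₐ[ℂ] Unitization ℂ A) where
  toFun g := unitMap (α g)
  map_one' := by
    refine AlgHom.ext fun x => Unitization.ext ?_ ?_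
    · simp [unitMap_fst]
    · simp [unitMap_snd]
  map_mul' g h := by
    refine AlgHom.ext fun x => Unitization.ext ?_ ?_
    · simp [unitMap_fst]
    · simp only [AlgHom.mul_apply, unitMap_snd, map_mul]
      rfl

theorem unitAct_apply (α : G →* (A →⋆ₙₐ[ℂ] A)) (g : G) : unitAct α g = unitMap (α g) := rfl

/-- The map `K_0^G(A⁺) → K_0^G(ℂ)` induced by the augmentation `A⁺ → ℂ`. -/
def augmentation (α : G →* (A →⋆ₙₐ[ℂ] A)) :
    K0 (unitAct α) →+ K0 (1 : G →* (ℂ →ₐ[ℂ] ℂ)) :=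
  K0.map (Unitization.fstHom ℂ A) (fun g b => by simp [unitAct_apply, unitMap_fst])

/-- `K_0^G(A)` for a (possibly non-unital) `C*`-algebra `A` with `G`-action `α`: the kernel of
`K_0^G(A⁺) → K_0^G(ℂ)`. -/
def NK0 (α : G →* (A →⋆ₙₐ[ℂ] A)) : AddSubgroup (K0 (unitAct α)) := (augmentation α).ker

/-- The homomorphism `K_0^G(A) → K_0^G(A')` induced by an equivariant `*`-homomorphism. -/
def NK0.map {α : G →* (A →⋆ₙₐ[ℂ] A)} {α' : G →* (A' →⋆ₙₐ[ℂ] A')} (φ : A →⋆ₙₐ[ℂ] A')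
    (hφ : ∀ g a, φ (α g a) = α' g (φ a)) : NK0 α →+ NK0 α' :=
  have hφ' : ∀ g b, unitMap φ (unitAct α g b) = unitAct α' g (unitMap φ b) := fun g b => by
    refine Unitization.ext ?_ ?_
    · simp [unitAct_apply, unitMap_fst]
    · simp [unitAct_apply, unitMap_snd, hφ]
  ((K0.map (unitMap φ) hφ').comp (NK0 α).subtype).codRestrict (NK0 α') (by
    rintro ⟨x, hx⟩
    change augmentation α x = 0 at hx
    change augmentation α' (K0.map (unitMap φ) hφ' x) = 0
    have hcomp : (Unitization.fstHom ℂ A').comp (unitMap φ) = Unitization.fstHom ℂ A :=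
      AlgHom.ext fun x => by simp [unitMap_fst]
    rw [← hx, augmentation, K0.map_map _ _ _ _ (fun g b => by
      simp [unitAct_apply, unitMap_fst]), augmentation]
    congr 2)

/-- The class in `K_0^G(A)` of a formal difference of two idempotents over `A⁺` that have the same
class in `K_0^G(ℂ)`. -/
def NK0.diff {α : G →* (A →⋆ₙₐ[ℂ] A)} (c d : Cycle (unitAct α))
    (h : augmentation α (K0.cls c) = augmentation α (K0.cls d)) : NK0 α :=
  ⟨K0.cls c - K0.cls d, by
    change augmentation α _ = 0
    rw [map_sub, h, sub_self]⟩

/-- The class `[p]` in `K_0^G(A)` of an invariant idempotent `p` in `A ⊗ End(W)`, given as a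
cycle over `A⁺` whose entries have vanishing scalar part. -/
def NK0.ofIdempotent {α : G →* (A →⋆ₙₐ[ℂ] A)} (c : Cycle (unitAct α))
    (h : ∀ i j, (c.e i j).fst = 0) : NK0 α :=
  ⟨K0.cls c, by
    change augmentation α _ = 0
    rw [augmentation, K0.map_cls]
    set z := c.map (β' := (1 : G →* (ℂ →ₐ[ℂ] ℂ))) (Unitization.fstHom ℂ A)
        (fun g b => by simp [unitAct_apply, unitMap_fst]) with hz
    have hz0 : z.e = 0 := by
      ext i j
      exact h i j
    have h1 : z.Equivalent (z.sum z) := by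
      have h0 : ∀ {ι κ : Type} (g : G),
          (0 : Matrix ι κ ℂ).map ((1 : G →* (ℂ →ₐ[ℂ] ℂ)) g) = 0 := fun g => by ext; simp
      refine ⟨0, 0, fun g => by rw [h0, Matrix.mul_zero, Matrix.zero_mul],
        fun g => by rw [h0, Matrix.mul_zero, Matrix.zero_mul], ?_, ?_⟩
      · rw [Matrix.mul_zero, hz0]
      · rw [Matrix.mul_zero]
        simp [Cycle.sum, hz0]
        rfl
    have h2 := K0.cls_eq_of_equivalent h1
    rw [K0.cls_sum] at h2
    exact left_eq_add.1 h2⟩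

end KTheory

/-! ## The representation group -/

section RepresentationRing

variable (G : Type*) [Group G] [TopologicalSpace G]

/-- A continuous finite-dimensional complex representation of `G`, in matrix form. -/
structure Rep where
  ι : Type
  [fintype : Fintype ι]
  [decEq : DecidableEq ι]
  ρ : G →* Matrix ι ι ℂ
  continuous_ρ : Continuous ρ

attribute [instance] Rep.fintype Rep.decEq

variable {G}

/-- Isomorphism of representations. -/
def Rep.Iso (σ τ : Rep G) : Prop :=
  ∃ (x : Matrix σ.ι τ.ι ℂ) (y : Matrix τ.ι σ.ι ℂ), x * y = 1 ∧ y * x = 1 ∧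
    ∀ g, σ.ρ g * x = x * τ.ρ g

/-- Direct sum of representations. -/
def Rep.sum (σ τ : Rep G) : Rep G where
  ι := σ.ι ⊕ τ.ι
  ρ :=
    { toFun := fun g => fromBlocks (σ.ρ g) 0 0 (τ.ρ g)
      map_one' := by simp
      map_mul' := fun g h => by simp [fromBlocks_multiply] }
  continuous_ρ := Continuous.matrix_fromBlocks σ.continuous_ρ continuous_const continuous_const
    τ.continuous_ρ

/-- The trivial one-dimensional representation. -/
def Rep.trivial : Rep G where
  ι := Unit
  ρ := 1
  continuous_ρ := continuous_const

variable (G)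

/-- Isomorphic representations are identified, and direct sum becomes addition. -/
def RRelations : AddSubgroup (FreeAbelianGroup (Rep G)) :=
  AddSubgroup.closure
    ({x | ∃ σ τ : Rep G, σ.Iso τ ∧ x = FreeAbelianGroup.of σ - FreeAbelianGroup.of τ} ∪
      {x | ∃ σ τ : Rep G,
        x = FreeAbelianGroup.of (σ.sum τ) - (FreeAbelianGroup.of σ + FreeAbelianGroup.of τ)})

/-- The (additive group of the) representation ring `R[G]`: the Grothendieck group of isomorphism
classes of continuous finite-dimensional complex representations of `G`. -/
def RRing : Type _ := FreeAbelianGroup (Rep G) ⧸ RRelations G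

instance : AddCommGroup (RRing G) :=
  inferInstanceAs (AddCommGroup (FreeAbelianGroup (Rep G) ⧸ RRelations G))

variable {G}

/-- The class of a representation in the representation ring. -/
def RRing.cls (σ : Rep G) : RRing G :=
  QuotientAddGroup.mk' (RRelations G) (FreeAbelianGroup.of σ)

end RepresentationRing

/-! ## Closed subalgebras, families, and actions on them -/

section CStar

set_option linter.unusedSectionVars false

variable {G : Type*} [Group G]
variable {A : Type*} [NonUnitalCStarAlgebra A] {A' : Type*} [NonUnitalCStarAlgebra A']

/-- The `C*`-subalgebra of a `C*`-algebra generated by a set. -/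
def closedAdjoin (s : Set A) : NonUnitalStarSubalgebra ℂ A :=
  (NonUnitalStarAlgebra.adjoin ℂ s).topologicalClosure

theorem map_mem_closedAdjoin (φ : A →⋆ₙₐ[ℂ] A') {s : Set A} {t : Set A'}
    (h : ∀ a ∈ s, φ a ∈ t) {a : A} (ha : a ∈ closedAdjoin s) : φ a ∈ closedAdjoin t := by
  have h1 : NonUnitalStarAlgebra.adjoin ℂ s ≤ (NonUnitalStarAlgebra.adjoin ℂ t).comap φ := by
    rw [NonUnitalStarAlgebra.adjoin_le_iff]
    intro a ha
    exact NonUnitalStarAlgebra.subset_adjoin ℂ t (h a ha)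
  exact map_mem_closure (AddMonoidHomClass.continuous_of_bound φ 1 fun b => by
    simpa using NonUnitalStarAlgHom.norm_apply_le φ b) ha (fun b hb => h1 hb)

/-- The `C*`-subalgebra generated by a set, as a `C*`-algebra of its own. -/
def Generated (s : Set A) : Type _ := closedAdjoin s

instance (s : Set A) : NonUnitalCStarAlgebra (Generated s) :=
  NonUnitalStarSubalgebra.nonUnitalCStarAlgebra (closedAdjoin s)
    (h_closed := NonUnitalStarSubalgebra.isClosed_topologicalClosure _)

namespace Generated

variable {s : Set A} {t : Set A'}

/-- The inclusion of a `C*`-subalgebra. -/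
def incl (s : Set A) : Generated s →⋆ₙₐ[ℂ] A where
  toFun a := a.1
  map_smul' _ _ := rfl
  map_zero' := rfl
  map_add' _ _ := rfl
  map_mul' _ _ := rfl
  map_star' _ := rfl

theorem incl_injective : Function.Injective (incl s) := Subtype.val_injective

/-- The homomorphism between generated `C*`-subalgebras induced by a `*`-homomorphism. -/
def map (φ : A →⋆ₙₐ[ℂ] A') (h : ∀ a ∈ s, φ a ∈ t) : Generated s →⋆ₙₐ[ℂ] Generated t where
  toFun a := ⟨φ a.1, map_mem_closedAdjoin φ h a.2⟩
  map_smul' c a := Subtype.ext (map_smul φ c a.1)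
  map_zero' := Subtype.ext (map_zero φ)
  map_add' a b := Subtype.ext (map_add φ a.1 b.1)
  map_mul' a b := Subtype.ext (map_mul φ a.1 b.1)
  map_star' a := Subtype.ext (map_star φ a.1)

theorem incl_map (φ : A →⋆ₙₐ[ℂ] A') (h : ∀ a ∈ s, φ a ∈ t) (a : Generated s) :
    incl t (map φ h a) = φ (incl s a) := rfl

/-- The restriction of an action to the `C*`-subalgebra generated by an invariant set. -/
def act (α : G →* (A →⋆ₙₐ[ℂ] A)) (h : ∀ g, ∀ a ∈ s, α g a ∈ s) :
    G →* (Generated s →⋆ₙₐ[ℂ] Generated s) where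
  toFun g := map (α g) (h g)
  map_one' := by
    refine NonUnitalStarAlgHom.ext fun a => incl_injective ?_
    rw [incl_map, map_one]
    rfl
  map_mul' g k := by
    refine NonUnitalStarAlgHom.ext fun a => incl_injective ?_
    rw [incl_map, map_mul]
    rfl

theorem incl_act (α : G →* (A →⋆ₙₐ[ℂ] A)) (h : ∀ g, ∀ a ∈ s, α g a ∈ s) (g : G)
    (a : Generated s) : incl s (act α h g a) = α g (incl s a) := rfl

end Generated

variable (I : Type*)

/-- Families of elements of two `C*`-algebras: one element of `A`, and a bounded family of elements
of `A'` indexed by `I`. -/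
def Families (A A' : Type*) [NonUnitalCStarAlgebra A] [NonUnitalCStarAlgebra A'] : Type _ :=
  A × lp (fun _ : I => A') ∞

instance : NonUnitalCStarAlgebra (Families I A A') :=
  inferInstanceAs (NonUnitalCStarAlgebra (A × lp (fun _ : I => A') ∞))

namespace Families

variable {I}

/-- The component of a family in `A`. -/
def base : Families I A A' →⋆ₙₐ[ℂ] A := NonUnitalStarAlgHom.fst ℂ A (lp (fun _ : I => A') ∞)

/-- The component of a family with index `i`. -/
def eval (i : I) : Families I A A' →⋆ₙₐ[ℂ] A' where
  toFun a := a.2 i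
  map_smul' _ _ := rfl
  map_zero' := rfl
  map_add' _ _ := rfl
  map_mul' _ _ := rfl
  map_star' _ := rfl

theorem ext {a b : Families I A A'} (h0 : base a = base b) (h : ∀ i, eval i a = eval i b) :
    a = b :=
  Prod.ext h0 (lp.ext (funext h))

/-- The componentwise map of families induced by two `*`-homomorphisms. -/
def map (φ : A →⋆ₙₐ[ℂ] A) (ψ : A' →⋆ₙₐ[ℂ] A') : Families I A A' →⋆ₙₐ[ℂ] Families I A A' where
  toFun a := (φ a.1, ⟨fun i => ψ (a.2 i), by
    refine memℓp_infty ⟨‖a.2‖, ?_⟩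
    rintro _ ⟨i, rfl⟩
    exact (NonUnitalStarAlgHom.norm_apply_le ψ _).trans
      (lp.norm_apply_le_norm ENNReal.top_ne_zero a.2 i)⟩)
  map_smul' c a := ext (map_smul φ c a.1) fun i => map_smul ψ c (a.2 i)
  map_zero' := ext (map_zero φ) fun _ => map_zero ψ
  map_add' a b := ext (map_add φ a.1 b.1) fun i => map_add ψ (a.2 i) (b.2 i)
  map_mul' a b := ext (map_mul φ a.1 b.1) fun i => map_mul ψ (a.2 i) (b.2 i)
  map_star' a := ext (map_star φ a.1) fun i => map_star ψ (a.2 i)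

/-- The componentwise action on families. -/
def act (α : G →* (A →⋆ₙₐ[ℂ] A)) (α' : G →* (A' →⋆ₙₐ[ℂ] A')) :
    G →* (Families I A A' →⋆ₙₐ[ℂ] Families I A A') where
  toFun g := map (α g) (α' g)
  map_one' := by
    refine NonUnitalStarAlgHom.ext fun a => ext ?_ fun i => ?_
    · change α 1 (base a) = base a
      rw [map_one]
      rfl
    · change α' 1 (eval i a) = eval i a
      rw [map_one]
      rfl
  map_mul' g k := by
    refine NonUnitalStarAlgHom.ext fun a => ext ?_ fun i => ?_
    · change α (g * k) (base a) = α g (α k (base a))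
      rw [map_mul]
      rfl
    · change α' (g * k) (eval i a) = α' g (α' k (eval i a))
      rw [map_mul]
      rfl

theorem base_act (α : G →* (A →⋆ₙₐ[ℂ] A)) (α' : G →* (A' →⋆ₙₐ[ℂ] A')) (g : G)
    (a : Families I A A') : base (act α α' g a) = α g (base a) := rfl

theorem eval_act (α : G →* (A →⋆ₙₐ[ℂ] A)) (α' : G →* (A' →⋆ₙₐ[ℂ] A')) (g : G) (i : I)
    (a : Families I A A') : eval i (act α α' g a) = α' g (eval i a) := rfl

end Families

end CStar

/-! ## The Moyal product and the deformation of `C₀(V)` -/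

section Weyl

set_option linter.unusedSectionVars false

variable (V : Type*) [NormedAddCommGroup V] [InnerProductSpace ℂ V] [FiniteDimensional ℂ V]
  [MeasurableSpace V] [BorelSpace V]

/-- The topology of the unitary group `U(V)`, i.e. the norm topology of linear operators. -/
instance : TopologicalSpace (V ≃ₗᵢ[ℂ] V) :=
  TopologicalSpace.induced
    (fun u => (u.toContinuousLinearEquiv : V →L[ℂ] V)) inferInstance

/-- Lebesgue measure on `V`, normalized by the Euclidean inner product `g`, the real part of the
Hermitian inner product. -/
def leb : Measure V :=
  letI : InnerProductSpace ℝ V := InnerProductSpace.complexToReal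
  volume

instance : (leb V).IsAddHaarMeasure := by
  let : InnerProductSpace ℝ V := InnerProductSpace.complexToReal
  exact inferInstanceAs (volume : Measure V).IsAddHaarMeasure

/-- The Hilbert space `L²(V)` for Lebesgue measure. -/
abbrev L2 : Type _ := Lp ℂ 2 (leb V)

/-- The `C*`-algebra of bounded operators on `L²(V)`. -/
abbrev BL2 : Type _ := L2 V →L[ℂ] L2 V

variable {V}

/-- The symplectic form `ω`, for which `g(v, w) = ω(v, i w)` is the real part of the inner product:
the imaginary part of the inner product that is linear in the second variable. -/
def omega (v w : V) : ℝ := (inner ℂ v w).im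

/-- The Moyal product
`(f #_λ g)(x) = (λ π)^{-2n} ∫∫ e^{(2 i / λ) ω(a, b)} f(x + a) g(x + b) da db`, for `λ ≠ 0`. -/
def moyal (lam : ℝ) (f g : V → ℂ) (x : V) : ℂ :=
  (((lam * Real.pi) ^ (2 * Module.finrank ℂ V))⁻¹ : ℝ) *
    ∫ a, ∫ b, Complex.exp ((2 / lam * omega a b : ℝ) * Complex.I) * f (x + a) * g (x + b)
      ∂(leb V) ∂(leb V)

/-- `T` is the operator of left Moyal multiplication by `f`. -/
def IsLeftMoyal (lam : ℝ) (f : V → ℂ) (T : BL2 V) : Prop :=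
  ∀ g : 𝓢(V, ℂ), (T (g.toLp 2 (leb V)) : V → ℂ) =ᵐ[leb V] moyal lam f g

/-- The unitary group acts on functions by `(u f)(x) = f(u⁻¹ x)`; on `C₀(V)`: -/
def c0Act : (V ≃ₗᵢ[ℂ] V) →* (C₀(V, ℂ) →⋆ₙₐ[ℂ] C₀(V, ℂ)) where
  toFun u :=
    { ZeroAtInftyContinuousMap.compNonUnitalAlgHom (R := ℂ) (δ := ℂ)
        u.symm.toHomeomorph.toCocompactMap with
      map_star' := fun _ => rfl }
  map_one' := rfl
  map_mul' _ _ := rfl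

theorem c0Act_apply (u : V ≃ₗᵢ[ℂ] V) (f : C₀(V, ℂ)) (x : V) : c0Act u f x = f (u.symm x) := rfl

theorem measurePreserving_unitary (u : V ≃ₗᵢ[ℂ] V) :
    MeasurePreserving (u : V → V) (leb V) (leb V) :=
  let : InnerProductSpace ℝ V := InnerProductSpace.complexToReal
  (LinearIsometryEquiv.mk (u.toLinearEquiv.restrictScalars ℝ) u.norm_map).measurePreserving

/-- The action of the unitary group on `L²(V)`. -/
def l2Act : (V ≃ₗᵢ[ℂ] V) →* (L2 V ≃ₗᵢ[ℂ] L2 V) where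
  toFun u :=
    LinearIsometryEquiv.mk
      (LinearEquiv.ofLinearMap
        (Lp.compMeasurePreservingₗ ℂ (u.symm : V → V) (measurePreserving_unitary u.symm))
        (Lp.compMeasurePreservingₗ ℂ (u : V → V) (measurePreserving_unitary u))
        (by
          ext1 f
          change Lp.compMeasurePreserving _ _ (Lp.compMeasurePreserving _ _ f) = f
          rw [← Lp.compMeasurePreserving_comp_apply]
          simp)
        (by
          ext1 f
          change Lp.compMeasurePreserving _ _ (Lp.compMeasurePreserving _ _ f) = f
          rw [← Lp.compMeasurePreserving_comp_apply]
          simp))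
      (fun f => Lp.norm_compMeasurePreserving f (measurePreserving_unitary u.symm))
  map_one' := by
    ext1 f
    exact Lp.compMeasurePreserving_id_apply f
  map_mul' u v := by
    ext1 f
    exact Lp.compMeasurePreserving_comp_apply f (measurePreserving_unitary v.symm)
      (measurePreserving_unitary u.symm)

/-- The action of the unitary group on operators, by conjugation with its action on `L²(V)`. -/
def opAct : (V ≃ₗᵢ[ℂ] V) →* (BL2 V →⋆ₙₐ[ℂ] BL2 V) where
  toFun u :=
    ((Unitary.conjStarAlgAut ℂ (BL2 V) (Unitary.linearIsometryEquiv.symm (l2Act u)) :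
      BL2 V ≃⋆ₐ[ℂ] BL2 V) : BL2 V →⋆ₙₐ[ℂ] BL2 V)
  map_one' := by
    ext1 T
    simp
  map_mul' u v := by
    ext1 T
    change Unitary.conjStarAlgAut ℂ (BL2 V) (Unitary.linearIsometryEquiv.symm (l2Act (u * v))) T =
      Unitary.conjStarAlgAut ℂ (BL2 V) (Unitary.linearIsometryEquiv.symm (l2Act u))
        (Unitary.conjStarAlgAut ℂ (BL2 V) (Unitary.linearIsometryEquiv.symm (l2Act v)) T)
    rw [map_mul, map_mul, map_mul]
    rfl

theorem opAct_apply (u : V ≃ₗᵢ[ℂ] V) (T : BL2 V) (f : L2 V) :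
    opAct u T f = l2Act u (T (l2Act u⁻¹ f)) := by
  change Unitary.conjStarAlgAut ℂ (BL2 V) (Unitary.linearIsometryEquiv.symm (l2Act u)) T f = _
  rw [Unitary.conjStarAlgAut_apply, map_inv]
  simp

theorem omega_unitary (u : V ≃ₗᵢ[ℂ] V) (v w : V) : omega (u v) (u w) = omega v w := by
  simp [omega]

theorem moyal_unitary (u : V ≃ₗᵢ[ℂ] V) (lam : ℝ) (f g : V → ℂ) (x : V) :
    moyal lam (fun y => f (u.symm y)) g x = moyal lam f (fun y => g (u y)) (u.symm x) := by
  have hu := measurePreserving_unitary u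
  have he : MeasurableEmbedding (u : V → V) := u.toHomeomorph.measurableEmbedding
  unfold moyal
  rw [← hu.integral_comp he]
  congr 1
  refine integral_congr_ae (Filter.Eventually.of_forall fun a => ?_)
  dsimp only
  rw [← hu.integral_comp he]
  simp [omega_unitary]

/-- The action of the unitary group on Schwartz functions. -/
def schwartzAct (u : V ≃ₗᵢ[ℂ] V) : 𝓢(V, ℂ) →L[ℂ] 𝓢(V, ℂ) :=
  SchwartzMap.compCLMOfContinuousLinearEquiv ℂ
    (u.symm.toContinuousLinearEquiv.restrictScalars ℝ)

theorem schwartzAct_apply (u : V ≃ₗᵢ[ℂ] V) (f : 𝓢(V, ℂ)) (x : V) :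
    schwartzAct u f x = f (u.symm x) := rfl

theorem l2Act_coe (u : V ≃ₗᵢ[ℂ] V) (f : L2 V) :
    (l2Act u f : V → ℂ) =ᵐ[leb V] fun x => f (u.symm x) :=
  Lp.coeFn_compMeasurePreserving f (measurePreserving_unitary u.symm)

theorem l2Act_toLp (u : V ≃ₗᵢ[ℂ] V) (f : 𝓢(V, ℂ)) :
    l2Act u (f.toLp 2 (leb V)) = (schwartzAct u f).toLp 2 (leb V) := by
  refine Lp.ext ?_
  have h1 := (measurePreserving_unitary u.symm).quasiMeasurePreserving.ae_eq
    (f.coeFn_toLp 2 (leb V))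
  filter_upwards [l2Act_coe u (f.toLp 2 (leb V)), h1,
    (schwartzAct u f).coeFn_toLp 2 (leb V)] with x hx hx1 hx2
  rw [hx, hx2, schwartzAct_apply]
  exact hx1

theorem IsLeftMoyal.opAct {lam : ℝ} {f : V → ℂ} {T : BL2 V} (h : IsLeftMoyal lam f T)
    (u : V ≃ₗᵢ[ℂ] V) : IsLeftMoyal lam (fun x => f (u.symm x)) (opAct u T) := by
  intro g
  rw [opAct_apply, l2Act_toLp]
  have h1 := (measurePreserving_unitary u.symm).quasiMeasurePreserving.ae_eq
    (h (schwartzAct u⁻¹ g))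
  filter_upwards [l2Act_coe u (T ((schwartzAct u⁻¹ g).toLp 2 (leb V))), h1] with x hx hx1
  rw [hx, moyal_unitary]
  exact hx1

/-- The operators of left Moyal multiplication by Schwartz functions. -/
def moyalOperators (V : Type*) [NormedAddCommGroup V] [InnerProductSpace ℂ V]
    [FiniteDimensional ℂ V] [MeasurableSpace V] [BorelSpace V] (lam : ℝ) : Set (BL2 V) :=
  {T | ∃ f : 𝓢(V, ℂ), IsLeftMoyal lam f T}

theorem opAct_mem_moyalOperators (lam : ℝ) (u : V ≃ₗᵢ[ℂ] V) {T : BL2 V}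
    (hT : T ∈ moyalOperators V lam) : opAct u T ∈ moyalOperators V lam := by
  obtain ⟨f, hf⟩ := hT
  exact ⟨schwartzAct u f, hf.opAct u⟩

variable (V) in
/-- The `C*`-algebra `C*(V, λ ω)`, for `λ ≠ 0`: the completion of the algebra of Schwartz functions
with the product `#_λ`, for its operator norm in the left regular representation on `L²(V)`.
(This representation is a multiple of the irreducible Weyl quantization.) -/
abbrev WeylAlgebra (lam : ℝ) : Type _ := Generated (moyalOperators V lam)

/-- The action of the unitary group on `C*(V, λ ω)`. -/
def weylAct (lam : ℝ) : (V ≃ₗᵢ[ℂ] V) →* (WeylAlgebra V lam →⋆ₙₐ[ℂ] WeylAlgebra V lam) :=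
  Generated.act opAct fun u _ hT => opAct_mem_moyalOperators lam u hT

/-! ### The continuous field -/

variable (V) in
/-- Families `(a_λ)`, `λ ∈ [0, 1]`, with `a_0 ∈ C₀(V)`, and with `a_λ` a bounded family of operators
on `L²(V)` for `λ ∈ (0, 1]`. -/
abbrev OpFamilies : Type _ := Families (Set.Ioc (0 : ℝ) 1) C₀(V, ℂ) (BL2 V)

variable (V) in
/-- The basic continuous sections `λ ↦ φ(λ) f`, where `f` is a Schwartz function, regarded as an
element of every fibre, and `φ` is a continuous scalar function. -/
def basicSections : Set (OpFamilies V) :=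
  {a | ∃ (φ : C(ℝ, ℂ)) (f : 𝓢(V, ℂ)),
    (∀ x, Families.base a x = φ 0 * f x) ∧
    ∀ lam : Set.Ioc (0 : ℝ) 1,
      IsLeftMoyal (lam : ℝ) (fun x => φ lam * f x) (Families.eval lam a)}

variable (V) in
/-- The `C*`-algebra of continuous sections of the continuous field `{C*(V, λ ω)}`,
`λ ∈ [0, 1]`, with fibre `C*(V) = C₀(V)` at `λ = 0`.  The field is generated by the
Schwartz functions, regarded as constant sections; since `[0, 1]` is compact, its continuous
sections are the uniform limits of sums of basic sections. -/
abbrev SectionAlgebra : Type _ := Generated (basicSections V)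

/-- The action of the unitary group on continuous sections. -/
def sectionAct : (V ≃ₗᵢ[ℂ] V) →* (SectionAlgebra V →⋆ₙₐ[ℂ] SectionAlgebra V) :=
  Generated.act (Families.act c0Act opAct) (by
    rintro u a ⟨φ, f, h0, h⟩
    exact ⟨φ, schwartzAct u f, fun x => h0 (u.symm x), fun lam => (h lam).opAct u⟩)

variable (V) in
/-- Evaluation of continuous sections at `λ = 0`. -/
def evalZero : SectionAlgebra V →⋆ₙₐ[ℂ] C₀(V, ℂ) :=
  Families.base.comp (Generated.incl (basicSections V))

theorem evalZero_act (u : V ≃ₗᵢ[ℂ] V) (a : SectionAlgebra V) :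
    evalZero V (sectionAct u a) = c0Act u (evalZero V a) := rfl

variable (V) in
/-- Evaluation of continuous sections at `λ = 1`. -/
def evalOne : SectionAlgebra V →⋆ₙₐ[ℂ] WeylAlgebra V 1 :=
  Generated.map (Families.eval ⟨1, by simp⟩) (by
    rintro a ⟨φ, f, -, h⟩
    exact ⟨φ 1 • f, h ⟨1, by simp⟩⟩)

theorem evalOne_act (u : V ≃ₗᵢ[ℂ] V) (a : SectionAlgebra V) :
    evalOne V (sectionAct u a) = weylAct 1 u (evalOne V a) := rfl

variable (V) in
/-- Restriction of `K`-theory classes of the field to `λ = 0`,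
`K_0^U(Γ) → K_0^U(C₀(V))`, where `Γ` is the algebra of continuous sections. -/
def evalZeroK : NK0 (sectionAct (V := V)) →+ NK0 (c0Act (V := V)) :=
  NK0.map (evalZero V) evalZero_act

variable (V) in
/-- Restriction of `K`-theory classes of the field to `λ = 1`,
`K_0^U(Γ) → K_0^U(C*(V, ω))`, where `Γ` is the algebra of continuous sections. -/
def evalOneK : NK0 (sectionAct (V := V)) →+ NK0 (weylAct (V := V) 1) :=
  NK0.map (evalOne V) evalOne_act

/-- The map `K_0^U(C₀(V)) → K_0^U(C*(V, ω))` determined by the deformation: an invariant idempotent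
over `C₀(V)⁺` is extended to a continuous section of invariant idempotents, which is evaluated at
`λ = 1`.  It is defined because restriction to `λ = 0` is bijective on `K`-theory. -/
def deformationMap (h : Function.Bijective (evalZeroK V)) :
    NK0 (c0Act (V := V)) →+ NK0 (weylAct (V := V) 1) :=
  (evalOneK V).comp (AddEquiv.ofBijective (evalZeroK V) h).symm.toAddMonoidHom

end Weyl

/-! ## The Bargmann–Fock representation -/

section Fock

variable {V : Type*} [NormedAddCommGroup V] [InnerProductSpace ℂ V] [FiniteDimensional ℂ V]
  [MeasurableSpace V] [BorelSpace V]

variable (V) in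
/-- The Bargmann–Fock space of square-integrable holomorphic functions on the conjugate (dual) of
the complex vector space `V`, with the Gaussian weight absorbed into the functions: the elements of
`L²(V)` of the form `x ↦ F(x) e^{-‖x‖²}`, where `F` is antiholomorphic.  It is invariant under left
Moyal multiplication (with `λ = 1`) and under the unitary group. -/
def fockSpace : Submodule ℂ (L2 V) where
  carrier := {f | ∃ F : V → ℂ, Differentiable ℂ F ∧
    (f : V → ℂ) =ᵐ[leb V] fun x => star (F x) * (Real.exp (-‖x‖ ^ 2) : ℝ)}
  zero_mem' := ⟨0, differentiable_const 0, by
    filter_upwards [Lp.coeFn_zero ℂ 2 (leb V)] with x hx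
    rw [hx]
    simp⟩
  add_mem' := by
    rintro f g ⟨F, hF, hf⟩ ⟨F', hF', hg⟩
    refine ⟨F + F', hF.add hF', ?_⟩
    filter_upwards [Lp.coeFn_add f g, hf, hg] with x hx h1 h2
    rw [hx, Pi.add_apply, h1, h2, Pi.add_apply, star_add, add_mul]
  smul_mem' := by
    rintro c f ⟨F, hF, hf⟩
    refine ⟨star c • F, hF.const_smul _, ?_⟩
    filter_upwards [Lp.coeFn_smul c f, hf] with x hx h1
    rw [hx, Pi.smul_apply, h1, Pi.smul_apply, smul_eq_mul, smul_eq_mul, star_mul', star_star,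
      mul_assoc]

/-- The range of an invariant idempotent `p ∈ C*(V, ω) ⊗ End(W)`, acting on `H ⊗ W` through the
Bargmann–Fock representation on the Fock space `H`. Here `W = ℂ^ι`, so that `H ⊗ W = H^ι`,
and `p` is the operator part of a cycle over the algebra with unit adjoined. -/
def fockRange (c : Cycle (unitAct (weylAct (V := V) 1))) : Submodule ℂ (c.ι → L2 V) where
  carrier := {h | (∀ i, h i ∈ fockSpace V) ∧
    ∀ i, ∑ j, Generated.incl (moyalOperators V 1) (c.e i j).snd (h j) = h i}
  zero_mem' := ⟨fun _ => zero_mem _, fun i => by simp⟩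
  add_mem' := by
    rintro h k ⟨h1, h2⟩ ⟨k1, k2⟩
    refine ⟨fun i => add_mem (h1 i) (k1 i), fun i => ?_⟩
    simp [Finset.sum_add_distrib, h2, k2]
  smul_mem' := by
    rintro r h ⟨h1, h2⟩
    refine ⟨fun i => Submodule.smul_mem _ r (h1 i), fun i => ?_⟩
    simp [← Finset.smul_sum, h2]

/-- `Φ` is the canonical map `K_0^U(C*(V, ω)) → R[U]` given by the Bargmann–Fock representation: it
sends the class of every invariant idempotent `p ∈ C*(V, ω) ⊗ End(W)` to the class of the
representation of `U` on the (finite-dimensional) range of `p` in `H ⊗ W`. -/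
def IsBargmannFock (Φ : NK0 (weylAct (V := V) 1) → RRing (V ≃ₗᵢ[ℂ] V)) : Prop :=
  ∀ (c : Cycle (unitAct (weylAct (V := V) 1))) (hc : ∀ i j, (c.e i j).fst = 0)
    (σ : Rep (V ≃ₗᵢ[ℂ] V)) (T : (σ.ι → ℂ) ≃ₗ[ℂ] fockRange c),
    (∀ u x i, (T (σ.ρ u *ᵥ x) : c.ι → L2 V) i =
      ∑ j, c.ρ u i j • l2Act u ((T x : c.ι → L2 V) j)) →
    Φ (NK0.ofIdempotent c hc) = RRing.cls σ

end Fock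

/-! ## Exterior algebra, Clifford multiplication, and the Bott element -/

section Bott

set_option linter.unusedSectionVars false

variable (V : Type*) [NormedAddCommGroup V] [InnerProductSpace ℂ V]

/-- The exterior algebra `Λ = Λ^• V`. -/
abbrev Lam : Type _ := ExteriorAlgebra ℂ V

variable {V}

/-- Clifford multiplication `c(z) = ε_z + ι_z`: the sum of exterior multiplication by `z` and
contraction with `v ↦ ⟨v, z⟩`, the linear functional given by the inner product with `z`. -/
def clifford (z : V) : Module.End ℂ (Lam V) :=
  LinearMap.mulLeft ℂ (ExteriorAlgebra.ι ℂ z) +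
    CliffordAlgebra.contractLeft (Q := (0 : QuadraticForm ℂ V)) (innerSL ℂ z : V →ₗ[ℂ] ℂ)

variable (V) in
/-- The grading operator of `Λ`: the identity on `Λ⁺`, and minus the identity on `Λ⁻`. -/
def grading : Module.End ℂ (Lam V) :=
  (CliffordAlgebra.involute (Q := (0 : QuadraticForm ℂ V))).toLinearMap

variable (V) in
/-- The projection of `Λ` onto the even part `Λ⁺`. -/
def projEven : Module.End ℂ (Lam V) := (2⁻¹ : ℂ) • (1 + grading V)

variable (V) in
/-- The projection of `Λ` onto the odd part `Λ⁻`. -/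
def projOdd : Module.End ℂ (Lam V) := (2⁻¹ : ℂ) • (1 - grading V)

/-- The Bott idempotent
`e_β(z) = (1 + ‖z‖²)⁻¹ [[1, c(z)], [c(z), ‖z‖²]]`,
in block form with respect to `Λ = Λ⁺ ⊕ Λ⁻`. -/
def bottFunction (z : V) : Module.End ℂ (Lam V) :=
  ((1 + ‖z‖ ^ 2 : ℝ) : ℂ)⁻¹ • (projEven V + clifford z + ((‖z‖ ^ 2 : ℝ) : ℂ) • projOdd V)

/-- The action of the unitary group on `Λ`. -/
def lamAct : (V ≃ₗᵢ[ℂ] V) →* Module.End ℂ (Lam V) where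
  toFun u := (ExteriorAlgebra.map (u.toLinearEquiv : V →ₗ[ℂ] V)).toLinearMap
  map_one' := by
    have : ((1 : V ≃ₗᵢ[ℂ] V).toLinearEquiv : V →ₗ[ℂ] V) = LinearMap.id := rfl
    rw [this, ExteriorAlgebra.map_id]
    rfl
  map_mul' u v := by
    have : ((u * v).toLinearEquiv : V →ₗ[ℂ] V) =
      (u.toLinearEquiv : V →ₗ[ℂ] V).comp (v.toLinearEquiv : V →ₗ[ℂ] V) := rfl
    rw [this, ← ExteriorAlgebra.map_comp_map]
    rfl

theorem lam_induction {p : Lam V → Prop} (h1 : p 1) (hadd : ∀ x y, p x → p y → p (x + y))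
    (hsmul : ∀ (c : ℂ) x, p x → p (c • x)) (hmul : ∀ v x, p x → p (ExteriorAlgebra.ι ℂ v * x))
    (x : Lam V) : p x := by
  refine CliffordAlgebra.left_induction (0 : QuadraticForm ℂ V) (fun r => ?_) (fun x y => hadd x y)
    (fun x v hx => hmul v x hx) x
  rw [Algebra.algebraMap_eq_smul_one]
  exact hsmul r 1 h1

theorem clifford_one (z : V) : clifford z 1 = ExteriorAlgebra.ι ℂ z := by
  simp [clifford, ExteriorAlgebra]

theorem clifford_ι_mul (z v : V) (x : Lam V) :
    clifford z (ExteriorAlgebra.ι ℂ v * x) =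
      (inner ℂ z v : ℂ) • x - ExteriorAlgebra.ι ℂ v * clifford z x := by
  have h : ExteriorAlgebra.ι ℂ z * ExteriorAlgebra.ι ℂ v =
      - (ExteriorAlgebra.ι ℂ v * ExteriorAlgebra.ι ℂ z) :=
    eq_neg_of_add_eq_zero_left (ExteriorAlgebra.ι_add_mul_swap z v)
  have h2 := CliffordAlgebra.contractLeft_ι_mul (Q := (0 : QuadraticForm ℂ V))
    (d := (innerSL ℂ z : V →ₗ[ℂ] ℂ)) v x
  simp only [clifford, LinearMap.add_apply, LinearMap.mulLeft_apply]
  rw [← mul_assoc, h]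
  erw [h2]
  simp only [innerSL_apply_apply, ContinuousLinearMap.coe_coe]
  rw [mul_add, neg_mul, mul_assoc]
  change _ + ((inner ℂ z v : ℂ) • x - ExteriorAlgebra.ι ℂ v * _) = _
  abel

theorem clifford_clifford (z : V) (x : Lam V) :
    clifford z (clifford z x) = ((‖z‖ ^ 2 : ℝ) : ℂ) • x := by
  have hz : (inner ℂ z z : ℂ) = ((‖z‖ ^ 2 : ℝ) : ℂ) := by
    rw [inner_self_eq_norm_sq_to_K]; simp
  induction x using lam_induction with
  | h1 =>
    have := clifford_ι_mul z z 1
    rw [mul_one, clifford_one, ExteriorAlgebra.ι_sq_zero, sub_zero] at this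
    rw [clifford_one, this, hz]
  | hadd x y hx hy => simp only [map_add, smul_add, hx, hy]
  | hsmul c x hx => rw [map_smul, map_smul, hx, smul_comm]
  | hmul v x hx =>
    rw [clifford_ι_mul, map_sub, clifford_ι_mul, hx, map_smul, mul_smul_comm]
    abel

theorem grading_one : grading V 1 = 1 := by
  simp [grading]

theorem grading_ι_mul (v : V) (x : Lam V) :
    grading V (ExteriorAlgebra.ι ℂ v * x) = -(ExteriorAlgebra.ι ℂ v * grading V x) := by
  have := CliffordAlgebra.involute_ι (Q := (0 : QuadraticForm ℂ V)) v
  have h2 := map_mul (CliffordAlgebra.involute (Q := (0 : QuadraticForm ℂ V)))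
    (CliffordAlgebra.ι (0 : QuadraticForm ℂ V) v) x
  rw [this] at h2
  rw [← neg_mul]
  exact h2

theorem grading_grading (x : Lam V) : grading V (grading V x) = x :=
  CliffordAlgebra.involute_involute (Q := (0 : QuadraticForm ℂ V)) x

theorem grading_clifford (z : V) (x : Lam V) :
    grading V (clifford z x) = - clifford z (grading V x) := by
  induction x using lam_induction with
  | h1 =>
    have := grading_ι_mul z 1
    rw [mul_one, grading_one, mul_one] at this
    rw [clifford_one, grading_one, clifford_one, this]
  | hadd x y hx hy => simp only [map_add, hx, hy]; abel
  | hsmul c x hx => rw [map_smul, map_smul, hx, map_smul, map_smul, smul_neg]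
  | hmul v x hx =>
    rw [clifford_ι_mul, map_sub, grading_ι_mul, hx, grading_ι_mul, map_smul, map_neg,
      clifford_ι_mul, mul_neg]
    abel

theorem lamAct_one (u : V ≃ₗᵢ[ℂ] V) : lamAct u (1 : Lam V) = 1 := map_one (ExteriorAlgebra.map _)

theorem lamAct_ι_mul (u : V ≃ₗᵢ[ℂ] V) (v : V) (x : Lam V) :
    lamAct u (ExteriorAlgebra.ι ℂ v * x) = ExteriorAlgebra.ι ℂ (u v) * lamAct u x := by
  have := map_mul (ExteriorAlgebra.map (u.toLinearEquiv : V →ₗ[ℂ] V)) (ExteriorAlgebra.ι ℂ v) x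
  rw [ExteriorAlgebra.map_apply_ι] at this
  exact this

theorem lamAct_clifford (u : V ≃ₗᵢ[ℂ] V) (z : V) (x : Lam V) :
    lamAct u (clifford z x) = clifford (u z) (lamAct u x) := by
  induction x using lam_induction with
  | h1 =>
    have := lamAct_ι_mul u z 1
    rw [mul_one, lamAct_one, mul_one] at this
    rw [clifford_one, lamAct_one, clifford_one, this]
  | hadd x y hx hy => simp only [map_add, hx, hy]
  | hsmul c x hx => simp only [map_smul, hx]
  | hmul v x hx =>
    rw [clifford_ι_mul, map_sub, lamAct_ι_mul, hx, lamAct_ι_mul, map_smul, clifford_ι_mul,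
      LinearIsometryEquiv.inner_map_map]

theorem lamAct_grading (u : V ≃ₗᵢ[ℂ] V) (x : Lam V) :
    lamAct u (grading V x) = grading V (lamAct u x) := by
  induction x using lam_induction with
  | h1 => rw [grading_one, lamAct_one, grading_one]
  | hadd x y hx hy => simp only [map_add, hx, hy]
  | hsmul c x hx => simp only [map_smul, hx]
  | hmul v x hx =>
    rw [grading_ι_mul, map_neg, lamAct_ι_mul, hx, lamAct_ι_mul, grading_ι_mul]

theorem projOdd_idem : projOdd V * projOdd V = projOdd V := by
  refine LinearMap.ext fun x => ?_
  simp only [projOdd, Module.End.mul_apply, LinearMap.smul_apply, LinearMap.sub_apply,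
    Module.End.one_apply, map_smul, map_sub, grading_grading]
  module

theorem bottFunction_idem (z : V) : bottFunction z * bottFunction z = bottFunction z := by
  have hz : ((1 + ‖z‖ ^ 2 : ℝ) : ℂ) ≠ 0 := by
    have : (0 : ℝ) < 1 + ‖z‖ ^ 2 := by positivity
    exact_mod_cast this.ne'
  refine LinearMap.ext fun x => ?_
  have h : (projEven V + clifford z + ((‖z‖ ^ 2 : ℝ) : ℂ) • projOdd V) *
      (projEven V + clifford z + ((‖z‖ ^ 2 : ℝ) : ℂ) • projOdd V) =
      ((1 + ‖z‖ ^ 2 : ℝ) : ℂ) •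
        (projEven V + clifford z + ((‖z‖ ^ 2 : ℝ) : ℂ) • projOdd V) := by
    refine LinearMap.ext fun x => ?_
    simp only [projOdd, projEven, Module.End.mul_apply, LinearMap.smul_apply, LinearMap.sub_apply,
      LinearMap.add_apply, Module.End.one_apply, map_smul, map_sub, map_add,
      grading_grading, grading_clifford, clifford_clifford]
    push_cast
    module
  rw [bottFunction, smul_mul_smul_comm, h, smul_smul, mul_assoc, inv_mul_cancel₀ hz, mul_one]

theorem lamAct_projOdd (u : V ≃ₗᵢ[ℂ] V) : lamAct u * projOdd V = projOdd V * lamAct u := by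
  refine LinearMap.ext fun x => ?_
  simp only [projOdd, Module.End.mul_apply, LinearMap.smul_apply, LinearMap.sub_apply,
    Module.End.one_apply, map_smul, map_sub, lamAct_grading]

theorem lamAct_bottFunction (u : V ≃ₗᵢ[ℂ] V) (z : V) :
    lamAct u * bottFunction (u.symm z) = bottFunction z * lamAct u := by
  refine LinearMap.ext fun x => ?_
  simp only [bottFunction, projOdd, projEven, Module.End.mul_apply, LinearMap.smul_apply,
    LinearMap.sub_apply, LinearMap.add_apply, Module.End.one_apply, map_smul, map_sub, map_add,
    lamAct_grading, lamAct_clifford, LinearIsometryEquiv.apply_symm_apply,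
    LinearIsometryEquiv.norm_map]

variable [FiniteDimensional ℂ V]

instance : Module.Finite ℂ (Lam V) := by
  have hz : ∀ i, Module.finrank ℂ V < i → (⋀[ℂ]^i V : Submodule ℂ (Lam V)) = ⊥ := by
    intro i hi
    rw [← Submodule.finrank_eq_zero (R := ℂ), exteriorPower.finrank_eq, Nat.choose_eq_zero_of_lt hi]
  have htop : (⨆ i, (⋀[ℂ]^i V : Submodule ℂ (Lam V))) = ⊤ :=
    (DirectSum.Decomposition.isInternal fun i : ℕ =>
      (⋀[ℂ]^i V : Submodule ℂ (Lam V))).submodule_iSup_eq_top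
  have hfin : (⨆ i ∈ Finset.range (Module.finrank ℂ V + 1),
      (⋀[ℂ]^i V : Submodule ℂ (Lam V))) = ⊤ := by
    rw [← htop]
    refine le_antisymm (iSup₂_le fun i _ => le_iSup _ i) (iSup_le fun i => ?_)
    by_cases hi : Module.finrank ℂ V < i
    · rw [hz i hi]
      exact bot_le
    · exact le_iSup₂_of_le i (Finset.mem_range.2 (by omega)) le_rfl
  refine ⟨?_⟩
  rw [← hfin]
  exact Submodule.fg_biSup _ _ fun i _ =>
    (Submodule.fg_top _).1 (Module.Finite.fg_top (R := ℂ) (M := ⋀[ℂ]^i V))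

/-- The index set of a basis of `Λ`. -/
abbrev LamIndex (V : Type*) [NormedAddCommGroup V] [InnerProductSpace ℂ V] : Type :=
  Fin (Module.finrank ℂ (Lam V))

/-- The matrix of an endomorphism of `Λ`, in a fixed basis. -/
def lamMatrix : Module.End ℂ (Lam V) ≃ₐ[ℂ] Matrix (LamIndex V) (LamIndex V) ℂ :=
  LinearMap.toMatrixAlgEquiv (Module.finBasis ℂ (Lam V))

/-- Matrix coefficients of families of endomorphisms that are pointwise continuous. -/
theorem continuous_lamMatrix {X : Type*} [TopologicalSpace X] (F : X → Module.End ℂ (Lam V))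
    (h : ∀ (x : Lam V) i, Continuous fun s => (Module.finBasis ℂ (Lam V)).repr (F s x) i) :
    Continuous fun s => lamMatrix (F s) := by
  refine continuous_matrix fun i j => ?_
  simp only [lamMatrix, LinearMap.toMatrixAlgEquiv_apply]
  exact h _ i

theorem continuous_repr_mul {X : Type*} [TopologicalSpace X] {f g : X → Lam V}
    (hf : ∀ i, Continuous fun s => (Module.finBasis ℂ (Lam V)).repr (f s) i)
    (hg : ∀ i, Continuous fun s => (Module.finBasis ℂ (Lam V)).repr (g s) i) (i : LamIndex V) :
    Continuous fun s => (Module.finBasis ℂ (Lam V)).repr (f s * g s) i := by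
  have h : ∀ s, (Module.finBasis ℂ (Lam V)).repr (f s * g s) i =
      ∑ k, ∑ l, (Module.finBasis ℂ (Lam V)).repr (f s) k *
        ((Module.finBasis ℂ (Lam V)).repr (g s) l *
        (Module.finBasis ℂ (Lam V)).repr
          (Module.finBasis ℂ (Lam V) k * Module.finBasis ℂ (Lam V) l) i) := by
    intro s
    conv_lhs => rw [← (Module.finBasis ℂ (Lam V)).sum_repr (f s),
      ← (Module.finBasis ℂ (Lam V)).sum_repr (g s), Finset.sum_mul_sum]
    simp [Finsupp.finsetSum_apply]
    exact Finset.sum_congr rfl fun k _ => Finset.sum_congr rfl fun l _ => by ring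
  simp only [h]
  exact continuous_finsetSum _ fun k _ => continuous_finsetSum _ fun l _ =>
    (hf k).mul ((hg l).mul continuous_const)

theorem continuous_repr_ι {X : Type*} [TopologicalSpace X] {f : X → V} (hf : Continuous f)
    (i : LamIndex V) :
    Continuous fun s => (Module.finBasis ℂ (Lam V)).repr (ExteriorAlgebra.ι ℂ (f s)) i :=
  (LinearMap.continuous_of_finiteDimensional
    (((Module.finBasis ℂ (Lam V)).coord i).comp (ExteriorAlgebra.ι ℂ))).comp hf

theorem continuous_unitary_apply (v : V) : Continuous fun u : V ≃ₗᵢ[ℂ] V => u v := by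
  have h : Continuous fun u : V ≃ₗᵢ[ℂ] V => (u.toContinuousLinearEquiv : V →L[ℂ] V) :=
    continuous_induced_dom
  exact h.clm_apply continuous_const

theorem continuous_lamAct :
    Continuous fun u : V ≃ₗᵢ[ℂ] V => lamMatrix (lamAct u) := by
  refine continuous_lamMatrix _ fun x => ?_
  induction x using lam_induction with
  | h1 => intro i; simp only [lamAct_one]; exact continuous_const
  | hadd x y hx hy =>
    intro i
    simp only [map_add, Finsupp.add_apply]
    exact (hx i).add (hy i)
  | hsmul c x hx =>
    intro i
    simp only [map_smul, Finsupp.smul_apply]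
    exact (hx i).const_smul c
  | hmul v x hx =>
    simp only [lamAct_ι_mul]
    exact continuous_repr_mul (continuous_repr_ι (continuous_unitary_apply v)) hx

theorem continuous_clifford : Continuous fun z : V => lamMatrix (clifford z) := by
  refine continuous_lamMatrix _ fun x => ?_
  induction x using lam_induction with
  | h1 => simp only [clifford_one]; exact continuous_repr_ι continuous_id
  | hadd x y hx hy =>
    intro i
    simp only [map_add, Finsupp.add_apply]
    exact (hx i).add (hy i)
  | hsmul c x hx =>
    intro i
    simp only [map_smul, Finsupp.smul_apply]
    exact (hx i).const_smul c
  | hmul v x hx =>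
    intro i
    simp only [clifford_ι_mul, map_sub, map_smul, Finsupp.sub_apply, Finsupp.smul_apply]
    exact ((Continuous.inner (𝕜 := ℂ) continuous_id continuous_const).smul
      continuous_const).sub
      (continuous_repr_mul (f := fun _ => ExteriorAlgebra.ι ℂ v) (fun _ => continuous_const) hx i)

theorem clifford_add (z w : V) : clifford (z + w) = clifford z + clifford w := by
  refine LinearMap.ext fun x => ?_
  induction x using lam_induction with
  | h1 => simp only [LinearMap.add_apply, clifford_one, map_add]
  | hadd x y hx hy => rw [map_add, hx, hy, map_add]
  | hsmul c x hx => rw [map_smul, hx, map_smul]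
  | hmul v x hx =>
    simp only [LinearMap.add_apply] at hx ⊢
    rw [clifford_ι_mul, hx, clifford_ι_mul, clifford_ι_mul, inner_add_left, add_smul, mul_add]
    abel

theorem clifford_smul_real (r : ℝ) (z : V) : clifford ((r : ℂ) • z) = (r : ℂ) • clifford z := by
  refine LinearMap.ext fun x => ?_
  induction x using lam_induction with
  | h1 => simp only [LinearMap.smul_apply, clifford_one, map_smul]
  | hadd x y hx hy => simp only [map_add, hx, hy]
  | hsmul c x hx => simp only [map_smul, hx]
  | hmul v x hx =>
    simp only [LinearMap.smul_apply] at hx ⊢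
    rw [clifford_ι_mul, hx, clifford_ι_mul, inner_smul_left, mul_smul_comm, smul_sub, smul_smul]
    simp

theorem bottFunction_eq (z : V) : bottFunction z =
    projOdd V + ((1 + ‖z‖ ^ 2 : ℝ) : ℂ)⁻¹ • (grading V + clifford z) := by
  have hz : ((1 + ‖z‖ ^ 2 : ℝ) : ℂ) ≠ 0 := by
    have : (0 : ℝ) < 1 + ‖z‖ ^ 2 := by positivity
    exact_mod_cast this.ne'
  have h : projEven V + clifford z + ((‖z‖ ^ 2 : ℝ) : ℂ) • projOdd V =
      ((1 + ‖z‖ ^ 2 : ℝ) : ℂ) • projOdd V + (grading V + clifford z) := by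
    simp only [projEven, projOdd]
    push_cast
    module
  rw [bottFunction, h, smul_add, smul_smul, inv_mul_cancel₀ hz, one_smul]

theorem exists_clifford_bound (i j : LamIndex V) :
    ∃ C : ℝ, ∀ z : V, ‖lamMatrix (clifford z) i j‖ ≤ C * ‖z‖ := by
  let L : V →ₗ[ℝ] ℂ :=
    { toFun := fun z => lamMatrix (clifford z) i j
      map_add' := fun z w => by rw [clifford_add, map_add, Matrix.add_apply]
      map_smul' := fun r z => by
        have : (r : ℝ) • z = (r : ℂ) • z := (Complex.coe_smul r z).symm
        rw [this, clifford_smul_real, map_smul, Matrix.smul_apply]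
        simp }
  exact ⟨‖LinearMap.toContinuousLinearMap L‖, fun z => (LinearMap.toContinuousLinearMap L).le_opNorm z⟩

theorem bottCoeff_eq (i j : LamIndex V) (z : V) :
    lamMatrix (bottFunction z - projOdd V) i j =
      ((1 + ‖z‖ ^ 2 : ℝ) : ℂ)⁻¹ * (lamMatrix (grading V) i j + lamMatrix (clifford z) i j) := by
  rw [bottFunction_eq, add_sub_cancel_left, map_smul, map_add]
  rfl

/-- The matrix coefficients of `e_β(z) - e_β(∞)`, where `e_β(∞)` is the projection onto `Λ⁻`.
They are functions in `C₀(V)`. -/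
def bottCoeff (i j : LamIndex V) : C₀(V, ℂ) where
  toFun z := lamMatrix (bottFunction z - projOdd V) i j
  continuous_toFun := by
    simp only [bottCoeff_eq]
    have hc : Continuous fun z : V => lamMatrix (clifford z) i j :=
      continuous_clifford.matrix_elem i j
    refine Continuous.mul (Continuous.inv₀ (by fun_prop) fun z => ?_) (continuous_const.add hc)
    have : (0 : ℝ) < 1 + ‖z‖ ^ 2 := by positivity
    exact_mod_cast this.ne'
  zero_at_infty' := by
    obtain ⟨C, hC⟩ := exists_clifford_bound (V := V) i j
    have hC0 : 0 ≤ |C| := abs_nonneg C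
    set D := ‖lamMatrix (grading V) i j‖ with hD
    have hD0 : 0 ≤ D := norm_nonneg _
    have hlim : Filter.Tendsto (fun z : V => (2 * (D + |C|)) / (1 + ‖z‖)) (Filter.cocompact V)
        (nhds 0) :=
      tendsto_const_nhds.div_atTop
        (Filter.tendsto_atTop_add_const_left _ _ (tendsto_norm_cocompact_atTop))
    refine squeeze_zero_norm (fun z => ?_) hlim
    have hz : 0 ≤ ‖z‖ := norm_nonneg z
    have h1 : (0 : ℝ) < 1 + ‖z‖ ^ 2 := by positivity
    rw [bottCoeff_eq, norm_mul, norm_inv, Complex.norm_real, Real.norm_of_nonneg h1.le,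
      inv_mul_eq_div, div_le_div_iff₀ h1 (by positivity)]
    have h2 : ‖lamMatrix (grading V) i j + lamMatrix (clifford z) i j‖ ≤
        (D + |C|) * (1 + ‖z‖) := by
      refine (norm_add_le _ _).trans ?_
      have h3 := (hC z).trans (mul_le_mul_of_nonneg_right (le_abs_self C) hz)
      nlinarith [mul_nonneg hD0 hz, mul_nonneg hC0 hz]
    calc _ ≤ (D + |C|) * (1 + ‖z‖) * (1 + ‖z‖) := by gcongr
      _ ≤ 2 * (D + |C|) * (1 + ‖z‖ ^ 2) := by
        nlinarith [mul_nonneg (add_nonneg hD0 hC0) (sq_nonneg (1 - ‖z‖))]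

theorem bottCoeff_apply (i j : LamIndex V) (z : V) :
    bottCoeff i j z = lamMatrix (bottFunction z - projOdd V) i j := rfl

/-- The value at a point of an element of `C₀(V)⁺ = C(V⁺)`. -/
def evalPlus (z : V) : Unitization ℂ C₀(V, ℂ) →ₐ[ℂ] ℂ :=
  Unitization.lift
    { toFun := fun f => f z
      map_smul' := fun _ _ => rfl
      map_zero' := rfl
      map_add' := fun _ _ => rfl
      map_mul' := fun _ _ => rfl }

theorem evalPlus_apply (z : V) (x : Unitization ℂ C₀(V, ℂ)) :
    evalPlus z x = x.fst + x.snd z := rfl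

theorem evalPlus_ext {ι κ : Type} {x y : Matrix ι κ (Unitization ℂ C₀(V, ℂ))}
    (h0 : x.map (Unitization.fstHom ℂ C₀(V, ℂ)) = y.map (Unitization.fstHom ℂ C₀(V, ℂ)))
    (h : ∀ z : V, x.map (evalPlus z) = y.map (evalPlus z)) : x = y := by
  ext1 i j
  have h1 : (x i j).fst = (y i j).fst := congrFun (congrFun h0 i) j
  refine Unitization.ext h1 (ZeroAtInftyContinuousMap.ext fun z => ?_)
  have h2 : evalPlus z (x i j) = evalPlus z (y i j) := congrFun (congrFun (h z) i) j
  rw [evalPlus_apply, evalPlus_apply, h1] at h2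
  exact add_left_cancel h2

theorem map_fst_scal {ι κ : Type} (m : Matrix ι κ ℂ) :
    (scal (Unitization ℂ C₀(V, ℂ)) m).map (Unitization.fstHom ℂ C₀(V, ℂ)) = m := by
  ext i j
  change (algebraMap ℂ (Unitization ℂ C₀(V, ℂ)) (m i j)).fst = m i j
  rw [Unitization.algebraMap_eq_inl]
  rfl

theorem map_evalPlus_scal {ι κ : Type} (z : V) (m : Matrix ι κ ℂ) :
    (scal (Unitization ℂ C₀(V, ℂ)) m).map (evalPlus z) = m := by
  ext i j
  exact (evalPlus z).commutes (m i j)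

theorem map_fst_act {ι κ : Type} (u : V ≃ₗᵢ[ℂ] V) (x : Matrix ι κ (Unitization ℂ C₀(V, ℂ))) :
    (x.map (unitAct c0Act u)).map (Unitization.fstHom ℂ C₀(V, ℂ)) =
      x.map (Unitization.fstHom ℂ C₀(V, ℂ)) := by
  ext i j
  exact unitMap_fst (c0Act u) (x i j)

theorem map_evalPlus_act {ι κ : Type} (z : V) (u : V ≃ₗᵢ[ℂ] V)
    (x : Matrix ι κ (Unitization ℂ C₀(V, ℂ))) :
    (x.map (unitAct c0Act u)).map (evalPlus z) = x.map (evalPlus (u.symm z)) := by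
  ext i j
  change evalPlus z (unitMap (c0Act u) (x i j)) = evalPlus (u.symm z) (x i j)
  rw [evalPlus_apply, evalPlus_apply, unitMap_fst, unitMap_snd]
  rfl

theorem map_fst_functionMatrix {p : Module.End ℂ (Lam V)}
    {k : Matrix (LamIndex V) (LamIndex V) C₀(V, ℂ)} :
    (Matrix.of fun i j => Unitization.inl (lamMatrix p i j) + Unitization.inr (k i j) :
      Matrix (LamIndex V) (LamIndex V) (Unitization ℂ C₀(V, ℂ))).map
        (Unitization.fstHom ℂ C₀(V, ℂ)) = lamMatrix p := by
  ext i j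
  simp

theorem map_evalPlus_functionMatrix {p e : Module.End ℂ (Lam V)}
    {k : Matrix (LamIndex V) (LamIndex V) C₀(V, ℂ)} (z : V)
    (hk : ∀ i j, k i j z = lamMatrix (e - p) i j) :
    (Matrix.of fun i j => Unitization.inl (lamMatrix p i j) + Unitization.inr (k i j) :
      Matrix (LamIndex V) (LamIndex V) (Unitization ℂ C₀(V, ℂ))).map (evalPlus z) =
        lamMatrix e := by
  ext i j
  simp [evalPlus_apply, hk]

/-- A `U`-equivariant idempotent-valued function `e : V → End(Λ)` for which `e - p` vanishes at
infinity, where `p` is an invariant constant idempotent, as an idempotent over `C₀(V)⁺ = C(V⁺)`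
(with the value `p` at infinity). The representation space is `Λ`, with its natural
action of the unitary group. -/
def functionCycle (p : Module.End ℂ (Lam V)) (e : V → Module.End ℂ (Lam V))
    (k : Matrix (LamIndex V) (LamIndex V) C₀(V, ℂ))
    (hk : ∀ i j z, k i j z = lamMatrix (e z - p) i j)
    (hp : p * p = p) (he : ∀ z, e z * e z = e z)
    (hup : ∀ u, lamAct u * p = p * lamAct u)
    (hue : ∀ u z, lamAct u * e (u.symm z) = e z * lamAct u) :
    Cycle (unitAct (c0Act (V := V))) where
  ι := LamIndex V
  ρ := (lamMatrix (V := V)).toAlgHom.toRingHom.toMonoidHom.comp lamAct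
  continuous_ρ := continuous_lamAct
  e := Matrix.of fun i j => Unitization.inl (lamMatrix p i j) + Unitization.inr (k i j)
  idem := by
    refine evalPlus_ext ?_ fun z => ?_
    · rw [Matrix.map_mul, map_fst_functionMatrix, ← map_mul, hp]
    · rw [Matrix.map_mul, map_evalPlus_functionMatrix z (hk · · z), ← map_mul, he]
  invariant := fun u => by
    refine evalPlus_ext ?_ fun z => ?_
    · rw [Matrix.map_mul, Matrix.map_mul, map_fst_functionMatrix, map_fst_scal, map_fst_act,
        map_fst_functionMatrix]
      change lamMatrix (lamAct u) * lamMatrix p = lamMatrix p * lamMatrix (lamAct u)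
      rw [← map_mul, ← map_mul, hup]
    · rw [Matrix.map_mul, Matrix.map_mul, map_evalPlus_functionMatrix z (hk · · z),
        map_evalPlus_scal, map_evalPlus_act,
        map_evalPlus_functionMatrix (u.symm z) (hk · · (u.symm z))]
      change lamMatrix (lamAct u) * lamMatrix (e (u.symm z)) =
        lamMatrix (e z) * lamMatrix (lamAct u)
      rw [← map_mul, ← map_mul, hue]

/-- The Bott idempotent `e_β` over `C₀(V)⁺`, with value at infinity the projection onto `Λ⁻`. -/
def bottIdempotent : Cycle (unitAct (c0Act (V := V))) :=
  functionCycle (projOdd V) bottFunction (Matrix.of bottCoeff) bottCoeff_apply projOdd_idem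
    bottFunction_idem lamAct_projOdd lamAct_bottFunction

/-- The constant idempotent `[[0, 0], [0, 1]]`, the projection onto `Λ⁻`. -/
def oddIdempotent : Cycle (unitAct (c0Act (V := V))) :=
  functionCycle (projOdd V) (fun _ => projOdd V) 0 (by simp) projOdd_idem
    (fun _ => projOdd_idem) lamAct_projOdd (fun u _ => lamAct_projOdd u)

variable (V) in
/-- The Bott generator `[e_β] - [[[0, 0], [0, 1]]]` of `K^0_U(V) = K_0^U(C₀(V))`. -/
def bott : NK0 (c0Act (V := V)) :=
  NK0.diff bottIdempotent oddIdempotent (by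
    rw [augmentation, K0.map_cls, K0.map_cls]
    congr 1)

end Bott

end

end WeylBott

namespace WeylBott

noncomputable section

/-! ## Weyl operators -/

section WeylOperators

set_option linter.unusedSectionVars false

open Filter Topology
open scoped FourierTransform

variable {V : Type*} [NormedAddCommGroup V] [InnerProductSpace ℂ V] [FiniteDimensional ℂ V]
  [MeasurableSpace V] [BorelSpace V]

attribute [local instance] InnerProductSpace.complexToReal

/-- `T` is the weighted composition operator `(T f)(x) = χ(x) f(φ(x))`. -/
def IsWeightedComp (T : L2 V → L2 V) (χ : V → ℂ) (φ : V → V) : Prop :=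
  Measure.QuasiMeasurePreserving φ (leb V) (leb V) ∧
    ∀ f : L2 V, (T f : V → ℂ) =ᵐ[leb V] fun x => χ x * (f : V → ℂ) (φ x)

theorem IsWeightedComp.comp {T S : L2 V → L2 V} {χ χ' : V → ℂ} {φ φ' : V → V}
    (hT : IsWeightedComp T χ φ) (hS : IsWeightedComp S χ' φ') :
    IsWeightedComp (fun f => T (S f)) (fun x => χ x * χ' (φ x)) (fun x => φ' (φ x)) := by
  refine ⟨hS.1.comp hT.1, fun f => ?_⟩
  filter_upwards [hT.2 (S f), hT.1.ae_eq (hS.2 f)] with x h1 h2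
  simp only [Function.comp] at h2
  rw [h1, h2, mul_assoc]

theorem IsWeightedComp.eq_smul {T S : L2 V → L2 V} {χ χ' : V → ℂ} {φ φ' : V → V}
    (hT : IsWeightedComp T χ φ) (hS : IsWeightedComp S χ' φ') (c : ℂ)
    (h1 : ∀ x, χ x = c * χ' x) (h2 : ∀ x, φ x = φ' x) (f : L2 V) : T f = c • S f := by
  refine Lp.ext ?_
  filter_upwards [hT.2 f, hS.2 f, Lp.coeFn_smul c (S f)] with x hx hx1 hx2
  rw [hx, hx2, Pi.smul_apply, hx1, h1, h2, smul_eq_mul, mul_assoc]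

theorem IsWeightedComp.eq {T S : L2 V → L2 V} {χ χ' : V → ℂ} {φ φ' : V → V}
    (hT : IsWeightedComp T χ φ) (hS : IsWeightedComp S χ' φ')
    (h1 : ∀ x, χ x = χ' x) (h2 : ∀ x, φ x = φ' x) (f : L2 V) : T f = S f := by
  rw [hT.eq_smul hS 1 (by simpa using h1) h2, one_smul]

theorem isWeightedComp_l2Act (u : V ≃ₗᵢ[ℂ] V) :
    IsWeightedComp (l2Act u) (fun _ => 1) (fun x => u.symm x) :=
  ⟨(measurePreserving_unitary u.symm).quasiMeasurePreserving, fun f => by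
    filter_upwards [l2Act_coe u f] with x hx
    rw [hx, one_mul]⟩

/-- Multiplication by a continuous unimodular function. -/
def modulation (χ : C(V, ℂ)) (h : ∀ x, ‖χ x‖ = 1) : L2 V →ₗᵢ[ℂ] L2 V :=
  have hm : ∀ f : L2 V, MemLp (fun x => χ x * (f : V → ℂ) x) 2 (leb V) := fun f =>
    (Lp.memLp f).of_le (χ.continuous.aestronglyMeasurable.mul (Lp.aestronglyMeasurable f))
      (Eventually.of_forall fun x => by simp [h])
  { toFun := fun f => (hm f).toLp _
    map_add' := fun f g => by
      refine Lp.ext ?_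
      filter_upwards [(hm (f + g)).coeFn_toLp, (hm f).coeFn_toLp, (hm g).coeFn_toLp,
        Lp.coeFn_add f g, Lp.coeFn_add ((hm f).toLp _) ((hm g).toLp _)] with x h1 h2 h3 h4 h5
      rw [h1, h5, Pi.add_apply, h2, h3, h4, Pi.add_apply, mul_add]
    map_smul' := fun c f => by
      refine Lp.ext ?_
      filter_upwards [(hm (c • f)).coeFn_toLp, (hm f).coeFn_toLp,
        Lp.coeFn_smul c f, Lp.coeFn_smul c ((hm f).toLp _)] with x h1 h2 h3 h4
      rw [RingHom.id_apply, h1, h4, Pi.smul_apply, h2, h3, Pi.smul_apply, smul_eq_mul,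
        smul_eq_mul, mul_left_comm]
    norm_map' := fun f => by
      change ‖(hm f).toLp _‖ = ‖f‖
      rw [Lp.norm_toLp, Lp.norm_def]
      congr 1
      exact eLpNorm_congr_norm_ae (Eventually.of_forall fun x => by simp [h]) }

theorem modulation_coe (χ : C(V, ℂ)) (h : ∀ x, ‖χ x‖ = 1) (f : L2 V) :
    (modulation χ h f : V → ℂ) =ᵐ[leb V] fun x => χ x * (f : V → ℂ) x :=
  MemLp.coeFn_toLp ((Lp.memLp f).of_le
    (χ.continuous.aestronglyMeasurable.mul (Lp.aestronglyMeasurable f))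
      (Eventually.of_forall fun x => by simp [h]))

/-- Translation `f ↦ f(· + a)`. -/
def translation (a : V) : L2 V →ₗᵢ[ℂ] L2 V :=
  Lp.compMeasurePreservingₗᵢ ℂ (fun x => x + a) (measurePreserving_add_right (leb V) a)

theorem translation_coe (a : V) (f : L2 V) :
    (translation a f : V → ℂ) =ᵐ[leb V] fun x => (f : V → ℂ) (x + a) :=
  Lp.coeFn_compMeasurePreserving f (measurePreserving_add_right (leb V) a)

/-- The character `x ↦ exp(2 π i Re ⟨x, w⟩)`. -/
def character (w : V) : C(V, ℂ) :=
  ⟨fun x => Complex.exp ((2 * Real.pi * (inner ℂ x w).re : ℝ) * Complex.I), by fun_prop⟩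

theorem character_apply (w x : V) : character w x =
    Complex.exp ((2 * Real.pi * (inner ℂ x w).re : ℝ) * Complex.I) := rfl

theorem norm_character (w x : V) : ‖character w x‖ = 1 := by
  rw [character_apply, Complex.norm_exp_ofReal_mul_I]

/-- The Weyl operators `(M_l(w) g)(x) = exp(2 π i Re ⟨x, w⟩) g(x - i π l w)`. -/
def weyl (l : ℝ) (w : V) : L2 V →ₗᵢ[ℂ] L2 V :=
  (modulation (character w) (norm_character w)).comp
    (translation (-(Complex.I * Real.pi * l : ℂ) • w))

theorem isWeightedComp_weyl (l : ℝ) (w : V) :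
    IsWeightedComp (weyl l w) (character w) (fun x => x + -(Complex.I * Real.pi * l : ℂ) • w) := by
  refine ⟨(measurePreserving_add_right (leb V) _).quasiMeasurePreserving, fun f => ?_⟩
  filter_upwards [modulation_coe (character w) (norm_character w)
    (translation (-(Complex.I * Real.pi * l : ℂ) • w) f),
    translation_coe (-(Complex.I * Real.pi * l : ℂ) • w) f] with x h1 h2
  rw [← h2, ← h1]
  rfl

theorem weyl_coe (l : ℝ) (w : V) (f : L2 V) : (weyl l w f : V → ℂ) =ᵐ[leb V]
    fun x => character w x * (f : V → ℂ) (x + -(Complex.I * Real.pi * l : ℂ) • w) :=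
  (isWeightedComp_weyl l w).2 f

theorem character_add (w w' x : V) : character (w + w') x = character w x * character w' x := by
  simp only [character_apply, inner_add_right, Complex.add_re, ← Complex.exp_add]
  congr 1
  push_cast
  ring

theorem character_add_right (w x y : V) :
    character w (x + y) = character w x * character w y := by
  simp only [character_apply, inner_add_left, Complex.add_re, ← Complex.exp_add]
  congr 1
  push_cast
  ring

/-- The cocycle `exp(-2 π² i l ω(w, w'))` of the Weyl operators. -/
def cocycle (l : ℝ) (w w' : V) : ℂ :=
  Complex.exp ((-(2 * Real.pi ^ 2 * l * omega w w') : ℝ) * Complex.I)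

theorem norm_cocycle (l : ℝ) (w w' : V) : ‖cocycle l w w'‖ = 1 := by
  rw [cocycle, Complex.norm_exp_ofReal_mul_I]

theorem character_shift (l : ℝ) (w w' : V) :
    character w' (-(Complex.I * Real.pi * l : ℂ) • w) = cocycle l w w' := by
  rw [character_apply, cocycle, inner_smul_left]
  congr 3
  simp [omega]
  ring

theorem weyl_weyl (l : ℝ) (w w' : V) (f : L2 V) :
    weyl l w (weyl l w' f) = cocycle l w w' • weyl l (w + w') f := by
  refine ((isWeightedComp_weyl l w).comp (isWeightedComp_weyl l w')).eq_smul
    (isWeightedComp_weyl l (w + w')) _ (fun x => ?_) (fun x => ?_) f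
  · rw [character_add_right, character_shift, character_add]
    ring
  · rw [smul_add, add_assoc]

theorem omega_swap (v w : V) : omega v w = -omega w v := by
  rw [omega, omega, ← inner_conj_symm, Complex.conj_im]

theorem cocycle_swap (l : ℝ) (w w' : V) : cocycle (-l) w w' = cocycle l w' w := by
  rw [cocycle, cocycle, omega_swap w w']
  congr 3
  ring

theorem weyl_comm_neg (l : ℝ) (w w' : V) (f : L2 V) :
    weyl l w (weyl (-l) w' f) = weyl (-l) w' (weyl l w f) := by
  refine ((isWeightedComp_weyl l w).comp (isWeightedComp_weyl (-l) w')).eq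
    ((isWeightedComp_weyl (-l) w').comp (isWeightedComp_weyl l w)) (fun x => ?_) (fun x => ?_) f
  · rw [character_add_right, character_add_right, character_shift, character_shift, cocycle_swap]
    ring
  · rw [add_assoc, add_assoc, add_comm (_ • w)]

theorem weyl_zero (l : ℝ) (f : L2 V) : weyl l 0 f = f := by
  refine Lp.ext ?_
  filter_upwards [weyl_coe l 0 f] with x hx
  rw [hx]
  simp [character_apply]

theorem omega_self (v : V) : omega v v = 0 := by
  have := omega_swap v v
  linarith

theorem weyl_neg_weyl (l : ℝ) (w : V) (f : L2 V) : weyl l (-w) (weyl l w f) = f := by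
  rw [weyl_weyl, neg_add_cancel, weyl_zero]
  have : omega (-w) w = 0 := by
    rw [omega, inner_neg_left, Complex.neg_im, ← omega, omega_self, neg_zero]
  simp [cocycle, this]

theorem weyl_weyl_neg (l : ℝ) (w : V) (f : L2 V) : weyl l w (weyl l (-w) f) = f := by
  simpa using weyl_neg_weyl l (-w) f

theorem inner_weyl_left (l : ℝ) (w : V) (f g : L2 V) :
    inner ℂ (weyl l w f) g = inner ℂ f (weyl l (-w) g) := by
  rw [← (weyl l w).inner_map_map f (weyl l (-w) g), weyl_weyl_neg]

theorem norm_sq_eq_integral (f : L2 V) : ‖f‖ ^ 2 = ∫ x, ‖(f : V → ℂ) x‖ ^ 2 ∂(leb V) := by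
  have h := L2.inner_def (𝕜 := ℂ) f f
  rw [inner_self_eq_norm_sq_to_K] at h
  have h2 : ∀ x, inner ℂ ((f : V → ℂ) x) ((f : V → ℂ) x) = ((‖(f : V → ℂ) x‖ ^ 2 : ℝ) : ℂ) :=
    fun x => by rw [inner_self_eq_norm_sq_to_K]; simp
  simp only [h2] at h
  rw [integral_complex_ofReal] at h
  exact Complex.ofReal_injective (by push_cast; exact h)

theorem integrable_norm_sq (f : L2 V) :
    Integrable (fun x => ‖(f : V → ℂ) x‖ ^ 2) (leb V) :=
  (memLp_two_iff_integrable_sq_norm (Lp.aestronglyMeasurable f)).1 (Lp.memLp f)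

theorem continuous_character (x : V) : Continuous fun w : V => character w x := by
  simp only [character_apply]
  fun_prop

theorem continuous_modulation (f : L2 V) :
    Continuous fun w : V => modulation (character w) (norm_character w) f := by
  rw [continuous_iff_continuousAt]
  intro w₀
  rw [ContinuousAt, tendsto_iff_norm_sub_tendsto_zero]
  have h : ∀ w : V, ‖modulation (character w) (norm_character w) f -
      modulation (character w₀) (norm_character w₀) f‖ ^ 2 =
      ∫ x, (‖character w x - character w₀ x‖ * ‖(f : V → ℂ) x‖) ^ 2 ∂(leb V) := by
    intro w
    rw [norm_sq_eq_integral]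
    refine integral_congr_ae ?_
    filter_upwards [Lp.coeFn_sub (modulation (character w) (norm_character w) f)
      (modulation (character w₀) (norm_character w₀) f),
      modulation_coe (character w) (norm_character w) f,
      modulation_coe (character w₀) (norm_character w₀) f] with x h1 h2 h3
    rw [h1, Pi.sub_apply, h2, h3, ← sub_mul, norm_mul]
  have h0 : Tendsto (fun w : V => ‖modulation (character w) (norm_character w) f -
      modulation (character w₀) (norm_character w₀) f‖ ^ 2) (𝓝 w₀) (𝓝 0) := by
    simp only [h]
    have : (0 : ℝ) = ∫ x : V, (0 : ℝ) ∂(leb V) := by simp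
    rw [this]
    refine tendsto_integral_filter_of_dominated_convergence
      (fun x => 4 * ‖(f : V → ℂ) x‖ ^ 2) ?_ ?_ ?_ ?_
    · refine Eventually.of_forall fun w => ?_
      have := (character w).continuous.aestronglyMeasurable (μ := leb V)
      have := (character w₀).continuous.aestronglyMeasurable (μ := leb V)
      have := Lp.aestronglyMeasurable f
      fun_prop
    · refine Eventually.of_forall fun w => Eventually.of_forall fun x => ?_
      rw [Real.norm_of_nonneg (by positivity), mul_pow]
      have h1 : ‖character w x - character w₀ x‖ ≤ 2 := by
        refine (norm_sub_le _ _).trans ?_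
        rw [norm_character, norm_character]
        norm_num
      have h2 : ‖character w x - character w₀ x‖ ^ 2 ≤ 4 := by
        have := norm_nonneg (character w x - character w₀ x)
        nlinarith
      exact mul_le_mul_of_nonneg_right h2 (by positivity)
    · exact (integrable_norm_sq f).const_mul 4
    · refine Eventually.of_forall fun x => ?_
      have : Continuous fun w : V => (‖character w x - character w₀ x‖ * ‖(f : V → ℂ) x‖) ^ 2 := by
        have := continuous_character x
        fun_prop
      have h2 := this.tendsto w₀
      simpa using h2
  have h1 := h0.sqrt
  simpa using h1

theorem continuous_translation (f : L2 V) : Continuous fun a : V => translation a f := by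
  have : Continuous fun a : V => (⟨fun x => x + a, by fun_prop⟩ : C(V, V)) :=
    ContinuousMap.continuous_of_continuous_uncurry _ (by
      change Continuous fun p : V × V => p.2 + p.1
      fun_prop)
  exact Continuous.compMeasurePreservingLp (f := fun _ : V => f) continuous_const this
    (fun a => measurePreserving_add_right (leb V) a) (by simp)

theorem continuous_weyl (l : ℝ) (f : L2 V) : Continuous fun w : V => weyl l w f := by
  rw [continuous_iff_continuousAt]
  intro w₀
  rw [ContinuousAt, tendsto_iff_norm_sub_tendsto_zero]
  set a : V → V := fun w => -(Complex.I * Real.pi * l : ℂ) • w with ha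
  have hc : Continuous a := by fun_prop
  have h1 : Tendsto (fun w => ‖translation (a w) f - translation (a w₀) f‖) (𝓝 w₀) (𝓝 0) :=
    tendsto_iff_norm_sub_tendsto_zero.1 (((continuous_translation f).comp hc).tendsto w₀)
  have h2 := tendsto_iff_norm_sub_tendsto_zero.1
    ((continuous_modulation (translation (a w₀) f)).tendsto w₀)
  refine squeeze_zero (fun _ => norm_nonneg _) (fun w => ?_) (by simpa using h1.add h2)
  have h3 : weyl l w f - weyl l w₀ f =
      modulation (character w) (norm_character w) (translation (a w) f - translation (a w₀) f) +
      (modulation (character w) (norm_character w) (translation (a w₀) f) -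
        modulation (character w₀) (norm_character w₀) (translation (a w₀) f)) := by
    rw [map_sub]
    simp [weyl, ha]
  rw [h3]
  refine (norm_add_le _ _).trans ?_
  rw [LinearIsometry.norm_map]

variable (V) in
/-- The space `L¹(V)`. -/
abbrev L1 : Type _ := Lp ℂ 1 (leb V)

theorem integrable_smul_weyl (l : ℝ) {F : V → ℂ} (hF : Integrable F (leb V)) (f : L2 V) :
    Integrable (fun w => F w • weyl l w f) (leb V) := by
  refine (hF.norm.mul_const ‖f‖).mono'
    (hF.aestronglyMeasurable.smul (continuous_weyl l f).aestronglyMeasurable) ?_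
  exact Eventually.of_forall fun w => by rw [norm_smul, LinearIsometry.norm_map]

/-- The integrated form `F ↦ ∫ F(w) M_l(w) dw` of the Weyl operators. -/
def weylInt (l : ℝ) : L1 V →L[ℂ] BL2 V :=
  LinearMap.mkContinuous₂
    (LinearMap.mk₂ ℂ (fun (F : L1 V) (f : L2 V) => ∫ w, (F : V → ℂ) w • weyl l w f ∂(leb V))
      (fun F G f => by
        rw [← integral_add (integrable_smul_weyl l (L1.integrable_coeFn F) f)
          (integrable_smul_weyl l (L1.integrable_coeFn G) f)]
        refine integral_congr_ae ?_
        filter_upwards [Lp.coeFn_add F G] with w hw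
        rw [hw, Pi.add_apply, add_smul])
      (fun c F f => by
        rw [← integral_smul]
        refine integral_congr_ae ?_
        filter_upwards [Lp.coeFn_smul c F] with w hw
        rw [hw, Pi.smul_apply, smul_assoc])
      (fun F f g => by
        rw [← integral_add (integrable_smul_weyl l (L1.integrable_coeFn F) f)
          (integrable_smul_weyl l (L1.integrable_coeFn F) g)]
        simp only [map_add, smul_add])
      (fun c F f => by
        rw [← integral_smul]
        simp only [map_smul]
        exact integral_congr_ae (Eventually.of_forall fun w => smul_comm _ _ _)))
    1 (fun F f => by
      rw [one_mul, LinearMap.mk₂_apply, L1.norm_eq_integral_norm, ← integral_mul_const]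
      refine (norm_integral_le_integral_norm _).trans (le_of_eq ?_)
      exact integral_congr_ae (Eventually.of_forall fun w => by
        simp only [norm_smul, LinearIsometry.norm_map]))

theorem weylInt_apply (l : ℝ) (F : L1 V) (f : L2 V) :
    weylInt l F f = ∫ w, (F : V → ℂ) w • weyl l w f ∂(leb V) := rfl

theorem weylInt_apply_of_ae (l : ℝ) (F : L1 V) {G : V → ℂ} (h : (F : V → ℂ) =ᵐ[leb V] G)
    (f : L2 V) : weylInt l F f = ∫ w, G w • weyl l w f ∂(leb V) := by
  rw [weylInt_apply]
  refine integral_congr_ae ?_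
  filter_upwards [h] with w hw
  rw [hw]

theorem norm_weylInt_le (l : ℝ) (F : L1 V) : ‖weylInt l F‖ ≤ ‖F‖ := by
  have h : ‖weylInt (V := V) l‖ ≤ 1 := LinearMap.mkContinuous₂_norm_le _ zero_le_one _
  exact (ContinuousLinearMap.le_of_opNorm_le _ h F).trans (by rw [one_mul])

end WeylOperators

/-! ## Left Moyal multiplication as an integral of Weyl operators -/

section MoyalIntegral

set_option linter.unusedSectionVars false

open Filter Topology
open scoped FourierTransform

variable {V : Type*} [NormedAddCommGroup V] [InnerProductSpace ℂ V] [FiniteDimensional ℂ V]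
  [MeasurableSpace V] [BorelSpace V]

attribute [local instance] InnerProductSpace.complexToReal

theorem setIntegral_norm_le (s : Set V) (hs : leb V s < ⊤) (f : L2 V) :
    ∫ x in s, ‖(f : V → ℂ) x‖ ∂(leb V) ≤ (leb V).real s + ‖f‖ ^ 2 := by
  have hfin : IsFiniteMeasure ((leb V).restrict s) := ⟨by simpa using hs⟩
  have h1 : Integrable (fun x => ‖(f : V → ℂ) x‖ ^ 2) ((leb V).restrict s) :=
    (integrable_norm_sq f).restrict
  have h2 : ∫ x in s, ‖(f : V → ℂ) x‖ ∂(leb V) ≤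
      ∫ x in s, (1 + ‖(f : V → ℂ) x‖ ^ 2) ∂(leb V) := by
    refine integral_mono_of_nonneg (Eventually.of_forall fun x => norm_nonneg _)
      ((integrable_const 1).add h1) (Eventually.of_forall fun x => ?_)
    have := norm_nonneg ((f : V → ℂ) x)
    change ‖(f : V → ℂ) x‖ ≤ 1 + ‖(f : V → ℂ) x‖ ^ 2
    nlinarith [sq_nonneg (‖(f : V → ℂ) x‖ - 1)]
  refine h2.trans ?_
  rw [integral_add (integrable_const 1) h1, norm_sq_eq_integral]
  gcongr
  · simp
  · exact Eventually.of_forall fun x => by positivity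
  · exact integrable_norm_sq f
  · exact Measure.restrict_le_self

theorem measurable_shift (l : ℝ) {g : V → ℂ} (hg : Continuous g) :
    Continuous fun p : V × V => character p.2 p.1 *
      g (p.1 + -(Complex.I * Real.pi * l : ℂ) • p.2) := by
  simp only [character_apply]
  fun_prop

/-- The integrand of `∫ F(w) M_l(w) g dw` is jointly integrable over sets of finite measure. -/
theorem integrable_weyl_kernel (l : ℝ) {F : V → ℂ} (hF : Integrable F (leb V)) {g : V → ℂ}
    (hg : Continuous g) (hg2 : MemLp g 2 (leb V)) (s : Set V) (hs : leb V s < ⊤) :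
    Integrable (fun p : V × V => F p.2 * (character p.2 p.1 *
      g (p.1 + -(Complex.I * Real.pi * l : ℂ) • p.2))) (((leb V).restrict s).prod (leb V)) := by
  have hfin : IsFiniteMeasure ((leb V).restrict s) := ⟨by simpa using hs⟩
  have hmeas : AEStronglyMeasurable (fun p : V × V => F p.2 * (character p.2 p.1 *
      g (p.1 + -(Complex.I * Real.pi * l : ℂ) • p.2))) (((leb V).restrict s).prod (leb V)) :=
    hF.aestronglyMeasurable.comp_snd.mul (measurable_shift l hg).aestronglyMeasurable
  have hw : ∀ w : V, (weyl l w (hg2.toLp g) : V → ℂ) =ᵐ[leb V]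
      fun x => character w x * g (x + -(Complex.I * Real.pi * l : ℂ) • w) := fun w => by
    filter_upwards [weyl_coe l w (hg2.toLp g),
      (isWeightedComp_weyl l w).1.ae_eq hg2.coeFn_toLp] with x h1 h2
    simp only [Function.comp] at h2
    rw [h1, h2]
  rw [integrable_prod_iff' hmeas]
  constructor
  · refine Eventually.of_forall fun w => ?_
    refine Integrable.const_mul ?_ (F w)
    have h1 : Integrable (weyl l w (hg2.toLp g) : V → ℂ) ((leb V).restrict s) :=
      ((Lp.memLp (weyl l w (hg2.toLp g))).restrict s).integrable one_le_two
    exact h1.congr (ae_restrict_of_ae (hw w))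
  · refine Integrable.mono' (hF.norm.mul_const ((leb V).real s + ‖hg2.toLp g‖ ^ 2))
      hmeas.norm.prod_swap.integral_prod_right' (Eventually.of_forall fun w => ?_)
    rw [Real.norm_of_nonneg (integral_nonneg fun _ => norm_nonneg _)]
    simp only [norm_mul (F w)]
    rw [integral_const_mul]
    refine mul_le_mul_of_nonneg_left ?_ (norm_nonneg _)
    have h1 := setIntegral_norm_le s hs (weyl l w (hg2.toLp g))
    rw [LinearIsometry.norm_map] at h1
    refine le_trans (le_of_eq ?_) h1
    refine integral_congr_ae (ae_restrict_of_ae ?_)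
    filter_upwards [hw w] with x hx
    rw [hx]

/-- Pointwise formula for the integrated Weyl operators. -/
theorem weylInt_coe (l : ℝ) (F : L1 V) {G : V → ℂ} (hFG : (F : V → ℂ) =ᵐ[leb V] G)
    {g : V → ℂ} (hg : Continuous g) (hg2 : MemLp g 2 (leb V)) :
    (weylInt l F (hg2.toLp g) : V → ℂ) =ᵐ[leb V] fun x => ∫ w, G w * (character w x *
      g (x + -(Complex.I * Real.pi * l : ℂ) • w)) ∂(leb V) := by
  have hG : Integrable G (leb V) := (L1.integrable_coeFn F).congr hFG
  refine ae_eq_of_forall_setIntegral_eq_of_sigmaFinite (fun s _ hs => ?_) (fun s _ hs => ?_)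
    (fun s hsm hs => ?_)
  · have hfin : IsFiniteMeasure ((leb V).restrict s) := ⟨by simpa using hs⟩
    exact ((Lp.memLp (weylInt l F (hg2.toLp g))).restrict s).integrable one_le_two
  · exact (integrable_weyl_kernel l hG hg hg2 s hs).integral_prod_left
  · have hw : ∀ w : V, (weyl l w (hg2.toLp g) : V → ℂ) =ᵐ[leb V]
        fun x => character w x * g (x + -(Complex.I * Real.pi * l : ℂ) • w) := fun w => by
      filter_upwards [weyl_coe l w (hg2.toLp g),
        (isWeightedComp_weyl l w).1.ae_eq hg2.coeFn_toLp] with x h1 h2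
      simp only [Function.comp] at h2
      rw [h1, h2]
    rw [← L2.inner_indicatorConstLp_one (𝕜 := ℂ) hsm hs.ne, weylInt_apply_of_ae l F hFG,
      ← integral_inner (integrable_smul_weyl l hG _)]
    have h1 : ∀ w, inner ℂ (indicatorConstLp 2 hsm hs.ne (1 : ℂ)) (G w • weyl l w (hg2.toLp g)) =
        ∫ x in s, G w * (character w x *
          g (x + -(Complex.I * Real.pi * l : ℂ) • w)) ∂(leb V) := fun w => by
      rw [inner_smul_right, L2.inner_indicatorConstLp_one, integral_const_mul]
      congr 1
      refine integral_congr_ae (ae_restrict_of_ae ?_)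
      filter_upwards [hw w] with x hx
      rw [hx]
    simp only [h1]
    exact (integral_integral_swap (integrable_weyl_kernel l hG hg hg2 s hs)).symm

/-- The operator of left Moyal multiplication by a Schwartz function. -/
def quant (l : ℝ) (f : 𝓢(V, ℂ)) : BL2 V := weylInt l ((𝓕 f).toLp 1 (leb V))

theorem fourier_eq_character (f : V → ℂ) (w : V) :
    𝓕 f w = ∫ x, character (-w) x * f x ∂(leb V) := by
  rw [Real.fourier_eq]
  refine integral_congr_ae (Eventually.of_forall fun x => ?_)
  change (Real.fourierChar (-inner ℝ x w)) • f x = _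
  change _ = character (-w) x * f x
  rw [Circle.smul_def, Real.fourierChar_apply, character_apply, smul_eq_mul, inner_neg_right]
  rfl

theorem integral_comp_complex_smul {E : Type*} [NormedAddCommGroup E] [NormedSpace ℝ E]
    (f : V → E) (t : ℝ) :
    ∫ w, f ((-(Complex.I * t) : ℂ) • w) ∂(leb V) =
      |(t ^ Module.finrank ℝ V)⁻¹| • ∫ w, f w ∂(leb V) := by
  let u : V ≃ₗᵢ[ℂ] V :=
    { LinearEquiv.smulOfUnit (Units.mk0 (-Complex.I) (by simp)) with
      norm_map' := fun x => by
        change ‖(-Complex.I) • x‖ = ‖x‖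
        rw [norm_smul]
        simp }
  have hu : ∀ x, u x = (-Complex.I) • x := fun _ => rfl
  have h1 : ∀ w : V, (-(Complex.I * t) : ℂ) • w = u (t • w) := fun w => by
    rw [hu, ← Complex.coe_smul, smul_smul, neg_mul]
  simp only [h1]
  rw [Measure.integral_comp_smul (leb V) (fun w => f (u w)) t]
  congr 1
  exact (measurePreserving_unitary u).integral_comp u.toHomeomorph.measurableEmbedding f

theorem moyal_eq_integral {l : ℝ} (hl : l ≠ 0) (f g : 𝓢(V, ℂ)) (x : V) :
    moyal l f g x = ∫ w, 𝓕 f w * (character w x *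
      g (x + -(Complex.I * Real.pi * l : ℂ) • w)) ∂(leb V) := by
  have hint : Integrable (Function.uncurry fun a b =>
      Complex.exp ((2 / l * omega a b : ℝ) * Complex.I) * f (x + a) * g (x + b))
      ((leb V).prod (leb V)) := by
    have hf : Integrable (fun a => f (x + a)) (leb V) := f.integrable.comp_add_left x
    have hg : Integrable (fun a => g (x + a)) (leb V) := g.integrable.comp_add_left x
    refine (hf.mul_prod hg).mono ?_ (Eventually.of_forall fun p => ?_)
    · refine Continuous.aestronglyMeasurable ?_
      simp only [Function.uncurry_def, omega]
      have := f.continuous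
      have := g.continuous
      fun_prop
    · simp only [Function.uncurry, norm_mul, Complex.norm_exp_ofReal_mul_I, one_mul, le_refl]
  have hpi := Real.pi_ne_zero
  rw [moyal, integral_integral_swap hint]
  have hfin : Module.finrank ℝ V = 2 * Module.finrank ℂ V := by
    rw [← finrank_real_of_complex]
  have key := integral_comp_complex_smul (V := V)
    (fun b => ∫ a, Complex.exp ((2 / l * omega a b : ℝ) * Complex.I) * f (x + a) * g (x + b)
      ∂(leb V)) (l * Real.pi)
  rw [hfin, abs_of_nonneg (inv_nonneg.2 ((even_two_mul _).pow_nonneg _))] at key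
  rw [← Complex.real_smul, ← key]
  refine integral_congr_ae (Eventually.of_forall fun w => ?_)
  have h2 : (-(Complex.I * (l * Real.pi : ℝ)) : ℂ) = -(Complex.I * Real.pi * l) := by
    push_cast
    ring
  simp only [h2]
  rw [integral_mul_const, SchwartzMap.fourier_coe, fourier_eq_character, ← mul_assoc]
  congr 1
  rw [← integral_add_left_eq_self (fun y => character (-w) y * f y) x, ← integral_mul_const]
  refine integral_congr_ae (Eventually.of_forall fun a => ?_)
  have h3 : Complex.exp ((2 / l * omega a (-(Complex.I * Real.pi * l : ℂ) • w) : ℝ) * Complex.I) =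
      character (-w) a := by
    rw [character_apply, omega, inner_smul_right, inner_neg_right]
    congr 3
    simp
    field_simp
  simp only [h3]
  have h4 : character (-w) x * character w x = 1 := by
    rw [← character_add]
    simp [character_apply]
  rw [character_add_right]
  linear_combination (-character (-w) a * f (x + a)) * h4

theorem isLeftMoyal_quant {l : ℝ} (hl : l ≠ 0) (f : 𝓢(V, ℂ)) : IsLeftMoyal l f (quant l f) := by
  intro g
  have h := weylInt_coe l ((𝓕 f).toLp 1 (leb V)) ((𝓕 f).coeFn_toLp 1 (leb V)) g.continuous
    (g.memLp 2 (leb V))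
  refine EventuallyEq.trans h (Eventually.of_forall fun x => ?_)
  exact (moyal_eq_integral hl f g x).symm

theorem IsLeftMoyal.unique {l : ℝ} {f : V → ℂ} {S T : BL2 V} (hS : IsLeftMoyal l f S)
    (hT : IsLeftMoyal l f T) : S = T := by
  have h : DenseRange (SchwartzMap.toLpCLM ℝ (E := V) ℂ 2 (leb V)) :=
    SchwartzMap.denseRange_toLpCLM (by simp)
  have h2 : (S : L2 V → L2 V) = T := h.equalizer S.continuous T.continuous (by
    funext g
    exact Lp.ext ((hS g).trans (hT g).symm))
  exact ContinuousLinearMap.ext fun x => congrFun h2 x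

theorem quant_add (l : ℝ) (f g : 𝓢(V, ℂ)) : quant l (f + g) = quant l f + quant l g := by
  rw [quant, quant, quant, FourierTransform.fourier_add, ← map_add]
  rfl

theorem quant_smul (l : ℝ) (c : ℂ) (f : 𝓢(V, ℂ)) : quant l (c • f) = c • quant l f := by
  rw [quant, quant, FourierTransform.fourier_smul, ← map_smul]
  rfl

theorem norm_quant_le (l : ℝ) (f : 𝓢(V, ℂ)) : ‖quant l f‖ ≤ ‖(𝓕 f).toLp 1 (leb V)‖ :=
  norm_weylInt_le _ _

theorem quant_apply (l : ℝ) (f : 𝓢(V, ℂ)) (φ : L2 V) :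
    quant l f φ = ∫ w, 𝓕 f w • weyl l w φ ∂(leb V) :=
  weylInt_apply_of_ae l _ ((𝓕 f).coeFn_toLp 1 (leb V)) φ

end MoyalIntegral

/-! ## The classical limit of the operators of Moyal multiplication -/

section ClassicalLimit

set_option linter.unusedSectionVars false

open Filter Topology
open scoped FourierTransform

variable {V : Type*} [NormedAddCommGroup V] [InnerProductSpace ℂ V] [FiniteDimensional ℂ V]
  [MeasurableSpace V] [BorelSpace V]

attribute [local instance] InnerProductSpace.complexToReal

/-- The complex conjugate of a Schwartz function. -/
def conjSchwartz (f : 𝓢(V, ℂ)) : 𝓢(V, ℂ) :=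
  SchwartzMap.postcompCLM (𝕜 := ℝ) (Complex.conjCLE : ℂ →L[ℝ] ℂ) f

theorem conjSchwartz_apply (f : 𝓢(V, ℂ)) (x : V) :
    conjSchwartz f x = starRingEnd ℂ (f x) := rfl

/-- The pointwise product of Schwartz functions. -/
def mulSchwartz (f g : 𝓢(V, ℂ)) : 𝓢(V, ℂ) :=
  SchwartzMap.pairing (ContinuousLinearMap.mul ℂ ℂ) f g

theorem mulSchwartz_apply (f g : 𝓢(V, ℂ)) (x : V) : mulSchwartz f g x = f x * g x := rfl

theorem conj_character (w x : V) : starRingEnd ℂ (character w x) = character (-w) x := by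
  rw [character_apply, character_apply, ← Complex.exp_conj, inner_neg_right]
  congr 1
  rw [map_mul, Complex.conj_I, Complex.conj_ofReal]
  simp

theorem fourier_conjSchwartz (f : 𝓢(V, ℂ)) (w : V) :
    𝓕 (conjSchwartz f) w = starRingEnd ℂ (𝓕 f (-w)) := by
  rw [SchwartzMap.fourier_coe, SchwartzMap.fourier_coe, fourier_eq_character,
    fourier_eq_character, ← integral_conj]
  refine integral_congr_ae (Eventually.of_forall fun x => ?_)
  simp [conj_character, conjSchwartz_apply]

theorem star_quant (l : ℝ) (f : 𝓢(V, ℂ)) : star (quant l f) = quant l (conjSchwartz f) := by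
  symm
  rw [ContinuousLinearMap.star_eq_adjoint, ContinuousLinearMap.eq_adjoint_iff]
  intro φ ψ
  rw [← inner_conj_symm, quant_apply, quant_apply,
    ← integral_inner (integrable_smul_weyl l (𝓕 (conjSchwartz f)).integrable φ),
    ← integral_inner (integrable_smul_weyl l (𝓕 f).integrable ψ), ← integral_conj,
    ← integral_neg_eq_self]
  refine integral_congr_ae (Eventually.of_forall fun w => ?_)
  simp only [inner_smul_right, map_mul, inner_conj_symm, fourier_conjSchwartz, neg_neg,
    Complex.conj_conj, inner_weyl_left]

theorem fourier_mulSchwartz (f g : 𝓢(V, ℂ)) (u : V) :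
    𝓕 (mulSchwartz f g) u = ∫ w, 𝓕 f w * 𝓕 g (u - w) ∂(leb V) := by
  have h1 := SchwartzMap.convolution_apply (ContinuousLinearMap.mul ℂ ℂ) (𝓕 f) (𝓕 g) u
  rw [convolution_def] at h1
  refine Eq.trans ?_ h1
  have h2 : ∀ (h : 𝓢(V, ℂ)) (x : V), 𝓕 (𝓕 h) x = h (-x) := fun h x => by
    have h3 : 𝓕⁻ (𝓕 h) (-x) = 𝓕 (𝓕 h) x := by
      rw [SchwartzMap.fourierInv_coe, Real.fourierInv_eq_fourier_neg, neg_neg,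
        SchwartzMap.fourier_coe (𝓕 h)]
    rw [← h3, FourierTransform.fourierInv_fourier_eq]
  have h4 : 𝓕⁻ (SchwartzMap.pairing (ContinuousLinearMap.mul ℂ ℂ) (𝓕 (𝓕 f)) (𝓕 (𝓕 g))) u =
      𝓕 (mulSchwartz f g) u := by
    rw [SchwartzMap.fourierInv_coe, Real.fourierInv_eq_fourier_neg, fourier_eq_character,
      SchwartzMap.fourier_coe, fourier_eq_character, neg_neg,
      ← integral_neg_eq_self (fun x => character (-u) x * mulSchwartz f g x)]
    refine integral_congr_ae (Eventually.of_forall fun x => ?_)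
    simp only [SchwartzMap.pairing_apply_apply, h2, mulSchwartz_apply,
      ContinuousLinearMap.mul_apply']
    congr 1
    rw [character_apply, character_apply, inner_neg_left, inner_neg_right, neg_neg]
  exact h4.symm

theorem integrable_weyl_prod (l : ℝ) {K : V × V → ℂ} (hK : Continuous K) (hK1 : ∀ p, ‖K p‖ ≤ 1)
    {F G : V → ℂ} (hF : Integrable F (leb V)) (hG : Integrable G (leb V)) (φ : L2 V) :
    Integrable (fun p : V × V => (F p.1 * G p.2 * K p) • weyl l (p.1 + p.2) φ)
      ((leb V).prod (leb V)) := by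
  refine ((hF.mul_prod hG).norm.mul_const ‖φ‖).mono' ?_ (Eventually.of_forall fun p => ?_)
  · exact ((hF.mul_prod hG).aestronglyMeasurable.mul hK.aestronglyMeasurable).smul
      ((continuous_weyl l φ).comp (continuous_fst.add continuous_snd)).aestronglyMeasurable
  · rw [norm_smul, LinearIsometry.norm_map, norm_mul]
    refine mul_le_mul_of_nonneg_right ?_ (norm_nonneg _)
    exact mul_le_of_le_one_right (norm_nonneg _) (hK1 p)

theorem continuous_cocycle (l : ℝ) : Continuous fun p : V × V => cocycle l p.1 p.2 := by
  simp only [cocycle, omega]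
  fun_prop

theorem quant_quant_apply (l : ℝ) (f g : 𝓢(V, ℂ)) (φ : L2 V) :
    quant l f (quant l g φ) = ∫ p : V × V, (𝓕 f p.1 * 𝓕 g p.2 * cocycle l p.1 p.2) •
      weyl l (p.1 + p.2) φ ∂((leb V).prod (leb V)) := by
  rw [integral_prod _ (integrable_weyl_prod l (continuous_cocycle l)
    (fun p => (norm_cocycle l p.1 p.2).le) (𝓕 f).integrable (𝓕 g).integrable φ), quant_apply]
  refine integral_congr_ae (Eventually.of_forall fun w => ?_)
  simp only
  rw [quant_apply]
  have h := ((weyl l w).toContinuousLinearMap).integral_comp_comm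
    (integrable_smul_weyl l (𝓕 g).integrable φ)
  change _ = (weyl l w) _ at h
  rw [← h, ← integral_smul]
  refine integral_congr_ae (Eventually.of_forall fun v => ?_)
  change 𝓕 f w • weyl l w (𝓕 g v • weyl l v φ) = _
  rw [map_smul, weyl_weyl, smul_smul, smul_smul]

theorem quant_mulSchwartz_apply (l : ℝ) (f g : 𝓢(V, ℂ)) (φ : L2 V) :
    quant l (mulSchwartz f g) φ = ∫ p : V × V, (𝓕 f p.1 * 𝓕 g p.2 * 1) •
      weyl l (p.1 + p.2) φ ∂((leb V).prod (leb V)) := by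
  have hint := integrable_weyl_prod l (K := fun _ : V × V => 1) continuous_const
    (fun p => by simp) (𝓕 f).integrable (𝓕 g).integrable φ
  have hmp : MeasurePreserving (fun p : V × V => (p.1, p.2 - p.1))
      ((leb V).prod (leb V)) ((leb V).prod (leb V)) := by
    simpa only [sub_eq_neg_add] using measurePreserving_prod_neg_add (leb V) (leb V)
  have hint2 : Integrable (fun p : V × V => (𝓕 f p.1 * 𝓕 g (p.2 - p.1)) • weyl l p.2 φ)
      ((leb V).prod (leb V)) := by
    refine (hmp.integrable_comp_of_integrable hint).congr (Eventually.of_forall fun p => ?_)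
    simp
  rw [quant_apply]
  have h1 : ∀ u, 𝓕 (mulSchwartz f g) u • weyl l u φ =
      ∫ w, (𝓕 f w * 𝓕 g (u - w)) • weyl l u φ ∂(leb V) := fun u => by
    rw [fourier_mulSchwartz, integral_smul_const]
  simp only [h1]
  rw [integral_integral_swap (f := fun u w => (𝓕 f w * 𝓕 g (u - w)) • weyl l u φ) hint2.swap,
    integral_prod _ hint]
  refine integral_congr_ae (Eventually.of_forall fun w => ?_)
  simp only
  rw [← integral_add_left_eq_self _ w]
  refine integral_congr_ae (Eventually.of_forall fun v => ?_)
  simp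

theorem integrable_cocycle_sub (l : ℝ) (f g : 𝓢(V, ℂ)) :
    Integrable (fun p : V × V => ‖𝓕 f p.1 * 𝓕 g p.2‖ * ‖cocycle l p.1 p.2 - 1‖)
      ((leb V).prod (leb V)) := by
  have hfg := ((𝓕 f).integrable (μ := leb V)).mul_prod ((𝓕 g).integrable (μ := leb V))
  refine (hfg.norm.mul_const 2).mono' ?_ (Eventually.of_forall fun p => ?_)
  · exact hfg.norm.aestronglyMeasurable.mul
      ((continuous_cocycle l).sub continuous_const).norm.aestronglyMeasurable
  · rw [norm_mul, norm_norm, norm_norm]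
    refine mul_le_mul_of_nonneg_left ?_ (norm_nonneg _)
    refine (norm_sub_le _ _).trans ?_
    rw [norm_cocycle, norm_one]
    norm_num

theorem norm_quant_mul_sub_le (l : ℝ) (f g : 𝓢(V, ℂ)) :
    ‖quant l f * quant l g - quant l (mulSchwartz f g)‖ ≤
      ∫ p : V × V, ‖𝓕 f p.1 * 𝓕 g p.2‖ * ‖cocycle l p.1 p.2 - 1‖ ∂((leb V).prod (leb V)) := by
  refine ContinuousLinearMap.opNorm_le_bound _
    (integral_nonneg fun p => by positivity) fun φ => ?_
  change ‖quant l f (quant l g φ) - quant l (mulSchwartz f g) φ‖ ≤ _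
  rw [quant_quant_apply, quant_mulSchwartz_apply, ← integral_sub
    (integrable_weyl_prod l (continuous_cocycle l)
      (fun p => (norm_cocycle l p.1 p.2).le) (𝓕 f).integrable (𝓕 g).integrable φ)
    (integrable_weyl_prod l (K := fun _ : V × V => 1) continuous_const
      (fun p => by simp) (𝓕 f).integrable (𝓕 g).integrable φ), ← integral_mul_const]
  refine (norm_integral_le_integral_norm _).trans (le_of_eq ?_)
  refine integral_congr_ae (Eventually.of_forall fun p => ?_)
  simp only
  rw [← sub_smul, ← mul_sub, norm_smul, LinearIsometry.norm_map, norm_mul]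

theorem tendsto_quant_mul_sub (f g : 𝓢(V, ℂ)) :
    Tendsto (fun l : ℝ => ‖quant l f * quant l g - quant l (mulSchwartz f g)‖) (𝓝 0) (𝓝 0) := by
  refine squeeze_zero (fun _ => norm_nonneg _) (fun l => norm_quant_mul_sub_le l f g) ?_
  have : (0 : ℝ) = ∫ p : V × V, (0 : ℝ) ∂((leb V).prod (leb V)) := by simp
  rw [this]
  refine tendsto_integral_filter_of_dominated_convergence
    (fun p : V × V => ‖𝓕 f p.1 * 𝓕 g p.2‖ * 2) ?_ ?_ ?_ ?_
  · exact Eventually.of_forall fun l => (integrable_cocycle_sub l f g).aestronglyMeasurable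
  · refine Eventually.of_forall fun l => Eventually.of_forall fun p => ?_
    rw [norm_mul, norm_norm, norm_norm]
    refine mul_le_mul_of_nonneg_left ?_ (norm_nonneg _)
    refine (norm_sub_le _ _).trans ?_
    rw [norm_cocycle, norm_one]
    norm_num
  · exact (((𝓕 f).integrable (μ := leb V)).mul_prod
      ((𝓕 g).integrable (μ := leb V))).norm.mul_const 2
  · refine Eventually.of_forall fun p => ?_
    have : Continuous fun l : ℝ =>
        ‖𝓕 f p.1 * 𝓕 g p.2‖ * ‖cocycle l p.1 p.2 - 1‖ := by
      simp only [cocycle]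
      fun_prop
    have h := this.tendsto 0
    simpa [cocycle] using h

/-- The Schwartz function `f / (c - f)`, for a real-valued Schwartz function `f` and a real
number `c` outside of the range of `f`. -/
theorem exists_quasiInverse (f : 𝓢(V, ℂ)) {m : ℝ} (hf : ∀ x, ‖f x‖ ≤ m) (hre : ∀ x, (f x).im = 0)
    {c : ℝ} (hc : m < |c|) : ∃ q : 𝓢(V, ℂ), ∀ x, (c : ℂ) * q x - f x - f x * q x = 0 := by
  have hm : 0 ≤ m := (norm_nonneg _).trans (hf 0)
  obtain ⟨m', hm1, hm2⟩ := exists_between hc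
  have hne' : ∀ t ∈ Set.Icc (-m') m', c - t ≠ 0 := by
    rintro t ⟨h1, h2⟩ h3
    have : c = t := by linarith
    rw [this] at hm2
    exact absurd (abs_le.2 ⟨h1, h2⟩) (not_le.2 hm2)
  have hcd : ContDiffOn ℝ (⊤ : ℕ∞) (fun t : ℝ => (c - t)⁻¹) (Set.Icc (-m') m') :=
    ContDiffOn.inv (by fun_prop) hne'
  have hud : UniqueDiffOn ℝ (Set.Icc (-m') m') := uniqueDiffOn_Icc (by linarith)
  have hreg : Function.HasTemperateGrowth (fun x : V => (f x).re) :=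
    Complex.reCLM.hasTemperateGrowth.comp f.hasTemperateGrowth
  have hg : Function.HasTemperateGrowth ((fun t : ℝ => (c - t)⁻¹) ∘ fun x : V => (f x).re) := by
    refine Function.HasTemperateGrowth.comp' (t := Set.Icc (-m') m') ?_ hud hcd ?_ hreg
    · rintro _ ⟨x, rfl⟩
      exact abs_le.1 ((Complex.abs_re_le_norm _).trans ((hf x).trans hm1.le))
    · intro N
      have h1 : ∀ n, ∃ C, ∀ x ∈ Set.Icc (-m') m',
          ‖iteratedFDerivWithin ℝ n (fun t : ℝ => (c - t)⁻¹) (Set.Icc (-m') m') x‖ ≤ C := fun n =>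
        isCompact_Icc.exists_bound_of_continuousOn
          (hcd.continuousOn_iteratedFDerivWithin (m := n) (mod_cast le_top) hud)
      choose C hC using h1
      refine ⟨0, ∑ n ∈ Finset.range (N + 1), |C n|,
        Finset.sum_nonneg fun _ _ => abs_nonneg _, fun n hn x hx => ?_⟩
      rw [pow_zero, mul_one]
      refine (hC n x hx).trans ((le_abs_self _).trans ?_)
      exact Finset.single_le_sum (f := fun n => |C n|) (fun _ _ => abs_nonneg _)
        (Finset.mem_range.2 (by omega))
  have hg2 : Function.HasTemperateGrowth (fun x : V => (((c - (f x).re)⁻¹ : ℝ) : ℂ)) :=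
    Function.HasTemperateGrowth.comp (g := Complex.ofReal) (by fun_prop) hg
  refine ⟨SchwartzMap.smulLeftCLM ℂ (fun x : V => (((c - (f x).re)⁻¹ : ℝ) : ℂ)) f, fun x => ?_⟩
  rw [SchwartzMap.smulLeftCLM_apply_apply hg2]
  have h1 : f x = ((f x).re : ℂ) := Complex.ext (by simp) (by simp [hre])
  have h2 : c - (f x).re ≠ 0 := hne' _ (abs_le.1 ((Complex.abs_re_le_norm _).trans
    ((hf x).trans hm1.le)))
  have h3 : (c : ℂ) - (f x).re ≠ 0 := by exact_mod_cast h2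
  rw [h1]
  push_cast
  rw [smul_eq_mul, Complex.ofReal_re]
  field_simp
  ring

theorem isUnit_of_mul_close {H : Type*} [NormedAddCommGroup H] [InnerProductSpace ℂ H]
    [CompleteSpace H] {A B : H →L[ℂ] H} (hA : IsSelfAdjoint A) {c : ℂ}
    (h : ‖A * B - c • (1 : H →L[ℂ] H)‖ < ‖c‖) : IsUnit A := by
  have hc : c ≠ 0 := fun h0 => by
    rw [h0, norm_zero] at h
    exact absurd h (not_lt.2 (norm_nonneg _))
  rcases subsingleton_or_nontrivial H with hs | hn
  · have : Subsingleton (H →L[ℂ] H) := inferInstance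
    exact isUnit_of_subsingleton A
  have h1 : ‖(1 : H →L[ℂ] H) - c⁻¹ • (A * B)‖ < 1 := by
    have h2 : (1 : H →L[ℂ] H) - c⁻¹ • (A * B) = -(c⁻¹ • (A * B - c • (1 : H →L[ℂ] H))) := by
      rw [smul_sub, smul_smul, inv_mul_cancel₀ hc, one_smul, neg_sub]
    rw [h2, norm_neg, norm_smul, norm_inv]
    rw [inv_mul_lt_iff₀ (norm_pos_iff.2 hc), mul_one]
    exact h
  have h3 : IsUnit (c⁻¹ • (A * B)) := by
    have := isUnit_one_sub_of_norm_lt_one h1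
    rwa [sub_sub_cancel] at this
  obtain ⟨u, hu⟩ := h3
  have h4 : A * (c⁻¹ • B * (↑u⁻¹ : H →L[ℂ] H)) = 1 := by
    rw [← mul_assoc, mul_smul_comm, ← hu, Units.mul_inv]
  have h5 : star (c⁻¹ • B * (↑u⁻¹ : H →L[ℂ] H)) * A = 1 := by
    have := congrArg star h4
    rwa [star_mul, hA.star_eq, star_one] at this
  exact isUnit_iff_exists.2 ⟨_, h4, by rwa [left_inv_eq_right_inv h5 h4] at h5⟩

theorem quant_zero_map (l : ℝ) : quant l (0 : 𝓢(V, ℂ)) = 0 := by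
  have := quant_smul l 0 (0 : 𝓢(V, ℂ))
  simpa using this

theorem quant_sub (l : ℝ) (f g : 𝓢(V, ℂ)) : quant l (f - g) = quant l f - quant l g := by
  rw [sub_eq_add_neg, ← neg_one_smul ℂ g, quant_add, quant_smul, neg_one_smul, sub_eq_add_neg]

theorem eventually_norm_quant_le_of_real (f : 𝓢(V, ℂ)) {m m' : ℝ} (hf : ∀ x, ‖f x‖ ≤ m)
    (hre : ∀ x, (f x).im = 0) (hm : m < m') : ∀ᶠ l in 𝓝 (0 : ℝ), ‖quant l f‖ ≤ m' := by
  have hm0 : 0 ≤ m := (norm_nonneg _).trans (hf 0)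
  set N := ‖(𝓕 f).toLp 1 (leb V)‖ with hN
  have hsa : ∀ l : ℝ, IsSelfAdjoint (quant l f) := fun l => by
    rw [IsSelfAdjoint, star_quant]
    congr 1
    ext x
    rw [conjSchwartz_apply]
    exact Complex.conj_eq_iff_im.2 (hre x)
  have hK : IsCompact (Metric.closedBall (0 : ℝ) N ∩ {c : ℝ | m' ≤ |c|}) :=
    (isCompact_closedBall _ _).inter_right (isClosed_le continuous_const continuous_abs)
  have key := hK.eventually_forall_of_forall_eventually (x₀ := (0 : ℝ))
    (P := fun l c => (c : ℂ) ∉ spectrum ℂ (quant (V := V) l f)) (by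
      rintro c ⟨-, hc⟩
      change m' ≤ |c| at hc
      obtain ⟨q, hq⟩ := exists_quasiInverse f hf hre (hm.trans_le hc)
      have hq' : (c : ℂ) • q - f - mulSchwartz f q = 0 := by
        ext x
        simpa [mulSchwartz_apply] using hq x
      set M := ‖(𝓕 q).toLp 1 (leb V)‖ with hM
      have hc0 : 0 < |c| := (hm0.trans_lt hm).trans_le hc
      have h1 : ∀ᶠ l : ℝ in 𝓝 0,
          ‖quant l f * quant l q - quant l (mulSchwartz f q)‖ < |c| / 2 :=
        (tendsto_quant_mul_sub f q).eventually_lt_const (by linarith)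
      have h2 : ∀ᶠ c' : ℝ in 𝓝 c, |c' - c| * (1 + M) < |c| / 2 := by
        have : Continuous fun c' : ℝ => |c' - c| * (1 + M) := by fun_prop
        refine (this.tendsto c).eventually_lt_const ?_
        simpa using hc0
      filter_upwards [h1.prod_nhds h2] with ⟨l, c'⟩ ⟨h3, h4⟩
      simp only at h3 h4 ⊢
      rw [spectrum.mem_iff, not_not]
      refine isUnit_of_mul_close (B := 1 + quant l q) (c := (c : ℂ)) ?_ ?_
      · rw [IsSelfAdjoint, star_sub, (hsa l).star_eq, Algebra.algebraMap_eq_smul_one, star_smul,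
          star_one]
        simp
      · have h5 : (algebraMap ℂ (BL2 V) c' - quant l f) * (1 + quant l q) - (c : ℂ) • 1 =
            ((c' - c : ℝ) : ℂ) • (1 + quant l q) -
              (quant l f * quant l q - quant l (mulSchwartz f q)) := by
          have h6 : (c : ℂ) • quant l q = quant l f + quant l (mulSchwartz f q) := by
            rw [← quant_smul, ← quant_add]
            congr 1
            rw [sub_sub, sub_eq_zero] at hq'
            exact hq'
          rw [Algebra.algebraMap_eq_smul_one, sub_mul, smul_mul_assoc, one_mul, mul_add, mul_one]
          push_cast
          rw [sub_smul, smul_add (c : ℂ), h6]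
          abel
        rw [h5]
        have h7 : ‖(1 : BL2 V) + quant l q‖ ≤ 1 + M :=
          (norm_add_le _ _).trans (add_le_add ContinuousLinearMap.norm_id_le (norm_quant_le l q))
        calc _ ≤ ‖((c' - c : ℝ) : ℂ) • (1 + quant l q)‖ +
              ‖quant l f * quant l q - quant l (mulSchwartz f q)‖ := norm_sub_le _ _
          _ < |c| / 2 + |c| / 2 := by
              refine add_lt_add ?_ h3
              rw [norm_smul, Complex.norm_real]
              exact (mul_le_mul_of_nonneg_left h7 (norm_nonneg _)).trans_lt h4
          _ = ‖(c : ℂ)‖ := by rw [Complex.norm_real, Real.norm_eq_abs]; ring)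
  filter_upwards [key] with l hl
  rcases subsingleton_or_nontrivial (BL2 V) with hs | hn
  · rw [Subsingleton.elim (quant l f) 0, norm_zero]
    exact hm0.trans hm.le
  by_contra! hlt
  obtain ⟨z, hz, hzn⟩ := spectrum.exists_nnnorm_eq_spectralRadius (quant (V := V) l f)
  rw [(hsa l).spectralRadius_eq_nnnorm] at hzn
  have hzn' : ‖z‖ = ‖quant (V := V) l f‖ := by
    have := ENNReal.coe_inj.1 hzn
    exact congrArg NNReal.toReal this
  have hzre := (hsa l).mem_spectrum_eq_re hz
  have habs : ‖z‖ = |z.re| := by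
    conv_lhs => rw [hzre]
    rw [Complex.norm_real, Real.norm_eq_abs]
  refine hl z.re ⟨?_, ?_⟩ (hzre ▸ hz)
  · rw [mem_closedBall_zero_iff, Real.norm_eq_abs, ← habs, hzn']
    exact norm_quant_le l f
  · change m' ≤ |z.re|
    rw [← habs, hzn']
    exact hlt.le

/-- The norm of the operator of Moyal multiplication by `f` is asymptotically at most the
supremum norm of `f`. -/
theorem eventually_norm_quant_le (f : 𝓢(V, ℂ)) {m m' : ℝ} (hf : ∀ x, ‖f x‖ ≤ m)
    (hm : m < m') : ∀ᶠ l in 𝓝 (0 : ℝ), ‖quant l f‖ ≤ m' := by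
  have hm0 : 0 ≤ m := (norm_nonneg _).trans (hf 0)
  obtain ⟨a, ha1, ha2⟩ := exists_between hm
  have h1 := eventually_norm_quant_le_of_real (mulSchwartz (conjSchwartz f) f) (m := m ^ 2)
    (m' := a ^ 2) (fun x => by
      rw [mulSchwartz_apply, conjSchwartz_apply, norm_mul, RCLike.norm_conj, ← sq]
      gcongr
      exact hf x) (fun x => by
      rw [mulSchwartz_apply, conjSchwartz_apply, mul_comm, Complex.mul_conj]
      simp) (by gcongr)
  have h2 := (tendsto_quant_mul_sub (conjSchwartz f) f).eventually_lt_const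
    (u := m' ^ 2 - a ^ 2) (by nlinarith)
  filter_upwards [h1, h2] with l h1 h2
  refine le_of_sq_le_sq ?_ (by linarith)
  rw [sq ‖_‖, ← CStarRing.norm_star_mul_self, star_quant]
  have := norm_le_norm_sub_add (quant l (conjSchwartz f) * quant l f)
    (quant l (mulSchwartz (conjSchwartz f) f))
  linarith

end ClassicalLimit

/-! ## Continuous sections and their behaviour near the classical fibre -/

section Sections

set_option linter.unusedSectionVars false

open Filter Topology
open scoped FourierTransform

theorem closedAdjoin_induction {A : Type*} [NonUnitalCStarAlgebra A] {s : Set A} {p : A → Prop}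
    (hs : ∀ a ∈ s, p a) (h0 : p 0) (hadd : ∀ a b, p a → p b → p (a + b))
    (hmul : ∀ a b, p a → p b → p (a * b)) (hsmul : ∀ (c : ℂ) a, p a → p (c • a))
    (hstar : ∀ a, p a → p (star a)) (hcl : IsClosed {a | p a}) {a : A}
    (ha : a ∈ closedAdjoin s) : p a := by
  have h : ((NonUnitalStarAlgebra.adjoin ℂ s : NonUnitalStarSubalgebra ℂ A) : Set A) ⊆
      {a | p a} := fun b hb =>
    NonUnitalStarAlgebra.adjoin_induction (p := fun x _ => p x) ℂ (fun x hx => hs x hx)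
      (fun x y _ _ => hadd x y) h0 (fun x y _ _ => hmul x y) (fun r x _ => hsmul r x)
      (fun x _ => hstar x) hb
  exact closure_minimal h hcl ha

theorem c0_norm_le {X : Type*} [TopologicalSpace X] {f : C₀(X, ℂ)} {C : ℝ} (hC : 0 ≤ C) :
    ‖f‖ ≤ C ↔ ∀ x, ‖f x‖ ≤ C := by
  rw [← ZeroAtInftyContinuousMap.norm_toBCF_eq_norm, BoundedContinuousFunction.norm_le hC]
  rfl

theorem c0_norm_apply_le {X : Type*} [TopologicalSpace X] (f : C₀(X, ℂ)) (x : X) :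
    ‖f x‖ ≤ ‖f‖ := (c0_norm_le (norm_nonneg f)).1 le_rfl x

namespace Families

variable {I : Type*} {A A' : Type*} [NonUnitalCStarAlgebra A] [NonUnitalCStarAlgebra A']

theorem norm_base_le (a : Families I A A') : ‖base a‖ ≤ ‖a‖ :=
  NonUnitalStarAlgHom.norm_apply_le base a

theorem norm_eval_le (i : I) (a : Families I A A') : ‖eval i a‖ ≤ ‖a‖ :=
  NonUnitalStarAlgHom.norm_apply_le (eval i) a

theorem norm_le {a : Families I A A'} {C : ℝ} (h0 : ‖base a‖ ≤ C) (h : ∀ i, ‖eval i a‖ ≤ C) :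
    ‖a‖ ≤ C :=
  max_le h0 (lp.norm_le_of_forall_le ((norm_nonneg _).trans h0) h)

/-- A family given by its components. -/
def mk (a : A) (b : I → A') (C : ℝ) (h : ∀ i, ‖b i‖ ≤ C) : Families I A A' :=
  (a, ⟨b, memℓp_infty ⟨C, by rintro _ ⟨i, rfl⟩; exact h i⟩⟩)

theorem base_mk (a : A) (b : I → A') (C : ℝ) (h : ∀ i, ‖b i‖ ≤ C) : base (mk a b C h) = a := rfl

theorem eval_mk (a : A) (b : I → A') (C : ℝ) (h : ∀ i, ‖b i‖ ≤ C) (i : I) :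
    eval i (mk a b C h) = b i := rfl

end Families

variable {V : Type*} [NormedAddCommGroup V] [InnerProductSpace ℂ V] [FiniteDimensional ℂ V]
  [MeasurableSpace V] [BorelSpace V]

attribute [local instance] InnerProductSpace.complexToReal

/-- The norm `∫ |f^|` of a Schwartz function, which dominates all the norms `‖quant l f‖`. -/
def wienerNorm (f : 𝓢(V, ℂ)) : ℝ := ‖(𝓕 f).toLp 1 (leb V)‖

theorem wienerNorm_nonneg (f : 𝓢(V, ℂ)) : 0 ≤ wienerNorm f := norm_nonneg _

theorem wienerNorm_eq (f : 𝓢(V, ℂ)) : wienerNorm f = ∫ w, ‖𝓕 f w‖ ∂(leb V) :=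
  SchwartzMap.norm_toLp_one

theorem wienerNorm_smul (c : ℂ) (f : 𝓢(V, ℂ)) : wienerNorm (c • f) = ‖c‖ * wienerNorm f := by
  rw [wienerNorm, wienerNorm, ← norm_smul, FourierTransform.fourier_smul]
  rfl

theorem eq_integral_fourier (f : 𝓢(V, ℂ)) (x : V) :
    f x = ∫ w, character w x * 𝓕 f w ∂(leb V) := by
  have h : 𝓕⁻ (𝓕 f) x = f x := by rw [FourierTransform.fourierInv_fourier_eq]
  rw [← h, SchwartzMap.fourierInv_coe, Real.fourierInv_eq_fourier_neg, fourier_eq_character,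
    neg_neg]
  refine integral_congr_ae (Eventually.of_forall fun w => ?_)
  simp only [character_apply]
  rw [show (inner ℂ w x).re = (inner ℂ x w).re by rw [← inner_conj_symm, Complex.conj_re]]

theorem norm_apply_le_wienerNorm (f : 𝓢(V, ℂ)) (x : V) : ‖f x‖ ≤ wienerNorm f := by
  rw [eq_integral_fourier f x, wienerNorm_eq]
  refine (norm_integral_le_integral_norm _).trans (le_of_eq ?_)
  simp [norm_character]

/-- The constant section defined by a Schwartz function, times a continuous scalar function. -/
def sectionFamily (φ : C(ℝ, ℂ)) (f : 𝓢(V, ℂ)) : OpFamilies V :=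
  have h : ∃ C, ∀ l ∈ Set.Icc (0 : ℝ) 1, ‖φ l‖ ≤ C :=
    isCompact_Icc.exists_bound_of_continuousOn φ.continuous.continuousOn
  Families.mk (φ 0 • f).toZeroAtInfty (fun l => quant l (φ l • f)) (h.choose * wienerNorm f)
    (fun l => (norm_quant_le _ _).trans (by
      change wienerNorm _ ≤ _
      rw [wienerNorm_smul]
      exact mul_le_mul_of_nonneg_right (h.choose_spec l ⟨l.2.1.le, l.2.2⟩)
        (wienerNorm_nonneg f)))

theorem base_sectionFamily (φ : C(ℝ, ℂ)) (f : 𝓢(V, ℂ)) (x : V) :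
    Families.base (sectionFamily φ f) x = φ 0 * f x := rfl

theorem eval_sectionFamily (φ : C(ℝ, ℂ)) (f : 𝓢(V, ℂ)) (l : Set.Ioc (0 : ℝ) 1) :
    Families.eval l (sectionFamily φ f) = φ l • quant (l : ℝ) f := quant_smul _ _ _

theorem sectionFamily_mem (φ : C(ℝ, ℂ)) (f : 𝓢(V, ℂ)) : sectionFamily φ f ∈ basicSections V :=
  ⟨φ, f, fun _ => rfl, fun l => isLeftMoyal_quant l.2.1.ne' (φ l • f)⟩

theorem exists_eq_sectionFamily {a : OpFamilies V} (ha : a ∈ basicSections V) :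
    ∃ φ f, a = sectionFamily φ f := by
  obtain ⟨φ, f, h0, h⟩ := ha
  refine ⟨φ, f, Families.ext (ZeroAtInftyContinuousMap.ext fun x => h0 x) fun l => ?_⟩
  exact (h l).unique (isLeftMoyal_quant l.2.1.ne' (φ l • f))

/-- The section `a` is, up to `ε`, constant near `0`. -/
def NearlyConstant (a : OpFamilies V) (ε : ℝ) : Prop :=
  ∃ f : 𝓢(V, ℂ), ‖Families.base a - f.toZeroAtInfty‖ ≤ ε ∧
    ∃ δ > 0, ∀ l : Set.Ioc (0 : ℝ) 1, (l : ℝ) < δ → ‖Families.eval l a - quant (l : ℝ) f‖ ≤ ε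

theorem nearlyConstant_of_eventually {a : OpFamilies V} {ε : ℝ} (f : 𝓢(V, ℂ))
    (h0 : ‖Families.base a - f.toZeroAtInfty‖ ≤ ε)
    (h : ∀ᶠ l in 𝓝 (0 : ℝ), ∀ hl : l ∈ Set.Ioc (0 : ℝ) 1,
      ‖Families.eval ⟨l, hl⟩ a - quant l f‖ ≤ ε) : NearlyConstant a ε := by
  obtain ⟨δ, hδ, h2⟩ := Metric.eventually_nhds_iff.1 h
  exact ⟨f, h0, δ, hδ, fun l hl => h2 (by simpa [abs_of_pos l.2.1] using hl) l.2⟩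

theorem NearlyConstant.eventually {a : OpFamilies V} {ε : ℝ} (h : NearlyConstant a ε) :
    ∃ f : 𝓢(V, ℂ), ‖Families.base a - f.toZeroAtInfty‖ ≤ ε ∧
    ∀ᶠ l in 𝓝 (0 : ℝ), ∀ hl : l ∈ Set.Ioc (0 : ℝ) 1,
      ‖Families.eval ⟨l, hl⟩ a - quant l f‖ ≤ ε := by
  obtain ⟨f, h0, δ, hδ, h⟩ := h
  refine ⟨f, h0, ?_⟩
  filter_upwards [gt_mem_nhds hδ] with l hl hl2
  exact h ⟨l, hl2⟩ hl

theorem norm_mul_sub_mul_le {A : Type*} [NonUnitalSeminormedRing A] (a b a' b' : A) :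
    ‖a * b - a' * b'‖ ≤ ‖a - a'‖ * ‖b‖ + ‖a'‖ * ‖b - b'‖ := by
  have h : a * b - a' * b' = (a - a') * b + a' * (b - b') := by noncomm_ring
  rw [h]
  exact (norm_add_le _ _).trans (add_le_add (norm_mul_le _ _) (norm_mul_le _ _))

theorem norm_mul_sub_mul_le' {A : Type*} [NonUnitalSeminormedRing A] {x y x' y' : A}
    {r s η δ : ℝ} (hx : ‖x‖ ≤ r) (hy : ‖y‖ ≤ s) (hxx : ‖x - x'‖ ≤ η) (hyy : ‖y - y'‖ ≤ η)
    (hη : η ≤ 1) (hηK : η * (2 + r + s) ≤ δ) : ‖x * y - x' * y'‖ ≤ δ := by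
  have h1 : ‖x'‖ ≤ r + 1 := by
    have := norm_sub_le x (x - x')
    rw [sub_sub_cancel] at this
    linarith
  have hη0 : 0 ≤ η := (norm_nonneg _).trans hxx
  have hr : 0 ≤ r := (norm_nonneg _).trans hx
  refine (norm_mul_sub_mul_le _ _ _ _).trans ?_
  calc _ ≤ η * s + (r + 1) * η := by gcongr
    _ ≤ η * (2 + r + s) := by nlinarith
    _ ≤ δ := hηK

theorem nearlyConstant_sectionFamily (φ : C(ℝ, ℂ)) (f : 𝓢(V, ℂ)) {ε : ℝ} (hε : 0 < ε) :
    NearlyConstant (sectionFamily φ f) ε := by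
  refine nearlyConstant_of_eventually (φ 0 • f) ?_ ?_
  · have : Families.base (sectionFamily φ f) - (φ 0 • f).toZeroAtInfty = 0 := by
      rw [sub_eq_zero]
      rfl
    rw [this, norm_zero]
    exact hε.le
  · have h1 : Continuous fun l : ℝ => ‖φ l - φ 0‖ * wienerNorm f := by fun_prop
    have h2 : ∀ᶠ l in 𝓝 (0 : ℝ), ‖φ l - φ 0‖ * wienerNorm f < ε :=
      (h1.tendsto 0).eventually_lt_const (by simpa using hε)
    filter_upwards [h2] with l hl hl'
    rw [eval_sectionFamily, quant_smul, ← sub_smul, norm_smul]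
    exact (mul_le_mul_of_nonneg_left (norm_quant_le l f) (norm_nonneg _)).trans hl.le

theorem nearlyConstant_zero {ε : ℝ} (hε : 0 < ε) : NearlyConstant (0 : OpFamilies V) ε := by
  refine nearlyConstant_of_eventually 0 ?_ (Eventually.of_forall fun l hl => ?_)
  · have : Families.base (0 : OpFamilies V) - (0 : 𝓢(V, ℂ)).toZeroAtInfty = 0 := by
      rw [map_zero, zero_sub, neg_eq_zero]
      rfl
    rw [this, norm_zero]
    exact hε.le
  · rw [map_zero, quant_zero_map, sub_zero, norm_zero]
    exact hε.le

theorem NearlyConstant.add {a b : OpFamilies V} (ha : ∀ ε > 0, NearlyConstant a ε)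
    (hb : ∀ ε > 0, NearlyConstant b ε) {ε : ℝ} (hε : 0 < ε) : NearlyConstant (a + b) ε := by
  obtain ⟨f, hf0, hf⟩ := (ha (ε / 2) (by linarith)).eventually
  obtain ⟨g, hg0, hg⟩ := (hb (ε / 2) (by linarith)).eventually
  refine nearlyConstant_of_eventually (f + g) ?_ ?_
  · have : Families.base (a + b) - (f + g).toZeroAtInfty =
        (Families.base a - f.toZeroAtInfty) + (Families.base b - g.toZeroAtInfty) := by
      have h : (f + g).toZeroAtInfty = f.toZeroAtInfty + g.toZeroAtInfty := rfl
      rw [map_add, h, add_sub_add_comm]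
    rw [this]
    refine (norm_add_le _ _).trans ?_
    linarith
  · filter_upwards [hf, hg] with l h1 h2 hl
    rw [map_add, quant_add, add_sub_add_comm]
    refine (norm_add_le _ _).trans ?_
    linarith [h1 hl, h2 hl]

theorem NearlyConstant.mul {a b : OpFamilies V} (ha : ∀ ε > 0, NearlyConstant a ε)
    (hb : ∀ ε > 0, NearlyConstant b ε) {ε : ℝ} (hε : 0 < ε) : NearlyConstant (a * b) ε := by
  set K := 2 + ‖a‖ + ‖b‖ with hK
  have hKpos : 0 < K := by positivity
  set η := min 1 (ε / (2 * K)) with hη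
  have hηpos : 0 < η := lt_min one_pos (by positivity)
  have hη1 : η ≤ 1 := min_le_left _ _
  have hηK : η * K ≤ ε / 2 := by
    have := mul_le_mul_of_nonneg_right (min_le_right 1 (ε / (2 * K))) hKpos.le
    refine this.trans (le_of_eq ?_)
    field_simp
  obtain ⟨f, hf0, hf⟩ := (ha η hηpos).eventually
  obtain ⟨g, hg0, hg⟩ := (hb η hηpos).eventually
  refine nearlyConstant_of_eventually (mulSchwartz f g) ?_ ?_
  · have h1 := norm_mul_sub_mul_le' (Families.norm_base_le a) (Families.norm_base_le b) hf0 hg0 hη1 hηK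
    rw [map_mul]
    refine le_trans (le_of_eq ?_) (h1.trans (by linarith))
    rfl
  · filter_upwards [hf, hg, (tendsto_quant_mul_sub f g).eventually_lt_const
      (half_pos hε)] with l h1 h2 h3 hl
    have h4 := norm_mul_sub_mul_le' (Families.norm_eval_le _ a) (Families.norm_eval_le _ b) (h1 hl) (h2 hl) hη1 hηK
    rw [map_mul]
    have h5 := norm_add_le (Families.eval ⟨l, hl⟩ a * Families.eval ⟨l, hl⟩ b -
      quant l f * quant l g) (quant l f * quant l g - quant l (mulSchwartz f g))
    rw [sub_add_sub_cancel] at h5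
    linarith

theorem NearlyConstant.smul (c : ℂ) {a : OpFamilies V} (ha : ∀ ε > 0, NearlyConstant a ε)
    {ε : ℝ} (hε : 0 < ε) : NearlyConstant (c • a) ε := by
  have hc : 0 < 1 + ‖c‖ := by positivity
  obtain ⟨f, hf0, hf⟩ := (ha (ε / (1 + ‖c‖)) (by positivity)).eventually
  have aux : ‖c‖ * (ε / (1 + ‖c‖)) ≤ ε := by
    rw [mul_div_assoc', div_le_iff₀ hc]
    nlinarith
  refine nearlyConstant_of_eventually (c • f) ?_ ?_
  · have : Families.base (c • a) - (c • f).toZeroAtInfty =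
        c • (Families.base a - f.toZeroAtInfty) := by
      have h : (c • f).toZeroAtInfty = c • f.toZeroAtInfty := rfl
      rw [map_smul, h]
      exact (smul_sub c (Families.base a) f.toZeroAtInfty).symm
    rw [this, norm_smul]
    exact (mul_le_mul_of_nonneg_left hf0 (norm_nonneg _)).trans aux
  · filter_upwards [hf] with l h1 hl
    rw [map_smul, quant_smul, ← smul_sub, norm_smul]
    exact (mul_le_mul_of_nonneg_left (h1 hl) (norm_nonneg _)).trans aux

theorem nearlyConstant_star {a : OpFamilies V} {ε : ℝ} (ha : NearlyConstant a ε) :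
    NearlyConstant (star a) ε := by
  obtain ⟨f, hf0, hf⟩ := ha.eventually
  refine nearlyConstant_of_eventually (conjSchwartz f) ?_ ?_
  · have : Families.base (star a) - (conjSchwartz f).toZeroAtInfty =
        star (Families.base a - f.toZeroAtInfty) := by
      have h : (conjSchwartz f).toZeroAtInfty = star f.toZeroAtInfty := rfl
      rw [map_star, h, star_sub]
    rw [this]
    exact (norm_star (Families.base a - f.toZeroAtInfty)).le.trans hf0
  · filter_upwards [hf] with l h1 hl
    rw [map_star, ← star_quant, ← star_sub, norm_star]
    exact h1 hl

theorem isClosed_nearlyConstant : IsClosed {a : OpFamilies V | ∀ ε > 0, NearlyConstant a ε} := by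
  refine isClosed_of_closure_subset fun a ha ε hε => ?_
  obtain ⟨b, hb, hab⟩ := Metric.mem_closure_iff.1 ha (ε / 2) (by linarith)
  obtain ⟨f, hf0, hf⟩ := (hb (ε / 2) (by linarith)).eventually
  rw [dist_eq_norm] at hab
  refine nearlyConstant_of_eventually f ?_ ?_
  · have h1 := Families.norm_base_le (a - b)
    rw [map_sub] at h1
    have := norm_add_le (Families.base a - Families.base b)
      (Families.base b - f.toZeroAtInfty)
    rw [sub_add_sub_cancel] at this
    linarith
  · filter_upwards [hf] with l h1 hl
    have h2 := Families.norm_eval_le ⟨l, hl⟩ (a - b)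
    rw [map_sub] at h2
    have := norm_add_le (Families.eval ⟨l, hl⟩ a - Families.eval ⟨l, hl⟩ b)
      (Families.eval ⟨l, hl⟩ b - quant l f)
    rw [sub_add_sub_cancel] at this
    linarith [h1 hl]

theorem nearlyConstant_of_mem {a : OpFamilies V} (ha : a ∈ closedAdjoin (basicSections V)) :
    ∀ ε > 0, NearlyConstant a ε := by
  refine closedAdjoin_induction (p := fun a => ∀ ε > 0, NearlyConstant a ε) ?_
    (fun _ => nearlyConstant_zero) (fun _ _ ha hb _ => NearlyConstant.add ha hb)
    (fun _ _ ha hb _ => NearlyConstant.mul ha hb) (fun c _ ha _ => NearlyConstant.smul c ha)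
    (fun _ ha ε hε => nearlyConstant_star (ha ε hε)) isClosed_nearlyConstant ha
  intro a ha ε hε
  obtain ⟨φ, f, rfl⟩ := exists_eq_sectionFamily ha
  exact nearlyConstant_sectionFamily φ f hε

/-- Upper semicontinuity at `0` of the norm of a continuous section. -/
theorem exists_norm_eval_le {a : OpFamilies V} (ha : a ∈ closedAdjoin (basicSections V)) {m : ℝ}
    (hm : ‖Families.base a‖ < m) :
    ∃ δ > 0, ∀ l : Set.Ioc (0 : ℝ) 1, (l : ℝ) < δ → ‖Families.eval l a‖ ≤ m := by
  set ε := (m - ‖Families.base a‖) / 3 with hε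
  have hεpos : 0 < ε := by linarith
  obtain ⟨f, hf0, hf⟩ := (nearlyConstant_of_mem ha ε hεpos).eventually
  have h1 : ∀ x, ‖f x‖ ≤ ‖Families.base a‖ + ε := fun x => by
    have h2 : ‖f.toZeroAtInfty‖ ≤ ‖Families.base a‖ + ε := by
      have := norm_sub_le (Families.base a) (Families.base a - f.toZeroAtInfty)
      rw [sub_sub_cancel] at this
      linarith
    exact (c0_norm_apply_le f.toZeroAtInfty x).trans h2
  have h2 := eventually_norm_quant_le f h1 (m' := ‖Families.base a‖ + 2 * ε) (by linarith)
  obtain ⟨δ, hδ, h3⟩ := Metric.eventually_nhds_iff.1 (hf.and h2)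
  refine ⟨δ, hδ, fun l hl => ?_⟩
  obtain ⟨h4, h5⟩ := h3 (y := l) (by simpa [abs_of_pos l.2.1] using hl)
  have h6 := norm_add_le (Families.eval l a - quant (l : ℝ) f) (quant (l : ℝ) f)
  rw [sub_add_cancel] at h6
  linarith [h4 l.2]

end Sections

/-! ## Dilations -/

section Dilation

set_option linter.unusedSectionVars false

open Filter Topology
open scoped FourierTransform

variable {V : Type*} [NormedAddCommGroup V] [InnerProductSpace ℂ V] [FiniteDimensional ℂ V]
  [MeasurableSpace V] [BorelSpace V]

attribute [local instance] InnerProductSpace.complexToReal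

theorem quasiMeasurePreserving_smul {s : ℝ} (hs : s ≠ 0) :
    Measure.QuasiMeasurePreserving (fun x : V => s • x) (leb V) (leb V) := by
  refine ⟨(continuous_const_smul s).measurable, ?_⟩
  rw [Measure.map_addHaar_smul (leb V) hs]
  exact Measure.smul_absolutelyContinuous

theorem MemLp.comp_smul_real {g : V → ℂ} (hg : MemLp g 2 (leb V)) {s : ℝ} (hs : s ≠ 0) :
    MemLp (fun x => g (s • x)) 2 (leb V) := by
  refine MemLp.comp_of_map (f := fun x : V => s • x) ?_ (continuous_const_smul s).aemeasurable
  rw [Measure.map_addHaar_smul (leb V) hs]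
  exact hg.smul_measure ENNReal.ofReal_ne_top

/-- The normalization of dilations. -/
def dilCoeff (V : Type*) [NormedAddCommGroup V] [InnerProductSpace ℂ V] (s : ℝ) : ℝ :=
  Real.sqrt (s ^ Module.finrank ℝ V)

theorem dilCoeff_sq {s : ℝ} (hs : 0 < s) : dilCoeff V s ^ 2 = s ^ Module.finrank ℝ V :=
  Real.sq_sqrt (by positivity)

theorem dilCoeff_mul_inv {s : ℝ} (hs : 0 < s) : dilCoeff V s * dilCoeff V s⁻¹ = 1 := by
  rw [dilCoeff, dilCoeff, ← Real.sqrt_mul (by positivity), ← mul_pow, mul_inv_cancel₀ hs.ne',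
    one_pow, Real.sqrt_one]

/-- The dilation `(D g)(x) = s^n g(s x)` of `L²(V)`, as an isometry. -/
def dilIsometry (s : ℝ) (hs : 0 < s) : L2 V →ₗᵢ[ℂ] L2 V :=
  have hm : ∀ f : L2 V, MemLp (fun x => (dilCoeff V s : ℂ) * (f : V → ℂ) (s • x)) 2 (leb V) :=
    fun f => (MemLp.comp_smul_real (Lp.memLp f) hs.ne').const_mul _
  have hq := quasiMeasurePreserving_smul (V := V) hs.ne'
  { toFun := fun f => (hm f).toLp _
    map_add' := fun f g => by
      refine Lp.ext ?_
      filter_upwards [(hm (f + g)).coeFn_toLp, (hm f).coeFn_toLp, (hm g).coeFn_toLp,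
        hq.ae_eq (Lp.coeFn_add f g), Lp.coeFn_add ((hm f).toLp _) ((hm g).toLp _)]
        with x h1 h2 h3 h4 h5
      simp only [Function.comp] at h4
      rw [h1, h5, Pi.add_apply, h2, h3, h4, Pi.add_apply, mul_add]
    map_smul' := fun c f => by
      refine Lp.ext ?_
      filter_upwards [(hm (c • f)).coeFn_toLp, (hm f).coeFn_toLp,
        hq.ae_eq (Lp.coeFn_smul c f), Lp.coeFn_smul c ((hm f).toLp _)] with x h1 h2 h3 h4
      simp only [Function.comp] at h3
      rw [RingHom.id_apply, h1, h4, Pi.smul_apply, h2, h3, Pi.smul_apply, smul_eq_mul,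
        smul_eq_mul, mul_left_comm]
    norm_map' := fun f => by
      change ‖(hm f).toLp _‖ = ‖f‖
      rw [← sq_eq_sq₀ (norm_nonneg _) (norm_nonneg _), norm_sq_eq_integral, norm_sq_eq_integral]
      have h1 : ∫ x, ‖((hm f).toLp _ : V → ℂ) x‖ ^ 2 ∂(leb V) =
          ∫ x, s ^ Module.finrank ℝ V * ‖(f : V → ℂ) (s • x)‖ ^ 2 ∂(leb V) := by
        refine integral_congr_ae ?_
        filter_upwards [(hm f).coeFn_toLp] with x hx
        rw [hx, norm_mul, mul_pow, Complex.norm_real, Real.norm_eq_abs, sq_abs, dilCoeff_sq hs]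
      rw [h1, integral_const_mul,
        Measure.integral_comp_smul (leb V) (fun x => ‖(f : V → ℂ) x‖ ^ 2) s,
        abs_of_pos (by positivity), smul_eq_mul, ← mul_assoc, mul_inv_cancel₀ (by positivity),
        one_mul] }

theorem isWeightedComp_dilIsometry (s : ℝ) (hs : 0 < s) :
    IsWeightedComp (dilIsometry (V := V) s hs) (fun _ => dilCoeff V s) (fun x => s • x) :=
  ⟨quasiMeasurePreserving_smul hs.ne', fun f =>
    ((MemLp.comp_smul_real (Lp.memLp f) hs.ne').const_mul (dilCoeff V s : ℂ)).coeFn_toLp⟩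

theorem isWeightedComp_id : IsWeightedComp (fun f : L2 V => f) (fun _ => 1) (fun x => x) :=
  ⟨Measure.QuasiMeasurePreserving.id _, fun _ => Eventually.of_forall fun _ => (one_mul _).symm⟩

/-- The dilation `(D g)(x) = s^n g(s x)` of `L²(V)`, as a unitary operator. -/
def dil (s : ℝ) (hs : 0 < s) : L2 V ≃ₗᵢ[ℂ] L2 V :=
  LinearIsometryEquiv.mk
    (LinearEquiv.ofLinearMap (dilIsometry s hs).toLinearMap
      (dilIsometry s⁻¹ (inv_pos.2 hs)).toLinearMap
      (LinearMap.ext fun f => ((isWeightedComp_dilIsometry s hs).comp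
        (isWeightedComp_dilIsometry s⁻¹ (inv_pos.2 hs))).eq isWeightedComp_id
        (fun x => by exact_mod_cast dilCoeff_mul_inv hs)
        (fun x => by rw [inv_smul_smul₀ hs.ne']) f)
      (LinearMap.ext fun f => ((isWeightedComp_dilIsometry s⁻¹ (inv_pos.2 hs)).comp
        (isWeightedComp_dilIsometry s hs)).eq isWeightedComp_id
        (fun x => by rw [mul_comm]; exact_mod_cast dilCoeff_mul_inv hs)
        (fun x => by rw [smul_inv_smul₀ hs.ne']) f))
    (dilIsometry s hs).norm_map

theorem isWeightedComp_dil (s : ℝ) (hs : 0 < s) :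
    IsWeightedComp (dil (V := V) s hs) (fun _ => dilCoeff V s) (fun x => s • x) :=
  isWeightedComp_dilIsometry s hs

theorem dil_weyl (s : ℝ) (hs : 0 < s) (l : ℝ) (w : V) (f : L2 V) :
    dil s hs (weyl (s ^ 2 * l) w f) = weyl l (s • w) (dil s hs f) := by
  refine ((isWeightedComp_dil s hs).comp (isWeightedComp_weyl _ w)).eq
    ((isWeightedComp_weyl l (s • w)).comp (isWeightedComp_dil s hs)) (fun x => ?_) (fun x => ?_) f
  · rw [mul_comm]
    congr 1
    rw [character_apply, character_apply]
    simp only [← Complex.coe_smul, inner_smul_left, inner_smul_right, Complex.conj_ofReal]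
  · rw [smul_add]
    simp only [← Complex.coe_smul, smul_smul]
    congr 2
    push_cast
    ring

theorem dil_l2Act (s : ℝ) (hs : 0 < s) (u : V ≃ₗᵢ[ℂ] V) (f : L2 V) :
    dil s hs (l2Act u f) = l2Act u (dil s hs f) :=
  ((isWeightedComp_dil s hs).comp (isWeightedComp_l2Act u)).eq
    ((isWeightedComp_l2Act u).comp (isWeightedComp_dil s hs)) (fun x => mul_comm _ _)
    (fun x => by
      simp only [← Complex.coe_smul]
      rw [map_smul]) f

theorem dil_symm_l2Act (s : ℝ) (hs : 0 < s) (u : V ≃ₗᵢ[ℂ] V) (f : L2 V) :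
    (dil s hs).symm (l2Act u f) = l2Act u ((dil s hs).symm f) := by
  rw [LinearIsometryEquiv.symm_apply_eq, dil_l2Act, LinearIsometryEquiv.apply_symm_apply]

/-- Conjugation by dilations. -/
def dilOp (s : ℝ) (hs : 0 < s) : BL2 V →⋆ₙₐ[ℂ] BL2 V :=
  ((Unitary.conjStarAlgAut ℂ (BL2 V) (Unitary.linearIsometryEquiv.symm (dil s hs)) :
      BL2 V ≃⋆ₐ[ℂ] BL2 V) : BL2 V →⋆ₙₐ[ℂ] BL2 V)

theorem dilOp_apply (s : ℝ) (hs : 0 < s) (T : BL2 V) (f : L2 V) :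
    dilOp s hs T f = dil s hs (T ((dil s hs).symm f)) := by
  change Unitary.conjStarAlgAut ℂ (BL2 V) (Unitary.linearIsometryEquiv.symm (dil s hs)) T f = _
  rw [Unitary.conjStarAlgAut_apply]
  simp

theorem dilOp_opAct (s : ℝ) (hs : 0 < s) (u : V ≃ₗᵢ[ℂ] V) (T : BL2 V) :
    dilOp s hs (opAct u T) = opAct u (dilOp s hs T) := by
  ext1 f
  rw [dilOp_apply, opAct_apply, opAct_apply, dilOp_apply, dil_l2Act, dil_symm_l2Act]

/-- The Schwartz function `x ↦ f(s x)`. -/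
def dilSchwartz (s : ℝ) (hs : 0 < s) : 𝓢(V, ℂ) →L[ℂ] 𝓢(V, ℂ) :=
  SchwartzMap.compCLMOfContinuousLinearEquiv ℂ
    (ContinuousLinearEquiv.smulLeft (Units.mk0 s hs.ne') : V ≃L[ℝ] V)

theorem dilSchwartz_apply (s : ℝ) (hs : 0 < s) (f : 𝓢(V, ℂ)) (x : V) :
    dilSchwartz s hs f x = f (s • x) := rfl

theorem fourier_dilSchwartz (s : ℝ) (hs : 0 < s) (f : 𝓢(V, ℂ)) (w : V) :
    𝓕 (dilSchwartz s hs f) w = ((s ^ Module.finrank ℝ V)⁻¹ : ℝ) * 𝓕 f (s⁻¹ • w) := by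
  rw [SchwartzMap.fourier_coe, SchwartzMap.fourier_coe, fourier_eq_character,
    fourier_eq_character]
  have h : ∀ x, character (-w) x * dilSchwartz s hs f x =
      (fun y => character (-(s⁻¹ • w)) y * f y) (s • x) := fun x => by
    rw [dilSchwartz_apply]
    congr 1
    rw [character_apply, character_apply]
    simp only [← Complex.coe_smul, ← smul_neg, inner_smul_left, inner_smul_right,
      Complex.conj_ofReal]
    rw [← mul_assoc, ← Complex.ofReal_mul, inv_mul_cancel₀ hs.ne', Complex.ofReal_one, one_mul]
  simp only [h]
  rw [Measure.integral_comp_smul (leb V) (fun y => character (-(s⁻¹ • w)) y * f y) s,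
    abs_of_pos (by positivity)]
  exact Complex.real_smul

theorem quant_dilSchwartz_apply (s : ℝ) (hs : 0 < s) (l : ℝ) (f : 𝓢(V, ℂ)) (φ : L2 V) :
    quant l (dilSchwartz s hs f) φ = ∫ w, 𝓕 f w • weyl l (s • w) φ ∂(leb V) := by
  rw [quant_apply]
  have h : ∀ w, 𝓕 (dilSchwartz s hs f) w • weyl l w φ =
      (((s ^ Module.finrank ℝ V)⁻¹ : ℝ) : ℂ) • (fun w => 𝓕 f w • weyl l (s • w) φ) (s⁻¹ • w) :=
    fun w => by
      simp only
      rw [fourier_dilSchwartz, mul_smul, smul_inv_smul₀ hs.ne']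
  simp only [h]
  rw [integral_smul, Measure.integral_comp_smul (leb V) (fun w => 𝓕 f w • weyl l (s • w) φ) s⁻¹,
    abs_of_pos (by positivity), Complex.coe_smul, inv_pow, inv_inv]
  exact inv_smul_smul₀ (by positivity : s ^ Module.finrank ℝ V ≠ 0)
    (∫ w, 𝓕 f w • weyl l (s • w) φ ∂(leb V))

theorem dilOp_quant (s : ℝ) (hs : 0 < s) (l : ℝ) (f : 𝓢(V, ℂ)) :
    dilOp s hs (quant (s ^ 2 * l) f) = quant l (dilSchwartz s hs f) := by
  ext1 φ
  rw [dilOp_apply, quant_apply, quant_dilSchwartz_apply]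
  change (dil s hs).toContinuousLinearEquiv _ = _
  rw [← ContinuousLinearEquiv.integral_comp_comm]
  refine integral_congr_ae (Eventually.of_forall fun w => ?_)
  change dil s hs (𝓕 f w • _) = _
  simp only
  rw [map_smul, dil_weyl, LinearIsometryEquiv.apply_symm_apply]

theorem tendsto_quant_dilSchwartz (l : ℝ) (f : 𝓢(V, ℂ)) (φ : L2 V) :
    Tendsto (fun s : ℝ => ∫ w, 𝓕 f w • weyl l (s • w) φ ∂(leb V)) (𝓝 0) (𝓝 (f 0 • φ)) := by
  have h0 : f 0 • φ = ∫ w, 𝓕 f w • weyl l ((0 : ℝ) • w) φ ∂(leb V) := by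
    simp only [zero_smul, weyl_zero]
    rw [integral_smul_const, eq_integral_fourier f 0]
    congr 1
    refine integral_congr_ae (Eventually.of_forall fun w => ?_)
    simp [character_apply]
  rw [h0]
  refine tendsto_integral_filter_of_dominated_convergence (fun w => ‖𝓕 f w‖ * ‖φ‖)
    (Eventually.of_forall fun s => ?_) (Eventually.of_forall fun s => Eventually.of_forall
      fun w => ?_) ((𝓕 f).integrable.norm.mul_const _) (Eventually.of_forall fun w => ?_)
  · exact ((𝓕 f).continuous.smul
      ((continuous_weyl l φ).comp (continuous_const_smul s))).aestronglyMeasurable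
  · rw [norm_smul, LinearIsometry.norm_map]
  · have h2 : Continuous fun s : ℝ => s • w := by fun_prop
    have h1 : Continuous fun s : ℝ => 𝓕 f w • weyl l (s • w) φ :=
      ((continuous_weyl l φ).comp h2).const_smul (𝓕 f w)
    exact h1.tendsto 0

end Dilation

/-! ## Dilations of continuous sections -/

section DilationSections

set_option linter.unusedSectionVars false

open Filter Topology
open scoped FourierTransform

variable {V : Type*} [NormedAddCommGroup V] [InnerProductSpace ℂ V] [FiniteDimensional ℂ V]
  [MeasurableSpace V] [BorelSpace V]

attribute [local instance] InnerProductSpace.complexToReal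

/-- Dilation of functions in `C₀(V)`. -/
def dilC0 (s : ℝ) (hs : 0 < s) : C₀(V, ℂ) →⋆ₙₐ[ℂ] C₀(V, ℂ) :=
  { ZeroAtInftyContinuousMap.compNonUnitalAlgHom (R := ℂ) (δ := ℂ)
      (ContinuousLinearEquiv.smulLeft (Units.mk0 s hs.ne') :
        V ≃L[ℝ] V).toHomeomorph.toCocompactMap with
    map_star' := fun _ => rfl }

theorem dilC0_apply (s : ℝ) (hs : 0 < s) (f : C₀(V, ℂ)) (x : V) :
    dilC0 s hs f x = f (s • x) := rfl

/-- Dilation by `s ∈ (0, 1]` of parameters in `(0, 1]`. -/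
def dilParam (s l : Set.Ioc (0 : ℝ) 1) : Set.Ioc (0 : ℝ) 1 :=
  ⟨(s : ℝ) ^ 2 * l, mul_pos (pow_pos s.2.1 2) l.2.1,
    mul_le_one₀ (pow_le_one₀ s.2.1.le s.2.2) l.2.1.le l.2.2⟩

/-- Dilation of families: the value at `l` of the dilation by `s` is the dilation of the value at
`s² l`. -/
def dilFamily (s : Set.Ioc (0 : ℝ) 1) : OpFamilies V →⋆ₙₐ[ℂ] OpFamilies V where
  toFun a := Families.mk (dilC0 s s.2.1 (Families.base a))
    (fun l => dilOp s s.2.1 (Families.eval (dilParam s l) a)) ‖a‖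
    (fun _ => (NonUnitalStarAlgHom.norm_apply_le _ _).trans (Families.norm_eval_le _ _))
  map_smul' c a := Families.ext (by simp only [Families.base_mk, map_smul]; rfl)
    fun l => by simp only [Families.eval_mk, map_smul]; rfl
  map_zero' := Families.ext (by simp only [Families.base_mk, map_zero])
    fun l => by simp only [Families.eval_mk, map_zero]
  map_add' a b := Families.ext (by simp only [Families.base_mk, map_add])
    fun l => by simp only [Families.eval_mk, map_add]
  map_mul' a b := Families.ext (by simp only [Families.base_mk, map_mul])
    fun l => by simp only [Families.eval_mk, map_mul]
  map_star' a := Families.ext (by simp only [Families.base_mk, map_star])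
    fun l => by simp only [Families.eval_mk, map_star]

theorem base_dilFamily (s : Set.Ioc (0 : ℝ) 1) (a : OpFamilies V) :
    Families.base (dilFamily s a) = dilC0 s s.2.1 (Families.base a) := rfl

theorem eval_dilFamily (s l : Set.Ioc (0 : ℝ) 1) (a : OpFamilies V) :
    Families.eval l (dilFamily s a) = dilOp s s.2.1 (Families.eval (dilParam s l) a) := rfl

/-- Dilation of the argument of a scalar function. -/
def dilScalar (s : ℝ) (φ : C(ℝ, ℂ)) : C(ℝ, ℂ) := φ.comp ⟨fun l => s ^ 2 * l, by fun_prop⟩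

theorem dilFamily_sectionFamily (s : Set.Ioc (0 : ℝ) 1) (φ : C(ℝ, ℂ)) (f : 𝓢(V, ℂ)) :
    dilFamily s (sectionFamily φ f) = sectionFamily (dilScalar s φ) (dilSchwartz s s.2.1 f) := by
  refine Families.ext (ZeroAtInftyContinuousMap.ext fun x => ?_) fun l => ?_
  · rw [base_dilFamily, dilC0_apply, base_sectionFamily, base_sectionFamily, dilSchwartz_apply]
    simp [dilScalar]
  · rw [eval_dilFamily, eval_sectionFamily, eval_sectionFamily, map_smul]
    congr 1
    exact dilOp_quant s s.2.1 l f

theorem dilFamily_mem_basicSections (s : Set.Ioc (0 : ℝ) 1) {a : OpFamilies V}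
    (ha : a ∈ basicSections V) : dilFamily s a ∈ basicSections V := by
  obtain ⟨φ, f, rfl⟩ := exists_eq_sectionFamily ha
  rw [dilFamily_sectionFamily]
  exact sectionFamily_mem _ _

/-- Dilation of continuous sections. -/
def dilSection (s : Set.Ioc (0 : ℝ) 1) : SectionAlgebra V →⋆ₙₐ[ℂ] SectionAlgebra V :=
  Generated.map (dilFamily s) fun _ ha => dilFamily_mem_basicSections s ha

theorem incl_dilSection (s : Set.Ioc (0 : ℝ) 1) (a : SectionAlgebra V) :
    Generated.incl _ (dilSection s a) = dilFamily s (Generated.incl _ a) := rfl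

theorem dilSection_act (s : Set.Ioc (0 : ℝ) 1) (u : V ≃ₗᵢ[ℂ] V) (a : SectionAlgebra V) :
    dilSection s (sectionAct u a) = sectionAct u (dilSection s a) := by
  refine Generated.incl_injective ?_
  refine Families.ext (ZeroAtInftyContinuousMap.ext fun x => ?_) fun l => ?_
  · change Families.base (Generated.incl _ a) (u.symm ((s : ℝ) • x)) =
      Families.base (Generated.incl _ a) ((s : ℝ) • u.symm x)
    congr 1
    simp only [← Complex.coe_smul]
    rw [map_smul]
  · exact dilOp_opAct s s.2.1 u _

theorem dilSection_one (a : SectionAlgebra V) : dilSection ⟨1, by simp⟩ a = a := by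
  refine Generated.incl_injective ?_
  refine Families.ext (ZeroAtInftyContinuousMap.ext fun x => ?_) fun l => ?_
  · change Families.base (Generated.incl _ a) ((1 : ℝ) • x) = _
    rw [one_smul]
  · rw [incl_dilSection, eval_dilFamily]
    have h1 : dilParam ⟨1, by simp⟩ l = l := Subtype.ext (by simp [dilParam])
    have h2 : ∀ f : L2 V, dil 1 one_pos f = f :=
      (isWeightedComp_dil 1 one_pos).eq isWeightedComp_id (by simp [dilCoeff]) (by simp)
    rw [h1]
    ext1 f
    rw [dilOp_apply, h2]
    congr 1
    rw [LinearIsometryEquiv.symm_apply_eq, h2]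

theorem norm_quant_sub_le (l : ℝ) (f g : 𝓢(V, ℂ)) :
    ‖quant l f - quant l g‖ ≤ wienerNorm (f - g) := by
  rw [← quant_sub]
  exact norm_quant_le _ _

theorem norm_smul_sub_smul_le {E : Type*} [SeminormedAddCommGroup E] [NormedSpace ℂ E]
    (c d : ℂ) (x y : E) : ‖c • x - d • y‖ ≤ ‖c - d‖ * ‖x‖ + ‖d‖ * ‖x - y‖ := by
  have h : c • x - d • y = (c - d) • x + d • (x - y) := by rw [sub_smul, smul_sub]; abel
  rw [h]
  exact (norm_add_le _ _).trans (by rw [norm_smul, norm_smul])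

theorem norm_sectionFamily_sub_le {φ ψ : C(ℝ, ℂ)} (f g : 𝓢(V, ℂ)) {C K : ℝ}
    (hφ : ∀ l ∈ Set.Icc (0 : ℝ) 1, ‖φ l - ψ l‖ ≤ C) (hψ : ∀ l ∈ Set.Icc (0 : ℝ) 1, ‖ψ l‖ ≤ K) :
    ‖sectionFamily φ f - sectionFamily ψ g‖ ≤ C * wienerNorm f + K * wienerNorm (f - g) := by
  have hC : 0 ≤ C := (norm_nonneg _).trans (hφ 0 (by simp))
  have hK : 0 ≤ K := (norm_nonneg _).trans (hψ 0 (by simp))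
  have h0 : 0 ≤ C * wienerNorm f + K * wienerNorm (f - g) :=
    add_nonneg (mul_nonneg hC (wienerNorm_nonneg _)) (mul_nonneg hK (wienerNorm_nonneg _))
  refine Families.norm_le ?_ fun l => ?_
  · refine (c0_norm_le h0).2 fun x => ?_
    rw [map_sub]
    change ‖φ 0 • f x - ψ 0 • g x‖ ≤ _
    refine (norm_smul_sub_smul_le _ _ _ _).trans (add_le_add ?_ ?_)
    · exact mul_le_mul (hφ 0 (by simp)) (norm_apply_le_wienerNorm f x) (norm_nonneg _) hC
    · exact mul_le_mul (hψ 0 (by simp)) (norm_apply_le_wienerNorm (f - g) x) (norm_nonneg _) hK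
  · have hl : (l : ℝ) ∈ Set.Icc (0 : ℝ) 1 := ⟨l.2.1.le, l.2.2⟩
    rw [map_sub, eval_sectionFamily, eval_sectionFamily]
    refine (norm_smul_sub_smul_le _ _ _ _).trans (add_le_add ?_ ?_)
    · exact mul_le_mul (hφ l hl) (norm_quant_le _ f) (norm_nonneg _) hC
    · exact mul_le_mul (hψ l hl) (norm_quant_sub_le _ f g) (norm_nonneg _) hK

theorem exists_schwartz_bound (g : 𝓢(V, ℂ)) :
    ∃ C : ℝ, ∃ k : ℕ, Integrable (fun x : V => (1 + ‖x‖) ^ (-(k : ℝ))) (leb V) ∧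
      ∀ x, ‖g x‖ ≤ C * (1 + ‖x‖) ^ (-(k : ℝ)) := by
  set k := Module.finrank ℝ V + 1 with hk
  obtain ⟨C, hC⟩ : ∃ C, ∀ x, (1 + ‖x‖) ^ k * ‖g x‖ ≤ C := by
    refine ⟨2 ^ k * ((Finset.Iic (k, 0)).sup fun m => SchwartzMap.seminorm ℂ m.1 m.2) g,
      fun x => ?_⟩
    have := SchwartzMap.one_add_le_sup_seminorm_apply (𝕜 := ℂ) (m := (k, 0)) (k := k) (n := 0)
      le_rfl le_rfl g x
    simpa using this
  refine ⟨C, k, integrable_one_add_norm (by rw [hk]; push_cast; linarith), fun x => ?_⟩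
  have h1 : 0 < 1 + ‖x‖ := by positivity
  rw [Real.rpow_neg h1.le, Real.rpow_natCast, ← div_eq_mul_inv, le_div_iff₀ (by positivity)]
  linarith [hC x]

theorem tendsto_wienerNorm_dilSchwartz (f : 𝓢(V, ℂ)) (s₀ : Set.Ioc (0 : ℝ) 1) :
    Tendsto (fun s : Set.Ioc (0 : ℝ) 1 =>
      wienerNorm (dilSchwartz s s.2.1 f - dilSchwartz s₀ s₀.2.1 f)) (𝓝 s₀) (𝓝 0) := by
  obtain ⟨C, k, hint, hC⟩ := exists_schwartz_bound (𝓕 f)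
  set n := Module.finrank ℝ V
  have hC0 : 0 ≤ C := by
    have := (norm_nonneg _).trans (hC 0)
    simpa using this
  have hbound : ∀ (s : Set.Ioc (0 : ℝ) 1) (w : V),
      ‖𝓕 f ((s : ℝ)⁻¹ • w)‖ ≤ C * (1 + ‖w‖) ^ (-(k : ℝ)) := fun s w => by
    refine (hC _).trans (mul_le_mul_of_nonneg_left ?_ hC0)
    refine Real.rpow_le_rpow_of_nonpos (by positivity) ?_ (by simp)
    rw [norm_smul, Real.norm_of_nonneg (inv_nonneg.2 s.2.1.le)]
    have := le_mul_of_one_le_left (norm_nonneg w) ((one_le_inv₀ s.2.1).2 s.2.2)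
    linarith
  have hcont : ∀ w : V, Continuous fun s : Set.Ioc (0 : ℝ) 1 => (((s : ℝ) ^ n)⁻¹ : ℝ) *
      𝓕 f ((s : ℝ)⁻¹ • w) := fun w => by
    have h1 : Continuous fun s : Set.Ioc (0 : ℝ) 1 => (s : ℝ)⁻¹ :=
      continuous_subtype_val.inv₀ fun s => s.2.1.ne'
    have h2 : Continuous fun s : Set.Ioc (0 : ℝ) 1 => ((s : ℝ) ^ n)⁻¹ :=
      (continuous_subtype_val.pow n).inv₀ fun s => (pow_pos s.2.1 n).ne'
    exact (Complex.continuous_ofReal.comp h2).mul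
      ((𝓕 f).continuous.comp (h1.smul continuous_const))
  have key : Tendsto (fun s : Set.Ioc (0 : ℝ) 1 => ∫ w, ‖((((s : ℝ) ^ n)⁻¹ : ℝ) : ℂ) *
      𝓕 f ((s : ℝ)⁻¹ • w) - ((((s₀ : ℝ) ^ n)⁻¹ : ℝ) : ℂ) * 𝓕 f ((s₀ : ℝ)⁻¹ • w)‖ ∂(leb V))
      (𝓝 s₀) (𝓝 (∫ _w : V, (0 : ℝ) ∂(leb V))) := by
    have hev : ∀ᶠ s : Set.Ioc (0 : ℝ) 1 in 𝓝 s₀, ((s : ℝ) ^ n)⁻¹ < ((s₀ : ℝ) ^ n)⁻¹ + 1 := by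
      have h2 : Continuous fun s : Set.Ioc (0 : ℝ) 1 => ((s : ℝ) ^ n)⁻¹ :=
        (continuous_subtype_val.pow n).inv₀ fun s => (pow_pos s.2.1 n).ne'
      exact (h2.tendsto s₀).eventually_lt_const (by linarith)
    refine tendsto_integral_filter_of_dominated_convergence
      (fun w => 2 * (((s₀ : ℝ) ^ n)⁻¹ + 1) * (C * (1 + ‖w‖) ^ (-(k : ℝ)))) ?_ ?_
      ((hint.const_mul C).const_mul _) (Eventually.of_forall fun w => ?_)
    · refine Eventually.of_forall fun s => Continuous.aestronglyMeasurable ?_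
      have h1 : ∀ s : ℝ, Continuous fun w : V => 𝓕 f (s • w) := fun s =>
        (𝓕 f).continuous.comp (continuous_const_smul s)
      exact ((continuous_const.mul (h1 _)).sub (continuous_const.mul (h1 _))).norm
    · filter_upwards [hev] with s hs
      refine Eventually.of_forall fun w => ?_
      have hp : ∀ s : Set.Ioc (0 : ℝ) 1, 0 < ((s : ℝ) ^ n)⁻¹ := fun s =>
        inv_pos.2 (pow_pos s.2.1 n)
      rw [norm_norm]
      refine (norm_sub_le _ _).trans ?_
      rw [norm_mul, norm_mul, Complex.norm_real, Complex.norm_real,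
        Real.norm_of_nonneg (hp s).le, Real.norm_of_nonneg (hp s₀).le]
      have h1 := mul_le_mul hs.le (hbound s w) (norm_nonneg _) (by linarith [hp s₀])
      have h2 := mul_le_mul (by linarith : ((s₀ : ℝ) ^ n)⁻¹ ≤ ((s₀ : ℝ) ^ n)⁻¹ + 1)
        (hbound s₀ w) (norm_nonneg _) (by linarith [hp s₀])
      linarith
    · have h1 := (((hcont w).sub continuous_const).norm (E := ℂ)).tendsto s₀
        (f := fun s : Set.Ioc (0 : ℝ) 1 => ‖((((s : ℝ) ^ n)⁻¹ : ℝ) : ℂ) * 𝓕 f ((s : ℝ)⁻¹ • w) -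
          ((((s₀ : ℝ) ^ n)⁻¹ : ℝ) : ℂ) * 𝓕 f ((s₀ : ℝ)⁻¹ • w)‖)
      simpa using h1
  rw [integral_zero] at key
  refine key.congr fun s => ?_
  rw [wienerNorm_eq]
  refine integral_congr_ae (Eventually.of_forall fun w => ?_)
  have h : 𝓕 (dilSchwartz s s.2.1 f - dilSchwartz s₀ s₀.2.1 f) =
      𝓕 (dilSchwartz s s.2.1 f) - 𝓕 (dilSchwartz s₀ s₀.2.1 f) :=
    map_sub (FourierTransform.fourierCLM ℂ 𝓢(V, ℂ)) _ _
  simp only [h, _root_.sub_apply, fourier_dilSchwartz]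
  rfl

theorem tendsto_dilScalar (φ : C(ℝ, ℂ)) (s₀ : Set.Ioc (0 : ℝ) 1) {ε : ℝ} (hε : 0 < ε) :
    ∀ᶠ s : Set.Ioc (0 : ℝ) 1 in 𝓝 s₀, ∀ l ∈ Set.Icc (0 : ℝ) 1,
      ‖dilScalar s φ l - dilScalar s₀ φ l‖ ≤ ε := by
  have h1 := (isCompact_Icc (a := (0 : ℝ)) (b := 1)).uniformContinuousOn_of_continuous
    φ.continuous.continuousOn
  obtain ⟨δ, hδ, h2⟩ := Metric.uniformContinuousOn_iff.1 h1 ε hε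
  have h3 : Continuous fun s : Set.Ioc (0 : ℝ) 1 => |(s : ℝ) ^ 2 - (s₀ : ℝ) ^ 2| := by fun_prop
  have h4 : ∀ᶠ s : Set.Ioc (0 : ℝ) 1 in 𝓝 s₀, |(s : ℝ) ^ 2 - (s₀ : ℝ) ^ 2| < δ :=
    (h3.tendsto s₀).eventually_lt_const (by simpa using hδ)
  filter_upwards [h4] with s hs l hl
  have hmem : ∀ s : Set.Ioc (0 : ℝ) 1, (s : ℝ) ^ 2 * l ∈ Set.Icc (0 : ℝ) 1 := fun s =>
    ⟨mul_nonneg (sq_nonneg _) hl.1, mul_le_one₀ (pow_le_one₀ s.2.1.le s.2.2) hl.1 hl.2⟩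
  have h5 := h2 _ (hmem s) _ (hmem s₀) (by
    rw [Real.dist_eq, ← sub_mul, abs_mul, abs_of_nonneg hl.1]
    exact (mul_le_of_le_one_right (abs_nonneg _) hl.2).trans_lt hs)
  rw [dist_eq_norm] at h5
  exact h5.le

theorem wienerNorm_sub_comm (f g : 𝓢(V, ℂ)) : wienerNorm (f - g) = wienerNorm (g - f) := by
  have h := wienerNorm_smul (-1) (f - g)
  rw [neg_one_smul, neg_sub, norm_neg, norm_one, one_mul] at h
  exact h.symm

theorem continuous_dilFamily_sectionFamily (φ : C(ℝ, ℂ)) (f : 𝓢(V, ℂ)) :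
    Continuous fun s : Set.Ioc (0 : ℝ) 1 => dilFamily s (sectionFamily φ f) := by
  refine continuous_iff_continuousAt.2 fun s₀ => Metric.tendsto_nhds.2 fun ε hε => ?_
  obtain ⟨K, hK⟩ := isCompact_Icc.exists_bound_of_continuousOn (s := Set.Icc (0 : ℝ) 1)
    φ.continuous.continuousOn
  have hK0 : 0 ≤ K := (norm_nonneg _).trans (hK 0 (by simp))
  set W := wienerNorm (dilSchwartz s₀ s₀.2.1 f) with hW
  have hW0 : 0 ≤ W := wienerNorm_nonneg _
  have h1 := tendsto_dilScalar φ s₀ (ε := ε / (2 * (W + 1))) (by positivity)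
  have h2 := (tendsto_wienerNorm_dilSchwartz f s₀).eventually_lt_const
    (u := ε / (2 * (K + 1))) (by positivity)
  filter_upwards [h1, h2] with s hs1 hs2
  rw [dist_comm, dist_eq_norm, dilFamily_sectionFamily, dilFamily_sectionFamily]
  refine (norm_sectionFamily_sub_le (C := ε / (2 * (W + 1))) (K := K) _ _ (fun l hl => ?_)
    fun l hl => ?_).trans_lt ?_
  · rw [norm_sub_rev]
    exact hs1 l hl
  · exact hK _ ⟨mul_nonneg (sq_nonneg _) hl.1,
      mul_le_one₀ (pow_le_one₀ s.2.1.le s.2.2) hl.1 hl.2⟩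
  · rw [wienerNorm_sub_comm, ← hW]
    have h3 : ε / (2 * (W + 1)) * W ≤ ε / 2 := by
      rw [div_mul_eq_mul_div, div_le_div_iff₀ (by positivity) two_pos]
      nlinarith
    have h4 : K * wienerNorm (dilSchwartz s s.2.1 f - dilSchwartz s₀ s₀.2.1 f) < ε / 2 := by
      calc _ ≤ K * (ε / (2 * (K + 1))) := mul_le_mul_of_nonneg_left hs2.le hK0
        _ < ε / 2 := by
          rw [mul_div_assoc', div_lt_div_iff₀ (by positivity) two_pos]
          nlinarith
    linarith

theorem norm_dilFamily_le (s : Set.Ioc (0 : ℝ) 1) (a : OpFamilies V) : ‖dilFamily s a‖ ≤ ‖a‖ :=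
  NonUnitalStarAlgHom.norm_apply_le _ _

theorem isClosed_continuous_dilFamily :
    IsClosed {a : OpFamilies V | Continuous fun s : Set.Ioc (0 : ℝ) 1 => dilFamily s a} := by
  refine isClosed_of_closure_subset fun a ha => ?_
  refine continuous_of_uniform_approx_of_continuous fun u hu => ?_
  obtain ⟨ε, hε, h⟩ := Metric.mem_uniformity_dist.1 hu
  obtain ⟨b, hb, hab⟩ := Metric.mem_closure_iff.1 ha ε hε
  refine ⟨_, hb, fun s => h ?_⟩
  rw [dist_eq_norm] at hab ⊢
  rw [← map_sub]
  exact (norm_dilFamily_le s _).trans_lt hab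

theorem continuous_dilFamily {a : OpFamilies V} (ha : a ∈ closedAdjoin (basicSections V)) :
    Continuous fun s : Set.Ioc (0 : ℝ) 1 => dilFamily s a := by
  refine closedAdjoin_induction
    (p := fun a => Continuous fun s : Set.Ioc (0 : ℝ) 1 => dilFamily s a) ?_ ?_ ?_ ?_ ?_ ?_
    isClosed_continuous_dilFamily ha
  · intro a ha
    obtain ⟨φ, f, rfl⟩ := exists_eq_sectionFamily ha
    exact continuous_dilFamily_sectionFamily φ f
  · simp only [map_zero]
    exact continuous_const
  · intro a b ha hb
    simp only [map_add]
    exact ha.add hb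
  · intro a b ha hb
    simp only [map_mul]
    exact ha.mul hb
  · intro c a ha
    simp only [map_smul]
    exact ha.const_smul c
  · intro a ha
    simp only [map_star]
    exact ha.star

theorem continuous_dilSection (a : SectionAlgebra V) :
    Continuous fun s : Set.Ioc (0 : ℝ) 1 => dilSection s a :=
  Continuous.subtype_mk (continuous_dilFamily a.2) _

/-- Dilations by small factors make the norm of a section close to that of its value at `0`. -/
theorem exists_norm_dilSection_le (a : SectionAlgebra V) {m : ℝ} (hm : ‖evalZero V a‖ < m) :
    ∃ δ > 0, ∀ s : Set.Ioc (0 : ℝ) 1, (s : ℝ) < δ → ‖dilSection s a‖ ≤ m := by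
  obtain ⟨δ, hδ, h⟩ := exists_norm_eval_le a.2 hm
  refine ⟨min δ 1, lt_min hδ one_pos, fun s hs => ?_⟩
  change ‖dilFamily s a.1‖ ≤ m
  refine Families.norm_le ?_ fun l => ?_
  · exact (NonUnitalStarAlgHom.norm_apply_le (dilC0 (s : ℝ) s.2.1) (evalZero V a)).trans hm.le
  · refine (NonUnitalStarAlgHom.norm_apply_le (dilOp (s : ℝ) s.2.1)
      (Families.eval (dilParam s l) a.1)).trans (h (dilParam s l) ?_)
    change (s : ℝ) ^ 2 * l < δ
    have h1 := s.2.1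
    have h2 := s.2.2
    have h3 := l.2.2
    have h4 := l.2.1
    have h5 : (s : ℝ) ^ 2 * l ≤ s := by nlinarith
    exact h5.trans_lt (hs.trans_le (min_le_left _ _))

/-- Under dilations by small factors, the operators of a section at `1` converge strongly to the
scalar which is the value of its classical limit at the origin. -/
theorem tendsto_evalOne_dilSection (a : SectionAlgebra V) (φ : L2 V) {ε : ℝ} (hε : 0 < ε) :
    ∃ δ > 0, ∀ s : Set.Ioc (0 : ℝ) 1, (s : ℝ) < δ →
      ‖Generated.incl _ (evalOne V (dilSection s a)) φ - evalZero V a 0 • φ‖ ≤ ε := by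
  set η := ε / (3 * (‖φ‖ + 1)) with hη
  have hη0 : 0 < η := by positivity
  have hηφ : η * ‖φ‖ ≤ ε / 3 := by
    rw [hη, div_mul_eq_mul_div, div_le_div_iff₀ (by positivity) (by norm_num)]
    nlinarith [norm_nonneg φ]
  obtain ⟨f, hf0, δ, hδ, hf⟩ := nearlyConstant_of_mem a.2 η hη0
  obtain ⟨δ', hδ', h⟩ := Metric.tendsto_nhds_nhds.1 (tendsto_quant_dilSchwartz 1 f φ) (ε / 3)
    (by linarith)
  refine ⟨min δ δ', lt_min hδ hδ', fun s hs => ?_⟩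
  have h1 : ‖dilOp s s.2.1 (Families.eval (dilParam s ⟨1, by simp⟩) a.1) φ -
      quant 1 (dilSchwartz s s.2.1 f) φ‖ ≤ ε / 3 := by
    rw [← dilOp_quant, ← _root_.sub_apply, ← map_sub]
    refine (ContinuousLinearMap.le_opNorm _ _).trans ?_
    refine (mul_le_mul_of_nonneg_right ((NonUnitalStarAlgHom.norm_apply_le _ _).trans
      (hf (dilParam s ⟨1, by simp⟩) ?_)) (norm_nonneg _)).trans hηφ
    change (s : ℝ) ^ 2 * 1 < δ
    have h1 := s.2.1
    have h2 := s.2.2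
    nlinarith [hs.trans_le (min_le_left _ _)]
  have h2 : ‖quant 1 (dilSchwartz s s.2.1 f) φ - f 0 • φ‖ ≤ ε / 3 := by
    rw [quant_dilSchwartz_apply, ← dist_eq_norm]
    exact (h (by simpa [abs_of_pos s.2.1] using hs.trans_le (min_le_right _ _))).le
  have h3 : ‖f 0 • φ - evalZero V a 0 • φ‖ ≤ ε / 3 := by
    rw [← sub_smul, norm_smul]
    refine (mul_le_mul_of_nonneg_right ?_ (norm_nonneg _)).trans hηφ
    rw [norm_sub_rev]
    exact (c0_norm_apply_le (Families.base a.1 - f.toZeroAtInfty) 0).trans hf0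
  have h4 := norm_add_le (dilOp s s.2.1 (Families.eval (dilParam s ⟨1, by simp⟩) a.1) φ -
      quant 1 (dilSchwartz s s.2.1 f) φ) (quant 1 (dilSchwartz s s.2.1 f) φ - f 0 • φ)
  have h5 := norm_add_le (dilOp s s.2.1 (Families.eval (dilParam s ⟨1, by simp⟩) a.1) φ -
    f 0 • φ) (f 0 • φ - evalZero V a 0 • φ)
  rw [sub_add_sub_cancel] at h4 h5
  change ‖dilOp s s.2.1 (Families.eval (dilParam s ⟨1, by simp⟩) a.1) φ -
    evalZero V a 0 • φ‖ ≤ ε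
  linarith

end DilationSections

/-! ## Equivalence of invariant idempotents -/

section Invariants

set_option linter.unusedSectionVars false

variable {G : Type*} [Group G] [TopologicalSpace G]
variable {B : Type*} [Ring B] [Algebra ℂ B] {B' : Type*} [Ring B'] [Algebra ℂ B']
variable {β : G →* (B →ₐ[ℂ] B)} {β' : G →* (B' →ₐ[ℂ] B')}
variable {ι κ τ : Type} [Fintype ι] [DecidableEq ι] [Fintype κ] [DecidableEq κ] [Fintype τ]
  [DecidableEq τ]

/-- Invariance of an element of `B ⊗ Hom(W', W)` under the group. -/
def IsInvariant (β : G →* (B →ₐ[ℂ] B)) (r : G →* Matrix ι ι ℂ) (s : G →* Matrix κ κ ℂ)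
    (x : Matrix ι κ B) : Prop :=
  ∀ g, scal B (r g) * x.map (β g) = x * scal B (s g)

variable {r : G →* Matrix ι ι ℂ} {s : G →* Matrix κ κ ℂ} {t : G →* Matrix τ τ ℂ}

namespace IsInvariant

theorem mul {x : Matrix ι κ B} {y : Matrix κ τ B} (hx : IsInvariant β r s x)
    (hy : IsInvariant β s t y) : IsInvariant β r t (x * y) := fun g => by
  rw [Matrix.map_mul, ← Matrix.mul_assoc, hx g, Matrix.mul_assoc, hy g, Matrix.mul_assoc]

theorem add {x y : Matrix ι κ B} (hx : IsInvariant β r s x) (hy : IsInvariant β r s y) :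
    IsInvariant β r s (x + y) := fun g => by
  have h : (x + y).map (β g) = x.map (β g) + y.map (β g) := by ext; simp
  rw [h, Matrix.mul_add, hx g, hy g, Matrix.add_mul]

theorem neg {x : Matrix ι κ B} (hx : IsInvariant β r s x) : IsInvariant β r s (-x) := fun g => by
  have h : (-x).map (β g) = -x.map (β g) := by ext; simp
  rw [h, Matrix.mul_neg, hx g, Matrix.neg_mul]

theorem sub {x y : Matrix ι κ B} (hx : IsInvariant β r s x) (hy : IsInvariant β r s y) :
    IsInvariant β r s (x - y) := by
  rw [sub_eq_add_neg]
  exact hx.add hy.neg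

theorem zero : IsInvariant β r s (0 : Matrix ι κ B) := fun g => by
  have h : (0 : Matrix ι κ B).map (β g) = 0 := by ext; simp
  rw [h, Matrix.mul_zero, Matrix.zero_mul]

theorem one : IsInvariant β r r (1 : Matrix ι ι B) := fun g => by
  have h : (1 : Matrix ι ι B).map (β g) = 1 := by simp
  rw [h, Matrix.mul_one, Matrix.one_mul]

theorem inv {x y : Matrix ι ι B} (hx : IsInvariant β r r x) (hxy : x * y = 1) (hyx : y * x = 1) :
    IsInvariant β r r y := fun g => by
  have h1 : x.map (β g) * y.map (β g) = 1 := by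
    rw [← Matrix.map_mul, hxy]
    simp
  calc scal B (r g) * y.map (β g) = y * x * scal B (r g) * y.map (β g) := by
        rw [hyx, Matrix.one_mul]
    _ = y * (x * scal B (r g)) * y.map (β g) := by simp only [Matrix.mul_assoc]
    _ = y * (scal B (r g) * x.map (β g)) * y.map (β g) := by rw [hx g]
    _ = y * scal B (r g) := by
        rw [Matrix.mul_assoc, Matrix.mul_assoc, h1, Matrix.mul_one]

theorem map {x : Matrix ι κ B} (hx : IsInvariant β r s x) {φ : B →ₐ[ℂ] B'}
    (hφ : ∀ g b, φ (β g b) = β' g (φ b)) : IsInvariant β' r s (x.map φ) := fun g =>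
  Cycle.map_invariant (hφ g) (hx g)

end IsInvariant

/-- The ring of invariant elements of `B ⊗ End(W)`. -/
def invariantSubring (β : G →* (B →ₐ[ℂ] B)) (r : G →* Matrix ι ι ℂ) : Subring (Matrix ι ι B) where
  carrier := {x | IsInvariant β r r x}
  mul_mem' := IsInvariant.mul
  one_mem' := IsInvariant.one
  add_mem' := IsInvariant.add
  zero_mem' := IsInvariant.zero
  neg_mem' := IsInvariant.neg

namespace Cycle

theorem Equivalent.symm {c d : Cycle β} (h : c.Equivalent d) : d.Equivalent c := by
  obtain ⟨x, y, hx, hy, hxy, hyx⟩ := h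
  exact ⟨y, x, hy, hx, hyx, hxy⟩

theorem Equivalent.trans {c d e : Cycle β} (h : c.Equivalent d) (h' : d.Equivalent e) :
    c.Equivalent e := by
  obtain ⟨x, y, hx, hy, hxy, hyx⟩ := h
  obtain ⟨z, w, hz, hw, hzw, hwz⟩ := h'
  refine ⟨x * z, w * y, IsInvariant.mul hx hz, IsInvariant.mul hw hy, ?_, ?_⟩
  · calc x * z * (w * y) = x * (z * w) * y := by simp only [Matrix.mul_assoc]
      _ = x * y * (x * y) := by rw [hzw, ← hyx]; simp only [Matrix.mul_assoc]
      _ = c.e := by rw [hxy, c.idem]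
  · calc w * y * (x * z) = w * (y * x) * z := by simp only [Matrix.mul_assoc]
      _ = w * z * (w * z) := by rw [hyx, ← hzw]; simp only [Matrix.mul_assoc]
      _ = e.e := by rw [hwz, e.idem]

theorem fromBlocks_diag_mul {ι κ τ ι' κ' τ' : Type} [Fintype κ] [Fintype κ'] (x : Matrix ι κ B)
    (y : Matrix κ τ B) (z : Matrix ι' κ' B) (w : Matrix κ' τ' B) :
    fromBlocks x 0 0 z * fromBlocks y 0 0 w = fromBlocks (x * y) 0 0 (z * w) := by
  rw [fromBlocks_multiply]
  simp

theorem fromBlocks_diag_invariant {ι κ ι' κ' : Type} [Fintype ι] [Fintype κ] [Fintype ι']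
    [Fintype κ'] {m : Matrix ι ι ℂ} {n : Matrix κ κ ℂ} {m' : Matrix ι' ι' ℂ} {n' : Matrix κ' κ' ℂ}
    {x : Matrix ι κ B} {z : Matrix ι' κ' B} {φ : B →ₐ[ℂ] B}
    (hx : scal B m * x.map φ = x * scal B n) (hz : scal B m' * z.map φ = z * scal B n') :
    scal B (fromBlocks m 0 0 m') * (fromBlocks x 0 0 z).map φ =
      fromBlocks x 0 0 z * scal B (fromBlocks n 0 0 n') := by
  have h : ∀ {ι κ : Type}, (0 : Matrix ι κ B).map φ = 0 := by intros; ext; simp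
  have h' : ∀ {ι κ : Type}, (0 : Matrix ι κ ℂ).map (algebraMap ℂ B) = 0 := by intros; ext; simp
  rw [scal, scal, fromBlocks_map, fromBlocks_map, fromBlocks_map, h, h, h', h', h', h',
    fromBlocks_diag_mul, fromBlocks_diag_mul]
  exact congrArg₂ (fun a b => fromBlocks a 0 0 b) hx hz

theorem Equivalent.sum {c c' d d' : Cycle β} (h : c.Equivalent d) (h' : c'.Equivalent d') :
    (c.sum c').Equivalent (d.sum d') := by
  obtain ⟨x, y, hx, hy, hxy, hyx⟩ := h
  obtain ⟨z, w, hz, hw, hzw, hwz⟩ := h'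
  refine ⟨fromBlocks x 0 0 z, fromBlocks y 0 0 w, fun g => fromBlocks_diag_invariant (hx g) (hz g),
    fun g => fromBlocks_diag_invariant (hy g) (hw g), ?_, ?_⟩
  · refine (fromBlocks_diag_mul x y z w).trans ?_
    rw [hxy, hzw]
    rfl
  · refine (fromBlocks_diag_mul y x w z).trans ?_
    rw [hyx, hwz]
    rfl

/-- Invariant elements `x`, `y` between the ranges of two idempotents, whose products are
invertible in the corners, define an equivalence. -/
theorem equivalent_of_isUnit {c d : Cycle β} {x : Matrix c.ι d.ι B} {y : Matrix d.ι c.ι B}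
    (hx : IsInvariant β c.ρ d.ρ x) (hy : IsInvariant β d.ρ c.ρ y)
    (hu : IsUnit (1 + (c.e * x * d.e * y * c.e - c.e)))
    (hv : IsUnit (1 + (d.e * y * c.e * x * d.e - d.e))) : c.Equivalent d := by
  obtain ⟨⟨u, u', huu, huu'⟩, hu⟩ := hu
  obtain ⟨⟨v, v', hvv, hvv'⟩, hv⟩ := hv
  simp only at hu hv
  set X := c.e * x * d.e with hX
  set Y := d.e * y * c.e with hY
  have hXi : IsInvariant β c.ρ d.ρ X :=
    (IsInvariant.mul c.invariant hx).mul d.invariant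
  have hYi : IsInvariant β d.ρ c.ρ Y :=
    (IsInvariant.mul d.invariant hy).mul c.invariant
  have hcX : c.e * X = X := by rw [hX, ← Matrix.mul_assoc, ← Matrix.mul_assoc, c.idem]
  have hXd : X * d.e = X := by rw [hX, Matrix.mul_assoc, d.idem]
  have hdY : d.e * Y = Y := by rw [hY, ← Matrix.mul_assoc, ← Matrix.mul_assoc, d.idem]
  have hYc : Y * c.e = Y := by rw [hY, Matrix.mul_assoc, c.idem]
  have hXY : c.e * x * d.e * y * c.e = X * Y := by
    rw [hX, hY]
    simp only [Matrix.mul_assoc]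
    rw [← Matrix.mul_assoc d.e d.e, d.idem]
  have hYX : d.e * y * c.e * x * d.e = Y * X := by
    rw [hX, hY]
    simp only [Matrix.mul_assoc]
    rw [← Matrix.mul_assoc c.e c.e, c.idem]
  rw [hXY] at hu
  rw [hYX] at hv
  have hui : IsInvariant β c.ρ c.ρ u := by
    rw [hu]
    exact IsInvariant.one.add ((hXi.mul hYi).sub c.invariant)
  have heu : c.e * u = X * Y := by
    rw [hu, Matrix.mul_add, Matrix.mul_sub, ← Matrix.mul_assoc, hcX, c.idem, Matrix.mul_one]
    abel
  have hfv : d.e * v = Y * X := by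
    rw [hv, Matrix.mul_add, Matrix.mul_sub, ← Matrix.mul_assoc, hdY, d.idem, Matrix.mul_one]
    abel
  have hcomm : X * v = u * X := by
    rw [hu, hv, Matrix.mul_add, Matrix.add_mul, Matrix.mul_sub, Matrix.sub_mul, hXd, hcX,
      Matrix.mul_one, Matrix.one_mul, ← Matrix.mul_assoc X Y X]
  have hcomm' : u' * X = X * v' := by
    calc u' * X = u' * X * (v * v') := by rw [hvv, Matrix.mul_one]
      _ = u' * (X * v) * v' := by simp only [Matrix.mul_assoc]
      _ = X * v' := by rw [hcomm, ← Matrix.mul_assoc, huu', Matrix.one_mul]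
  refine ⟨X, Y * u', hXi, hYi.mul (hui.inv huu huu'), ?_, ?_⟩
  · rw [← Matrix.mul_assoc, ← heu, Matrix.mul_assoc, huu, Matrix.mul_one]
  · rw [Matrix.mul_assoc, hcomm', ← Matrix.mul_assoc, ← hfv, Matrix.mul_assoc, hvv, Matrix.mul_one]

end Cycle

/-- A homomorphism along which invariant idempotents can be lifted up to equivalence, uniquely up
to equivalence, is an isomorphism in equivariant `K`-theory. -/
theorem K0.map_bijective {φ : B →ₐ[ℂ] B'} (hφ : ∀ g b, φ (β g b) = β' g (φ b))
    (hlift : ∀ c : Cycle β', ∃ q : Cycle β, (q.map φ hφ).Equivalent c)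
    (hrefl : ∀ q q' : Cycle β, (q.map φ hφ).Equivalent (q'.map φ hφ) → q.Equivalent q') :
    Function.Bijective (K0.map φ hφ) := by
  choose q hq using hlift
  let S : K0 β' →+ K0 β := QuotientAddGroup.lift (K0Relations β')
    (FreeAbelianGroup.lift fun c : Cycle β' => K0.cls (q c)) (by
      rw [K0Relations, AddSubgroup.closure_le]
      rintro x (⟨c, d, h, rfl⟩ | ⟨c, d, rfl⟩)
      · have h1 := hrefl (q c) (q d) (((hq c).trans h).trans (hq d).symm)
        simp [AddMonoidHom.mem_ker, K0.cls_eq_of_equivalent h1]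
      · have h1 := hrefl (q (c.sum d)) ((q c).sum (q d)) (by
          rw [Cycle.map_sum]
          exact (hq _).trans ((hq c).sum (hq d)).symm)
        simp [AddMonoidHom.mem_ker, K0.cls_eq_of_equivalent h1, K0.cls_sum])
  have hS : ∀ c, S (K0.cls c) = K0.cls (q c) := fun c => by
    change FreeAbelianGroup.lift (fun c : Cycle β' => K0.cls (q c)) (FreeAbelianGroup.of c) = _
    simp
  have h1 : S.comp (K0.map φ hφ) = AddMonoidHom.id _ := K0.hom_ext fun c => by
    rw [AddMonoidHom.comp_apply, K0.map_cls, hS]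
    exact K0.cls_eq_of_equivalent (hrefl _ _ (hq _))
  have h2 : (K0.map φ hφ).comp S = AddMonoidHom.id _ := K0.hom_ext fun c => by
    rw [AddMonoidHom.comp_apply, hS, K0.map_cls]
    exact K0.cls_eq_of_equivalent (hq _)
  exact ⟨Function.LeftInverse.injective (g := S) (DFunLike.congr_fun h1),
    Function.RightInverse.surjective (g := S) (DFunLike.congr_fun h2)⟩

end Invariants

section Newton

/-- Newton's iteration: an element `x` of a Banach algebra for which `x² - x` is small is close to
an idempotent. -/
theorem exists_idempotent_near {R : Type*} [NormedRing R] [CompleteSpace R] (h1 : ‖(1 : R)‖ ≤ 1)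
    (S : Subring R) (hS : IsClosed (S : Set R)) {x : R} (hx : x ∈ S) {η : ℝ}
    (hη : η ≤ 1 / 8) (hd : ‖x * x - x‖ ≤ η) :
    ∃ q ∈ S, q * q = q ∧ ‖q - x‖ ≤ 4 * (1 + 2 * ‖x‖) * η := by
  set z : ℕ → R := fun k => (fun x => x + (1 - 2 * x) * (x * x - x))^[k] x with hz
  have hz0 : z 0 = x := rfl
  have hzs : ∀ k, z (k + 1) = z k + (1 - 2 * z k) * (z k * z k - z k) := fun k => by
    simp only [hz, Function.iterate_succ_apply']
  set M := 1 + 2 * ‖x‖ with hM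
  have hM0 : 0 ≤ M := by positivity
  have hη0 : 0 ≤ η := (norm_nonneg _).trans hd
  have hmem : ∀ k, z k ∈ S := by
    intro k
    induction k with
    | zero => exact hx
    | succ k ih =>
      rw [hzs]
      have h2 : (2 : R) ∈ S := by
        rw [← one_add_one_eq_two]
        exact S.add_mem S.one_mem S.one_mem
      exact S.add_mem ih (S.mul_mem (S.sub_mem S.one_mem (S.mul_mem h2 ih))
        (S.sub_mem (S.mul_mem ih ih) ih))
  have hdk : ∀ k, ‖z k * z k - z k‖ ≤ η * (1 / 2) ^ k := by
    intro k
    induction k with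
    | zero =>
      rw [hz0, pow_zero, mul_one]
      exact hd
    | succ k ih =>
      have h2 : z (k + 1) * z (k + 1) - z (k + 1) =
          4 • ((z k * z k - z k) * ((z k * z k - z k) * (z k * z k - z k))) -
            3 • ((z k * z k - z k) * (z k * z k - z k)) := by
        rw [hzs]
        noncomm_ring
      set d := z k * z k - z k with hd
      have hk1 : ((1 : ℝ) / 2) ^ k ≤ 1 := pow_le_one₀ (by norm_num) (by norm_num)
      have hk0 : (0 : ℝ) ≤ (1 / 2) ^ k := by positivity
      have h5 : ‖d‖ ≤ 1 / 8 := ih.trans (by nlinarith)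
      have h7 := norm_nonneg d
      have h6 : ‖d * d‖ ≤ ‖d‖ * ‖d‖ := norm_mul_le _ _
      have h8 : ‖d * (d * d)‖ ≤ ‖d‖ * (‖d‖ * ‖d‖) :=
        (norm_mul_le _ _).trans (mul_le_mul_of_nonneg_left h6 h7)
      rw [h2]
      refine (norm_sub_le _ _).trans ((add_le_add norm_nsmul_le norm_nsmul_le).trans ?_)
      have h9 : ‖d‖ * ‖d‖ ≤ ‖d‖ * (1 / 8) := mul_le_mul_of_nonneg_left h5 h7
      have h10 : ‖d‖ * (‖d‖ * ‖d‖) ≤ ‖d‖ * (1 / 64) :=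
        mul_le_mul_of_nonneg_left (by nlinarith) h7
      rw [pow_succ]
      push_cast
      linarith
  have hyk : ∀ k, ‖1 - 2 * z k‖ ≤ M * (2 - (1 / 2) ^ k) := by
    intro k
    induction k with
    | zero =>
      rw [hz0, two_mul]
      have h2 := norm_sub_le (1 : R) (x + x)
      have h3 := norm_add_le x x
      rw [pow_zero, hM]
      linarith
    | succ k ih =>
      have h2 : 1 - 2 * z (k + 1) = (1 - 2 * z k) - 2 • ((1 - 2 * z k) * (z k * z k - z k)) := by
        rw [hzs]
        noncomm_ring
      have hk1 : ((1 : ℝ) / 2) ^ k ≤ 1 := pow_le_one₀ (by norm_num) (by norm_num)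
      have hk0 : (0 : ℝ) ≤ (1 / 2) ^ k := by positivity
      have h3 : ‖z k * z k - z k‖ ≤ (1 / 2) ^ k / 8 := by
        have := hdk k
        nlinarith
      have h4 : ‖(1 - 2 * z k) * (z k * z k - z k)‖ ≤ M * (2 - (1 / 2) ^ k) * ((1 / 2) ^ k / 8) :=
        (norm_mul_le _ _).trans (mul_le_mul ih h3 (norm_nonneg _)
          (mul_nonneg hM0 (by linarith)))
      rw [h2, pow_succ]
      refine (norm_sub_le _ _).trans ((add_le_add ih norm_nsmul_le).trans ?_)
      push_cast
      have h5 : M * ((1 / 2) ^ k * (1 / 2) ^ k) ≥ 0 := by positivity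
      nlinarith [mul_nonneg hM0 hk0]
  have hdist : ∀ k, dist (z k) (z (k + 1)) ≤ (2 * M * η) * (1 / 2) ^ k := fun k => by
    rw [dist_comm, dist_eq_norm, hzs, add_sub_cancel_left]
    refine (norm_mul_le _ _).trans ?_
    have hk0 : (0 : ℝ) ≤ (1 / 2) ^ k := by positivity
    have h1 : ‖1 - 2 * z k‖ ≤ M * 2 := (hyk k).trans (by nlinarith)
    refine (mul_le_mul h1 (hdk k) (norm_nonneg _) (by positivity)).trans (le_of_eq ?_)
    ring
  obtain ⟨q, hq⟩ := cauchySeq_tendsto_of_complete (cauchySeq_of_le_geometric (1 / 2) (2 * M * η)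
    (by norm_num) hdist)
  refine ⟨q, hS.mem_of_tendsto hq (Filter.Eventually.of_forall hmem), ?_, ?_⟩
  · have h1 : Filter.Tendsto (fun k => z k * z k - z k) Filter.atTop (nhds (q * q - q)) :=
      (hq.mul hq).sub hq
    have h2 : Filter.Tendsto (fun k => z k * z k - z k) Filter.atTop (nhds 0) := by
      refine squeeze_zero_norm hdk ?_
      have := (tendsto_pow_atTop_nhds_zero_of_lt_one (r := (1 : ℝ) / 2) (by norm_num)
        (by norm_num)).const_mul η
      simpa using this
    exact sub_eq_zero.1 (tendsto_nhds_unique h1 h2)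
  · have h1 := dist_le_of_le_geometric_of_tendsto₀ (1 / 2) (2 * M * η) (by norm_num) hdist hq
    rw [dist_comm, dist_eq_norm, hz0] at h1
    refine h1.trans (le_of_eq ?_)
    ring

end Newton

/-! ## Homotopies and asymptotic retractions in equivariant `K`-theory -/

section MatrixNorm

set_option linter.unusedSectionVars false

open Filter Topology

attribute [local instance] Matrix.linftyOpNormedAddCommGroup Matrix.linftyOpNormedRing

variable {ι κ : Type} [Fintype ι] [DecidableEq ι] [Fintype κ] [DecidableEq κ]

theorem matrix_norm_le_of_forall {E : Type*} [NormedAddCommGroup E] {x : Matrix ι κ E} {m : ℝ}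
    (hm : 0 ≤ m) (h : ∀ i j, ‖x i j‖ ≤ m) : ‖x‖ ≤ Fintype.card κ * m := by
  have h1 : ‖x‖₊ ≤ Fintype.card κ * ⟨m, hm⟩ := by
    rw [Matrix.linfty_opNNNorm_def]
    refine Finset.sup_le fun i _ => ?_
    refine (Finset.sum_le_card_nsmul _ _ ⟨m, hm⟩ fun j _ => h i j).trans (le_of_eq ?_)
    exact nsmul_eq_mul _ _
  exact h1

theorem matrix_norm_apply_le {E : Type*} [NormedAddCommGroup E] (x : Matrix ι κ E) (i : ι) (j : κ) :
    ‖x i j‖ ≤ ‖x‖ := by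
  have h1 : ‖x i j‖₊ ≤ ‖x‖₊ := by
    rw [Matrix.linfty_opNNNorm_def]
    exact (Finset.single_le_sum (f := fun j => ‖x i j‖₊) (fun _ _ => zero_le)
      (Finset.mem_univ j)).trans (Finset.le_sup (f := fun i => ∑ j, ‖x i j‖₊) (Finset.mem_univ i))
  exact h1

theorem matrix_norm_map_le {E F : Type*} [NormedAddCommGroup E] [NormedAddCommGroup F]
    (x : Matrix ι κ E) (f : E → F) (hf : ∀ b, ‖f b‖ ≤ ‖b‖) : ‖x.map f‖ ≤ ‖x‖ := by
  have h1 : ‖x.map f‖₊ ≤ ‖x‖₊ := by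
    rw [Matrix.linfty_opNNNorm_def, Matrix.linfty_opNNNorm_def]
    exact Finset.sup_mono_fun fun i _ => Finset.sum_le_sum fun j _ => hf (x i j)
  exact h1

theorem tendsto_matrix_norm {E X : Type*} [NormedAddCommGroup E] {l : Filter X}
    {x : X → Matrix ι κ E} {y : Matrix ι κ E}
    (h : ∀ i j, Tendsto (fun t => x t i j) l (𝓝 (y i j))) :
    Tendsto (fun t => ‖x t - y‖) l (𝓝 0) := by
  have h1 : Tendsto x l (𝓝 y) := tendsto_pi_nhds.2 fun i => tendsto_pi_nhds.2 fun j => h i j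
  exact tendsto_iff_norm_sub_tendsto_zero.1 h1

theorem matrix_norm_one_le {R : Type*} [NormedRing R] [NormOneClass R] :
    ‖(1 : Matrix ι ι R)‖ ≤ 1 := by
  have h1 : ‖(1 : Matrix ι ι R)‖₊ ≤ 1 := by
    rw [Matrix.linfty_opNNNorm_def]
    refine Finset.sup_le fun i _ => ?_
    rw [Finset.sum_eq_single i (fun j _ hj => by simp [Matrix.one_apply_ne' hj]) (by simp)]
    simp
  exact h1

instance matrix_complete {R : Type*} [NormedRing R] [CompleteSpace R] :
    @CompleteSpace (Matrix ι ι R) PseudoMetricSpace.toUniformSpace :=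
  inferInstanceAs (CompleteSpace (ι → ι → R))

theorem matrix_isUnit {R : Type*} [NormedRing R] [CompleteSpace R] {t : Matrix ι ι R}
    (h : ‖t‖ < 1) : IsUnit (1 + t) := by
  have : HasSummableGeomSeries (Matrix ι ι R) := inferInstance
  have h2 := isUnit_one_sub_of_norm_lt_one (x := -t) (by rwa [norm_neg])
  rwa [sub_neg_eq_add] at h2

end MatrixNorm

section Homotopy

open Filter Topology

set_option linter.unusedSectionVars false

attribute [local instance] Matrix.linftyOpNormedAddCommGroup Matrix.linftyOpNormedRing

variable {G : Type*} [Group G] [TopologicalSpace G]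
variable {A : Type*} [NonUnitalCStarAlgebra A] {A' : Type*} [NonUnitalCStarAlgebra A']
variable {α : G →* (A →⋆ₙₐ[ℂ] A)} {α' : G →* (A' →⋆ₙₐ[ℂ] A')}
variable {ι κ : Type} [Fintype ι] [DecidableEq ι] [Fintype κ] [DecidableEq κ]

theorem norm_unitMap_le (φ : A →⋆ₙₐ[ℂ] A') (x : Unitization ℂ A) : ‖unitMap φ x‖ ≤ ‖x‖ :=
  NonUnitalStarAlgHom.norm_apply_le (Unitization.starMap φ) x

theorem continuous_unitMap (φ : A →⋆ₙₐ[ℂ] A') : Continuous (unitMap φ) :=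
  AddMonoidHomClass.continuous_of_bound (unitMap φ) 1 fun x => by
    simpa using norm_unitMap_le φ x

theorem unitMap_act {φ : A →⋆ₙₐ[ℂ] A'} (hφ : ∀ g a, φ (α g a) = α' g (φ a)) (g : G)
    (b : Unitization ℂ A) : unitMap φ (unitAct α g b) = unitAct α' g (unitMap φ b) :=
  Unitization.ext (by simp [unitAct_apply, unitMap_fst]) (by simp [unitAct_apply, unitMap_snd, hφ])

theorem isClosed_invariantSubring (r : G →* Matrix ι ι ℂ) :
    IsClosed (invariantSubring (unitAct α) r : Set (Matrix ι ι (Unitization ℂ A))) := by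
  have h : (invariantSubring (unitAct α) r : Set (Matrix ι ι (Unitization ℂ A))) =
      ⋂ g, {x | scal (Unitization ℂ A) (r g) * x.map (unitAct α g) =
        x * scal (Unitization ℂ A) (r g)} := by
    ext x
    simp [invariantSubring, IsInvariant]
  rw [h]
  refine isClosed_iInter fun g => isClosed_eq ?_ ?_
  · exact continuous_const.matrix_mul (continuous_id.matrix_map (continuous_unitMap (α g)))
  · exact continuous_id.matrix_mul continuous_const

theorem Cycle.equivalent_of_norm_lt {c d : Cycle (unitAct α)}
    {x : Matrix c.ι d.ι (Unitization ℂ A)} {y : Matrix d.ι c.ι (Unitization ℂ A)}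
    (hx : IsInvariant (unitAct α) c.ρ d.ρ x) (hy : IsInvariant (unitAct α) d.ρ c.ρ y)
    (hu : ‖c.e * x * d.e * y * c.e - c.e‖ < 1) (hv : ‖d.e * y * c.e * x * d.e - d.e‖ < 1) :
    c.Equivalent d :=
  Cycle.equivalent_of_isUnit hx hy (matrix_isUnit hu) (matrix_isUnit hv)

/-- Close invariant idempotents are equivalent. -/
theorem Cycle.equivalent_of_close {r : G →* Matrix ι ι ℂ} (hr : Continuous r)
    {e f : Matrix ι ι (Unitization ℂ A)} (he : e * e = e) (hf : f * f = f)
    (hei : IsInvariant (unitAct α) r r e) (hfi : IsInvariant (unitAct α) r r f)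
    {K : ℝ} (heK : ‖e‖ ≤ K) (hfK : ‖f‖ ≤ K) (h : K ^ 2 * ‖e - f‖ < 1) :
    Cycle.Equivalent (⟨ι, r, hr, e, he, hei⟩ : Cycle (unitAct α)) ⟨ι, r, hr, f, hf, hfi⟩ := by
  have key : ∀ {e f : Matrix ι ι (Unitization ℂ A)}, e * e = e → f * f = f → ‖e‖ ≤ K →
      K ^ 2 * ‖e - f‖ < 1 → ‖e * 1 * f * 1 * e - e‖ < 1 := by
    intro e f he hf heK h
    have h1 : e * 1 * f * 1 * e - e = -(e * (e - f) * e) := by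
      rw [Matrix.mul_one, Matrix.mul_one, mul_sub, sub_mul, he, he]
      abel
    have hK : 0 ≤ K := (norm_nonneg _).trans heK
    rw [h1, norm_neg]
    refine ((norm_mul_le _ _).trans (mul_le_mul ((norm_mul_le _ _).trans
      (mul_le_mul_of_nonneg_right heK (norm_nonneg _))) heK (norm_nonneg _)
      (by positivity))).trans_lt ?_
    linarith
  refine Cycle.equivalent_of_norm_lt (x := (1 : Matrix ι ι (Unitization ℂ A)))
    (y := (1 : Matrix ι ι (Unitization ℂ A))) IsInvariant.one IsInvariant.one
    (key he hf heK h) (key hf he hfK (by rwa [norm_sub_rev]))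

/-- A continuous family of equivariant endomorphisms, parametrized by `(0, 1]`, that starts at the
identity at the parameter `1`. -/
structure Contraction (α : G →* (A →⋆ₙₐ[ℂ] A)) where
  hom : Set.Ioc (0 : ℝ) 1 → A →⋆ₙₐ[ℂ] A
  act : ∀ s g a, hom s (α g a) = α g (hom s a)
  one : ∀ a, hom ⟨1, by simp⟩ a = a
  cont : ∀ a, Continuous fun s => hom s a

namespace Contraction

variable (ρ : Contraction α)

theorem continuous_unitMap (b : Unitization ℂ A) : Continuous fun s => unitMap (ρ.hom s) b := by
  have h : (fun s => unitMap (ρ.hom s) b) =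
      fun s => Unitization.inl b.fst + Unitization.inr (ρ.hom s b.snd) := by
    funext s
    exact Unitization.ext (by simp [unitMap_fst]) (by simp [unitMap_snd])
  rw [h]
  exact continuous_const.add (Unitization.isometry_inr.continuous.comp (ρ.cont b.snd))

/-- The image of a cycle. -/
def cycle (s : Set.Ioc (0 : ℝ) 1) (c : Cycle (unitAct α)) : Cycle (unitAct α) :=
  c.map (unitMap (ρ.hom s)) (unitMap_act (ρ.act s))

theorem equivalent (s : Set.Ioc (0 : ℝ) 1) (c : Cycle (unitAct α)) :
    (ρ.cycle s c).Equivalent c := by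
  have hone : ρ.cycle ⟨1, by simp⟩ c = c := by
    have h1 : c.e.map (unitMap (ρ.hom ⟨1, by simp⟩)) = c.e := by
      ext i j
      · simp [unitMap_fst]
      · simp only [Matrix.map_apply, unitMap_snd]
        exact ρ.one _
    simp only [cycle, Cycle.map]
    congr 1
  have hnorm : ∀ s, ‖c.e.map (unitMap (ρ.hom s))‖ ≤ ‖c.e‖ := fun s =>
    matrix_norm_map_le _ _ (norm_unitMap_le (ρ.hom s))
  have : PreconnectedSpace (Set.Ioc (0 : ℝ) 1) := Subtype.preconnectedSpace isPreconnected_Ioc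
  have key := isPreconnected_univ.induction₂ (α := Set.Ioc (0 : ℝ) 1)
    (fun s t => (ρ.cycle s c).Equivalent (ρ.cycle t c)) (fun s _ => ?_)
    (fun _ _ _ _ _ _ h h' => h.trans h') (fun _ _ _ _ h => h.symm) (Set.mem_univ s)
    (Set.mem_univ ⟨1, by simp⟩)
  · rwa [hone] at key
  · rw [nhdsWithin_univ]
    have h1 : Tendsto (fun t => ‖c.e.map (unitMap (ρ.hom t)) - c.e.map (unitMap (ρ.hom s))‖)
        (𝓝 s) (𝓝 0) :=
      tendsto_matrix_norm fun i j => (ρ.continuous_unitMap (c.e i j)).tendsto s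
    have h2 : Tendsto (fun t => ‖c.e‖ ^ 2 *
        ‖c.e.map (unitMap (ρ.hom t)) - c.e.map (unitMap (ρ.hom s))‖) (𝓝 s) (𝓝 0) := by
      simpa using h1.const_mul (‖c.e‖ ^ 2)
    filter_upwards [h2.eventually_lt_const one_pos] with t ht
    exact Cycle.equivalent_of_close c.continuous_ρ (ρ.cycle s c).idem (ρ.cycle t c).idem
      (ρ.cycle s c).invariant (ρ.cycle t c).invariant (hnorm s) (hnorm t)
      (by rw [norm_sub_rev] at ht; exact ht)

end Contraction

end Homotopy

section Retraction

open Filter Topology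

set_option linter.unusedSectionVars false

attribute [local instance] Matrix.linftyOpNormedAddCommGroup Matrix.linftyOpNormedRing

variable {G : Type*} [Group G] [TopologicalSpace G]
variable {A : Type*} [NonUnitalCStarAlgebra A] {A' : Type*} [NonUnitalCStarAlgebra A']
variable {α : G →* (A →⋆ₙₐ[ℂ] A)} {α' : G →* (A' →⋆ₙₐ[ℂ] A')}
variable {ι κ : Type} [Fintype ι] [DecidableEq ι] [Fintype κ] [DecidableEq κ]

/-- The filter of parameters in `(0, 1]` that tend to `0`. -/
def smallParam : Filter (Set.Ioc (0 : ℝ) 1) := comap (fun s => (s : ℝ)) (𝓝 0)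

instance : smallParam.NeBot :=
  mem_closure_iff_comap_neBot.1 (by rw [closure_Ioc zero_ne_one]; simp)

theorem eventually_smallParam {p : Set.Ioc (0 : ℝ) 1 → Prop} :
    (∀ᶠ s in smallParam, p s) ↔ ∃ δ > 0, ∀ s : Set.Ioc (0 : ℝ) 1, (s : ℝ) < δ → p s := by
  constructor
  · intro h
    obtain ⟨δ, hδ, h2⟩ := Metric.eventually_nhds_iff.1 (eventually_comap.1 h)
    exact ⟨δ, hδ, fun s hs => h2 (y := s) (by simpa [abs_of_pos s.2.1] using hs) s rfl⟩
  · rintro ⟨δ, hδ, h⟩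
    refine eventually_comap.2 ?_
    filter_upwards [gt_mem_nhds hδ] with l hl s hs
    exact h s (by rw [hs]; exact hl)

/-- The extension of a linear map to the unitizations. -/
def unitLift (L : A' →ₗ[ℂ] A) : Unitization ℂ A' →ₗ[ℂ] Unitization ℂ A where
  toFun b := Unitization.inl b.fst + Unitization.inr (L b.snd)
  map_add' a b := Unitization.ext (by simp) (by simp)
  map_smul' c a := Unitization.ext (by simp) (by simp)

theorem unitLift_fst (L : A' →ₗ[ℂ] A) (b : Unitization ℂ A') : (unitLift L b).fst = b.fst := by
  simp [unitLift]

theorem unitLift_snd (L : A' →ₗ[ℂ] A) (b : Unitization ℂ A') : (unitLift L b).snd = L b.snd := by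
  simp [unitLift]

theorem IsInvariant.map_linear {B B' : Type*} [Ring B] [Algebra ℂ B] [Ring B'] [Algebra ℂ B']
    {β : G →* (B →ₐ[ℂ] B)} {β' : G →* (B' →ₐ[ℂ] B')}
    {r : G →* Matrix ι ι ℂ} {s : G →* Matrix κ κ ℂ} {x : Matrix ι κ B}
    (hx : IsInvariant β r s x) (L : B →ₗ[ℂ] B') (hL : ∀ g b, L (β g b) = β' g (L b)) :
    IsInvariant β' r s (x.map L) := fun g => by
  ext i j
  have h := congrArg L (congrFun (congrFun (hx g) i) j)
  simp only [Matrix.mul_apply, scal, Matrix.map_apply, map_sum, ← Algebra.smul_def,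
    ← Algebra.commutes, map_smul, hL] at h ⊢
  exact h

theorem norm_unitMap_of_fst_eq_zero (φ : A →⋆ₙₐ[ℂ] A') {b : Unitization ℂ A} (hb : b.fst = 0) :
    ‖unitMap φ b‖ = ‖φ b.snd‖ := by
  have h2 : unitMap φ b = Unitization.inr (φ b.snd) :=
    Unitization.ext (by simp [unitMap_fst, hb]) (by simp [unitMap_snd])
  rw [h2, Unitization.norm_inr]

theorem defect_eq_zero {R : Type*} [Ring R] {e : Matrix ι ι R} {f : Matrix κ κ R}
    {x : Matrix ι κ R} {y : Matrix κ ι R} (he : e * e = e) (hxy : x * y = e) (hyx : y * x = f) :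
    e * x * f * y * e - e = 0 := by
  rw [← hyx, Matrix.mul_assoc e x, ← Matrix.mul_assoc x y x, hxy, ← Matrix.mul_assoc,
    Matrix.mul_assoc _ x y, hxy, he, he, he, sub_self]

/-- An equivariant homomorphism `A → A'` that is, asymptotically, a homotopy equivalence: it is
compatible with contractions of `A` and `A'`, elements of `A` with small image become small under
the contraction, and there are equivariant linear maps `A' → A` that are approximate sections. -/
structure Retraction (ρ : Contraction α) (σ : Contraction α') where
  hom : A →⋆ₙₐ[ℂ] A'
  act : ∀ g a, hom (α g a) = α' g (hom a)
  comm : ∀ s a, hom (ρ.hom s a) = σ.hom s (hom a)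
  small : ∀ a m, ‖hom a‖ < m → ∀ᶠ s in smallParam, ‖ρ.hom s a‖ ≤ m
  lift : ℕ → A' →ₗ[ℂ] A
  lift_act : ∀ n g a, lift n (α' g a) = α g (lift n a)
  lift_tendsto : ∀ a, Tendsto (fun n => hom (lift n a)) atTop (𝓝 a)

namespace Retraction

variable {ρ : Contraction α} {σ : Contraction α'} (π : Retraction ρ σ)

theorem small_matrix (z : Matrix ι κ (Unitization ℂ A)) {m : ℝ} (hm : 0 ≤ m)
    (h0 : z.map (Unitization.fstHom ℂ A) = 0) (h : ‖z.map (unitMap π.hom)‖ < m) :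
    ∀ᶠ s in smallParam, ‖z.map (unitMap (ρ.hom s))‖ ≤ Fintype.card κ * m := by
  have h1 : ∀ᶠ s in smallParam, ∀ i j, ‖ρ.hom s (z i j).snd‖ ≤ m := by
    refine eventually_all.2 fun i => eventually_all.2 fun j => π.small _ _ ?_
    rw [← norm_unitMap_of_fst_eq_zero _ (congrFun (congrFun h0 i) j)]
    exact (matrix_norm_apply_le (z.map (unitMap π.hom)) i j).trans_lt h
  filter_upwards [h1] with s hs
  refine matrix_norm_le_of_forall hm fun i j => ?_
  rw [Matrix.map_apply, norm_unitMap_of_fst_eq_zero _ (congrFun (congrFun h0 i) j)]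
  exact hs i j

theorem unitLift_act (n : ℕ) (g : G) (b : Unitization ℂ A') :
    unitLift (π.lift n) (unitAct α' g b) = unitAct α g (unitLift (π.lift n) b) :=
  Unitization.ext (by simp [unitAct_apply, unitMap_fst, unitLift_fst])
    (by simp [unitAct_apply, unitMap_snd, unitLift_snd, π.lift_act])

theorem tendsto_map_lift (x : Matrix ι κ (Unitization ℂ A')) :
    Tendsto (fun n => (x.map (unitLift (π.lift n))).map (unitMap π.hom)) atTop (𝓝 x) := by
  refine tendsto_pi_nhds.2 fun i => tendsto_pi_nhds.2 fun j => ?_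
  have h : ∀ n, unitMap π.hom (unitLift (π.lift n) (x i j)) =
      Unitization.inl (x i j).fst + Unitization.inr (π.hom (π.lift n (x i j).snd)) := fun n =>
    Unitization.ext (by simp [unitMap_fst, unitLift_fst]) (by simp [unitMap_snd, unitLift_snd])
  have h2 : x i j = Unitization.inl (x i j).fst + Unitization.inr (x i j).snd :=
    (Unitization.inl_fst_add_inr_snd_eq _).symm
  simp only [Matrix.map_apply, h]
  nth_rewrite 3 [h2]
  exact tendsto_const_nhds.add
    ((Unitization.isometry_inr.continuous.tendsto _).comp (π.lift_tendsto _))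

theorem map_fst_lift (n : ℕ) (x : Matrix ι κ (Unitization ℂ A')) :
    (x.map (unitLift (π.lift n))).map (Unitization.fstHom ℂ A) =
      x.map (Unitization.fstHom ℂ A') := by
  ext i j
  exact unitLift_fst _ _

theorem map_fst_map (x : Matrix ι κ (Unitization ℂ A)) :
    (x.map (unitMap π.hom)).map (Unitization.fstHom ℂ A') = x.map (Unitization.fstHom ℂ A) := by
  ext i j
  exact unitMap_fst _ _

theorem map_sub_hom {B B' : Type*} [Ring B] [Algebra ℂ B] [Ring B'] [Algebra ℂ B'] (φ : B →ₐ[ℂ] B')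
    (x y : Matrix ι κ B) : (x - y).map φ = x.map φ - y.map φ := by
  ext
  simp

/-- The defect of `x`, `y` as an equivalence, evaluated at a contraction. -/
theorem eventually_defect {e : Matrix ι ι (Unitization ℂ A)} {f : Matrix κ κ (Unitization ℂ A)}
    {x : Matrix ι κ (Unitization ℂ A')} {y : Matrix κ ι (Unitization ℂ A')}
    (he : e * e = e) (hxy : x * y = e.map (unitMap π.hom)) (hyx : y * x = f.map (unitMap π.hom)) :
    ∀ᶠ n in atTop, ∀ᶠ s in smallParam,
      ‖e.map (unitMap (ρ.hom s)) * (x.map (unitLift (π.lift n))).map (unitMap (ρ.hom s)) *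
        f.map (unitMap (ρ.hom s)) * (y.map (unitLift (π.lift n))).map (unitMap (ρ.hom s)) *
        e.map (unitMap (ρ.hom s)) - e.map (unitMap (ρ.hom s))‖ < 1 := by
  set z : ℕ → Matrix ι ι (Unitization ℂ A) := fun n =>
    e * x.map (unitLift (π.lift n)) * f * y.map (unitLift (π.lift n)) * e - e with hz
  have hE : e.map (unitMap π.hom) * e.map (unitMap π.hom) = e.map (unitMap π.hom) := by
    rw [← Matrix.map_mul, he]
  have h0 : ∀ n, (z n).map (Unitization.fstHom ℂ A) = 0 := fun n => by
    have h1 := defect_eq_zero hE hxy hyx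
    have h2 := congrArg (fun m => m.map (Unitization.fstHom ℂ A')) h1
    simp only [map_sub_hom, Matrix.map_mul, map_fst_map] at h2
    simp only [hz, map_sub_hom, Matrix.map_mul, map_fst_lift]
    rw [h2]
    ext i j
    simp
  have hlim : Tendsto (fun n => (z n).map (unitMap π.hom)) atTop (𝓝 0) := by
    set E := e.map (unitMap π.hom)
    set F := f.map (unitMap π.hom)
    have hc : Continuous fun p : Matrix ι κ (Unitization ℂ A') × Matrix κ ι (Unitization ℂ A') =>
        E * p.1 * F * p.2 * E - E :=
      ((((continuous_const.matrix_mul continuous_fst).matrix_mul continuous_const).matrix_mul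
        continuous_snd).matrix_mul continuous_const).sub continuous_const
    have h1 := (hc.tendsto (x, y)).comp
      ((π.tendsto_map_lift x).prodMk_nhds (π.tendsto_map_lift y))
    have h2 : E * x * F * y * E - E = 0 := defect_eq_zero hE hxy hyx
    simp only [h2] at h1
    refine h1.congr fun n => ?_
    simp only [hz, map_sub_hom, Matrix.map_mul, Function.comp]
    rfl
  have hlim2 : Tendsto (fun n => ‖(z n).map (unitMap π.hom)‖) atTop (𝓝 0) := by
    have := tendsto_iff_norm_sub_tendsto_zero.1 hlim
    simpa using this
  filter_upwards [hlim2.eventually_lt_const (u := 1 / ((Fintype.card ι : ℝ) + 1)) (by positivity)]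
    with n hn
  filter_upwards [π.small_matrix (z n) (by positivity) (h0 n) hn] with s hs
  simp only [hz, map_sub_hom, Matrix.map_mul] at hs
  refine hs.trans_lt ?_
  rw [mul_one_div, div_lt_one (by positivity)]
  linarith

theorem equivalent_of_map (q q' : Cycle (unitAct α))
    (h : (q.map (unitMap π.hom) (unitMap_act π.act)).Equivalent
      (q'.map (unitMap π.hom) (unitMap_act π.act))) : q.Equivalent q' := by
  obtain ⟨x, y, hx, hy, hxy, hyx⟩ := h
  obtain ⟨n, h1, h2⟩ := ((π.eventually_defect q.idem hxy hyx).and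
    (π.eventually_defect q'.idem hyx hxy)).exists
  obtain ⟨s, h3, h4⟩ := (h1.and h2).exists
  have hX : IsInvariant (unitAct α) q.ρ q'.ρ (x.map (unitLift (π.lift n))) :=
    IsInvariant.map_linear hx _ (π.unitLift_act n)
  have hY : IsInvariant (unitAct α) q'.ρ q.ρ (y.map (unitLift (π.lift n))) :=
    IsInvariant.map_linear hy _ (π.unitLift_act n)
  have h5 : (ρ.cycle s q).Equivalent (ρ.cycle s q') :=
    Cycle.equivalent_of_norm_lt (hX.map (unitMap_act (ρ.act s))) (hY.map (unitMap_act (ρ.act s)))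
      h3 h4
  exact ((ρ.equivalent s q).symm.trans h5).trans (ρ.equivalent s q')

theorem eventually_norm_lift_le (x : Matrix ι κ (Unitization ℂ A')) :
    ∃ K : ℝ, 0 ≤ K ∧ ∀ᶠ n in atTop, ∀ᶠ s in smallParam,
      ‖(x.map (unitLift (π.lift n))).map (unitMap (ρ.hom s))‖ ≤ K := by
  obtain ⟨K, hK⟩ : ∃ K : ℝ, ∀ i j, ‖(x i j).fst‖ + ‖(x i j).snd‖ + 2 ≤ K := by
    refine ⟨∑ i, ∑ j, (‖(x i j).fst‖ + ‖(x i j).snd‖ + 2), fun i j => ?_⟩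
    refine (Finset.single_le_sum (f := fun j => ‖(x i j).fst‖ + ‖(x i j).snd‖ + 2)
      (fun _ _ => by positivity) (Finset.mem_univ j)).trans ?_
    exact Finset.single_le_sum (f := fun i => ∑ j, (‖(x i j).fst‖ + ‖(x i j).snd‖ + 2))
      (fun _ _ => by positivity) (Finset.mem_univ i)
  refine ⟨Fintype.card κ * |K|, by positivity, ?_⟩
  have h1 : ∀ᶠ n in atTop, ∀ i j, ‖π.hom (π.lift n (x i j).snd)‖ < ‖(x i j).snd‖ + 2 :=
    eventually_all.2 fun i => eventually_all.2 fun j =>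
      (π.lift_tendsto _).norm.eventually_lt_const (by linarith)
  filter_upwards [h1] with n hn
  have h2 : ∀ᶠ s in smallParam, ∀ i j, ‖ρ.hom s (π.lift n (x i j).snd)‖ ≤ ‖(x i j).snd‖ + 2 :=
    eventually_all.2 fun i => eventually_all.2 fun j => π.small _ _ (hn i j)
  filter_upwards [h2] with s hs
  refine matrix_norm_le_of_forall (abs_nonneg K) fun i j => ?_
  have h3 : unitMap (ρ.hom s) (unitLift (π.lift n) (x i j)) =
      algebraMap ℂ _ (x i j).fst + Unitization.inr (ρ.hom s (π.lift n (x i j).snd)) :=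
    Unitization.ext (by simp [unitMap_fst, unitLift_fst, Unitization.algebraMap_eq_inl])
      (by simp [unitMap_snd, unitLift_snd, Unitization.algebraMap_eq_inl])
  rw [Matrix.map_apply, Matrix.map_apply, h3]
  refine (norm_add_le _ _).trans ?_
  rw [norm_algebraMap', Unitization.norm_inr]
  linarith [hs i j, hK i j, le_abs_self K]

theorem exists_lift (c : Cycle (unitAct α')) :
    ∃ q : Cycle (unitAct α), (q.map (unitMap π.hom) (unitMap_act π.act)).Equivalent c := by
  obtain ⟨K, hK0, hK⟩ := π.eventually_norm_lift_le c.e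
  set a : ℕ → Matrix c.ι c.ι (Unitization ℂ A) := fun n => c.e.map (unitLift (π.lift n)) with ha
  set K₁ := ‖c.e‖ + 1 with hK₁
  have hK₁1 : 1 ≤ K₁ := by linarith [norm_nonneg c.e]
  set ε := 1 / (4 * K₁ ^ 2) with hε
  have hε0 : 0 < ε := by positivity
  have hεK : K₁ ^ 2 * ε = 1 / 4 := by rw [hε]; field_simp
  have hK₁2 : 1 ≤ K₁ ^ 2 := one_le_pow₀ hK₁1
  have hε1 : ε ≤ 1 / 4 := by nlinarith
  set N := (Fintype.card c.ι : ℝ) with hN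
  have hN0 : 0 ≤ N := by positivity
  set η := min (1 / 8) (ε / (4 * (1 + 2 * K))) with hη
  have hη0 : 0 < η := lt_min (by norm_num) (by positivity)
  have hηK : 4 * (1 + 2 * K) * η ≤ ε := by
    have h1 := mul_le_mul_of_nonneg_left (min_le_right (1 / 8) (ε / (4 * (1 + 2 * K))))
      (by positivity : 0 ≤ 4 * (1 + 2 * K))
    refine h1.trans (le_of_eq ?_)
    field_simp
  have hlim := π.tendsto_map_lift c.e
  have hd0 : ∀ n, (a n * a n - a n).map (Unitization.fstHom ℂ A) = 0 := fun n => by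
    rw [map_sub_hom, Matrix.map_mul, map_fst_lift, ← Matrix.map_mul, c.idem, sub_self]
  have hd : Tendsto (fun n => ‖(a n * a n - a n).map (unitMap π.hom)‖) atTop (𝓝 0) := by
    have h1 : Tendsto (fun n => (a n * a n - a n).map (unitMap π.hom)) atTop (𝓝 0) := by
      have h2 : c.e * c.e - c.e = 0 := by rw [c.idem, sub_self]
      rw [← h2]
      simp only [map_sub_hom, Matrix.map_mul]
      have hc : Continuous fun m : Matrix c.ι c.ι (Unitization ℂ A') => m * m - m :=
        (continuous_id.matrix_mul continuous_id).sub continuous_id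
      exact (hc.tendsto c.e).comp hlim
    have := tendsto_iff_norm_sub_tendsto_zero.1 h1
    simpa using this
  obtain ⟨n, hn1, hn2, hn3⟩ := (hK.and ((hd.eventually_lt_const (u := η / (N + 1))
    (by positivity)).and ((tendsto_iff_norm_sub_tendsto_zero.1 hlim).eventually_lt_const
      hε0))).exists
  obtain ⟨s, hs1, hs2⟩ := (hn1.and (π.small_matrix (a n * a n - a n) (by positivity) (hd0 n)
    hn2)).exists
  have hinv : IsInvariant (unitAct α) c.ρ c.ρ ((a n).map (unitMap (ρ.hom s))) :=
    (IsInvariant.map_linear c.invariant _ (π.unitLift_act n)).map (unitMap_act (ρ.act s))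
  have hdη : ‖(a n).map (unitMap (ρ.hom s)) * (a n).map (unitMap (ρ.hom s)) -
      (a n).map (unitMap (ρ.hom s))‖ ≤ η := by
    rw [← Matrix.map_mul, ← map_sub_hom]
    refine hs2.trans ?_
    rw [← hN, mul_div_assoc', div_le_iff₀ (by positivity)]
    nlinarith
  obtain ⟨q, hqS, hqq, hqa⟩ := exists_idempotent_near matrix_norm_one_le
    (invariantSubring (unitAct α) c.ρ) (isClosed_invariantSubring c.ρ) hinv
    (min_le_left _ _) hdη
  refine ⟨⟨c.ι, c.ρ, c.continuous_ρ, q, hqq, hqS⟩, ?_⟩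
  refine Cycle.Equivalent.trans ?_ (σ.equivalent s c)
  have hqa' : ‖q - (a n).map (unitMap (ρ.hom s))‖ ≤ ε := by
    refine hqa.trans (le_trans ?_ hηK)
    have : 0 ≤ η := hη0.le
    gcongr
  have hcomm : ((a n).map (unitMap (ρ.hom s))).map (unitMap π.hom) =
      ((a n).map (unitMap π.hom)).map (unitMap (σ.hom s)) := by
    ext i j
    · simp only [Matrix.map_apply, unitMap_fst]
    · simp only [Matrix.map_apply, unitMap_snd]
      exact π.comm _ _
  have h1 : ‖q.map (unitMap π.hom) - c.e.map (unitMap (σ.hom s))‖ ≤ 2 * ε := by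
    have h2 : q.map (unitMap π.hom) - c.e.map (unitMap (σ.hom s)) =
        (q - (a n).map (unitMap (ρ.hom s))).map (unitMap π.hom) +
          ((a n).map (unitMap π.hom) - c.e).map (unitMap (σ.hom s)) := by
      rw [map_sub_hom, map_sub_hom, hcomm, sub_add_sub_cancel]
    rw [h2]
    refine (norm_add_le _ _).trans ?_
    have h3 := (matrix_norm_map_le (q - (a n).map (unitMap (ρ.hom s))) (unitMap π.hom)
      (norm_unitMap_le π.hom)).trans hqa'
    have h4 := (matrix_norm_map_le ((a n).map (unitMap π.hom) - c.e) (unitMap (σ.hom s))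
      (norm_unitMap_le (σ.hom s))).trans hn3.le
    linarith
  have h2 : ‖c.e.map (unitMap (σ.hom s))‖ ≤ ‖c.e‖ :=
    matrix_norm_map_le _ _ (norm_unitMap_le (σ.hom s))
  have h3 : ‖q.map (unitMap π.hom)‖ ≤ K₁ := by
    have := norm_add_le (q.map (unitMap π.hom) - c.e.map (unitMap (σ.hom s)))
      (c.e.map (unitMap (σ.hom s)))
    rw [sub_add_cancel] at this
    linarith
  refine Cycle.equivalent_of_close c.continuous_ρ (by rw [← Matrix.map_mul, hqq])
    (σ.cycle s c).idem (IsInvariant.map hqS (unitMap_act π.act)) (σ.cycle s c).invariant h3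
    (h2.trans (by linarith)) ?_
  have h4 := mul_le_mul_of_nonneg_left h1 (sq_nonneg K₁)
  refine h4.trans_lt ?_
  linarith

theorem K0_bijective : Function.Bijective (K0.map (unitMap π.hom) (unitMap_act π.act)) :=
  K0.map_bijective _ π.exists_lift π.equivalent_of_map

theorem NK0_bijective : Function.Bijective (NK0.map π.hom π.act) := by
  obtain ⟨hi, hs⟩ := π.K0_bijective
  constructor
  · rintro ⟨x, hx⟩ ⟨y, hy⟩ h
    exact Subtype.ext (hi (congrArg Subtype.val h))
  · rintro ⟨y, hy⟩
    obtain ⟨x, rfl⟩ := hs y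
    refine ⟨⟨x, ?_⟩, rfl⟩
    change augmentation α x = 0
    change augmentation α' (K0.map (unitMap π.hom) (unitMap_act π.act) x) = 0 at hy
    have hcomp : (Unitization.fstHom ℂ A').comp (unitMap π.hom) = Unitization.fstHom ℂ A :=
      AlgHom.ext fun x => by simp [unitMap_fst]
    rw [← hy, augmentation, augmentation, K0.map_map _ _ _ _ (fun g b => by
      simp [unitAct_apply, unitMap_fst])]
    congr 2
    exact hcomp.symm

end Retraction

end Retraction

/-! ## Equivariant smoothing, and the `K`-theory of the algebra of sections -/

section Smoothing

set_option linter.unusedSectionVars false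

open Filter Topology
open scoped Convolution ContDiff

variable {V : Type*} [NormedAddCommGroup V] [InnerProductSpace ℂ V] [FiniteDimensional ℂ V]
  [MeasurableSpace V] [BorelSpace V]

attribute [local instance] InnerProductSpace.complexToReal

/-- A smooth function of `‖x‖`, equal to `1` for `‖x‖ ≤ 1 / a`, and vanishing for `‖x‖ ≥ 2 / a`. -/
def radialBump (a : ℝ) (x : V) : ℝ := Real.smoothTransition (2 - a ^ 2 * ‖x‖ ^ 2)

theorem radialBump_nonneg (a : ℝ) (x : V) : 0 ≤ radialBump a x := Real.smoothTransition.nonneg _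

theorem radialBump_le_one (a : ℝ) (x : V) : radialBump a x ≤ 1 := Real.smoothTransition.le_one _

theorem contDiff_radialBump (a : ℝ) : ContDiff ℝ ∞ (radialBump a : V → ℝ) :=
  Real.smoothTransition.contDiff.comp (contDiff_const.sub
    (contDiff_const.mul ((contDiff_norm_sq ℝ).of_le le_top)))

theorem radialBump_eq_one {a : ℝ} (ha : 0 < a) {x : V} (hx : ‖x‖ ≤ 1 / a) :
    radialBump a x = 1 := by
  rw [le_div_iff₀ ha] at hx
  refine Real.smoothTransition.one_of_one_le ?_
  have h0 : 0 ≤ ‖x‖ * a := by positivity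
  nlinarith

theorem support_radialBump {a : ℝ} (ha : 0 < a) :
    Function.support (radialBump a : V → ℝ) ⊆ Metric.ball 0 (2 / a) := by
  intro x hx
  by_contra h
  rw [mem_ball_zero_iff, not_lt, div_le_iff₀ ha] at h
  refine hx (Real.smoothTransition.zero_of_nonpos ?_)
  nlinarith

theorem hasCompactSupport_radialBump {a : ℝ} (ha : 0 < a) :
    HasCompactSupport (radialBump a : V → ℝ) := by
  have : ProperSpace V := FiniteDimensional.proper ℂ V
  exact HasCompactSupport.intro (isCompact_closedBall (0 : V) (2 / a)) fun x hx =>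
    Function.notMem_support.1 fun h => hx (Metric.ball_subset_closedBall (support_radialBump ha h))

theorem integral_radialBump_pos {a : ℝ} (ha : 0 < a) :
    0 < ∫ x : V, radialBump a x ∂(leb V) := by
  refine (contDiff_radialBump a).continuous.integral_pos_of_hasCompactSupport_nonneg_nonzero
    (hasCompactSupport_radialBump ha) (radialBump_nonneg a) (x := 0) ?_
  rw [radialBump_eq_one ha (by simpa using ha.le)]
  exact one_ne_zero

/-- The radial mollifiers. -/
def mollifier (n : ℕ) (x : V) : ℝ :=
  (∫ x : V, radialBump (n + 1 : ℝ) x ∂(leb V))⁻¹ * radialBump (n + 1 : ℝ) x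

theorem contDiff_mollifier (n : ℕ) : ContDiff ℝ ∞ (mollifier n : V → ℝ) :=
  contDiff_const.mul (contDiff_radialBump _)

theorem hasCompactSupport_mollifier (n : ℕ) : HasCompactSupport (mollifier n : V → ℝ) :=
  (hasCompactSupport_radialBump (by positivity)).mul_left

theorem mollifier_nonneg (n : ℕ) (x : V) : 0 ≤ mollifier n x :=
  mul_nonneg (inv_nonneg.2 (integral_radialBump_pos (by positivity)).le) (radialBump_nonneg _ x)

theorem integral_mollifier (n : ℕ) : ∫ x : V, mollifier n x ∂(leb V) = 1 := by
  simp only [mollifier]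
  rw [integral_const_mul, inv_mul_cancel₀ (integral_radialBump_pos (by positivity)).ne']

theorem support_mollifier (n : ℕ) :
    Function.support (mollifier n : V → ℝ) ⊆ Metric.ball 0 (2 / (n + 1)) :=
  (Function.support_mul_subset_right _ _).trans (support_radialBump (by positivity))

/-- The function `x ↦ f(x)` cut off at radius about `n + 1`. -/
def cutoff (n : ℕ) (f : V → ℂ) (x : V) : ℂ := radialBump (1 / (n + 1) : ℝ) x • f x

theorem continuous_cutoff (n : ℕ) {f : V → ℂ} (hf : Continuous f) : Continuous (cutoff n f) :=
  (contDiff_radialBump _).continuous.smul hf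

theorem hasCompactSupport_cutoff (n : ℕ) (f : V → ℂ) : HasCompactSupport (cutoff n f) :=
  (hasCompactSupport_radialBump (by positivity)).smul_right

/-- The cut-off function, convolved with a mollifier. -/
def smoothing (n : ℕ) (f : V → ℂ) (x : V) : ℂ :=
  ∫ t, mollifier n t • cutoff n f (x - t) ∂(leb V)

theorem smoothing_eq_convolution (n : ℕ) (f : V → ℂ) :
    smoothing n f = (mollifier n ⋆[ContinuousLinearMap.lsmul ℝ ℝ, leb V] cutoff n f) := rfl

theorem contDiff_smoothing (n : ℕ) {f : V → ℂ} (hf : Continuous f) :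
    ContDiff ℝ ∞ (smoothing n f) := by
  rw [smoothing_eq_convolution]
  exact (hasCompactSupport_mollifier n).contDiff_convolution_left _ (contDiff_mollifier n)
    (continuous_cutoff n hf).locallyIntegrable

theorem hasCompactSupport_smoothing (n : ℕ) (f : V → ℂ) : HasCompactSupport (smoothing n f) := by
  rw [smoothing_eq_convolution]
  exact (hasCompactSupport_mollifier n).convolution _ (hasCompactSupport_cutoff n f)

theorem integrable_smoothing (n : ℕ) {f : V → ℂ} (hf : Continuous f) (x : V) :
    Integrable (fun t => mollifier n t • cutoff n f (x - t)) (leb V) := by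
  exact (hasCompactSupport_mollifier n).convolutionExists_left (ContinuousLinearMap.lsmul ℝ ℝ)
    (contDiff_mollifier n).continuous (continuous_cutoff n hf).locallyIntegrable x

/-- The smoothing operators from `C₀(V)` to the Schwartz functions. -/
def smoothingMap (n : ℕ) : C₀(V, ℂ) →ₗ[ℂ] 𝓢(V, ℂ) where
  toFun f := (hasCompactSupport_smoothing n f).toSchwartzMap (contDiff_smoothing n f.continuous)
  map_add' f g := by
    ext x
    change smoothing n (f + g : C₀(V, ℂ)) x = smoothing n f x + smoothing n g x
    rw [smoothing, smoothing, smoothing, ← integral_add (integrable_smoothing n (map_continuous f) x)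
      (integrable_smoothing n (map_continuous g) x)]
    refine integral_congr_ae (Eventually.of_forall fun t => ?_)
    simp [cutoff]
  map_smul' c f := by
    ext x
    change smoothing n (c • f : C₀(V, ℂ)) x = c • smoothing n f x
    rw [smoothing, smoothing, ← integral_smul]
    refine integral_congr_ae (Eventually.of_forall fun t => ?_)
    simp only [cutoff, ZeroAtInftyContinuousMap.smul_apply, smul_eq_mul, Complex.real_smul]
    ring

theorem smoothingMap_apply (n : ℕ) (f : C₀(V, ℂ)) (x : V) :
    smoothingMap n f x = smoothing n f x := rfl

theorem radialBump_unitary (a : ℝ) (u : V ≃ₗᵢ[ℂ] V) (x : V) :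
    radialBump a (u x) = radialBump a x := by
  simp [radialBump]

theorem smoothingMap_act (n : ℕ) (u : V ≃ₗᵢ[ℂ] V) (f : C₀(V, ℂ)) :
    smoothingMap n (c0Act u f) = schwartzAct u (smoothingMap n f) := by
  ext x
  rw [schwartzAct_apply, smoothingMap_apply, smoothingMap_apply, smoothing, smoothing,
    ← (measurePreserving_unitary u).integral_comp u.toHomeomorph.measurableEmbedding]
  refine integral_congr_ae (Eventually.of_forall fun t => ?_)
  have h1 : x - u t = u (u.symm x - t) := by simp
  simp only [mollifier, cutoff, radialBump_unitary, h1, c0Act_apply,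
    LinearIsometryEquiv.symm_apply_apply]

theorem tendsto_smoothingMap (f : C₀(V, ℂ)) :
    Tendsto (fun n => (smoothingMap n f).toZeroAtInfty) atTop (𝓝 f) := by
  rw [tendsto_iff_norm_sub_tendsto_zero]
  rw [Metric.tendsto_nhds]
  intro ε hε
  have hu : UniformContinuous f := ZeroAtInftyContinuousMap.uniformContinuous f
  obtain ⟨δ, hδ, h1⟩ := Metric.uniformContinuous_iff.1 hu (ε / 4) (by linarith)
  have h2 : ∀ᶠ x in cocompact V, ‖f x‖ < ε / 4 := by
    have := f.zero_at_infty'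
    exact (this.norm).eventually_lt_const (by simpa using by linarith)
  obtain ⟨R, hR⟩ := Metric.closedBall_compl_subset_of_mem_cocompact h2 0
  have h3 : ∀ᶠ n : ℕ in atTop, R < n := tendsto_natCast_atTop_atTop.eventually_gt_atTop R
  have h4 : ∀ᶠ n : ℕ in atTop, 2 / ((n : ℝ) + 1) < δ := by
    have := tendsto_one_div_add_atTop_nhds_zero_nat (𝕜 := ℝ)
    have h5 := this.const_mul 2
    rw [mul_zero] at h5
    filter_upwards [h5.eventually_lt_const hδ] with n hn
    rwa [mul_one_div] at hn
  filter_upwards [h3, h4] with n hn3 hn4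
  rw [dist_zero_right, norm_norm]
  refine lt_of_le_of_lt ((c0_norm_le (by positivity : (0 : ℝ) ≤ ε / 2)).2 fun x => ?_)
    (by linarith)
  change ‖smoothing n f x - f x‖ ≤ ε / 2
  rw [smoothing_eq_convolution, ← dist_eq_norm]
  refine dist_convolution_le (by positivity) (support_mollifier n) (mollifier_nonneg n)
    (integral_mollifier n) (continuous_cutoff n f.continuous).aestronglyMeasurable fun y hy => ?_
  have h5 : dist (f y) (f x) < ε / 4 := h1 ((Metric.mem_ball.1 hy).trans hn4)
  have h6 : dist (cutoff n f y) (f y) ≤ ε / 4 := by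
    rw [dist_eq_norm, cutoff]
    by_cases hyR : ‖y‖ ≤ n + 1
    · rw [radialBump_eq_one (by positivity) (by simpa using hyR), one_smul, sub_self, norm_zero]
      positivity
    · have h7 : ‖f y‖ < ε / 4 := hR (by
        simp only [Set.mem_compl_iff, mem_closedBall_zero_iff]
        intro h8
        exact hyR (by linarith))
      have h8 : radialBump (1 / (n + 1) : ℝ) y • f y - f y =
          ((radialBump (1 / (n + 1) : ℝ) y - 1 : ℝ) : ℂ) * f y := by
        rw [Complex.real_smul]
        push_cast
        ring
      rw [h8, norm_mul, Complex.norm_real, Real.norm_eq_abs]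
      have h9 : |radialBump (1 / (n + 1) : ℝ) y - 1| ≤ 1 := by
        have h10 := radialBump_nonneg (1 / (n + 1) : ℝ) y
        have h11 := radialBump_le_one (1 / (n + 1) : ℝ) y
        exact abs_le.2 ⟨by linarith, by linarith⟩
      have h10 := norm_nonneg (f y)
      nlinarith
  have h7 := dist_triangle (cutoff n f y) (f y) (f x)
  linarith

/-- Schwartz functions as constant sections. -/
def constantSection : 𝓢(V, ℂ) →ₗ[ℂ] SectionAlgebra V where
  toFun f := ⟨sectionFamily 1 f, subset_closure
    (NonUnitalStarAlgebra.subset_adjoin ℂ _ (sectionFamily_mem 1 f))⟩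
  map_add' f g := by
    refine Generated.incl_injective (Families.ext (ZeroAtInftyContinuousMap.ext fun x => ?_)
      fun l => ?_)
    · change (1 : ℂ) * (f x + g x) = 1 * f x + 1 * g x
      ring
    · change Families.eval l (sectionFamily 1 (f + g)) =
        Families.eval l (sectionFamily 1 f + sectionFamily 1 g)
      rw [map_add, eval_sectionFamily, eval_sectionFamily, eval_sectionFamily, quant_add, smul_add]
  map_smul' c f := by
    refine Generated.incl_injective (Families.ext (ZeroAtInftyContinuousMap.ext fun x => ?_)
      fun l => ?_)
    · change (1 : ℂ) * (c * f x) = c * (1 * f x)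
      ring
    · change Families.eval l (sectionFamily 1 (c • f)) = Families.eval l (c • sectionFamily 1 f)
      rw [map_smul, eval_sectionFamily, eval_sectionFamily, quant_smul, smul_comm]

theorem evalZero_constantSection (f : 𝓢(V, ℂ)) :
    evalZero V (constantSection f) = f.toZeroAtInfty :=
  ZeroAtInftyContinuousMap.ext fun x => one_mul (f x)

theorem opAct_quant (l : ℝ) (hl : l ≠ 0) (u : V ≃ₗᵢ[ℂ] V) (f : 𝓢(V, ℂ)) :
    opAct u (quant l f) = quant l (schwartzAct u f) :=
  IsLeftMoyal.unique ((isLeftMoyal_quant hl f).opAct u) (isLeftMoyal_quant hl (schwartzAct u f))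

theorem constantSection_act (u : V ≃ₗᵢ[ℂ] V) (f : 𝓢(V, ℂ)) :
    constantSection (schwartzAct u f) = sectionAct u (constantSection f) := by
  refine Generated.incl_injective (Families.ext rfl fun l => ?_)
  change Families.eval l (sectionFamily 1 (schwartzAct u f)) =
    opAct u (Families.eval l (sectionFamily 1 f))
  rw [eval_sectionFamily, eval_sectionFamily, map_smul, opAct_quant _ l.2.1.ne']

/-- Dilations of sections, as a contraction. -/
def sectionContraction : Contraction (sectionAct (V := V)) where
  hom := dilSection
  act := dilSection_act
  one := dilSection_one
  cont := continuous_dilSection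

theorem continuous_dilC0 (f : C₀(V, ℂ)) :
    Continuous fun s : Set.Ioc (0 : ℝ) 1 => dilC0 s s.2.1 f := by
  refine continuous_of_uniform_approx_of_continuous fun u hu => ?_
  obtain ⟨ε, hε, h⟩ := Metric.mem_uniformity_dist.1 hu
  obtain ⟨n, hn⟩ := (Metric.tendsto_nhds.1 (tendsto_smoothingMap f) ε hε).exists
  refine ⟨fun s => evalZero V (dilSection s (constantSection (smoothingMap n f))), ?_, fun s => ?_⟩
  · have h1 : Continuous (evalZero V) :=
      AddMonoidHomClass.continuous_of_bound (evalZero V) 1 fun b => by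
        simpa using NonUnitalStarAlgHom.norm_apply_le (evalZero V) b
    exact h1.comp (continuous_dilSection _)
  · refine h ?_
    change dist (dilC0 (s : ℝ) s.2.1 f)
      (dilC0 (s : ℝ) s.2.1 (evalZero V (constantSection (smoothingMap n f)))) < ε
    rw [evalZero_constantSection, dist_eq_norm, ← map_sub]
    refine (NonUnitalStarAlgHom.norm_apply_le (dilC0 (s : ℝ) s.2.1) _).trans_lt ?_
    rwa [dist_comm, dist_eq_norm] at hn

/-- Dilations of functions, as a contraction. -/
def c0Contraction : Contraction (c0Act (V := V)) where
  hom s := dilC0 s s.2.1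
  act s u f := ZeroAtInftyContinuousMap.ext fun x => by
    change f (u.symm ((s : ℝ) • x)) = f ((s : ℝ) • u.symm x)
    congr 1
    simp only [← Complex.coe_smul]
    rw [map_smul]
  one f := ZeroAtInftyContinuousMap.ext fun x => by
    change f ((1 : ℝ) • x) = f x
    rw [one_smul]
  cont := continuous_dilC0

/-- Evaluation of sections at `0` is asymptotically a homotopy equivalence. -/
def evalZeroRetraction : Retraction (sectionContraction (V := V)) c0Contraction where
  hom := evalZero V
  act := evalZero_act
  comm _ _ := rfl
  small _ _ hm := eventually_smallParam.2 (exists_norm_dilSection_le _ hm)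
  lift n := constantSection.comp (smoothingMap n)
  lift_act n u f := by
    rw [LinearMap.comp_apply, LinearMap.comp_apply, smoothingMap_act, constantSection_act]
  lift_tendsto f := (tendsto_smoothingMap f).congr fun _ => (evalZero_constantSection _).symm

theorem evalZeroK_bijective : Function.Bijective (evalZeroK V) :=
  (evalZeroRetraction (V := V)).NK0_bijective

end Smoothing

/-! ## The Fock space and the vacuum projection -/

section FockVacuum

set_option linter.unusedSectionVars false

open Filter Topology
open scoped FourierTransform

variable {V : Type*} [NormedAddCommGroup V] [InnerProductSpace ℂ V] [FiniteDimensional ℂ V]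
  [MeasurableSpace V] [BorelSpace V]

attribute [local instance] InnerProductSpace.complexToReal

theorem integrable_gaussian {b : ℝ} (hb : 0 < b) :
    Integrable (fun x : V => Real.exp (-b * ‖x‖ ^ 2)) (leb V) := by
  have h := (GaussianFourier.integrable_cexp_neg_mul_sq_norm_add (V := V) (b := (b : ℂ))
    (by simpa using hb) 0 0).norm
  refine h.congr (Eventually.of_forall fun x => ?_)
  simp only [Complex.norm_exp]
  congr 1
  simp [← Complex.ofReal_pow]

/-- A function of at most exponential growth times the Gaussian is square integrable. -/
theorem memLp_mul_gaussian {F : V → ℂ} (hF : Continuous F) {C c : ℝ}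
    (hb : ∀ x, ‖F x‖ ≤ C * Real.exp (c * ‖x‖)) :
    MemLp (fun x => F x * (Real.exp (-‖x‖ ^ 2) : ℝ)) 2 (leb V) := by
  refine (memLp_two_iff_integrable_sq_norm (by fun_prop)).2 ?_
  refine ((integrable_gaussian (V := V) one_pos).const_mul (C ^ 2 * Real.exp (c ^ 2))).mono'
    (by fun_prop) (Eventually.of_forall fun x => ?_)
  have hC : 0 ≤ C := by
    have h1 := (norm_nonneg _).trans (hb 0)
    simpa using h1
  rw [norm_mul, Complex.norm_real, Real.norm_of_nonneg (Real.exp_pos _).le,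
    Real.norm_of_nonneg (by positivity)]
  calc (‖F x‖ * Real.exp (-‖x‖ ^ 2)) ^ 2
      ≤ (C * Real.exp (c * ‖x‖) * Real.exp (-‖x‖ ^ 2)) ^ 2 := by
        gcongr
        exact hb x
    _ = C ^ 2 * Real.exp (2 * (c * ‖x‖ - ‖x‖ ^ 2)) := by
        rw [mul_assoc, ← Real.exp_add, mul_pow, ← Real.exp_nat_mul]
        congr 2
    _ ≤ C ^ 2 * Real.exp (c ^ 2 + -1 * ‖x‖ ^ 2) := by
        gcongr
        nlinarith [sq_nonneg (c - ‖x‖)]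
    _ = _ := by rw [Real.exp_add, mul_assoc]

/-- The vector `x ↦ conj (F x) e^{-‖x‖²}` of the Fock space given by an entire function `F` of at
most exponential growth. -/
def fockVec (F : V → ℂ) (hF : Differentiable ℂ F)
    (hb : ∃ C c : ℝ, ∀ x, ‖F x‖ ≤ C * Real.exp (c * ‖x‖)) : L2 V :=
  MemLp.toLp (fun x => star (F x) * (Real.exp (-‖x‖ ^ 2) : ℝ))
    (memLp_mul_gaussian (F := fun x => star (F x)) hF.continuous.star (C := hb.choose)
      (c := hb.choose_spec.choose) fun x => by
        rw [norm_star]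
        exact hb.choose_spec.choose_spec x)

theorem fockVec_coe {F : V → ℂ} (hF : Differentiable ℂ F)
    (hb : ∃ C c : ℝ, ∀ x, ‖F x‖ ≤ C * Real.exp (c * ‖x‖)) :
    (fockVec F hF hb : V → ℂ) =ᵐ[leb V] fun x => star (F x) * (Real.exp (-‖x‖ ^ 2) : ℝ) :=
  MemLp.coeFn_toLp _

/-- `f` is the element `x ↦ conj (F x) e^{-‖x‖²}` of the Fock space. -/
def IsFock (f : L2 V) (F : V → ℂ) : Prop :=
  Differentiable ℂ F ∧ (f : V → ℂ) =ᵐ[leb V] fun x => star (F x) * (Real.exp (-‖x‖ ^ 2) : ℝ)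

theorem IsFock.memLp {f : L2 V} {F : V → ℂ} (h : IsFock f F) :
    MemLp (fun x => star (F x) * (Real.exp (-‖x‖ ^ 2) : ℝ)) 2 (leb V) :=
  (memLp_congr_ae h.2).1 (Lp.memLp f)

theorem IsFock.toLp {f : L2 V} {F : V → ℂ} (h : IsFock f F) : h.memLp.toLp _ = f := by
  refine Lp.ext ?_
  filter_upwards [h.memLp.coeFn_toLp, h.2] with x h1 h2
  rw [h1, h2]

theorem IsFock.congr {f g : L2 V} {F : V → ℂ} (h : IsFock f F) (h' : IsFock g F) : f = g := by
  refine Lp.ext ?_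
  filter_upwards [h.2, h'.2] with x h1 h2
  rw [h1, h2]

theorem IsFock.smul {f : L2 V} {F : V → ℂ} (h : IsFock f F) (c : ℂ) :
    IsFock (c • f) (fun x => star c * F x) := by
  refine ⟨h.1.const_mul _, ?_⟩
  filter_upwards [Lp.coeFn_smul c f, h.2] with x h1 h2
  rw [h1, Pi.smul_apply, h2, star_mul', star_star, smul_eq_mul, mul_assoc]

/-- The entire function of `M(w) f`. -/
theorem IsFock.weyl {f : L2 V} {F : V → ℂ} (h : IsFock f F) (w : V) :
    IsFock (weyl 1 w f) fun x => Complex.exp (-(Real.pi ^ 2 * ‖w‖ ^ 2 : ℝ) -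
      2 * Real.pi * Complex.I * inner ℂ w x) * F (x + -(Complex.I * Real.pi) • w) := by
  have hd : Differentiable ℂ fun x : V => (inner ℂ w x : ℂ) := (innerSL ℂ w).differentiable
  refine ⟨((hd.const_mul _).const_sub _).cexp.mul (h.1.comp (by fun_prop)), ?_⟩
  filter_upwards [weyl_coe 1 w f, (isWeightedComp_weyl 1 w).1.ae_eq h.2] with x h1 h2
  simp only [Function.comp, Complex.ofReal_one, mul_one] at h1 h2
  rw [h1, h2, star_mul', mul_left_comm, mul_comm _ (star (F _)), mul_assoc]
  congr 1
  rw [character_apply, ← starRingEnd_apply, ← Complex.exp_conj, Complex.ofReal_exp,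
    Complex.ofReal_exp, ← Complex.exp_add, ← Complex.exp_add]
  congr 1
  have hn : ‖x + -(Complex.I * Real.pi) • w‖ ^ 2 =
      ‖x‖ ^ 2 + 2 * Real.pi * (inner ℂ x w : ℂ).im + Real.pi ^ 2 * ‖w‖ ^ 2 := by
    rw [@norm_add_sq ℂ, norm_smul, inner_smul_right]
    simp [abs_of_pos Real.pi_pos]
    ring
  have hc : starRingEnd ℂ (inner ℂ w x) = inner ℂ x w := inner_conj_symm _ _
  have hre : (inner ℂ x w : ℂ) = ((inner ℂ x w : ℂ).re : ℂ) + ((inner ℂ x w : ℂ).im : ℂ) * Complex.I :=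
    (Complex.re_add_im _).symm
  rw [hn]
  simp only [map_sub, map_neg, map_mul, Complex.conj_ofReal, Complex.conj_I, hc, map_ofNat]
  rw [hre]
  push_cast
  simp only [Complex.add_re, Complex.add_im, Complex.mul_re, Complex.mul_im, Complex.ofReal_re,
    Complex.ofReal_im, Complex.I_re, Complex.I_im]
  push_cast
  linear_combination (-2 * (Real.pi : ℂ) * ((inner ℂ x w : ℂ).im : ℂ)) * Complex.I_sq

/-- The mean value property, for Gaussian averages. -/
theorem integral_gaussian_mul {G : V → ℂ} (hG : Differentiable ℂ G)
    (hint : Integrable (fun x => ((Real.exp (-2 * ‖x‖ ^ 2) : ℝ) : ℂ) * G x) (leb V)) :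
    ∫ x, ((Real.exp (-2 * ‖x‖ ^ 2) : ℝ) : ℂ) * G x ∂(leb V) =
      G 0 * ((∫ x : V, Real.exp (-2 * ‖x‖ ^ 2) ∂(leb V) : ℝ) : ℂ) := by
  let u : ℝ → V ≃ₗᵢ[ℂ] V := fun t =>
    { LinearEquiv.smulOfUnit (Units.mk0 (Complex.exp (t * Complex.I)) (Complex.exp_ne_zero _)) with
      norm_map' := fun x => by
        change ‖(Complex.exp (t * Complex.I)) • x‖ = ‖x‖
        rw [norm_smul, Complex.norm_exp_ofReal_mul_I, one_mul] }
  have hu : ∀ t x, u t x = Complex.exp (t * Complex.I) • x := fun _ _ => rfl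
  have hun : ∀ (t : ℝ) (x : V), ‖Complex.exp (t * Complex.I) • x‖ = ‖x‖ := fun t => (u t).norm_map
  have h1 : ∀ t : ℝ, ∫ x, ((Real.exp (-2 * ‖x‖ ^ 2) : ℝ) : ℂ) *
      G (Complex.exp (t * Complex.I) • x) ∂(leb V) =
      ∫ x, ((Real.exp (-2 * ‖x‖ ^ 2) : ℝ) : ℂ) * G x ∂(leb V) := fun t => by
    rw [← (measurePreserving_unitary (u t)).integral_comp (u t).toHomeomorph.measurableEmbedding
      fun x => ((Real.exp (-2 * ‖x‖ ^ 2) : ℝ) : ℂ) * G x]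
    simp only [hu, hun]
  have hn : ∀ t : ℝ, Integrable (fun x => ((Real.exp (-2 * ‖x‖ ^ 2) : ℝ) : ℂ) *
      G (Complex.exp (t * Complex.I) • x)) (leb V) ∧
      ∫ x, ‖((Real.exp (-2 * ‖x‖ ^ 2) : ℝ) : ℂ) * G (Complex.exp (t * Complex.I) • x)‖ ∂(leb V) =
      ∫ x, ‖((Real.exp (-2 * ‖x‖ ^ 2) : ℝ) : ℂ) * G x‖ ∂(leb V) := fun t => by
    constructor
    · have := ((measurePreserving_unitary (u t)).integrable_comp_emb
        (u t).toHomeomorph.measurableEmbedding).2 hint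
      simpa only [Function.comp_def, hu, hun] using this
    · rw [← (measurePreserving_unitary (u t)).integral_comp
        (u t).toHomeomorph.measurableEmbedding
        fun x => ‖((Real.exp (-2 * ‖x‖ ^ 2) : ℝ) : ℂ) * G x‖]
      simp only [hu, hun]
  have hGc := hG.continuous
  have hprod : Integrable (fun p : ℝ × V => ((Real.exp (-2 * ‖p.2‖ ^ 2) : ℝ) : ℂ) *
      G (Complex.exp (p.1 * Complex.I) • p.2))
      ((volume.restrict (Set.uIoc 0 (2 * Real.pi))).prod (leb V)) := by
    rw [integrable_prod_iff (by
      have : Continuous (fun p : ℝ × V => ((Real.exp (-2 * ‖p.2‖ ^ 2) : ℝ) : ℂ) *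
        G (Complex.exp (p.1 * Complex.I) • p.2)) := by fun_prop
      exact this.aestronglyMeasurable)]
    refine ⟨Eventually.of_forall fun t => (hn t).1, ?_⟩
    simp only [fun t => (hn t).2]
    rw [Set.uIoc_of_le (by positivity)]
    exact integrable_const _
  have h2 : ∀ x : V, Real.circleAverage (fun z : ℂ => G (z • x)) 0 1 = G 0 := fun x => by
    rw [DiffContOnCl.circleAverage, zero_smul]
    have : Differentiable ℂ fun z : ℂ => G (z • x) := hG.comp (by fun_prop)
    exact this.diffContOnCl
  have h3 : (2 * Real.pi : ℝ) • ∫ x, ((Real.exp (-2 * ‖x‖ ^ 2) : ℝ) : ℂ) * G x ∂(leb V) =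
      ∫ t in (0 : ℝ)..(2 * Real.pi), ∫ x, ((Real.exp (-2 * ‖x‖ ^ 2) : ℝ) : ℂ) *
      G (Complex.exp (t * Complex.I) • x) ∂(leb V) := by
    simp only [h1]
    rw [intervalIntegral.integral_const, sub_zero]
  rw [intervalIntegral_integral_swap hprod] at h3
  have h4 : ∀ x : V, (∫ t in (0 : ℝ)..(2 * Real.pi), ((Real.exp (-2 * ‖x‖ ^ 2) : ℝ) : ℂ) *
      G (Complex.exp (t * Complex.I) • x)) =
      (2 * Real.pi : ℝ) • (((Real.exp (-2 * ‖x‖ ^ 2) : ℝ) : ℂ) * G 0) := fun x => by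
    rw [← h2 x, Real.circleAverage_def, intervalIntegral.integral_const_mul]
    simp only [circleMap, zero_add, Complex.ofReal_one, one_mul]
    rw [mul_smul_comm, smul_smul, mul_inv_cancel₀ (by positivity), one_smul]
  simp only [h4] at h3
  rw [integral_smul] at h3
  rw [smul_right_injective ℂ (by positivity : (2 * Real.pi : ℝ) ≠ 0) h3, integral_mul_const,
    integral_complex_ofReal, mul_comm]

end FockVacuum

/-! ## Coherent states -/

section Coherent

set_option linter.unusedSectionVars false

open Filter Topology
open scoped FourierTransform

variable {V : Type*} [NormedAddCommGroup V] [InnerProductSpace ℂ V] [FiniteDimensional ℂ V]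
  [MeasurableSpace V] [BorelSpace V]

attribute [local instance] InnerProductSpace.complexToReal

/-- The coherent state `x ↦ e^{2 ⟨x, z⟩ - ‖x‖²}`. -/
def coherent (z : V) : L2 V :=
  fockVec (fun x => Complex.exp (2 * inner ℂ z x))
    (((innerSL ℂ z).differentiable.const_mul 2).cexp) ⟨1, 2 * ‖z‖, fun x => by
      rw [Complex.norm_exp, one_mul, Real.exp_le_exp]
      refine (Complex.re_le_norm _).trans ?_
      rw [norm_mul, mul_assoc]
      have := norm_inner_le_norm (𝕜 := ℂ) z x
      simpa using this⟩

theorem isFock_coherent (z : V) : IsFock (coherent z) fun x => Complex.exp (2 * inner ℂ z x) :=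
  ⟨((innerSL ℂ z).differentiable.const_mul 2).cexp, fockVec_coe _ _⟩

theorem isFock_vacuum : IsFock (coherent (0 : V)) fun _ => 1 := by
  have := isFock_coherent (0 : V)
  simpa using this

variable (V) in
/-- The integral of `e^{-2 ‖x‖²}`. -/
def gaussMass : ℝ := ∫ x : V, Real.exp (-2 * ‖x‖ ^ 2) ∂(leb V)

theorem gaussMass_pos : 0 < gaussMass V :=
  integral_pos_of_integrable_nonneg_nonzero (x := 0) (by fun_prop) (integrable_gaussian two_pos)
    (fun x => (Real.exp_pos _).le) (Real.exp_pos _).ne'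

theorem inner_vacuum {f : L2 V} {F : V → ℂ} (h : IsFock f F) :
    inner ℂ (coherent 0) f = (gaussMass V : ℂ) * star (F 0) := by
  have h1 : (fun x => inner ℂ ((coherent (0 : V) : V → ℂ) x) ((f : V → ℂ) x)) =ᵐ[leb V]
      fun x => starRingEnd ℂ (((Real.exp (-2 * ‖x‖ ^ 2) : ℝ) : ℂ) * F x) := by
    filter_upwards [(isFock_vacuum (V := V)).2, h.2] with x hx hx1
    rw [hx, hx1, RCLike.inner_apply, star_one, one_mul, Complex.conj_ofReal, map_mul,
      Complex.conj_ofReal, mul_assoc, ← Complex.ofReal_mul, ← Real.exp_add, mul_comm]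
    congr 4
    ring
  have h2 : Integrable (fun x => ((Real.exp (-2 * ‖x‖ ^ 2) : ℝ) : ℂ) * F x) (leb V) := by
    have hF := h.1.continuous
    refine ((L2.integrable_inner (𝕜 := ℂ) (coherent (0 : V)) f).congr h1).norm.mono'
      (Continuous.aestronglyMeasurable (by fun_prop)) (Eventually.of_forall fun x => ?_)
    rw [RCLike.norm_conj]
  rw [L2.inner_def, integral_congr_ae h1, integral_conj, integral_gaussian_mul h.1 h2, map_mul,
    Complex.conj_ofReal, mul_comm]
  rfl

theorem weyl_vacuum (w : V) : weyl 1 w (coherent 0) =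
    ((Real.exp (-(Real.pi ^ 2 * ‖w‖ ^ 2)) : ℝ) : ℂ) • coherent ((Complex.I * Real.pi) • w) := by
  refine (isFock_vacuum.weyl w).congr ?_
  have h := (isFock_coherent ((Complex.I * Real.pi : ℂ) • w)).smul
    ((Real.exp (-(Real.pi ^ 2 * ‖w‖ ^ 2)) : ℝ) : ℂ)
  convert h using 2 with x
  rw [mul_one, ← starRingEnd_apply, Complex.conj_ofReal, Complex.ofReal_exp, ← Complex.exp_add,
    inner_smul_left]
  congr 1
  simp
  ring

/-- The reproducing property of the coherent states. -/
theorem inner_coherent {f : L2 V} {F : V → ℂ} (h : IsFock f F) (z : V) :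
    inner ℂ (coherent z) f = (gaussMass V : ℂ) * star (F z) := by
  set w : V := (-(Complex.I * (Real.pi⁻¹ : ℝ)) : ℂ) • z with hw
  have hp : (Real.pi : ℂ) ≠ 0 := by exact_mod_cast Real.pi_ne_zero
  have hz : z = (Complex.I * Real.pi : ℂ) • w := by
    rw [hw, smul_smul]
    have : (Complex.I * Real.pi * -(Complex.I * (Real.pi⁻¹ : ℝ)) : ℂ) = 1 := by
      push_cast
      field_simp
      simp
    rw [this, one_smul]
  have h1 := inner_vacuum (h.weyl (-w))
  rw [← inner_weyl_left, weyl_vacuum, ← hz, inner_smul_left, Complex.conj_ofReal] at h1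
  have h2 : (0 : V) + -(Complex.I * Real.pi : ℂ) • -w = z := by
    rw [zero_add, smul_neg, neg_smul, neg_neg, ← hz]
  rw [h2, inner_zero_right, mul_zero, sub_zero, ← Complex.ofReal_neg, ← Complex.ofReal_exp, star_mul', norm_neg,
    ← starRingEnd_apply (((Real.exp _ : ℝ)) : ℂ), Complex.conj_ofReal, mul_left_comm] at h1
  refine mul_left_cancel₀ ?_ h1
  exact_mod_cast (Real.exp_pos _).ne'

theorem differentiable_inner_coherent (f : L2 V) :
    Differentiable ℂ fun z : V => (inner ℂ f (coherent z) : ℂ) := by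
  have hrep : ∀ z : V, (inner ℂ f (coherent z) : ℂ) = ∫ x, starRingEnd ℂ ((f : V → ℂ) x) *
      (Complex.exp (2 * inner ℂ x z) * ((Real.exp (-‖x‖ ^ 2) : ℝ) : ℂ)) ∂(leb V) := fun z => by
    rw [L2.inner_def]
    refine integral_congr_ae ?_
    filter_upwards [(isFock_coherent z).2] with x hx
    rw [hx, RCLike.inner_apply, mul_comm, ← starRingEnd_apply, ← Complex.exp_conj, map_mul,
      inner_conj_symm, map_ofNat]
  have hint : ∀ z : V, Integrable (fun x => starRingEnd ℂ ((f : V → ℂ) x) *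
      (Complex.exp (2 * inner ℂ x z) * ((Real.exp (-‖x‖ ^ 2) : ℝ) : ℂ))) (leb V) := fun z => by
    refine (L2.integrable_inner (𝕜 := ℂ) f (coherent z)).congr ?_
    filter_upwards [(isFock_coherent z).2] with x hx
    rw [hx, RCLike.inner_apply, mul_comm, ← starRingEnd_apply, ← Complex.exp_conj, map_mul,
      inner_conj_symm, map_ofNat]
  intro z₀
  have hfm : AEStronglyMeasurable (fun x => starRingEnd ℂ ((f : V → ℂ) x)) (leb V) :=
    (Lp.aestronglyMeasurable f).star
  have hmem : MemLp (fun x : V => (Complex.exp ((2 * (‖z₀‖ + 1) + 1) * ‖x‖ : ℝ) : ℂ) *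
      (Real.exp (-‖x‖ ^ 2) : ℝ)) 2 (leb V) :=
    memLp_mul_gaussian (by fun_prop) (C := 1) (c := 2 * (‖z₀‖ + 1) + 1) fun x => by
      rw [Complex.norm_exp, one_mul, Complex.ofReal_re]
  have hb : Integrable (fun x : V => 2 * (‖(f : V → ℂ) x‖ *
      ‖(Complex.exp ((2 * (‖z₀‖ + 1) + 1) * ‖x‖ : ℝ) : ℂ) * (Real.exp (-‖x‖ ^ 2) : ℝ)‖))
      (leb V) := ((Lp.memLp f).norm.integrable_mul hmem.norm).const_mul 2
  have key := hasFDerivAt_integral_of_dominated_of_fderiv_le (𝕜 := ℂ) (μ := leb V)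
    (F := fun z x => starRingEnd ℂ ((f : V → ℂ) x) *
      (Complex.exp (2 * inner ℂ x z) * ((Real.exp (-‖x‖ ^ 2) : ℝ) : ℂ)))
    (F' := fun z x => (starRingEnd ℂ ((f : V → ℂ) x) * (2 *
      (Complex.exp (2 * inner ℂ x z) * ((Real.exp (-‖x‖ ^ 2) : ℝ) : ℂ)))) • innerSL ℂ x)
    (x₀ := z₀) (s := Metric.ball z₀ 1) (Metric.ball_mem_nhds _ one_pos)
    (Eventually.of_forall fun z => (hint z).aestronglyMeasurable) (hint z₀) ?_
    (Eventually.of_forall fun x z hz => ?_) hb (Eventually.of_forall fun x z hz => ?_)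
  · simp only [hrep]
    exact key.differentiableAt
  · have h1 : Continuous fun x : V => (innerSL ℂ x : V →L[ℂ] ℂ) := (innerSL ℂ).continuous
    refine AEStronglyMeasurable.smul (hfm.mul ?_) h1.aestronglyMeasurable
    exact Continuous.aestronglyMeasurable (by fun_prop)
  · have hz1 : ‖z‖ ≤ ‖z₀‖ + 1 := by
      have h1 : ‖z - z₀‖ < 1 := by simpa [dist_eq_norm] using hz
      have h2 := norm_le_norm_add_norm_sub' z z₀
      linarith
    have h3 : ‖x‖ ≤ Real.exp ‖x‖ := by
      have := Real.add_one_le_exp ‖x‖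
      linarith
    have h4 : (2 * inner ℂ x z : ℂ).re ≤ 2 * (‖z₀‖ + 1) * ‖x‖ := by
      refine (Complex.re_le_norm _).trans ?_
      rw [norm_mul]
      have h5 := norm_inner_le_norm (𝕜 := ℂ) x z
      have h6 := mul_le_mul_of_nonneg_left hz1 (norm_nonneg x)
      simp only [Complex.norm_ofNat]
      linarith
    rw [norm_smul, innerSL_apply_norm, norm_mul, norm_mul, norm_mul, norm_mul, RCLike.norm_conj,
      Complex.norm_exp, Complex.norm_exp, Complex.ofReal_re]
    calc ‖(f : V → ℂ) x‖ * (‖(2 : ℂ)‖ * (Real.exp (2 * inner ℂ x z : ℂ).re *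
          ‖((Real.exp (-‖x‖ ^ 2) : ℝ) : ℂ)‖)) * ‖x‖
        ≤ ‖(f : V → ℂ) x‖ * (‖(2 : ℂ)‖ * (Real.exp (2 * (‖z₀‖ + 1) * ‖x‖) *
          ‖((Real.exp (-‖x‖ ^ 2) : ℝ) : ℂ)‖)) * Real.exp ‖x‖ := by gcongr
      _ = _ := by
        rw [add_mul, one_mul, Real.exp_add, Complex.norm_ofNat]
        ring
  · have h1 : HasFDerivAt (fun z : V => (2 : ℂ) * inner ℂ x z) ((2 : ℂ) • innerSL ℂ x) z :=
      (innerSL ℂ x).hasFDerivAt.const_mul 2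
    have h2 := (h1.cexp.mul_const ((Real.exp (-‖x‖ ^ 2) : ℝ) : ℂ)).const_mul
      (starRingEnd ℂ ((f : V → ℂ) x))
    refine h2.congr_fderiv (ContinuousLinearMap.ext fun v => ?_)
    change starRingEnd ℂ ((f : V → ℂ) x) * (((Real.exp (-‖x‖ ^ 2) : ℝ) : ℂ) *
      (Complex.exp (2 * inner ℂ x z) * (2 * inner ℂ x v))) = starRingEnd ℂ ((f : V → ℂ) x) * (2 *
      (Complex.exp (2 * inner ℂ x z) * ((Real.exp (-‖x‖ ^ 2) : ℝ) : ℂ))) * inner ℂ x v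
    ring

theorem isClosed_fockSpace : IsClosed (fockSpace V : Set (L2 V)) := by
  refine IsSeqClosed.isClosed fun f f₀ hf hlim => ?_
  choose F hF using hf
  have hm : (gaussMass V : ℂ) ≠ 0 := by exact_mod_cast gaussMass_pos.ne'
  set F₀ : V → ℂ := fun z => (gaussMass V : ℂ)⁻¹ * inner ℂ f₀ (coherent z) with hF₀
  have hFn : ∀ n z, F n z = (gaussMass V : ℂ)⁻¹ * inner ℂ (f n) (coherent z) := fun n z => by
    rw [← inner_conj_symm, inner_coherent (hF n) z, map_mul, Complex.conj_ofReal,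
      ← starRingEnd_apply, Complex.conj_conj, inv_mul_cancel_left₀ hm]
  have hpt : ∀ z, Tendsto (fun n => F n z) atTop (𝓝 (F₀ z)) := fun z => by
    simp only [hFn]
    exact (hlim.inner tendsto_const_nhds).const_mul _
  obtain ⟨ns, hns, hae⟩ := (tendstoInMeasure_of_tendsto_Lp hlim).exists_seq_tendsto_ae
  refine ⟨F₀, (differentiable_inner_coherent f₀).const_mul _, ?_⟩
  filter_upwards [hae, ae_all_iff.2 fun n => (hF n).2] with x hx hx1
  refine tendsto_nhds_unique hx ?_
  simp only [hx1]
  exact (((hpt x).comp hns.tendsto_atTop).star).mul_const _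

instance : CompleteSpace (fockSpace V) := (isClosed_fockSpace (V := V)).completeSpace_coe

theorem eq_zero_of_inner_coherent {f : L2 V} (hf : f ∈ fockSpace V)
    (h : ∀ z, inner ℂ (coherent z) f = 0) : f = 0 := by
  obtain ⟨F, hF⟩ := hf
  have hm : (gaussMass V : ℂ) ≠ 0 := by exact_mod_cast gaussMass_pos.ne'
  refine Lp.ext ?_
  filter_upwards [hF.2, Lp.coeFn_zero ℂ 2 (leb V)] with x hx hx1
  have h1 := h x
  rw [inner_coherent hF, mul_eq_zero, or_iff_right hm] at h1
  rw [hx, h1, zero_mul, hx1]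
  rfl

/-- The Gaussian `w ↦ e^{-π² ‖w‖²}`. -/
theorem integrable_weylGaussian :
    Integrable (fun w : V => ((Real.exp (-Real.pi ^ 2 * ‖w‖ ^ 2) : ℝ) : ℂ)) (leb V) := by
  have := integrable_gaussian (V := V) (b := Real.pi ^ 2) (by positivity)
  exact this.ofReal

theorem weylInt_gaussian {f : L2 V} {F : V → ℂ} (h : IsFock f F) :
    weylInt 1 (integrable_weylGaussian.toL1 _) f =
      ((|(Real.pi ^ Module.finrank ℝ V)⁻¹| * gaussMass V : ℝ) * star (F 0) : ℂ) •
        coherent (0 : V) := by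
  have hg : Continuous fun x : V => star (F x) * ((Real.exp (-‖x‖ ^ 2) : ℝ) : ℂ) := by
    have := h.1.continuous
    fun_prop
  have h0 := weylInt_coe 1 _ (Integrable.coeFn_toL1 (integrable_weylGaussian (V := V))) hg h.memLp
  rw [h.toLp] at h0
  refine Lp.ext ?_
  filter_upwards [h0, Lp.coeFn_smul ((|(Real.pi ^ Module.finrank ℝ V)⁻¹| * gaussMass V : ℝ) *
    star (F 0) : ℂ) (coherent (0 : V)), (isFock_vacuum (V := V)).2] with x hx hx1 hx2
  rw [hx, hx1, Pi.smul_apply, hx2]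
  set Q : V → ℂ := fun u => ((Real.exp (-‖u‖ ^ 2) : ℝ) : ℂ) *
    (Complex.exp (-(2 * (inner ℂ x u : ℂ).im : ℝ) * Complex.I) *
      (star (F (x + u)) * ((Real.exp (-‖x + u‖ ^ 2) : ℝ) : ℂ))) with hQ
  have h1 : ∀ w : V, ((Real.exp (-Real.pi ^ 2 * ‖w‖ ^ 2) : ℝ) : ℂ) * (character w x *
      (star (F (x + -(Complex.I * Real.pi * (1 : ℝ) : ℂ) • w)) *
        ((Real.exp (-‖x + -(Complex.I * Real.pi * (1 : ℝ) : ℂ) • w‖ ^ 2) : ℝ) : ℂ))) =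
      Q ((-(Complex.I * Real.pi) : ℂ) • w) := fun w => by
    rw [hQ]
    simp only [Complex.ofReal_one, mul_one]
    congr 2
    · congr 2
      rw [norm_smul, mul_pow]
      simp
    · rw [character_apply, inner_smul_right]
      congr 2
      simp
      ring
  simp only [h1]
  have h2 := integral_comp_complex_smul Q Real.pi
  rw [h2, ← integral_sub_right_eq_self Q x]
  have h3 : ∀ y : V, Q (y - x) = ((Real.exp (-‖x‖ ^ 2) : ℝ) : ℂ) * starRingEnd ℂ
      (((Real.exp (-2 * ‖y‖ ^ 2) : ℝ) : ℂ) * (Complex.exp (2 * inner ℂ x y) * F y)) := fun y => by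
    rw [hQ]
    simp only [add_sub_cancel]
    have hre : (inner ℂ x y : ℂ) =
      ((inner ℂ x y : ℂ).re : ℂ) + ((inner ℂ x y : ℂ).im : ℂ) * Complex.I :=
      (Complex.re_add_im _).symm
    have hn : ‖y - x‖ ^ 2 = ‖y‖ ^ 2 - 2 * (inner ℂ x y : ℂ).re + ‖x‖ ^ 2 := by
      rw [@norm_sub_sq ℂ, inner_re_symm]
      rfl
    have him : (inner ℂ x (y - x) : ℂ).im = (inner ℂ x y : ℂ).im := by
      rw [inner_sub_right, Complex.sub_im]
      have := omega_self x
      rw [omega] at this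
      rw [this, sub_zero]
    rw [him, map_mul, map_mul, Complex.conj_ofReal, ← Complex.exp_conj, ← starRingEnd_apply]
    simp only [Complex.ofReal_exp]
    have e1 : ∀ a b c d : ℂ, Complex.exp a * (Complex.exp b * (c * Complex.exp d)) =
      Complex.exp (a + b + d) * c := fun a b c d => by
        rw [Complex.exp_add, Complex.exp_add]; ring
    have e2 : ∀ a b c d : ℂ, Complex.exp a * (Complex.exp b * (Complex.exp c * d)) =
      Complex.exp (a + b + c) * d := fun a b c d => by
        rw [Complex.exp_add, Complex.exp_add]; ring
    rw [e1, e2]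
    congr 2
    rw [hn, map_mul, hre]
    simp only [map_add, map_mul, Complex.conj_ofReal, Complex.conj_I, map_ofNat]
    simp
    ring
  have hG : Differentiable ℂ fun y : V => Complex.exp (2 * inner ℂ x y) * F y :=
    ((innerSL ℂ x).differentiable.const_mul 2).cexp.mul h.1
  have hint : Integrable (fun y : V => ((Real.exp (-2 * ‖y‖ ^ 2) : ℝ) : ℂ) *
      (Complex.exp (2 * inner ℂ x y) * F y)) (leb V) := by
    have hF := h.1.continuous
    refine (L2.integrable_inner (𝕜 := ℂ) f (coherent x)).norm.mono'
      (Continuous.aestronglyMeasurable (by fun_prop)) ?_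
    filter_upwards [h.2, (isFock_coherent x).2] with y hy hy1
    rw [hy, hy1, RCLike.inner_apply]
    simp only [norm_mul, norm_star, RCLike.norm_conj, Complex.norm_real,
      Real.norm_of_nonneg (Real.exp_pos _).le]
    rw [show -2 * ‖y‖ ^ 2 = -‖y‖ ^ 2 + -‖y‖ ^ 2 by ring, Real.exp_add]
    refine le_of_eq ?_
    ring
  simp only [h3]
  rw [integral_const_mul, integral_conj, integral_gaussian_mul hG hint, map_mul,
    Complex.conj_ofReal, inner_zero_right, mul_zero, Complex.exp_zero, one_mul, Complex.real_smul,
    smul_eq_mul, star_one, one_mul, ← starRingEnd_apply]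
  push_cast
  rw [gaussMass]
  ring

end Coherent

/-! ## The Bargmann–Fock representation is faithful -/

section FockRep

set_option linter.unusedSectionVars false

open Filter Topology
open scoped FourierTransform

theorem integral_mem_of_isClosed {X E : Type*} [MeasurableSpace X] {μ : Measure X}
    [NormedAddCommGroup E] [NormedSpace ℂ E] [CompleteSpace E] (K : Submodule ℂ E)
    (hK : IsClosed (K : Set E)) {f : X → E} (hf : ∀ x, f x ∈ K) : ∫ x, f x ∂μ ∈ K := by
  by_cases hi : Integrable f μ
  · have h := K.mkQL.integral_comp_comm hi
    have h0 : ∀ x, K.mkQL (f x) = 0 := fun x => by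
      rw [Submodule.mkQL_apply]
      exact (Submodule.Quotient.mk_eq_zero K).2 (hf x)
    simp only [h0, integral_zero] at h
    rw [Submodule.mkQL_apply] at h
    exact (Submodule.Quotient.mk_eq_zero K).1 h.symm
  · rw [integral_undef hi]
    exact zero_mem _

variable {V : Type*} [NormedAddCommGroup V] [InnerProductSpace ℂ V] [FiniteDimensional ℂ V]
  [MeasurableSpace V] [BorelSpace V]

attribute [local instance] InnerProductSpace.complexToReal

theorem exists_fourier_eq (g : 𝓢(V, ℂ)) : ∃ f : 𝓢(V, ℂ), 𝓕 f = g :=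
  ⟨𝓕⁻ g, FourierTransform.fourier_fourierInv_eq g⟩

theorem weylInt_mem (F : L1 V) : weylInt 1 F ∈ closedAdjoin (moyalOperators V 1) := by
  have h : DenseRange (SchwartzMap.toLpCLM ℝ (E := V) ℂ 1 (leb V)) :=
    SchwartzMap.denseRange_toLpCLM (by simp)
  have hc : IsClosed {F : L1 V | weylInt 1 F ∈ closedAdjoin (moyalOperators V 1)} :=
    (NonUnitalStarSubalgebra.isClosed_topologicalClosure _).preimage (weylInt 1).continuous
  have hsub : Set.range (SchwartzMap.toLpCLM ℝ (E := V) ℂ 1 (leb V)) ⊆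
      {F : L1 V | weylInt 1 F ∈ closedAdjoin (moyalOperators V 1)} := by
    rintro _ ⟨g, rfl⟩
    obtain ⟨f, rfl⟩ := exists_fourier_eq g
    refine subset_closure (NonUnitalStarAlgebra.subset_adjoin ℂ _ ?_)
    exact ⟨f, isLeftMoyal_quant one_ne_zero f⟩
  exact hc.closure_subset_iff.2 hsub (h F)

theorem ae_eq_zero_of_integral_character {h : V → ℂ} (hh : Integrable h (leb V))
    (h0 : ∀ a : V, ∫ x, character a x * h x ∂(leb V) = 0) : h =ᵐ[leb V] 0 := by
  refine ae_eq_zero_of_integral_contDiff_smul_eq_zero hh.locallyIntegrable fun g hg hgc => ?_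
  have hg' : HasCompactSupport fun x => (g x : ℂ) := hgc.comp_left (g := fun r : ℝ => (r : ℂ)) rfl
  have hg2 : ContDiff ℝ (⊤ : ℕ∞) fun x => (g x : ℂ) := Complex.ofRealCLM.contDiff.comp hg
  obtain ⟨f, hf⟩ := exists_fourier_eq (hg'.toSchwartzMap hg2)
  have h1 : ∀ x, (g x : ℂ) = ∫ y, character (-x) y * f y ∂(leb V) := fun x => by
    rw [← fourier_eq_character, ← SchwartzMap.fourier_coe, hf]
    rfl
  have hsymm : ∀ x y : V, character (-x) y = character (-y) x := fun x y => by
    rw [character_apply, character_apply, inner_neg_right, inner_neg_right, Complex.neg_re,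
      Complex.neg_re]
    have : (inner ℂ x y : ℂ).re = (inner ℂ y x : ℂ).re := inner_re_symm (𝕜 := ℂ) x y
    rw [this]
  have hint : Integrable (fun p : V × V => character (-p.2) p.1 * f p.2 * h p.1)
      ((leb V).prod (leb V)) := by
    refine (hh.mul_prod f.integrable).mono ?_ (Eventually.of_forall fun p => ?_)
    · refine AEStronglyMeasurable.mul (Continuous.aestronglyMeasurable ?_)
        hh.aestronglyMeasurable.comp_fst
      have := f.continuous
      simp only [character_apply]
      fun_prop
    · simp [norm_character, mul_comm]
  calc ∫ x, g x • h x ∂(leb V)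
      = ∫ x, ∫ y, character (-y) x * f y * h x ∂(leb V) ∂(leb V) := by
        refine integral_congr_ae (Eventually.of_forall fun x => ?_)
        simp only
        rw [integral_mul_const, ← Complex.coe_smul, h1, smul_eq_mul]
        simp only [hsymm x]
    _ = ∫ y, ∫ x, character (-y) x * f y * h x ∂(leb V) ∂(leb V) := integral_integral_swap hint
    _ = 0 := by
        refine integral_eq_zero_of_ae (Eventually.of_forall fun y => ?_)
        simp only [mul_right_comm _ (f y), integral_mul_const, h0, zero_mul, Pi.zero_apply]

theorem coherent_zero_coe :
    (coherent (0 : V) : V → ℂ) =ᵐ[leb V] fun x => ((Real.exp (-‖x‖ ^ 2) : ℝ) : ℂ) := by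
  filter_upwards [(isFock_vacuum (V := V)).2] with x hx
  rw [hx, star_one, one_mul]

/-- The translates of the vacuum under both families of Weyl operators are total. -/
theorem eq_zero_of_inner_weyl_weyl {g : L2 V}
    (h : ∀ w : V, inner ℂ (weyl (-1) w (weyl 1 w (coherent 0))) g = 0) : g = 0 := by
  have hcoe : ∀ w : V, (weyl (-1) w (weyl 1 w (coherent 0)) : V → ℂ) =ᵐ[leb V]
      fun x => character (w + w) x * ((Real.exp (-‖x‖ ^ 2) : ℝ) : ℂ) := fun w => by
    have hc := (isWeightedComp_weyl (-1) w).comp (isWeightedComp_weyl (V := V) 1 w)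
    have hx0 : ∀ x : V, x + -(Complex.I * Real.pi * (-1 : ℝ) : ℂ) • w +
        -(Complex.I * Real.pi * (1 : ℝ) : ℂ) • w = x := fun x => by
      push_cast
      module
    filter_upwards [hc.2 (coherent 0), coherent_zero_coe (V := V)] with x hx hx1
    rw [hx, hx0, hx1, character_add_right, character_shift, character_add]
    simp [cocycle, omega_self]
  have hint : Integrable (fun x => ((Real.exp (-‖x‖ ^ 2) : ℝ) : ℂ) * (g : V → ℂ) x) (leb V) := by
    refine (L2.integrable_inner (𝕜 := ℂ) (coherent (0 : V)) g).congr ?_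
    filter_upwards [coherent_zero_coe (V := V)] with x hx
    rw [hx, RCLike.inner_apply, Complex.conj_ofReal, mul_comm]
  have h1 := ae_eq_zero_of_integral_character hint fun a => by
    rw [← h (-(2⁻¹ : ℂ) • a), L2.inner_def]
    refine integral_congr_ae ?_
    filter_upwards [hcoe (-(2⁻¹ : ℂ) • a)] with x hx
    have ha : -(2⁻¹ : ℂ) • a + -(2⁻¹ : ℂ) • a = -a := by module
    rw [hx, ha, RCLike.inner_apply, map_mul, conj_character, neg_neg, Complex.conj_ofReal]
    ring
  refine Lp.ext ?_
  filter_upwards [h1, Lp.coeFn_zero ℂ 2 (leb V)] with x hx hx1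
  rw [hx1]
  refine (mul_eq_zero.1 hx).resolve_left ?_
  exact_mod_cast (Real.exp_pos _).ne'

theorem weyl_mem_fockSpace (w : V) {f : L2 V} (hf : f ∈ fockSpace V) :
    weyl 1 w f ∈ fockSpace V := by
  obtain ⟨F, hF⟩ := hf
  exact ⟨_, IsFock.weyl hF w⟩

theorem l2Act_mem_fockSpace (u : V ≃ₗᵢ[ℂ] V) {f : L2 V} (hf : f ∈ fockSpace V) :
    l2Act u f ∈ fockSpace V := by
  obtain ⟨F, hF, hf⟩ := hf
  refine ⟨fun x => F (u.symm x), hF.comp (u.symm.toContinuousLinearEquiv.differentiable), ?_⟩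
  filter_upwards [l2Act_coe u f,
    (measurePreserving_unitary u.symm).quasiMeasurePreserving.ae_eq hf] with x h1 h2
  simp only [Function.comp, LinearIsometryEquiv.norm_map] at h2
  rw [h1, h2]

theorem eq_quant_of_mem_moyalOperators {T : BL2 V} (hT : T ∈ moyalOperators V 1) :
    ∃ f, T = quant 1 f := by
  obtain ⟨f, hf⟩ := hT
  exact ⟨f, hf.unique (isLeftMoyal_quant one_ne_zero f)⟩

/-- The Weyl algebra leaves the Fock space invariant. -/
theorem incl_apply_mem (a : WeylAlgebra V 1) {f : L2 V} (hf : f ∈ fockSpace V) :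
    Generated.incl (moyalOperators V 1) a f ∈ fockSpace V := by
  have h : (∀ f ∈ fockSpace V, Generated.incl (moyalOperators V 1) a f ∈ fockSpace V) ∧
      ∀ f ∈ fockSpace V, star (Generated.incl (moyalOperators V 1) a) f ∈ fockSpace V := by
    refine closedAdjoin_induction (p := fun T : BL2 V =>
      (∀ f ∈ fockSpace V, T f ∈ fockSpace V) ∧ ∀ f ∈ fockSpace V, star T f ∈ fockSpace V)
      ?_ ?_ ?_ ?_ ?_ ?_ ?_ a.2
    · intro T hT
      obtain ⟨φ, rfl⟩ := eq_quant_of_mem_moyalOperators hT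
      have hq : ∀ (φ : 𝓢(V, ℂ)), ∀ f ∈ fockSpace V, quant 1 φ f ∈ fockSpace V := fun φ f hf => by
        rw [quant_apply]
        exact integral_mem_of_isClosed _ isClosed_fockSpace fun w =>
          Submodule.smul_mem _ _ (weyl_mem_fockSpace w hf)
      exact ⟨hq φ, by rw [star_quant]; exact hq _⟩
    · exact ⟨fun f _ => zero_mem _, by rw [star_zero]; exact fun f _ => zero_mem _⟩
    · rintro S T ⟨h1, h2⟩ ⟨h3, h4⟩
      refine ⟨fun f hf => add_mem (h1 f hf) (h3 f hf), ?_⟩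
      rw [star_add]
      exact fun f hf => add_mem (h2 f hf) (h4 f hf)
    · rintro S T ⟨h1, h2⟩ ⟨h3, h4⟩
      refine ⟨fun f hf => h1 _ (h3 f hf), ?_⟩
      rw [star_mul]
      exact fun f hf => h4 _ (h2 f hf)
    · rintro c T ⟨h1, h2⟩
      refine ⟨fun f hf => Submodule.smul_mem _ c (h1 f hf), ?_⟩
      rw [star_smul]
      exact fun f hf => Submodule.smul_mem _ _ (h2 f hf)
    · rintro T ⟨h1, h2⟩
      refine ⟨h2, ?_⟩
      rw [star_star]
      exact h1
    · have hc : ∀ φ : BL2 V → BL2 V, Continuous φ →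
          IsClosed {T : BL2 V | ∀ f ∈ fockSpace V, φ T f ∈ fockSpace V} := fun φ hφ => by
        simp only [Set.ofPred_forall]
        exact isClosed_biInter fun f _ => isClosed_fockSpace.preimage
          ((ContinuousLinearMap.apply ℂ (L2 V) f).continuous.comp hφ)
      exact (hc _ continuous_id).inter (hc _ continuous_star)
  exact h.1 f hf

/-- The Weyl algebra commutes with right Moyal multiplication by characters. -/
theorem incl_weyl_neg (a : WeylAlgebra V 1) (w : V) (f : L2 V) :
    Generated.incl (moyalOperators V 1) a (weyl (-1) w f) =
      weyl (-1) w (Generated.incl (moyalOperators V 1) a f) := by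
  have h : ∀ w f, Generated.incl (moyalOperators V 1) a (weyl (-1) w f) =
      weyl (-1) w (Generated.incl (moyalOperators V 1) a f) := by
    refine closedAdjoin_induction (p := fun T : BL2 V => ∀ w f, T (weyl (-1) w f) =
      weyl (-1) w (T f)) ?_ ?_ ?_ ?_ ?_ ?_ ?_ a.2
    · intro T hT w f
      obtain ⟨φ, rfl⟩ := eq_quant_of_mem_moyalOperators hT
      rw [quant_apply, quant_apply]
      have h1 := (weyl (-1) w).toContinuousLinearMap.integral_comp_comm
        (integrable_smul_weyl 1 (𝓕 φ).integrable f)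
      refine Eq.trans ?_ h1
      refine integral_congr_ae (Eventually.of_forall fun w' => ?_)
      change _ = weyl (-1) w (_ • _)
      rw [map_smul, ← weyl_comm_neg]
    · intro w f
      exact (map_zero (weyl (-1) w)).symm
    · intro S T h1 h2 w f
      rw [_root_.add_apply, _root_.add_apply, h1, h2, map_add]
    · intro S T h1 h2 w f
      rw [mul_apply_eq_comp, mul_apply_eq_comp, h2, h1]
    · intro c T h w f
      rw [_root_.smul_apply, _root_.smul_apply, h, map_smul]
    · intro T h w f
      refine ext_inner_left ℂ fun v => ?_
      rw [ContinuousLinearMap.star_eq_adjoint, ContinuousLinearMap.adjoint_inner_right]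
      have h3 : inner ℂ v (weyl (-1) w (ContinuousLinearMap.adjoint T f)) =
          inner ℂ (weyl (-1) (-w) v) (ContinuousLinearMap.adjoint T f) := by
        rw [inner_weyl_left, neg_neg]
      rw [h3, ContinuousLinearMap.adjoint_inner_right, h, inner_weyl_left, neg_neg]
    · simp only [Set.ofPred_forall]
      refine isClosed_iInter fun w => isClosed_iInter fun f => isClosed_eq ?_ ?_
      · exact (ContinuousLinearMap.apply ℂ (L2 V) _).continuous
      · exact (weyl (-1) w).continuous.comp (ContinuousLinearMap.apply ℂ (L2 V) f).continuous
  exact h w f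

variable (V) in
/-- The Fock space as a Hilbert space. -/
def Fock : Type _ := fockSpace V

instance : NormedAddCommGroup (Fock V) := inferInstanceAs (NormedAddCommGroup (fockSpace V))

instance : InnerProductSpace ℂ (Fock V) := inferInstanceAs (InnerProductSpace ℂ (fockSpace V))

instance : CompleteSpace (Fock V) := inferInstanceAs (CompleteSpace (fockSpace V))

/-- The restriction to the Fock space of an operator that leaves it invariant. -/
def Fock.restrict (T : BL2 V) (h : ∀ f ∈ fockSpace V, T f ∈ fockSpace V) : Fock V →L[ℂ] Fock V :=
  T.restrict h

theorem Fock.restrict_val (T : BL2 V) (h : ∀ f ∈ fockSpace V, T f ∈ fockSpace V) (f : Fock V) :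
    (Fock.restrict T h f).1 = T f.1 := rfl

/-- The inclusion of the Fock space. -/
def Fock.subtypeL : Fock V →L[ℂ] L2 V := (fockSpace V).subtypeL

theorem Fock.inner_val (f g : Fock V) : inner ℂ f.1 g.1 = inner ℂ f g := rfl

variable (V) in
/-- The Bargmann–Fock representation. -/
def fockRep : WeylAlgebra V 1 →⋆ₙₐ[ℂ] (Fock V →L[ℂ] Fock V) where
  toFun a := Fock.restrict (Generated.incl (moyalOperators V 1) a) fun _ hf => incl_apply_mem a hf
  map_smul' _ _ := rfl
  map_zero' := rfl
  map_add' _ _ := rfl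
  map_mul' _ _ := rfl
  map_star' a := by
    rw [ContinuousLinearMap.star_eq_adjoint, ContinuousLinearMap.eq_adjoint_iff]
    intro f g
    rw [← Fock.inner_val, ← Fock.inner_val, Fock.restrict_val, Fock.restrict_val, map_star,
      ContinuousLinearMap.star_eq_adjoint, ContinuousLinearMap.adjoint_inner_left]

theorem fockRep_val (a : WeylAlgebra V 1) (f : Fock V) :
    (fockRep V a f).1 = Generated.incl (moyalOperators V 1) a f.1 := rfl

theorem fockRep_injective : Function.Injective (fockRep V) := by
  rw [injective_iff_map_eq_zero]
  intro a ha
  have h0 : ∀ f ∈ fockSpace V, Generated.incl (moyalOperators V 1) a f = 0 := fun f hf => by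
    have := congrArg (fun T : Fock V →L[ℂ] Fock V => (T ⟨f, hf⟩).1) ha
    exact this
  refine Generated.incl_injective ?_
  rw [map_zero]
  refine ContinuousLinearMap.ext fun g => ?_
  refine ext_inner_left ℂ fun v => ?_
  rw [_root_.zero_apply, inner_zero_right, ← ContinuousLinearMap.adjoint_inner_left]
  have hz : ContinuousLinearMap.adjoint (Generated.incl (moyalOperators V 1) a) v = 0 := by
    refine eq_zero_of_inner_weyl_weyl fun w => ?_
    rw [ContinuousLinearMap.adjoint_inner_right, incl_weyl_neg, h0, map_zero, inner_zero_left]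
    exact weyl_mem_fockSpace w ⟨_, isFock_vacuum⟩
  rw [hz, inner_zero_left]

theorem norm_fockRep (a : WeylAlgebra V 1) : ‖fockRep V a‖ = ‖a‖ :=
  NonUnitalStarAlgHom.norm_map (fockRep V) fockRep_injective a

end FockRep

/-! ## The Weyl algebra is the algebra of compact operators on the Fock space -/

section FockCompact

set_option linter.unusedSectionVars false

open Filter Topology InnerProductSpace
open scoped FourierTransform

section RankOne

variable {E : Type*} [NormedAddCommGroup E] [InnerProductSpace ℂ E]

theorem continuous_rankOne : Continuous fun p : E × E => rankOne ℂ p.1 p.2 := by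
  have h : Continuous fun p : E × E => (innerSL ℂ p.2 : E →L[ℂ] ℂ) :=
    (innerSL ℂ).continuous.comp continuous_snd
  exact ((ContinuousLinearMap.smulRightL ℂ E E).continuous.comp h).clm_apply continuous_fst

variable (E) in
/-- The closed linear span of the operators of rank one. -/
def rankOneSpan : Submodule ℂ (E →L[ℂ] E) :=
  (Submodule.span ℂ (Set.range fun p : E × E => rankOne ℂ p.1 p.2)).topologicalClosure

theorem isClosed_rankOneSpan : IsClosed (rankOneSpan E : Set (E →L[ℂ] E)) :=
  Submodule.isClosed_topologicalClosure _

theorem rankOne_mem (h k : E) : rankOne ℂ h k ∈ rankOneSpan E :=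
  Submodule.le_topologicalClosure _ (Submodule.subset_span ⟨(h, k), rfl⟩)

/-- Induction in the closure of the span of a set. -/
theorem closedSpan_induction {F : Type*} [NormedAddCommGroup F] [NormedSpace ℂ F] {s : Set F}
    {p : F → Prop} (h1 : ∀ x ∈ s, p x) (h0 : p 0) (hadd : ∀ x y, p x → p y → p (x + y))
    (hsmul : ∀ (c : ℂ) x, p x → p (c • x)) (hcl : IsClosed {x | p x})
    {x : F} (hx : x ∈ (Submodule.span ℂ s).topologicalClosure) : p x := by
  refine hcl.closure_subset_iff.2 (fun y hy => ?_) hx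
  exact Submodule.span_induction (p := fun y _ => p y) h1 h0 (fun x y _ _ => hadd x y)
    (fun c x _ => hsmul c x) hy

theorem rankOneSpan_induction {p : (E →L[ℂ] E) → Prop}
    (h1 : ∀ h k, p (rankOne ℂ h k)) (h0 : p 0) (hadd : ∀ S T, p S → p T → p (S + T))
    (hsmul : ∀ (c : ℂ) T, p T → p (c • T)) (hcl : IsClosed {T | p T})
    {T : E →L[ℂ] E} (hT : T ∈ rankOneSpan E) : p T :=
  closedSpan_induction (by rintro _ ⟨⟨h, k⟩, rfl⟩; exact h1 h k) h0 hadd hsmul hcl hT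

theorem mul_rankOne (S : E →L[ℂ] E) (h k : E) : S * rankOne ℂ h k = rankOne ℂ (S h) k := by
  refine ContinuousLinearMap.ext fun f => ?_
  rw [mul_apply_eq_comp, rankOne_apply, rankOne_apply, map_smul]

theorem rankOneSpan_mul {S T : E →L[ℂ] E} (hT : T ∈ rankOneSpan E) : S * T ∈ rankOneSpan E := by
  refine rankOneSpan_induction (p := fun T => S * T ∈ rankOneSpan E) (fun h k => ?_) ?_ ?_ ?_ ?_ hT
  · rw [mul_rankOne]
    exact rankOne_mem _ _
  · rw [mul_zero]
    exact zero_mem _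
  · intro A B hA hB
    rw [mul_add]
    exact add_mem hA hB
  · intro c A hA
    rw [mul_smul_comm]
    exact Submodule.smul_mem _ _ hA
  · exact isClosed_rankOneSpan.preimage (continuous_const_mul S)

variable [CompleteSpace E]

theorem rankOneSpan_star {T : E →L[ℂ] E} (hT : T ∈ rankOneSpan E) : star T ∈ rankOneSpan E := by
  refine rankOneSpan_induction (p := fun T => star T ∈ rankOneSpan E) (fun h k => ?_) ?_ ?_ ?_ ?_ hT
  · rw [ContinuousLinearMap.star_eq_adjoint, adjoint_rankOne]
    exact rankOne_mem _ _
  · rw [star_zero]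
    exact zero_mem _
  · intro A B hA hB
    rw [star_add]
    exact add_mem hA hB
  · intro c A hA
    rw [star_smul]
    exact Submodule.smul_mem _ _ hA
  · exact isClosed_rankOneSpan.preimage continuous_star

end RankOne

variable {V : Type*} [NormedAddCommGroup V] [InnerProductSpace ℂ V] [FiniteDimensional ℂ V]
  [MeasurableSpace V] [BorelSpace V]

attribute [local instance] InnerProductSpace.complexToReal

/-- The element `∫ F(w) M(w) dw` of the Weyl algebra. -/
def ofL1 (F : L1 V) : WeylAlgebra V 1 := ⟨weylInt 1 F, weylInt_mem F⟩

theorem incl_ofL1 (F : L1 V) : Generated.incl (moyalOperators V 1) (ofL1 F) = weylInt 1 F := rfl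

/-- The coherent states, in the Fock space. -/
def coh (z : V) : Fock V := ⟨coherent z, ⟨_, isFock_coherent z⟩⟩

/-- The Weyl operators on the Fock space. -/
def fockWeyl (w : V) : Fock V →L[ℂ] Fock V :=
  Fock.restrict (weyl 1 w).toContinuousLinearMap fun _ hf => weyl_mem_fockSpace w hf

theorem inner_fockWeyl (w : V) (f g : Fock V) :
    inner ℂ (fockWeyl w f) g = inner ℂ f (fockWeyl (-w) g) :=
  inner_weyl_left 1 w f.1 g.1

theorem continuous_fockWeyl (f : Fock V) : Continuous fun w : V => fockWeyl w f :=
  Continuous.subtype_mk (continuous_weyl 1 f.1) _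

theorem span_coh : (Submodule.span ℂ (Set.range (coh (V := V)))).topologicalClosure = ⊤ := by
  rw [Submodule.topologicalClosure_eq_top_iff, Submodule.eq_bot_iff]
  intro f hf
  refine Subtype.ext (eq_zero_of_inner_coherent f.2 fun z => ?_)
  exact (Submodule.mem_orthogonal _ _).1 hf (coh z) (Submodule.subset_span ⟨z, rfl⟩)

theorem coh_eq_smul_fockWeyl (z : V) : ∃ (c : ℂ) (w : V), coh z = c • fockWeyl w (coh 0) := by
  set w : V := (-(Complex.I * (Real.pi⁻¹ : ℝ)) : ℂ) • z with hw
  have hp : (Real.pi : ℂ) ≠ 0 := by exact_mod_cast Real.pi_ne_zero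
  have hz : z = (Complex.I * Real.pi : ℂ) • w := by
    rw [hw, smul_smul]
    have : (Complex.I * Real.pi * -(Complex.I * (Real.pi⁻¹ : ℝ)) : ℂ) = 1 := by
      push_cast
      field_simp
      simp
    rw [this, one_smul]
  have h := weyl_vacuum w
  rw [← hz] at h
  refine ⟨((Real.exp (-(Real.pi ^ 2 * ‖w‖ ^ 2)) : ℝ) : ℂ)⁻¹, w, Subtype.ext ?_⟩
  change coherent z = _ • weyl 1 w (coherent 0)
  rw [h, inv_smul_smul₀]
  exact_mod_cast (Real.exp_pos _).ne'

/-- The Gaussian acts as a multiple of the projection onto the vacuum. -/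
theorem fockRep_gaussian : ∃ c : ℂ, c ≠ 0 ∧
    fockRep V (ofL1 (integrable_weylGaussian.toL1 _)) = c • rankOne ℂ (coh 0) (coh (0 : V)) := by
  refine ⟨((|(Real.pi ^ Module.finrank ℝ V)⁻¹| : ℝ) : ℂ), ?_, ?_⟩
  · have : (0 : ℝ) < |(Real.pi ^ Module.finrank ℝ V)⁻¹| :=
      abs_pos.2 (inv_ne_zero (pow_ne_zero _ Real.pi_ne_zero))
    exact_mod_cast this.ne'
  · refine ContinuousLinearMap.ext fun f => Subtype.ext ?_
    obtain ⟨F, hF⟩ := f.2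
    have h1 := weylInt_gaussian hF
    rw [fockRep_val, incl_ofL1, h1]
    rw [_root_.smul_apply, rankOne_apply]
    change _ = _ • ((inner ℂ (coherent (0 : V)) f.1 : ℂ) • coherent (0 : V))
    rw [inner_vacuum hF, smul_smul]
    congr 1
    push_cast
    ring

/-- Multiplication by Weyl operators from both sides. -/
theorem exists_ofL1_eq (w w' : V) (F : L1 V) : ∃ F' : L1 V,
    ∀ f, weylInt 1 F' f = weyl 1 w (weylInt 1 F (weyl 1 w' f)) := by
  have hF := L1.integrable_coeFn F
  have hc : Continuous fun v : V => cocycle 1 w (v - (w + w')) * cocycle 1 (v - w') w' := by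
    simp only [cocycle, omega]
    fun_prop
  have hi : Integrable (fun v : V => (cocycle 1 w (v - (w + w')) * cocycle 1 (v - w') w') *
      (F : V → ℂ) (v - (w + w'))) (leb V) := by
    refine (hF.comp_sub_right (w + w')).bdd_mul (c := 1) hc.aestronglyMeasurable ?_
    exact Eventually.of_forall fun v => by rw [norm_mul, norm_cocycle, norm_cocycle, one_mul]
  refine ⟨hi.toL1 _, fun f => ?_⟩
  rw [weylInt_apply_of_ae 1 _ hi.coeFn_toL1, weylInt_apply,
    ← integral_add_right_eq_self _ (w + w')]
  refine Eq.trans ?_ ((weyl 1 w).toContinuousLinearMap.integral_comp_comm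
    (integrable_smul_weyl 1 hF (weyl 1 w' f)))
  refine integral_congr_ae (Eventually.of_forall fun v => ?_)
  change _ = weyl 1 w (_ • _)
  rw [map_smul, weyl_weyl, weyl_weyl]
  simp only [add_sub_cancel_right, smul_smul]
  have h1 : v + (w + w') - w' = w + v := by abel
  have h2 : v + (w + w') = w + (v + w') := by abel
  have h3 : cocycle 1 w (v + w') * cocycle 1 v w' = cocycle 1 w v * cocycle 1 (w + v) w' := by
    rw [cocycle, cocycle, cocycle, cocycle, ← Complex.exp_add, ← Complex.exp_add]
    simp only [omega, inner_add_left, inner_add_right, Complex.add_im]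
    congr 1
    push_cast
    ring
  rw [h1, h2, ← h3, add_assoc w v w']
  congr 1
  ring

theorem isClosed_range_fockRep : IsClosed (Set.range (fockRep V)) := by
  have h : Isometry (fockRep V) := Isometry.of_dist_eq fun a b => by
    rw [dist_eq_norm, dist_eq_norm, ← map_sub, norm_fockRep]
  exact h.isClosedEmbedding.isClosed_range

/-- Every operator of rank one on the Fock space belongs to the Weyl algebra. -/
theorem exists_rankOne (h k : Fock V) : ∃ a, fockRep V a = rankOne ℂ h k := by
  have hmem : ∀ k : Fock V, k ∈ (Submodule.span ℂ (Set.range (coh (V := V)))).topologicalClosure :=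
    fun k => by rw [span_coh]; trivial
  have h0 : (0 : Fock V →L[ℂ] Fock V) ∈ Set.range (fockRep V) := ⟨0, map_zero _⟩
  have hadd : ∀ S T : Fock V →L[ℂ] Fock V, S ∈ Set.range (fockRep V) → T ∈ Set.range (fockRep V) →
      S + T ∈ Set.range (fockRep V) := by
    rintro _ _ ⟨a, rfl⟩ ⟨b, rfl⟩
    exact ⟨a + b, map_add _ a b⟩
  have hsmul : ∀ (c : ℂ) (S : Fock V →L[ℂ] Fock V), S ∈ Set.range (fockRep V) →
      c • S ∈ Set.range (fockRep V) := by
    rintro c _ ⟨a, rfl⟩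
    exact ⟨c • a, map_smul _ c a⟩
  have h1 : ∀ w w' : V, rankOne ℂ (fockWeyl w (coh 0)) (fockWeyl w' (coh 0)) ∈
      Set.range (fockRep V) := fun w w' => by
    obtain ⟨c, hc, h⟩ := fockRep_gaussian (V := V)
    obtain ⟨F', hF'⟩ := exists_ofL1_eq w (-w') (integrable_weylGaussian.toL1 _)
    refine ⟨c⁻¹ • ofL1 F', ContinuousLinearMap.ext fun f => ?_⟩
    rw [map_smul, _root_.smul_apply, inv_smul_eq_iff₀ hc, rankOne_apply, inner_fockWeyl]
    have h2 := congrArg (fun T : Fock V →L[ℂ] Fock V => fockWeyl w (T (fockWeyl (-w') f))) h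
    simp only [_root_.smul_apply, rankOne_apply, map_smul] at h2
    refine Eq.trans (Subtype.ext ?_) h2
    exact hF' f.1
  have h2 : ∀ z z' : V, rankOne ℂ (coh z) (coh z') ∈ Set.range (fockRep V) := fun z z' => by
    obtain ⟨c, w, hw⟩ := coh_eq_smul_fockWeyl z
    obtain ⟨c', w', hw'⟩ := coh_eq_smul_fockWeyl z'
    rw [hw, hw', map_smulₛₗ, map_smul, _root_.smul_apply]
    exact hsmul _ _ (hsmul _ _ (h1 w w'))
  have h3 : ∀ (z : V) (k : Fock V), rankOne ℂ (coh z) k ∈ Set.range (fockRep V) := fun z k => by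
    refine closedSpan_induction (p := fun k => rankOne ℂ (coh z) k ∈ Set.range (fockRep V))
      ?_ ?_ ?_ ?_ ?_ (hmem k)
    · rintro _ ⟨z', rfl⟩
      exact h2 z z'
    · rw [map_zero]
      exact h0
    · intro x y hx hy
      rw [map_add]
      exact hadd _ _ hx hy
    · intro c x hx
      rw [map_smulₛₗ]
      exact hsmul _ _ hx
    · exact isClosed_range_fockRep.preimage
        (continuous_rankOne.comp (by fun_prop : Continuous fun k : Fock V => (coh z, k)))
  refine closedSpan_induction (p := fun h => rankOne ℂ h k ∈ Set.range (fockRep V))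
    ?_ ?_ ?_ ?_ ?_ (hmem h)
  · rintro _ ⟨z, rfl⟩
    exact h3 z k
  · rw [map_zero]
    exact h0
  · intro x y hx hy
    rw [map_add]
    exact hadd _ _ hx hy
  · intro c x hx
    rw [map_smul]
    exact hsmul _ _ hx
  · exact isClosed_range_fockRep.preimage
      (continuous_rankOne.comp (by fun_prop : Continuous fun h : Fock V => (h, k)))

end FockCompact

section FockDensity

set_option linter.unusedSectionVars false

open Filter Topology InnerProductSpace
open scoped FourierTransform

variable {V : Type*} [NormedAddCommGroup V] [InnerProductSpace ℂ V] [FiniteDimensional ℂ V]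
  [MeasurableSpace V] [BorelSpace V]

attribute [local instance] InnerProductSpace.complexToReal

theorem integrable_smul_inner {E : Type*} [NormedAddCommGroup E] [InnerProductSpace ℂ E]
    {c : V → ℂ} (hc : Integrable c (leb V)) {v : V → E} (hv : Continuous v) {C : ℝ}
    (hC : ∀ y, ‖v y‖ = C) (f : E) :
    Integrable (fun y => c y • ((inner ℂ (v y) f : ℂ) • v y)) (leb V) := by
  refine (hc.norm.mul_const (C * ‖f‖ * C)).mono' ?_ (Eventually.of_forall fun y => ?_)
  · have h : Continuous fun y => (inner ℂ (v y) f : ℂ) • v y := by fun_prop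
    exact hc.aestronglyMeasurable.smul h.aestronglyMeasurable
  · rw [norm_smul, norm_smul]
    have := norm_inner_le_norm (𝕜 := ℂ) (v y) f
    rw [hC] at this ⊢
    have hC0 : 0 ≤ C := (norm_nonneg _).trans_eq (hC y)
    gcongr

theorem integral_rankOne_apply {E : Type*} [NormedAddCommGroup E] [InnerProductSpace ℂ E]
    [CompleteSpace E] {c : V → ℂ} (hc : Integrable c (leb V)) {v : V → E} (hv : Continuous v)
    {C : ℝ} (hC : ∀ y, ‖v y‖ = C) (f : E) :
    (∫ y, c y • rankOne ℂ (v y) (v y) ∂(leb V)) f =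
      ∫ y, c y • ((inner ℂ (v y) f : ℂ) • v y) ∂(leb V) := by
  have hTi : Integrable (fun y : V => c y • rankOne ℂ (v y) (v y)) (leb V) := by
    refine (hc.norm.mul_const (C * C)).mono' ?_ (Eventually.of_forall fun y => ?_)
    · exact hc.aestronglyMeasurable.smul
        (continuous_rankOne.comp (hv.prodMk hv)).aestronglyMeasurable
    · rw [norm_smul, norm_rankOne, hC]
  rw [ContinuousLinearMap.integral_apply hTi]
  rfl

theorem weyl_conj (y w : V) (f : L2 V) : weyl 1 y (weyl 1 w (weyl 1 (-y) f)) =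
    character ((2 * Real.pi * Complex.I : ℂ) • w) y • weyl 1 w f := by
  rw [weyl_weyl, weyl_weyl, smul_smul, add_right_comm, add_neg_cancel, zero_add]
  congr 1
  rw [cocycle, cocycle, character_apply, ← Complex.exp_add, inner_smul_right]
  congr 1
  have h1 := omega_self y
  have h2 := omega_swap w y
  simp only [omega, inner_add_left, inner_neg_right, Complex.add_im, Complex.neg_im] at h1 h2 ⊢
  simp only [h1, h2]
  simp
  ring

theorem exists_eq_gaussian_mul {ψ : V → ℂ} (hψ : ContDiff ℝ (⊤ : ℕ∞) ψ)
    (hψc : HasCompactSupport ψ) : ∃ φ : 𝓢(V, ℂ), ∀ w, ψ w =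
      ((Real.exp (-Real.pi ^ 2 * ‖w‖ ^ 2) : ℝ) : ℂ) *
        ∫ y, character ((2 * Real.pi * Complex.I : ℂ) • w) y * φ y ∂(leb V) := by
  set r : ℂ := -(2 * Real.pi * Complex.I) with hr
  have hr0 : r ≠ 0 := by
    rw [hr]
    simp [Real.pi_ne_zero]
  have hlin : ContDiff ℝ (⊤ : ℕ∞) fun w : V => r⁻¹ • w := contDiff_const_smul _
  have hPd : ContDiff ℝ (⊤ : ℕ∞) fun w : V => ((Real.exp (Real.pi ^ 2 * ‖w‖ ^ 2) : ℝ) : ℂ) :=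
    Complex.ofRealCLM.contDiff.comp ((contDiff_const.mul (contDiff_norm_sq ℝ)).exp)
  set ξ : V → ℂ := fun w => ψ (r⁻¹ • w) *
    ((Real.exp (Real.pi ^ 2 * ‖r⁻¹ • w‖ ^ 2) : ℝ) : ℂ) with hξ
  have hξd : ContDiff ℝ (⊤ : ℕ∞) ξ := (hψ.comp hlin).mul (hPd.comp hlin)
  have hξc : HasCompactSupport ξ := by
    have h1 : HasCompactSupport fun w => ψ (r⁻¹ • w) :=
      hψc.comp_homeomorph (Homeomorph.smulOfNeZero r⁻¹ (inv_ne_zero hr0))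
    exact h1.mul_right
  obtain ⟨φ, hφ⟩ := exists_fourier_eq (hξc.toSchwartzMap hξd)
  refine ⟨φ, fun w => ?_⟩
  have h1 : 𝓕 (φ : V → ℂ) (r • w) = ψ w * ((Real.exp (Real.pi ^ 2 * ‖w‖ ^ 2) : ℝ) : ℂ) := by
    rw [← SchwartzMap.fourier_coe, hφ]
    change ψ (r⁻¹ • r • w) * ((Real.exp (Real.pi ^ 2 * ‖r⁻¹ • r • w‖ ^ 2) : ℝ) : ℂ) = _
    rw [inv_smul_smul₀ hr0]
  rw [fourier_eq_character, hr, neg_smul, neg_neg] at h1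
  rw [h1, mul_left_comm, ← Complex.ofReal_mul, ← Real.exp_add, neg_mul, neg_add_cancel,
    Real.exp_zero, Complex.ofReal_one, mul_one]

theorem integral_smul_weyl_eq {ψ : V → ℂ} {φ : 𝓢(V, ℂ)} (h : ∀ w, ψ w =
    ((Real.exp (-Real.pi ^ 2 * ‖w‖ ^ 2) : ℝ) : ℂ) *
      ∫ y, character ((2 * Real.pi * Complex.I : ℂ) • w) y * φ y ∂(leb V)) (f : L2 V) :
    ∫ w, ψ w • weyl 1 w f ∂(leb V) = ∫ y, φ y • weyl 1 y
      (weylInt 1 (integrable_weylGaussian.toL1 _) (weyl 1 (-y) f)) ∂(leb V) := by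
  have hPi : Integrable (fun w : V => ((Real.exp (-Real.pi ^ 2 * ‖w‖ ^ 2) : ℝ) : ℂ)) (leb V) :=
    integrable_weylGaussian
  have hint : Integrable (fun p : V × V => (((Real.exp (-Real.pi ^ 2 * ‖p.1‖ ^ 2) : ℝ) : ℂ) *
      (character ((2 * Real.pi * Complex.I : ℂ) • p.1) p.2 * φ p.2)) • weyl 1 p.1 f)
      ((leb V).prod (leb V)) := by
    refine ((hPi.mul_prod φ.integrable).norm.mul_const ‖f‖).mono' ?_
      (Eventually.of_forall fun p => ?_)
    · have h1 : Continuous fun p : V × V => ((Real.exp (-Real.pi ^ 2 * ‖p.1‖ ^ 2) : ℝ) : ℂ) *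
          (character ((2 * Real.pi * Complex.I : ℂ) • p.1) p.2 * φ p.2) := by
        have := φ.continuous
        simp only [character_apply]
        fun_prop
      exact h1.aestronglyMeasurable.smul
        ((continuous_weyl 1 f).comp continuous_fst).aestronglyMeasurable
    · rw [norm_smul, LinearIsometry.norm_map, norm_mul, norm_mul, norm_character, one_mul,
        norm_mul]
  have h0 : ∫ w, ψ w • weyl 1 w f ∂(leb V) = ∫ w, ∫ y,
      (((Real.exp (-Real.pi ^ 2 * ‖w‖ ^ 2) : ℝ) : ℂ) *
        (character ((2 * Real.pi * Complex.I : ℂ) • w) y * φ y)) •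
          weyl 1 w f ∂(leb V) ∂(leb V) := by
    refine integral_congr_ae (Eventually.of_forall fun w => ?_)
    simp only
    rw [integral_smul_const, integral_const_mul, h]
  rw [h0, integral_integral_swap hint]
  refine integral_congr_ae (Eventually.of_forall fun y => ?_)
  simp only
  have h1 : ∀ w, (((Real.exp (-Real.pi ^ 2 * ‖w‖ ^ 2) : ℝ) : ℂ) *
      (character ((2 * Real.pi * Complex.I : ℂ) • w) y * φ y)) • weyl 1 w f =
      φ y • weyl 1 y (((Real.exp (-Real.pi ^ 2 * ‖w‖ ^ 2) : ℝ) : ℂ) •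
        weyl 1 w (weyl 1 (-y) f)) := fun w => by
    rw [map_smul, weyl_conj, smul_smul, smul_smul]
    congr 1
    ring
  simp only [h1]
  rw [integral_smul, weylInt_apply_of_ae 1 _ (integrable_weylGaussian (V := V)).coeFn_toL1]
  exact congrArg (fun g : L2 V => φ y • g) ((weyl 1 y).toContinuousLinearMap.integral_comp_comm
    (integrable_smul_weyl 1 hPi (weyl 1 (-y) f)))

/-- Operators `∫ ψ(w) M(w) dw`, where `ψ` is a test function, are averages of operators of rank
one. -/
theorem fockRep_ofL1_mem_of_contDiff {ψ : V → ℂ} (hψ : ContDiff ℝ (⊤ : ℕ∞) ψ)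
    (hψc : HasCompactSupport ψ) (hi : Integrable ψ (leb V)) :
    fockRep V (ofL1 (hi.toL1 ψ)) ∈ rankOneSpan (Fock V) := by
  obtain ⟨φ, hφ⟩ := exists_eq_gaussian_mul hψ hψc
  obtain ⟨c, -, hc⟩ := fockRep_gaussian (V := V)
  have hT : fockRep V (ofL1 (hi.toL1 ψ)) = ∫ y, (c * φ y) •
      rankOne ℂ (fockWeyl y (coh (0 : V))) (fockWeyl y (coh 0)) ∂(leb V) := by
    refine ContinuousLinearMap.ext fun f => Subtype.ext ?_
    rw [integral_rankOne_apply (φ.integrable.const_mul c) (continuous_fockWeyl _)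
      (fun y => (weyl 1 y).norm_map _), fockRep_val, incl_ofL1,
      weylInt_apply_of_ae 1 _ hi.coeFn_toL1, integral_smul_weyl_eq hφ]
    refine Eq.trans ?_ (Fock.subtypeL.integral_comp_comm
      (integrable_smul_inner (φ.integrable.const_mul c) (continuous_fockWeyl _)
      (fun y => (weyl 1 y).norm_map _) f))
    refine integral_congr_ae (Eventually.of_forall fun y => ?_)
    have h3 : weylInt 1 (integrable_weylGaussian.toL1 _) (weyl 1 (-y) f.1) =
        c • ((inner ℂ (coh (0 : V)) (fockWeyl (-y) f) : ℂ) • (coh (0 : V)).1) :=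
      congrArg (fun T : Fock V →L[ℂ] Fock V => (T (fockWeyl (-y) f)).1) hc
    have h4 : Fock.subtypeL ((c * φ y) •
        ((inner ℂ (fockWeyl y (coh (0 : V))) f : ℂ) • fockWeyl y (coh 0))) =
        (c * φ y) • ((inner ℂ (fockWeyl y (coh (0 : V))) f : ℂ) • weyl 1 y (coh (0 : V)).1) := rfl
    simp only
    rw [h4, h3, inner_fockWeyl, map_smul, map_smul, smul_smul, mul_comm (φ y)]
  rw [hT]
  exact integral_mem_of_isClosed _ isClosed_rankOneSpan fun y =>
    Submodule.smul_mem _ _ (rankOne_mem _ _)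

theorem fockRep_ofL1_mem (F : L1 V) : fockRep V (ofL1 F) ∈ rankOneSpan (Fock V) := by
  refine isClosed_rankOneSpan.closure_subset_iff.2 (subset_refl _)
    (Metric.mem_closure_iff.2 fun ε hε => ?_)
  obtain ⟨ψ, hψc, hψ, hn⟩ := (Lp.memLp F).exist_eLpNorm_sub_le (by simp) le_rfl (half_pos hε)
  have hi : Integrable ψ (leb V) := hψ.continuous.integrable_of_hasCompactSupport hψc
  refine ⟨_, fockRep_ofL1_mem_of_contDiff hψ hψc hi, ?_⟩
  rw [dist_eq_norm, ← map_sub, norm_fockRep]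
  have h1 : ‖ofL1 F - ofL1 (hi.toL1 ψ)‖ ≤ ‖F - hi.toL1 ψ‖ := by
    change ‖weylInt 1 F - weylInt 1 (hi.toL1 ψ)‖ ≤ _
    rw [← map_sub]
    exact norm_weylInt_le 1 _
  refine (h1.trans ?_).trans_lt (half_lt_self hε)
  rw [Lp.norm_def]
  refine ENNReal.toReal_le_of_le_ofReal (half_pos hε).le (le_trans (le_of_eq ?_) hn)
  refine eLpNorm_congr_ae ?_
  filter_upwards [Lp.coeFn_sub F (hi.toL1 ψ), hi.coeFn_toL1] with x h1 h2
  rw [h1, Pi.sub_apply, h2, Pi.sub_apply]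

/-- The Weyl algebra acts by compact operators on the Fock space. -/
theorem fockRep_mem_rankOneSpan (a : WeylAlgebra V 1) : fockRep V a ∈ rankOneSpan (Fock V) := by
  have hcl : IsClosed (Generated.incl (moyalOperators V 1) ''
      (fockRep V ⁻¹' (rankOneSpan (Fock V) : Set (Fock V →L[ℂ] Fock V)))) := by
    have hi : Isometry (Generated.incl (moyalOperators V 1)) := Isometry.of_dist_eq fun _ _ => rfl
    have hf : Isometry (fockRep V) := Isometry.of_dist_eq fun a b => by
      rw [dist_eq_norm, dist_eq_norm, ← map_sub, norm_fockRep]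
    exact hi.isClosedEmbedding.isClosedMap _ (isClosed_rankOneSpan.preimage hf.continuous)
  have h : Generated.incl (moyalOperators V 1) a ∈ Generated.incl (moyalOperators V 1) ''
      (fockRep V ⁻¹' (rankOneSpan (Fock V) : Set (Fock V →L[ℂ] Fock V))) := by
    refine closedAdjoin_induction (p := fun T => T ∈ Generated.incl (moyalOperators V 1) ''
      (fockRep V ⁻¹' (rankOneSpan (Fock V) : Set (Fock V →L[ℂ] Fock V)))) ?_ ?_ ?_ ?_ ?_ ?_ hcl a.2
    · intro T hT
      obtain ⟨f, rfl⟩ := eq_quant_of_mem_moyalOperators hT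
      exact ⟨ofL1 ((𝓕 f).toLp 1 (leb V)), fockRep_ofL1_mem _, rfl⟩
    · exact ⟨0, by rw [Set.mem_preimage, map_zero]; exact zero_mem _, map_zero _⟩
    · rintro _ _ ⟨a, ha, rfl⟩ ⟨b, hb, rfl⟩
      exact ⟨a + b, by rw [Set.mem_preimage, map_add]; exact add_mem ha hb, map_add _ a b⟩
    · rintro _ _ ⟨a, ha, rfl⟩ ⟨b, hb, rfl⟩
      exact ⟨a * b, by rw [Set.mem_preimage, map_mul]; exact rankOneSpan_mul hb, map_mul _ a b⟩
    · rintro c _ ⟨a, ha, rfl⟩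
      exact ⟨c • a, by rw [Set.mem_preimage, map_smul]; exact Submodule.smul_mem _ c ha,
        map_smul _ c a⟩
    · rintro _ ⟨a, ha, rfl⟩
      exact ⟨star a, by rw [Set.mem_preimage, map_star]; exact rankOneSpan_star ha, map_star _ a⟩
  obtain ⟨b, hb, hab⟩ := h
  rw [← Generated.incl_injective hab]
  exact hb

/-- The element of the Weyl algebra that acts as an operator of rank one on the Fock space. -/
def weylRankOne (h k : Fock V) : WeylAlgebra V 1 := (exists_rankOne h k).choose

theorem fockRep_weylRankOne (h k : Fock V) : fockRep V (weylRankOne h k) = rankOne ℂ h k :=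
  (exists_rankOne h k).choose_spec

/-- The action of the unitary group on the Fock space. -/
def fockAct : (V ≃ₗᵢ[ℂ] V) →* (Fock V →L[ℂ] Fock V) where
  toFun u := Fock.restrict ((l2Act u).toContinuousLinearEquiv : L2 V →L[ℂ] L2 V)
    fun _ hf => l2Act_mem_fockSpace u hf
  map_one' := by
    refine ContinuousLinearMap.ext fun f => Subtype.ext ?_
    change l2Act 1 f.1 = f.1
    rw [map_one]
    rfl
  map_mul' u v := by
    refine ContinuousLinearMap.ext fun f => Subtype.ext ?_
    change l2Act (u * v) f.1 = l2Act u (l2Act v f.1)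
    rw [map_mul]
    rfl

theorem fockAct_val (u : V ≃ₗᵢ[ℂ] V) (f : Fock V) : (fockAct u f).1 = l2Act u f.1 := rfl

theorem inner_fockAct (u : V ≃ₗᵢ[ℂ] V) (f g : Fock V) :
    inner ℂ (fockAct u f) (fockAct u g) = inner ℂ f g := (l2Act u).inner_map_map f.1 g.1

theorem fockAct_inv_apply (u : V ≃ₗᵢ[ℂ] V) (f : Fock V) : fockAct u (fockAct u⁻¹ f) = f := by
  have h := congrArg (fun T : Fock V →L[ℂ] Fock V => T f) (map_mul fockAct u u⁻¹)
  rw [mul_inv_cancel, map_one] at h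
  exact h.symm

theorem fockRep_weylAct (u : V ≃ₗᵢ[ℂ] V) (a : WeylAlgebra V 1) (f : Fock V) :
    fockRep V (weylAct 1 u a) (fockAct u f) = fockAct u (fockRep V a f) := by
  refine Subtype.ext ?_
  rw [fockRep_val, weylAct, Generated.incl_act, opAct_apply, fockAct_val, fockAct_val, fockRep_val]
  congr 2
  have h : l2Act u⁻¹ (l2Act u f.1) = (l2Act u⁻¹ * l2Act u : L2 V ≃ₗᵢ[ℂ] L2 V) f.1 := rfl
  rw [h, ← map_mul, inv_mul_cancel, map_one]
  rfl

theorem weylAct_weylRankOne (u : V ≃ₗᵢ[ℂ] V) (h k : Fock V) :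
    weylAct 1 u (weylRankOne h k) = weylRankOne (fockAct u h) (fockAct u k) := by
  refine fockRep_injective (ContinuousLinearMap.ext fun f => ?_)
  rw [← fockAct_inv_apply u f, fockRep_weylAct, fockRep_weylRankOne, fockRep_weylRankOne,
    rankOne_apply, rankOne_apply, inner_fockAct, map_smul]

end FockDensity

/-! ## Classes of finite-dimensional subrepresentations -/

section SubRep

variable {G : Type*} [Group G] [TopologicalSpace G]
variable {M : Type*} [AddCommGroup M] [Module ℂ M] {M' : Type*} [AddCommGroup M'] [Module ℂ M']

theorem RRing.cls_eq_of_iso {σ τ : Rep G} (h : σ.Iso τ) : RRing.cls σ = RRing.cls τ := by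
  refine (QuotientAddGroup.eq_iff_sub_mem (N := RRelations G)).2 ?_
  exact AddSubgroup.subset_closure (Or.inl ⟨σ, τ, h, rfl⟩)

theorem RRing.cls_sum (σ τ : Rep G) : RRing.cls (σ.sum τ) = RRing.cls σ + RRing.cls τ := by
  refine (QuotientAddGroup.eq_iff_sub_mem (N := RRelations G)).2 ?_
  exact AddSubgroup.subset_closure (Or.inr ⟨σ, τ, rfl⟩)

/-- Homomorphisms out of the representation ring. -/
def RRing.lift {K : Type*} [AddCommGroup K] (φ : Rep G → K)
    (hiso : ∀ σ τ : Rep G, σ.Iso τ → φ σ = φ τ)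
    (hsum : ∀ σ τ : Rep G, φ (σ.sum τ) = φ σ + φ τ) : RRing G →+ K :=
  QuotientAddGroup.lift (RRelations G) (FreeAbelianGroup.lift φ) (by
    rw [RRelations, AddSubgroup.closure_le]
    rintro x (⟨σ, τ, h, rfl⟩ | ⟨σ, τ, rfl⟩)
    · simp [AddMonoidHom.mem_ker, hiso σ τ h]
    · simp [AddMonoidHom.mem_ker, hsum])

theorem RRing.lift_cls {K : Type*} [AddCommGroup K] (φ : Rep G → K)
    (hiso : ∀ σ τ : Rep G, σ.Iso τ → φ σ = φ τ)
    (hsum : ∀ σ τ : Rep G, φ (σ.sum τ) = φ σ + φ τ) (σ : Rep G) :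
    RRing.lift φ hiso hsum (RRing.cls σ) = φ σ := by
  change FreeAbelianGroup.lift φ (FreeAbelianGroup.of σ) = φ σ
  simp

theorem RRing.hom_ext {K : Type*} [AddCommGroup K] {f g : RRing G →+ K}
    (h : ∀ σ, f (RRing.cls σ) = g (RRing.cls σ)) : f = g := by
  refine QuotientAddGroup.addMonoidHom_ext _ ?_
  ext σ
  exact h σ

/-- Every element of the representation ring is a difference of two representations. -/
theorem RRing.exists_sub (r : RRing G) : ∃ σ τ : Rep G, r = RRing.cls σ - RRing.cls τ := by
  let z : Rep G := ⟨Empty, 1, continuous_const⟩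
  obtain ⟨x, rfl⟩ := QuotientAddGroup.mk'_surjective (RRelations G) r
  induction x using FreeAbelianGroup.induction_on with
  | zero => exact ⟨z, z, (map_zero _).trans (sub_self _).symm⟩
  | of σ =>
    refine ⟨σ.sum z, z, ?_⟩
    rw [RRing.cls_sum, add_sub_cancel_right]
    rfl
  | neg σ _ =>
    refine ⟨z, z.sum σ, ?_⟩
    rw [RRing.cls_sum, sub_add_cancel_left, map_neg]
    rfl
  | add x y hx hy =>
    obtain ⟨σ, τ, h⟩ := hx
    obtain ⟨σ', τ', h'⟩ := hy
    refine ⟨σ.sum σ', τ.sum τ', ?_⟩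
    rw [RRing.cls_sum, RRing.cls_sum, map_add, h, h']
    abel

/-- An isomorphism of representations, as an equivariant linear isomorphism. -/
theorem Rep.iso_of_equiv {σ τ : Rep G} (T : (τ.ι → ℂ) ≃ₗ[ℂ] (σ.ι → ℂ))
    (h : ∀ g x, T (τ.ρ g *ᵥ x) = σ.ρ g *ᵥ T x) : σ.Iso τ := by
  refine ⟨LinearMap.toMatrix' T.toLinearMap, LinearMap.toMatrix' T.symm.toLinearMap, ?_, ?_,
    fun g => ?_⟩
  · rw [← LinearMap.toMatrix'_comp]
    simp
  · rw [← LinearMap.toMatrix'_comp]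
    simp
  · refine Matrix.toLin'.injective (LinearMap.ext fun x => ?_)
    rw [Matrix.toLin'_mul, Matrix.toLin'_mul, Matrix.toLin'_toMatrix']
    exact (h g x).symm

theorem Rep.sum_mulVec (σ τ : Rep G) (g : G) (x : σ.ι ⊕ τ.ι → ℂ) :
    (σ.sum τ).ρ g *ᵥ x = Sum.elim (σ.ρ g *ᵥ (x ∘ Sum.inl)) (τ.ρ g *ᵥ (x ∘ Sum.inr)) := by
  refine (fromBlocks_mulVec (σ.ρ g) 0 0 (τ.ρ g) x).trans ?_
  simp

/-- `X` is a finite-dimensional continuous subrepresentation of the representation `τ`. -/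
structure IsSubRep (τ : G →* Module.End ℂ M) (X : Submodule ℂ M) : Prop where
  fin : FiniteDimensional ℂ X
  inv : ∀ g, ∀ x ∈ X, τ g x ∈ X
  cont : ∀ x ∈ X, ∀ φ : M →ₗ[ℂ] ℂ, Continuous fun g => φ (τ g x)

/-- A finite-dimensional invariant subspace of a strongly continuous representation. -/
theorem IsSubRep.of_continuous {M : Type*} [NormedAddCommGroup M] [NormedSpace ℂ M]
    {τ : G →* Module.End ℂ M} {X : Submodule ℂ M} (fin : FiniteDimensional ℂ X)
    (inv : ∀ g, ∀ x ∈ X, τ g x ∈ X) (cont : ∀ x ∈ X, Continuous fun g => τ g x) :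
    IsSubRep τ X where
  fin := fin
  inv := inv
  cont x hx φ := by
    have h1 : Continuous fun g => (⟨τ g x, inv g x hx⟩ : X) := (cont x hx).subtype_mk _
    exact (LinearMap.continuous_of_finiteDimensional (φ.comp X.subtype)).comp h1

variable {τ : G →* Module.End ℂ M} {τ' : G →* Module.End ℂ M'}

theorem IsSubRep.mono {X Y : Submodule ℂ M} (hY : IsSubRep τ Y) (hXY : X ≤ Y)
    (inv : ∀ g, ∀ x ∈ X, τ g x ∈ X) : IsSubRep τ X where
  fin := have := hY.fin
    Submodule.finiteDimensional_of_le hXY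
  inv := inv
  cont x hx := hY.cont x (hXY hx)

theorem IsSubRep.sup {X Y : Submodule ℂ M} (hX : IsSubRep τ X) (hY : IsSubRep τ Y) :
    IsSubRep τ (X ⊔ Y) where
  fin := by
    have := hX.fin
    have := hY.fin
    infer_instance
  inv g x hx := by
    obtain ⟨y, hy, z, hz, rfl⟩ := Submodule.mem_sup.1 hx
    rw [map_add]
    exact add_mem (Submodule.mem_sup_left (hX.inv g y hy)) (Submodule.mem_sup_right (hY.inv g z hz))
  cont x hx φ := by
    obtain ⟨y, hy, z, hz, rfl⟩ := Submodule.mem_sup.1 hx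
    simp only [map_add]
    exact (hX.cont y hy φ).add (hY.cont z hz φ)

theorem IsSubRep.bot : IsSubRep τ (⊥ : Submodule ℂ M) where
  fin := inferInstance
  inv g x hx := by
    rw [Submodule.mem_bot] at hx ⊢
    rw [hx, map_zero]
  cont x hx φ := by
    rw [Submodule.mem_bot] at hx
    simp only [hx, map_zero]
    exact continuous_const

/-- A subrepresentation in matrix form. -/
def subRep {X : Submodule ℂ M} (h : IsSubRep τ X) : Rep G :=
  have := h.fin
  { ι := Fin (Module.finrank ℂ X)
    ρ :=
      { toFun := fun g => LinearMap.toMatrix (Module.finBasis ℂ X) (Module.finBasis ℂ X)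
          ((τ g).restrict (h.inv g))
        map_one' := by
          rw [← LinearMap.toMatrix_one (Module.finBasis ℂ X)]
          congr 1
          ext x
          simp
        map_mul' := fun g k => by
          rw [← LinearMap.toMatrix_mul]
          congr 1
          ext x
          simp }
    continuous_ρ := by
      refine continuous_matrix fun i j => ?_
      obtain ⟨φ, hφ⟩ := LinearMap.exists_extend ((Module.finBasis ℂ X).coord i)
      refine (h.cont _ (Module.finBasis ℂ X j).2 φ).congr fun g => ?_
      change _ = LinearMap.toMatrix _ _ _ i j
      rw [LinearMap.toMatrix_apply]
      exact LinearMap.congr_fun hφ ((τ g).restrict (h.inv g) (Module.finBasis ℂ X j)) }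

theorem exists_subRep_equiv {X : Submodule ℂ M} (h : IsSubRep τ X) :
    ∃ T : ((subRep h).ι → ℂ) ≃ₗ[ℂ] X,
      ∀ g x, (T ((subRep h).ρ g *ᵥ x) : M) = τ g (T x) := by
  have := h.fin
  have key : ∀ (f : X →ₗ[ℂ] X) (x : Fin (Module.finrank ℂ X) → ℂ),
      (Module.finBasis ℂ X).equivFun.symm
        (LinearMap.toMatrix (Module.finBasis ℂ X) (Module.finBasis ℂ X) f *ᵥ x) =
      f ((Module.finBasis ℂ X).equivFun.symm x) := fun f x => by
    have h1 := LinearMap.toMatrix_mulVec_repr (Module.finBasis ℂ X) (Module.finBasis ℂ X) f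
      ((Module.finBasis ℂ X).equivFun.symm x)
    have h2 : ⇑((Module.finBasis ℂ X).repr ((Module.finBasis ℂ X).equivFun.symm x)) = x :=
      (Module.finBasis ℂ X).equivFun.apply_symm_apply x
    rw [h2] at h1
    rw [h1]
    exact (Module.finBasis ℂ X).equivFun.symm_apply_apply _
  exact ⟨(Module.finBasis ℂ X).equivFun.symm, fun g x => congrArg Subtype.val (key _ x)⟩

/-- The class of a subrepresentation in the representation ring. -/
def repCls {X : Submodule ℂ M} (h : IsSubRep τ X) : RRing G := RRing.cls (subRep h)

theorem repCls_eq_cls {X : Submodule ℂ M} (h : IsSubRep τ X) (σ : Rep G)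
    (T : (σ.ι → ℂ) ≃ₗ[ℂ] X) (hT : ∀ g x, (T (σ.ρ g *ᵥ x) : M) = τ g (T x)) :
    repCls h = RRing.cls σ := by
  obtain ⟨S, hS⟩ := exists_subRep_equiv h
  refine RRing.cls_eq_of_iso (Rep.iso_of_equiv (T.trans S.symm) fun g x => ?_)
  refine S.injective (Subtype.ext ?_)
  rw [hS, LinearEquiv.trans_apply, LinearEquiv.trans_apply, S.apply_symm_apply,
    S.apply_symm_apply, hT]

theorem repCls_congr {X : Submodule ℂ M} {Y : Submodule ℂ M'} (hX : IsSubRep τ X)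
    (hY : IsSubRep τ' Y) (T : X ≃ₗ[ℂ] Y)
    (hT : ∀ g (x : X), (T ⟨τ g x, hX.inv g x x.2⟩ : M') = τ' g (T x)) :
    repCls hX = repCls hY := by
  obtain ⟨S, hS⟩ := exists_subRep_equiv hX
  refine (repCls_eq_cls hY _ (S.trans T) fun g x => ?_).symm
  rw [LinearEquiv.trans_apply, LinearEquiv.trans_apply, ← hT]
  congr 2
  exact Subtype.ext (hS g x)

theorem repCls_eq_of_eq {X Y : Submodule ℂ M} (hX : IsSubRep τ X) (hY : IsSubRep τ Y)
    (h : X = Y) : repCls hX = repCls hY := by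
  subst h
  rfl

/-- Mutually inverse equivariant maps give an isomorphism. -/
theorem repCls_eq_of_maps {X : Submodule ℂ M} {Y : Submodule ℂ M'} (hX : IsSubRep τ X)
    (hY : IsSubRep τ' Y) (a : M →ₗ[ℂ] M') (b : M' →ₗ[ℂ] M) (ha : ∀ x ∈ X, a x ∈ Y)
    (hb : ∀ y ∈ Y, b y ∈ X) (hba : ∀ x ∈ X, b (a x) = x) (hab : ∀ y ∈ Y, a (b y) = y)
    (hg : ∀ g, ∀ x ∈ X, a (τ g x) = τ' g (a x)) : repCls hX = repCls hY :=
  repCls_congr hX hY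
    (LinearEquiv.ofLinearMap (a.restrict ha) (b.restrict hb)
      (LinearMap.ext fun y => Subtype.ext (hab y y.2))
      (LinearMap.ext fun x => Subtype.ext (hba x x.2)))
    fun g x => hg g x x.2

theorem repCls_sup {X Y : Submodule ℂ M} (hX : IsSubRep τ X) (hY : IsSubRep τ Y)
    (hd : Disjoint X Y) : repCls (hX.sup hY) = repCls hX + repCls hY := by
  obtain ⟨S, hS⟩ := exists_subRep_equiv hX
  obtain ⟨T, hT⟩ := exists_subRep_equiv hY
  rw [repCls, repCls, repCls, ← RRing.cls_sum]
  let f : X × Y →ₗ[ℂ] M := X.subtype.coprod Y.subtype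
  have hf : Function.Injective f := by
    rw [← LinearMap.ker_eq_bot, LinearMap.ker_eq_bot']
    rintro ⟨x, y⟩ hxy
    change (x : M) + y = 0 at hxy
    have hx : (x : M) = 0 := by
      refine Submodule.disjoint_def.1 hd x x.2 ?_
      rw [eq_neg_of_add_eq_zero_left hxy]
      exact neg_mem y.2
    rw [hx, zero_add] at hxy
    exact Prod.ext (Subtype.ext hx) (Subtype.ext hxy)
  have hr : LinearMap.range f = X ⊔ Y := by
    rw [LinearMap.range_coprod, Submodule.range_subtype, Submodule.range_subtype]
  let e : (((subRep hX).sum (subRep hY)).ι → ℂ) ≃ₗ[ℂ] (X ⊔ Y : Submodule ℂ M) :=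
    (LinearEquiv.sumArrowLequivProdArrow (subRep hX).ι (subRep hY).ι ℂ ℂ).trans
      ((S.prodCongr T).trans ((LinearEquiv.ofInjective f hf).trans (LinearEquiv.ofEq _ _ hr)))
  have he : ∀ x, (e x : M) = S (x ∘ Sum.inl) + T (x ∘ Sum.inr) := fun x => rfl
  refine repCls_eq_cls (hX.sup hY) _ e fun g x => ?_
  rw [he, he, map_add, ← hS, ← hT]
  have h1 := Rep.sum_mulVec (subRep hX) (subRep hY) g x
  exact (congrArg (fun y : (subRep hX).ι ⊕ (subRep hY).ι → ℂ =>
    (S (y ∘ Sum.inl) + T (y ∘ Sum.inr) : M)) h1).trans rfl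

theorem repCls_bot : repCls (IsSubRep.bot (τ := τ)) = 0 := by
  have h := repCls_sup (IsSubRep.bot (τ := τ)) IsSubRep.bot disjoint_bot_left
  rw [repCls_eq_of_eq _ IsSubRep.bot (sup_bot_eq ⊥)] at h
  exact left_eq_add.1 h

/-- Additivity over finite independent families. -/
theorem repCls_biSup {ν : Type*} [DecidableEq ν] (X : ν → Submodule ℂ M)
    (hX : ∀ m, IsSubRep τ (X m)) (hi : iSupIndep X) (s : Finset ν) :
    ∃ h : IsSubRep τ (⨆ m ∈ s, X m), repCls h = ∑ m ∈ s, repCls (hX m) := by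
  induction s using Finset.induction_on with
  | empty =>
    have h0 : (⨆ m ∈ (∅ : Finset ν), X m) = ⊥ := by simp
    rw [h0]
    exact ⟨IsSubRep.bot, by rw [repCls_bot, Finset.sum_empty]⟩
  | insert m s hm ih =>
    obtain ⟨h, hs⟩ := ih
    rw [Finset.iSup_insert, Finset.sum_insert hm]
    refine ⟨(hX m).sup h, ?_⟩
    rw [repCls_sup (hX m) h, hs]
    refine (hi m).mono_right (iSup₂_le fun k hk => le_iSup₂_of_le k ?_ le_rfl)
    rintro rfl
    exact hm hk

end SubRep

/-! ## Weights of a central element, and the characters of `K`-theory they define -/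

section Weights

set_option linter.unusedSectionVars false

variable {G : Type*} [Group G] [TopologicalSpace G]
variable {B : Type*} [Ring B] [Algebra ℂ B] {B' : Type*} [Ring B'] [Algebra ℂ B']
variable {M : Type*} [AddCommGroup M] [Module ℂ M] {M₁ M₂ : Type*} [AddCommGroup M₁] [Module ℂ M₁]
  [AddCommGroup M₂] [Module ℂ M₂]
variable {β : G →* (B →ₐ[ℂ] B)} {β' : G →* (B' →ₐ[ℂ] B')}

theorem repCls_prod {τ : G →* Module.End ℂ M} {τ₁ : G →* Module.End ℂ M₁}
    {τ₂ : G →* Module.End ℂ M₂} {X : Submodule ℂ M} {Y : Submodule ℂ M₁} {Z : Submodule ℂ M₂}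
    (hX : IsSubRep τ X) (hY : IsSubRep τ₁ Y) (hZ : IsSubRep τ₂ Z)
    (i₁ : M₁ →ₗ[ℂ] M) (i₂ : M₂ →ₗ[ℂ] M) (p₁ : M →ₗ[ℂ] M₁) (p₂ : M →ₗ[ℂ] M₂)
    (hi₁ : ∀ y ∈ Y, i₁ y ∈ X) (hi₂ : ∀ y ∈ Z, i₂ y ∈ X) (hp₁ : ∀ x ∈ X, p₁ x ∈ Y)
    (hp₂ : ∀ x ∈ X, p₂ x ∈ Z) (h11 : ∀ y, p₁ (i₁ y) = y) (h22 : ∀ y, p₂ (i₂ y) = y)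
    (h12 : ∀ y, p₁ (i₂ y) = 0) (h : ∀ x, i₁ (p₁ x) + i₂ (p₂ x) = x)
    (hg₁ : ∀ g y, i₁ (τ₁ g y) = τ g (i₁ y)) (hg₂ : ∀ g y, i₂ (τ₂ g y) = τ g (i₂ y)) :
    repCls hX = repCls hY + repCls hZ := by
  have hY' : IsSubRep τ (Y.map i₁) := hX.mono (Submodule.map_le_iff_le_comap.2 hi₁) (by
    rintro g _ ⟨y, hy, rfl⟩
    exact ⟨τ₁ g y, hY.inv g y hy, hg₁ g y⟩)
  have hZ' : IsSubRep τ (Z.map i₂) := hX.mono (Submodule.map_le_iff_le_comap.2 hi₂) (by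
    rintro g _ ⟨y, hy, rfl⟩
    exact ⟨τ₂ g y, hZ.inv g y hy, hg₂ g y⟩)
  have hd : Disjoint (Y.map i₁) (Z.map i₂) := by
    rw [Submodule.disjoint_def]
    rintro _ ⟨y, hy, rfl⟩ ⟨y', hy', hyy⟩
    rw [← h11 y, ← hyy, h12, map_zero]
  have hs : Y.map i₁ ⊔ Z.map i₂ = X := by
    refine le_antisymm (sup_le (Submodule.map_le_iff_le_comap.2 hi₁)
      (Submodule.map_le_iff_le_comap.2 hi₂)) fun x hx => ?_
    rw [← h x]
    exact Submodule.add_mem_sup ⟨_, hp₁ x hx, rfl⟩ ⟨_, hp₂ x hx, rfl⟩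
  rw [repCls_eq_of_eq hX (hY'.sup hZ') hs.symm, repCls_sup hY' hZ' hd]
  congr 1
  · refine repCls_eq_of_maps hY' hY p₁ i₁ ?_ (fun y hy => ⟨y, hy, rfl⟩) ?_ (fun y _ => h11 y) ?_
    · rintro _ ⟨y, hy, rfl⟩
      rwa [h11]
    · rintro _ ⟨y, hy, rfl⟩
      rw [h11]
    · rintro g _ ⟨y, hy, rfl⟩
      rw [← hg₁, h11, h11]
  · refine repCls_eq_of_maps hZ' hZ p₂ i₂ ?_ (fun y hy => ⟨y, hy, rfl⟩) ?_ (fun y _ => h22 y) ?_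
    · rintro _ ⟨y, hy, rfl⟩
      rwa [h22]
    · rintro _ ⟨y, hy, rfl⟩
      rw [h22]
    · rintro g _ ⟨y, hy, rfl⟩
      rw [← hg₂, h22, h22]

/-- The action of matrices over `B` on vectors with entries in a `B`-module. -/
def matAct (π : B →ₐ[ℂ] Module.End ℂ M) {ι κ : Type} [Fintype κ] (X : Matrix ι κ B) :
    (κ → M) →ₗ[ℂ] (ι → M) where
  toFun h i := ∑ j, π (X i j) (h j)
  map_add' h k := by
    ext i
    simp [Finset.sum_add_distrib]
  map_smul' c h := by
    ext i
    simp [Finset.smul_sum]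

theorem matAct_apply (π : B →ₐ[ℂ] Module.End ℂ M) {ι κ : Type} [Fintype κ] (X : Matrix ι κ B)
    (h : κ → M) (i : ι) : matAct π X h i = ∑ j, π (X i j) (h j) := rfl

theorem matAct_mul (π : B →ₐ[ℂ] Module.End ℂ M) {ι κ ν : Type} [Fintype κ] [Fintype ν]
    (X : Matrix ι κ B) (Y : Matrix κ ν B) (h : ν → M) :
    matAct π (X * Y) h = matAct π X (matAct π Y h) := by
  ext i
  simp only [matAct_apply, Matrix.mul_apply, map_sum, map_mul, LinearMap.sum_apply,
    Module.End.mul_apply]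
  exact Finset.sum_comm

/-- The diagonal action of the group on `M ⊗ W`, where `W` carries the representation `ρ`. -/
def twist (τ : G →* Module.End ℂ M) {ι : Type} [Fintype ι] [DecidableEq ι]
    (ρ : G →* Matrix ι ι ℂ) : G →* Module.End ℂ (ι → M) where
  toFun g :=
    { toFun := fun h i => ∑ j, ρ g i j • τ g (h j)
      map_add' := fun h k => by
        ext i
        simp [Finset.sum_add_distrib]
      map_smul' := fun c h => by
        ext i
        simp [Finset.smul_sum, smul_comm c] }
  map_one' := by
    ext h i j
    simp [Matrix.one_apply]
  map_mul' g k := by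
    refine LinearMap.ext fun h => funext fun i => ?_
    simp only [map_mul, Matrix.mul_apply, LinearMap.coe_mk, AddHom.coe_mk, Module.End.mul_apply,
      map_sum, map_smul, Finset.sum_smul, Finset.smul_sum, smul_smul]
    exact Finset.sum_comm

theorem twist_apply (τ : G →* Module.End ℂ M) {ι : Type} [Fintype ι] [DecidableEq ι]
    (ρ : G →* Matrix ι ι ℂ) (g : G) (h : ι → M) (i : ι) :
    twist τ ρ g h i = ∑ j, ρ g i j • τ g (h j) := rfl

/-- A representation of an algebra and a representation of a group that acts on the algebra are
covariant. -/
def Covariant (β : G →* (B →ₐ[ℂ] B)) (τ : G →* Module.End ℂ M) (π : B →ₐ[ℂ] Module.End ℂ M) :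
    Prop :=
  ∀ g b x, τ g (π b x) = π (β g b) (τ g x)

variable {τ : G →* Module.End ℂ M} {π : B →ₐ[ℂ] Module.End ℂ M}

theorem Covariant.comp {π' : B' →ₐ[ℂ] Module.End ℂ M} (h : Covariant β' τ π') (φ : B →ₐ[ℂ] B')
    (hφ : ∀ g b, φ (β g b) = β' g (φ b)) : Covariant β τ (π'.comp φ) := fun g b x => by
  rw [AlgHom.comp_apply, AlgHom.comp_apply, hφ]
  exact h g (φ b) x

theorem Covariant.twist_matAct (hπ : Covariant β τ π) {ι κ : Type} [Fintype ι] [DecidableEq ι]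
    [Fintype κ] [DecidableEq κ] {ρ : G →* Matrix ι ι ℂ} {σ : G →* Matrix κ κ ℂ} {X : Matrix ι κ B}
    {g : G} (hX : scal B (ρ g) * X.map (β g) = X * scal B (σ g)) (h : κ → M) :
    twist τ ρ g (matAct π X h) = matAct π X (twist τ σ g h) := by
  have h1 : ∀ i k, ∑ j, ρ g i j • π (β g (X j k)) = ∑ j, σ g j k • π (X i j) := fun i k => by
    have := congrArg (fun Y : Matrix ι κ B => π (Y i k)) hX
    simp only [Matrix.mul_apply, scal, Matrix.map_apply, map_sum, map_mul, AlgHom.commutes] at this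
    refine Eq.trans ?_ (this.trans ?_)
    · exact Finset.sum_congr rfl fun j _ => by rw [Algebra.smul_def]
    · exact Finset.sum_congr rfl fun j _ => by rw [Algebra.smul_def, Algebra.commutes]
  ext i
  simp only [twist_apply, matAct_apply, map_sum, map_smul, Finset.smul_sum]
  rw [Finset.sum_comm]
  calc ∑ k, ∑ j, ρ g i j • τ g (π (X j k) (h k))
      = ∑ k, (∑ j, ρ g i j • π (β g (X j k))) (τ g (h k)) := by
        simp only [LinearMap.sum_apply, LinearMap.smul_apply]
        exact Finset.sum_congr rfl fun k _ => Finset.sum_congr rfl fun j _ => by rw [hπ g]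
    _ = ∑ k, (∑ j, σ g j k • π (X i j)) (τ g (h k)) := by simp only [h1]
    _ = _ := by
        simp only [LinearMap.sum_apply, LinearMap.smul_apply]
        exact Finset.sum_comm

/-- The generalized weight space of an element of the group in `M ⊗ W`. -/
def block (τ : G →* Module.End ℂ M) {ι : Type} [Fintype ι] [DecidableEq ι]
    (ρ : G →* Matrix ι ι ℂ) (z : G) (μ : ℂ) : Submodule ℂ (ι → M) :=
  Module.End.maxGenEigenspace (twist τ ρ z) μ

theorem map_mem_maxGenEigenspace {f : Module.End ℂ M₁} {f' : Module.End ℂ M₂} (a : M₁ →ₗ[ℂ] M₂)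
    (h : ∀ x, a (f x) = f' (a x)) {μ : ℂ} {x : M₁} (hx : x ∈ f.maxGenEigenspace μ) :
    a x ∈ f'.maxGenEigenspace μ := by
  rw [Module.End.mem_maxGenEigenspace] at hx ⊢
  obtain ⟨k, hk⟩ := hx
  refine ⟨k, ?_⟩
  have h1 : ∀ (k : ℕ) (x : M₁), ((f' - μ • 1) ^ k) (a x) = a (((f - μ • 1) ^ k) x) := by
    intro k
    induction k with
    | zero => intro x; rfl
    | succ k ih =>
      intro x
      rw [pow_succ, pow_succ, Module.End.mul_apply, Module.End.mul_apply, ← ih]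
      simp [h]
  rw [h1, hk, map_zero]

/-- The generalized weight spaces of the central element `z` in `M ⊗ W` are finite-dimensional
continuous representations. -/
structure IsGraded (τ : G →* Module.End ℂ M) (z : G) : Prop where
  central : ∀ g, g * z = z * g
  sub : ∀ {ι : Type} [Fintype ι] [DecidableEq ι] (ρ : G →* Matrix ι ι ℂ), Continuous ρ →
    ∀ μ, IsSubRep (twist τ ρ) (block τ ρ z μ)

theorem twist_mem_block {z : G} (hz : ∀ g, g * z = z * g) {ι : Type} [Fintype ι]
    [DecidableEq ι] (ρ : G →* Matrix ι ι ℂ) {μ : ℂ} (g : G) {x : ι → M}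
    (hx : x ∈ block τ ρ z μ) : twist τ ρ g x ∈ block τ ρ z μ := by
  refine map_mem_maxGenEigenspace _ (fun y => ?_) hx
  rw [← Module.End.mul_apply, ← Module.End.mul_apply, ← map_mul, ← map_mul, hz]

/-- The range of an idempotent in a weight space. -/
def weightRange (τ : G →* Module.End ℂ M) (π : B →ₐ[ℂ] Module.End ℂ M) (z : G) (μ : ℂ)
    (c : Cycle β) : Submodule ℂ (c.ι → M) :=
  block τ c.ρ z μ ⊓ LinearMap.eqLocus (matAct π c.e) LinearMap.id

theorem mem_weightRange {z : G} {μ : ℂ} {c : Cycle β} {x : c.ι → M} :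
    x ∈ weightRange τ π z μ c ↔ x ∈ block τ c.ρ z μ ∧ matAct π c.e x = x := Iff.rfl

variable {z : G}

theorem isSubRep_weightRange (hz : IsGraded τ z) (hπ : Covariant β τ π) (μ : ℂ) (c : Cycle β) :
    IsSubRep (twist τ c.ρ) (weightRange τ π z μ c) :=
  (hz.sub c.ρ c.continuous_ρ μ).mono inf_le_left fun g x hx => by
    rw [mem_weightRange] at hx ⊢
    refine ⟨twist_mem_block hz.central c.ρ g hx.1, ?_⟩
    rw [← hπ.twist_matAct (c.invariant g), hx.2]

/-- The class of the range of an idempotent in a weight space. -/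
def weightCls (hz : IsGraded τ z) (hπ : Covariant β τ π) (μ : ℂ) (c : Cycle β) : RRing G :=
  repCls (isSubRep_weightRange hz hπ μ c)

theorem matAct_mem_block (hπ : Covariant β τ π) {ι κ : Type} [Fintype ι] [DecidableEq ι]
    [Fintype κ] [DecidableEq κ] {ρ : G →* Matrix ι ι ℂ} {σ : G →* Matrix κ κ ℂ} {X : Matrix ι κ B}
    (hX : ∀ g, scal B (ρ g) * X.map (β g) = X * scal B (σ g)) {μ : ℂ} {x : κ → M}
    (hx : x ∈ block τ σ z μ) : matAct π X x ∈ block τ ρ z μ :=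
  map_mem_maxGenEigenspace _ (fun y => (hπ.twist_matAct (hX z) y).symm) hx

theorem weightCls_eq_of_equivalent (hz : IsGraded τ z) (hπ : Covariant β τ π) (μ : ℂ)
    {c d : Cycle β} (h : c.Equivalent d) : weightCls hz hπ μ c = weightCls hz hπ μ d := by
  obtain ⟨X, Y, hX, hY, hXY, hYX⟩ := h
  refine repCls_eq_of_maps _ _ (matAct π Y) (matAct π X) ?_ ?_ ?_ ?_
    fun g x _ => (hπ.twist_matAct (hY g) x).symm
  · intro x hx
    rw [mem_weightRange] at hx ⊢
    refine ⟨matAct_mem_block hπ hY hx.1, ?_⟩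
    rw [← hYX, matAct_mul, ← matAct_mul π X, hXY, hx.2]
  · intro x hx
    rw [mem_weightRange] at hx ⊢
    refine ⟨matAct_mem_block hπ hX hx.1, ?_⟩
    rw [← hXY, matAct_mul, ← matAct_mul π Y, hYX, hx.2]
  · intro x hx
    rw [← matAct_mul, hXY]
    exact hx.2
  · intro x hx
    rw [← matAct_mul, hYX]
    exact hx.2

theorem weightCls_sum (hz : IsGraded τ z) (hπ : Covariant β τ π) (μ : ℂ) (c d : Cycle β) :
    weightCls hz hπ μ (c.sum d) = weightCls hz hπ μ c + weightCls hz hπ μ d := by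
  let i₁ : (c.ι → M) →ₗ[ℂ] (c.ι ⊕ d.ι → M) :=
    { toFun := fun x => Sum.elim x 0
      map_add' := fun x y => by ext (i | i) <;> simp
      map_smul' := fun r x => by ext (i | i) <;> simp }
  let i₂ : (d.ι → M) →ₗ[ℂ] (c.ι ⊕ d.ι → M) :=
    { toFun := fun x => Sum.elim 0 x
      map_add' := fun x y => by ext (i | i) <;> simp
      map_smul' := fun r x => by ext (i | i) <;> simp }
  let p₁ : (c.ι ⊕ d.ι → M) →ₗ[ℂ] (c.ι → M) := LinearMap.funLeft ℂ M Sum.inl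
  let p₂ : (c.ι ⊕ d.ι → M) →ₗ[ℂ] (d.ι → M) := LinearMap.funLeft ℂ M Sum.inr
  have ht : ∀ g (x : c.ι ⊕ d.ι → M), twist τ (c.sum d).ρ g x =
      Sum.elim (twist τ c.ρ g (x ∘ Sum.inl)) (twist τ d.ρ g (x ∘ Sum.inr)) := fun g x => by
    ext (i | i)
    · refine (Fintype.sum_sum_type _).trans ?_
      change (∑ a, c.ρ g i a • τ g (x (Sum.inl a))) +
        ∑ b : d.ι, (0 : ℂ) • τ g (x (Sum.inr b)) = ∑ a, c.ρ g i a • τ g (x (Sum.inl a))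
      simp
    · refine (Fintype.sum_sum_type _).trans ?_
      change (∑ a : c.ι, (0 : ℂ) • τ g (x (Sum.inl a))) +
        ∑ b, d.ρ g i b • τ g (x (Sum.inr b)) = ∑ a, d.ρ g i a • τ g (x (Sum.inr a))
      simp
  have he : ∀ (x : c.ι ⊕ d.ι → M), matAct π (c.sum d).e x =
      Sum.elim (matAct π c.e (x ∘ Sum.inl)) (matAct π d.e (x ∘ Sum.inr)) := fun x => by
    ext (i | i)
    · refine (Fintype.sum_sum_type _).trans ?_
      simp [Cycle.sum, matAct_apply]
    · refine (Fintype.sum_sum_type _).trans ?_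
      simp [Cycle.sum, matAct_apply]
  have hg₁ : ∀ g y, i₁ (twist τ c.ρ g y) = twist τ (c.sum d).ρ g (i₁ y) := fun g y => by
    refine Eq.trans ?_ (ht g (i₁ y)).symm
    change _ = Sum.elim (twist τ c.ρ g y) (twist τ d.ρ g 0)
    rw [map_zero]
    rfl
  have hg₂ : ∀ g y, i₂ (twist τ d.ρ g y) = twist τ (c.sum d).ρ g (i₂ y) := fun g y => by
    refine Eq.trans ?_ (ht g (i₂ y)).symm
    change _ = Sum.elim (twist τ c.ρ g 0) (twist τ d.ρ g y)
    rw [map_zero]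
    rfl
  have hp₁ : ∀ g x, p₁ (twist τ (c.sum d).ρ g x) = twist τ c.ρ g (p₁ x) := fun g x =>
    congrArg p₁ (ht g x)
  have hp₂ : ∀ g x, p₂ (twist τ (c.sum d).ρ g x) = twist τ d.ρ g (p₂ x) := fun g x =>
    congrArg p₂ (ht g x)
  refine repCls_prod _ _ _ i₁ i₂ p₁ p₂ ?_ ?_ ?_ ?_ (fun _ => rfl) (fun _ => rfl) (fun _ => rfl)
    ?_ hg₁ hg₂
  · intro y hy
    refine ⟨map_mem_maxGenEigenspace i₁ (hg₁ z) hy.1, (he (i₁ y)).trans ?_⟩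
    change Sum.elim (matAct π c.e y) (matAct π d.e 0) = _
    rw [map_zero, show matAct π c.e y = y from hy.2]
    rfl
  · intro y hy
    refine ⟨map_mem_maxGenEigenspace i₂ (hg₂ z) hy.1, (he (i₂ y)).trans ?_⟩
    change Sum.elim (matAct π c.e 0) (matAct π d.e y) = _
    rw [map_zero, show matAct π d.e y = y from hy.2]
    rfl
  · intro x hx
    exact ⟨map_mem_maxGenEigenspace p₁ (hp₁ z) hx.1,
      (congrArg p₁ (he x)).symm.trans (congrArg p₁ hx.2)⟩
  · intro x hx
    exact ⟨map_mem_maxGenEigenspace p₂ (hp₂ z) hx.1,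
      (congrArg p₂ (he x)).symm.trans (congrArg p₂ hx.2)⟩
  · intro x
    ext (i | i)
    · exact add_zero (x (Sum.inl i))
    · exact zero_add (x (Sum.inr i))

/-- The homomorphism from `K`-theory to the representation ring given by the weight `μ`. -/
def weightK (hz : IsGraded τ z) (hπ : Covariant β τ π) (μ : ℂ) : K0 β →+ RRing G :=
  QuotientAddGroup.lift (K0Relations β) (FreeAbelianGroup.lift (weightCls hz hπ μ)) (by
    rw [K0Relations, AddSubgroup.closure_le]
    rintro x (⟨c, d, h, rfl⟩ | ⟨c, d, rfl⟩)
    · simp [AddMonoidHom.mem_ker, weightCls_eq_of_equivalent hz hπ μ h]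
    · simp [AddMonoidHom.mem_ker, weightCls_sum])

theorem weightK_cls (hz : IsGraded τ z) (hπ : Covariant β τ π) (μ : ℂ) (c : Cycle β) :
    weightK hz hπ μ (K0.cls c) = weightCls hz hπ μ c := by
  change FreeAbelianGroup.lift (weightCls hz hπ μ) (FreeAbelianGroup.of c) = _
  simp

theorem weightK_map {π' : B' →ₐ[ℂ] Module.End ℂ M} (hz : IsGraded τ z) (hπ' : Covariant β' τ π')
    (φ : B →ₐ[ℂ] B') (hφ : ∀ g b, φ (β g b) = β' g (φ b)) (μ : ℂ) (x : K0 β) :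
    weightK hz hπ' μ (K0.map φ hφ x) = weightK hz (hπ'.comp φ hφ) μ x := by
  have : (weightK hz hπ' μ).comp (K0.map φ hφ) = weightK hz (hπ'.comp φ hφ) μ := by
    refine K0.hom_ext fun c => ?_
    rw [AddMonoidHom.comp_apply, K0.map_cls, weightK_cls, weightK_cls]
    rfl
  exact DFunLike.congr_fun this x

end Weights

/-! ### The weight decomposition of the representation ring -/

section Restriction

set_option linter.unusedSectionVars false

variable {G : Type*} [Group G] [TopologicalSpace G]

theorem isGraded_one {z : G} (hz : ∀ g, g * z = z * g) :
    IsGraded (1 : G →* Module.End ℂ ℂ) z where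
  central := hz
  sub ρ hρ _ := IsSubRep.of_continuous inferInstance
    (fun g _ hx => twist_mem_block hz ρ g hx)
    fun _ _ => continuous_pi fun i => continuous_finsetSum _ fun j _ =>
      ((hρ.matrix_elem i j).smul continuous_const)

theorem covariant_one : Covariant (1 : G →* (ℂ →ₐ[ℂ] ℂ)) (1 : G →* Module.End ℂ ℂ)
    (Algebra.lmul ℂ ℂ) := fun _ _ _ => rfl

variable {B : Type*} [Ring B] [Algebra ℂ B] {β : G →* (B →ₐ[ℂ] B)}

/-- The matrix `m ⊗ p`. -/
def ampl (p : B) {ι κ : Type} (m : Matrix ι κ ℂ) : Matrix ι κ B := m.map (· • p)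

theorem ampl_mul {p q : B} {ι κ ν : Type} [Fintype κ] (m : Matrix ι κ ℂ)
    (n : Matrix κ ν ℂ) : ampl p m * ampl q n = ampl (p * q) (m * n) := by
  ext i j
  simp only [ampl, Matrix.mul_apply, Matrix.map_apply, Finset.sum_smul, smul_mul_smul_comm]

theorem scal_eq_ampl {ι κ : Type} (m : Matrix ι κ ℂ) : scal B m = ampl 1 m := by
  ext i j
  simp [ampl, scal, Algebra.algebraMap_eq_smul_one]

theorem ampl_map {p : B} {g : G} (hp : β g p = p) {ι κ : Type} (m : Matrix ι κ ℂ) :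
    (ampl p m).map (β g) = ampl p m := by
  ext i j
  simp [ampl, hp]

theorem ampl_invariant {p : B} {g : G} (hp : β g p = p) {ι κ : Type} [Fintype ι] [Fintype κ]
    {r : Matrix ι ι ℂ} {s : Matrix κ κ ℂ} {m : Matrix ι κ ℂ} (h : r * m = m * s) :
    scal B r * (ampl p m).map (β g) = ampl p m * scal B s := by
  rw [ampl_map hp, scal_eq_ampl, scal_eq_ampl, ampl_mul, ampl_mul, h, one_mul, mul_one]

theorem matAct_ampl {M : Type*} [AddCommGroup M] [Module ℂ M] (π : B →ₐ[ℂ] Module.End ℂ M)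
    (p : B) {ι : Type} [Fintype ι] [DecidableEq ι] (x : ι → M) (i : ι) :
    matAct π (ampl p (1 : Matrix ι ι ℂ)) x i = π p (x i) := by
  rw [matAct_apply, Finset.sum_eq_single i]
  · simp [ampl]
  · intro j _ h
    simp [ampl, Matrix.one_apply_ne h.symm]
  · simp

theorem matAct_ampl_one {M : Type*} [AddCommGroup M] [Module ℂ M] (π : B →ₐ[ℂ] Module.End ℂ M)
    {ι : Type} [Fintype ι] [DecidableEq ι] (x : ι → M) :
    matAct π (ampl (1 : B) (1 : Matrix ι ι ℂ)) x = x :=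
  funext fun i => by rw [matAct_ampl, map_one, Module.End.one_apply]

/-- The tensor product of an invariant idempotent and a representation. -/
def repCycle {p : B} (hp : p * p = p) (hβ : ∀ g, β g p = p) (σ : Rep G) : Cycle β where
  ι := σ.ι
  ρ := σ.ρ
  continuous_ρ := σ.continuous_ρ
  e := ampl p 1
  idem := by rw [ampl_mul, hp, mul_one]
  invariant g := ampl_invariant (hβ g) (by rw [one_mul, mul_one])

/-- The map from the representation ring to `K`-theory given by an invariant idempotent. -/
def repK {p : B} (hp : p * p = p) (hβ : ∀ g, β g p = p) : RRing G →+ K0 β :=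
  RRing.lift (fun σ => K0.cls (repCycle hp hβ σ))
    (by
      rintro σ τ ⟨x, y, hxy, hyx, h⟩
      have h' : ∀ g, τ.ρ g * y = y * σ.ρ g := fun g => by
        calc τ.ρ g * y = y * x * (τ.ρ g * y) := by rw [hyx, Matrix.one_mul]
          _ = y * (x * τ.ρ g) * y := by simp only [Matrix.mul_assoc]
          _ = y * σ.ρ g := by rw [← h, Matrix.mul_assoc, Matrix.mul_assoc, hxy, Matrix.mul_one]
      refine K0.cls_eq_of_equivalent ⟨ampl p x, ampl p y, fun g => ampl_invariant (hβ g) (h g),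
        fun g => ampl_invariant (hβ g) (h' g), ?_, ?_⟩
      · refine (ampl_mul x y).trans ?_
        rw [hp, hxy]
        rfl
      · refine (ampl_mul y x).trans ?_
        rw [hp, hyx]
        rfl)
    (fun σ τ => by
      rw [← K0.cls_sum]
      have h1 : ampl p (1 : Matrix (σ.ι ⊕ τ.ι) (σ.ι ⊕ τ.ι) ℂ) =
          fromBlocks (ampl p 1) 0 0 (ampl p 1) := by
        ext (i | i) (j | j) <;> simp [ampl, Matrix.one_apply]
      refine congrArg K0.cls ?_
      simp only [repCycle, Cycle.sum, Rep.sum]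
      congr 1)

theorem repK_cls {p : B} (hp : p * p = p) (hβ : ∀ g, β g p = p) (σ : Rep G) :
    repK hp hβ (RRing.cls σ) = K0.cls (repCycle hp hβ σ) := RRing.lift_cls _ _ _ σ

/-- The part of weight `μ` of a representation. -/
def repWeight {z : G} (hz : ∀ g, g * z = z * g) (μ : ℂ) : RRing G →+ RRing G :=
  (weightK (isGraded_one hz) covariant_one μ).comp
    (repK (β := (1 : G →* (ℂ →ₐ[ℂ] ℂ))) (p := 1) (one_mul 1) fun _ => map_one _)

theorem repWeight_cls {z : G} (hz : ∀ g, g * z = z * g) (μ : ℂ) (σ : Rep G) :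
    repWeight hz μ (RRing.cls σ) = repCls ((isGraded_one hz).sub σ.ρ σ.continuous_ρ μ) := by
  rw [repWeight, AddMonoidHom.comp_apply, repK_cls, weightK_cls]
  refine repCls_eq_of_eq _ _ (inf_eq_left.2 fun x _ => ?_)
  exact matAct_ampl_one _ x

/-- A representation is the sum of its parts. -/
theorem exists_sum_repWeight {z : G} (hz : ∀ g, g * z = z * g) (σ : Rep G) :
    ∃ S : Finset ℂ, ∀ S', S ⊆ S' → ∑ μ ∈ S', repWeight hz μ (RRing.cls σ) = RRing.cls σ := by
  classical
  have htop : (⨆ μ, block (1 : G →* Module.End ℂ ℂ) σ.ρ z μ) = ⊤ :=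
    Module.End.iSup_maxGenEigenspace_eq_top _
  have hfg := (Submodule.fg_iff_compact (⊤ : Submodule ℂ (σ.ι → ℂ))).1 Module.Finite.fg_top
  obtain ⟨S, hS⟩ := CompleteLattice.IsCompactElement.exists_finset_of_le_iSup _ hfg _ htop.ge
  refine ⟨S, fun S' hSS' => ?_⟩
  obtain ⟨h, hs⟩ := repCls_biSup (block (1 : G →* Module.End ℂ ℂ) σ.ρ z)
    (fun μ => (isGraded_one hz).sub σ.ρ σ.continuous_ρ μ)
    (Module.End.independent_maxGenEigenspace _) S'
  simp only [repWeight_cls]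
  rw [← hs]
  have ht : (⨆ m ∈ S', block (1 : G →* Module.End ℂ ℂ) σ.ρ z m) = ⊤ :=
    top_le_iff.1 (hS.trans (biSup_mono hSS'))
  refine repCls_eq_cls h σ ((LinearEquiv.ofTop _ ht).symm) fun g x => ?_
  change σ.ρ g *ᵥ x = twist 1 σ.ρ g x
  ext i
  simp [twist_apply, Matrix.mulVec, dotProduct]

/-- An element of the representation ring is determined by its weights. -/
theorem eq_of_repWeight_eq {z : G} (hz : ∀ g, g * z = z * g) {r s : RRing G}
    (h : ∀ μ, repWeight hz μ r = repWeight hz μ s) : r = s := by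
  classical
  rw [← sub_eq_zero]
  obtain ⟨σ, τ, hστ⟩ := RRing.exists_sub (r - s)
  obtain ⟨S, hS⟩ := exists_sum_repWeight hz σ
  obtain ⟨T, hT⟩ := exists_sum_repWeight hz τ
  rw [hστ, ← hS _ Finset.subset_union_left, ← hT _ Finset.subset_union_right,
    ← Finset.sum_sub_distrib]
  refine Finset.sum_eq_zero fun μ _ => ?_
  rw [← map_sub, ← hστ, map_sub, h, sub_self]

end Restriction

/-! ## The grading of the Fock space by degree -/

section Degree

set_option linter.unusedSectionVars false

open Filter Topology InnerProductSpace

variable {V : Type*} [NormedAddCommGroup V] [InnerProductSpace ℂ V] [FiniteDimensional ℂ V]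
  [MeasurableSpace V] [BorelSpace V]

attribute [local instance] InnerProductSpace.complexToReal

section Functions

variable {E : Type*} [AddCommGroup E] [Module ℂ E]

/-- Multiplication of a function by the antilinear functional `x ↦ ⟨x, v⟩`. -/
def mulInner : V →ₗ[ℂ] (V → E) →ₗ[ℂ] (V → E) :=
  LinearMap.mk₂ ℂ (fun v f x => (inner ℂ x v : ℂ) • f x)
    (fun v w f => by ext x; simp [add_smul])
    (fun c v f => by ext x; simp [mul_smul])
    (fun v f g => by ext x; simp)
    (fun c v f => by ext x; simp [smul_comm c])

theorem mulInner_apply (v : V) (f : V → E) (x : V) : mulInner v f x = (inner ℂ x v : ℂ) • f x :=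
  rfl

/-- The action of the unitary group on functions. -/
def fnAct : (V ≃ₗᵢ[ℂ] V) →* Module.End ℂ (V → E) where
  toFun u := LinearMap.funLeft ℂ E u.symm
  map_one' := rfl
  map_mul' _ _ := rfl

theorem fnAct_apply (u : V ≃ₗᵢ[ℂ] V) (f : V → E) (x : V) : fnAct u f x = f (u.symm x) := rfl

theorem fnAct_mulInner (u : V ≃ₗᵢ[ℂ] V) (v : V) (f : V → E) :
    fnAct u (mulInner v f) = mulInner (u v) (fnAct u f) := by
  ext x
  simp only [fnAct_apply, mulInner_apply]
  rw [← u.inner_map_map (u.symm x) v, u.apply_symm_apply]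

end Functions

variable (V) in
/-- Homogeneous antiholomorphic polynomials of degree `k`. -/
def antiPoly : ℕ → Submodule ℂ (V → ℂ)
  | 0 => Submodule.span ℂ {fun _ => 1}
  | k + 1 => Submodule.map₂ mulInner ⊤ (antiPoly k)

theorem antiPoly_induction {p : ℕ → (V → ℂ) → Prop} (one : p 0 fun _ => 1)
    (zero : ∀ k, p k 0) (add : ∀ k f g, p k f → p k g → p k (f + g))
    (smul : ∀ k (c : ℂ) f, p k f → p k (c • f))
    (mul : ∀ k v f, p k f → p (k + 1) (mulInner v f)) {k : ℕ} {f : V → ℂ}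
    (hf : f ∈ antiPoly V k) : p k f := by
  induction k generalizing f with
  | zero =>
    obtain ⟨c, rfl⟩ := Submodule.mem_span_singleton.1 hf
    exact smul _ _ _ one
  | succ k ih =>
    let S : Submodule ℂ (V → ℂ) :=
      { carrier := {f | p (k + 1) f}
        add_mem' := fun hf hg => add _ _ _ hf hg
        zero_mem' := zero _
        smul_mem' := fun c _ hf => smul _ c _ hf }
    have h : antiPoly V (k + 1) ≤ S :=
      Submodule.map₂_le.2 fun v _ f hf => mul k v f (ih hf)
    exact h hf

theorem fg_antiPoly (k : ℕ) : (antiPoly V k).FG := by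
  induction k with
  | zero => exact Submodule.fg_span (Set.finite_singleton _)
  | succ k ih => exact Submodule.FG.map₂ _ Module.Finite.fg_top ih

theorem continuous_of_mem_antiPoly {k : ℕ} {f : V → ℂ} (hf : f ∈ antiPoly V k) :
    Continuous f := by
  exact antiPoly_induction (p := fun _ f => Continuous f) continuous_const
    (fun _ => continuous_const) (fun _ _ _ hf hg => hf.add hg) (fun _ c _ hf => hf.const_smul c)
    (fun _ v _ hf => (show Continuous fun x : V => (inner ℂ x v : ℂ) by fun_prop).smul hf) hf

theorem fnAct_mem_antiPoly (u : V ≃ₗᵢ[ℂ] V) {k : ℕ} {f : V → ℂ} (hf : f ∈ antiPoly V k) :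
    fnAct u f ∈ antiPoly V k := by
  refine antiPoly_induction (p := fun k f => fnAct u f ∈ antiPoly V k) ?_ (fun k => ?_)
    (fun k f g hf hg => ?_) (fun k c f hf => ?_) (fun k v f hf => ?_) hf
  · exact Submodule.subset_span rfl
  · rw [map_zero]
    exact zero_mem _
  · rw [map_add]
    exact add_mem hf hg
  · rw [map_smul]
    exact Submodule.smul_mem _ _ hf
  · rw [fnAct_mulInner]
    exact Submodule.apply_mem_map₂ _ trivial hf

theorem continuous_unitary_symm_apply (x : V) :
    Continuous fun u : V ≃ₗᵢ[ℂ] V => u.symm x := by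
  let b := stdOrthonormalBasis ℂ V
  have h : (fun u : V ≃ₗᵢ[ℂ] V => u.symm x) = fun u => ∑ i, (inner ℂ (u (b i)) x : ℂ) • b i := by
    ext1 u
    conv_lhs => rw [← b.sum_repr' (u.symm x)]
    refine Finset.sum_congr rfl fun i _ => ?_
    rw [← u.inner_map_map (b i), u.apply_symm_apply]
  rw [h]
  exact continuous_finsetSum _ fun i _ =>
    ((continuous_unitary_apply (b i)).inner continuous_const).smul continuous_const

theorem isSubRep_antiPoly (k : ℕ) : IsSubRep (fnAct (V := V)) (antiPoly V k) where
  fin := Module.Finite.iff_fg.2 (fg_antiPoly k)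
  inv u f hf := fnAct_mem_antiPoly u hf
  cont f hf φ := by
    have : FiniteDimensional ℂ (antiPoly V k) := Module.Finite.iff_fg.2 (fg_antiPoly k)
    have h1 : Continuous fun u : V ≃ₗᵢ[ℂ] V =>
        (⟨fnAct u f, fnAct_mem_antiPoly u hf⟩ : antiPoly V k) :=
      (continuous_pi fun x => (continuous_of_mem_antiPoly hf).comp
        (continuous_unitary_symm_apply x)).subtype_mk _
    exact (LinearMap.continuous_of_finiteDimensional
      (φ.comp (antiPoly V k).subtype)).comp h1

variable (V) in
/-- Antiholomorphic functions of exponential growth. -/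
def entireSpace : Submodule ℂ (V → ℂ) where
  carrier := {f | Differentiable ℂ (fun x => star (f x)) ∧
    ∃ C c : ℝ, ∀ x, ‖f x‖ ≤ C * Real.exp (c * ‖x‖)}
  zero_mem' := ⟨by simp, 0, 0, by simp⟩
  add_mem' := by
    rintro f g ⟨hf, C, c, hC⟩ ⟨hg, D, d, hD⟩
    have h0 : (fun x => star ((f + g) x)) = (fun x => star (f x)) + fun x => star (g x) := by
      ext x
      simp
    refine ⟨h0 ▸ hf.add hg, |C| + |D|, |c| + |d|, fun x => ?_⟩
    have h1 : C * Real.exp (c * ‖x‖) ≤ |C| * Real.exp ((|c| + |d|) * ‖x‖) := by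
      gcongr
      · exact le_abs_self C
      · linarith [le_abs_self c, abs_nonneg d]
    have h2 : D * Real.exp (d * ‖x‖) ≤ |D| * Real.exp ((|c| + |d|) * ‖x‖) := by
      gcongr
      · exact le_abs_self D
      · linarith [le_abs_self d, abs_nonneg c]
    calc ‖(f + g) x‖ ≤ ‖f x‖ + ‖g x‖ := norm_add_le _ _
      _ ≤ |C| * Real.exp ((|c| + |d|) * ‖x‖) + |D| * Real.exp ((|c| + |d|) * ‖x‖) :=
        add_le_add ((hC x).trans h1) ((hD x).trans h2)
      _ = _ := by ring
  smul_mem' := by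
    rintro r f ⟨hf, C, c, hC⟩
    have h0 : (fun x => star ((r • f) x)) = fun x => star r * star (f x) := by
      ext x
      simp
    refine ⟨h0 ▸ hf.const_mul (star r), ‖r‖ * C, c, fun x => ?_⟩
    rw [Pi.smul_apply, norm_smul, mul_assoc]
    gcongr
    exact hC x

theorem mulInner_mem_entireSpace (v : V) {f : V → ℂ} (hf : f ∈ entireSpace V) :
    mulInner v f ∈ entireSpace V := by
  obtain ⟨hf, C, c, hC⟩ := hf
  have hd : Differentiable ℂ fun x : V => (inner ℂ v x : ℂ) := (innerSL ℂ v).differentiable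
  have h0 : (fun x => star (mulInner v f x)) = (fun x => inner ℂ v x) * fun x => star (f x) := by
    ext x
    simp [mulInner_apply]
  refine ⟨h0 ▸ hd.mul hf, C * ‖v‖, c + 1, fun x => ?_⟩
  · have hC0 : 0 ≤ C * Real.exp (c * ‖x‖) := (norm_nonneg _).trans (hC x)
    rw [mulInner_apply, norm_smul]
    calc _ ≤ (‖x‖ * ‖v‖) * (C * Real.exp (c * ‖x‖)) := by
          gcongr
          · exact norm_inner_le_norm x v
          · exact hC x
      _ ≤ (Real.exp ‖x‖ * ‖v‖) * (C * Real.exp (c * ‖x‖)) := by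
          gcongr
          linarith [Real.add_one_le_exp ‖x‖]
      _ = _ := by
          rw [add_mul, one_mul, Real.exp_add]
          ring

theorem antiPoly_le_entireSpace (k : ℕ) : antiPoly V k ≤ entireSpace V := fun _ hf =>
  antiPoly_induction (p := fun _ f => f ∈ entireSpace V) ⟨by simp, 1, 0, by simp⟩
    (fun _ => zero_mem _) (fun _ _ _ hf hg => add_mem hf hg)
    (fun _ _ _ hf => Submodule.smul_mem _ _ hf)
    (fun _ v _ hf => mulInner_mem_entireSpace v hf) hf

theorem fnAct_mem_entireSpace (u : V ≃ₗᵢ[ℂ] V) {f : V → ℂ} (hf : f ∈ entireSpace V) :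
    fnAct u f ∈ entireSpace V := by
  obtain ⟨hf, C, c, hC⟩ := hf
  refine ⟨hf.comp (u.symm.toContinuousLinearEquiv : V →L[ℂ] V).differentiable, C, c,
    fun x => (hC (u.symm x)).trans_eq (by rw [u.symm.norm_map])⟩

theorem entireSpace_memLp (f : entireSpace V) :
    MemLp (fun x => f.1 x * (Real.exp (-‖x‖ ^ 2) : ℝ)) 2 (leb V) := by
  obtain ⟨C, c, h⟩ := f.2.2
  refine memLp_mul_gaussian ?_ h
  simpa using f.2.1.continuous.star

variable (V) in
/-- The element of the Fock space given by an antiholomorphic function of exponential growth. -/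
def fockOf : entireSpace V →ₗ[ℂ] Fock V where
  toFun f := ⟨(entireSpace_memLp f).toLp _, _, f.2.1, by
    simpa using (entireSpace_memLp f).coeFn_toLp⟩
  map_add' f g := by
    refine Subtype.ext ?_
    refine Eq.trans ?_ (MemLp.toLp_add (entireSpace_memLp f) (entireSpace_memLp g))
    refine MemLp.toLp_congr (entireSpace_memLp (f + g)) _ (Eventually.of_forall fun x => ?_)
    simp [add_mul]
  map_smul' c f := by
    refine Subtype.ext ?_
    refine Eq.trans ?_ (MemLp.toLp_const_smul c (entireSpace_memLp f))
    refine MemLp.toLp_congr (entireSpace_memLp (c • f)) _ (Eventually.of_forall fun x => ?_)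
    simp [mul_assoc]

theorem fockOf_coe (f : entireSpace V) :
    ((fockOf V f).1 : V → ℂ) =ᵐ[leb V] fun x => f.1 x * (Real.exp (-‖x‖ ^ 2) : ℝ) :=
  (entireSpace_memLp f).coeFn_toLp

theorem continuous_entireSpace (f : entireSpace V) : Continuous f.1 := by
  simpa using f.2.1.continuous.star

theorem fockOf_injective : Function.Injective (fockOf V) := by
  intro f g hfg
  refine Subtype.ext ?_
  refine Continuous.ae_eq_iff_eq (leb V) (continuous_entireSpace f) (continuous_entireSpace g) |>.1
    ?_
  have hg := fockOf_coe g
  rw [← hfg] at hg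
  filter_upwards [fockOf_coe f, hg] with x h1 h2
  rw [h1] at h2
  exact mul_right_cancel₀ (by exact_mod_cast (Real.exp_pos _).ne') h2

theorem fockAct_fockOf (u : V ≃ₗᵢ[ℂ] V) (f : entireSpace V) :
    fockAct u (fockOf V f) = fockOf V ⟨fnAct u f.1, fnAct_mem_entireSpace u f.2⟩ := by
  refine Subtype.ext (Lp.ext ?_)
  rw [fockAct_val]
  filter_upwards [l2Act_coe u (fockOf V f).1,
    (measurePreserving_unitary u.symm).quasiMeasurePreserving.ae_eq (fockOf_coe f),
    fockOf_coe ⟨fnAct u f.1, fnAct_mem_entireSpace u f.2⟩] with x h1 h2 h3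
  rw [h1, h3]
  refine h2.trans ?_
  simp [fnAct_apply]

variable (V) in
/-- The action of the unitary group on the Fock space. -/
def fockEnd : (V ≃ₗᵢ[ℂ] V) →* Module.End ℂ (Fock V) where
  toFun u := (fockAct u).toLinearMap
  map_one' := by rw [map_one]; rfl
  map_mul' u v := by rw [map_mul]; rfl

theorem fockEnd_apply (u : V ≃ₗᵢ[ℂ] V) (f : Fock V) : fockEnd V u f = fockAct u f := rfl

variable (V) in
/-- The homogeneous part of the Fock space of degree `k`. -/
def fockDeg (k : ℕ) : Submodule ℂ (Fock V) :=
  ((antiPoly V k).comap (entireSpace V).subtype).map (fockOf V)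

theorem isSubRep_fockDeg (k : ℕ) : IsSubRep (fockEnd V) (fockDeg V k) where
  fin := by
    refine Module.Finite.iff_fg.2 (Submodule.FG.map _ ?_)
    refine Submodule.fg_of_fg_map_injective _ (Submodule.subtype_injective _) ?_
    rw [Submodule.map_comap_subtype, inf_eq_right.2 (antiPoly_le_entireSpace k)]
    exact fg_antiPoly k
  inv := by
    rintro u _ ⟨f, hf, rfl⟩
    rw [fockEnd_apply, fockAct_fockOf]
    exact ⟨_, fnAct_mem_antiPoly u hf, rfl⟩
  cont := by
    rintro _ ⟨f, hf, rfl⟩ φ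
    obtain ⟨ψ, hψ⟩ := LinearMap.exists_extend (φ.comp (fockOf V))
    refine ((isSubRep_antiPoly (V := V) k).cont f.1 hf ψ).congr fun u => ?_
    rw [fockEnd_apply, fockAct_fockOf]
    exact LinearMap.congr_fun hψ ⟨fnAct u f.1, fnAct_mem_entireSpace u f.2⟩

variable (V) in
/-- The part of the Fock space of degree less than `N`. -/
def fockTrunc : ℕ → Submodule ℂ (Fock V)
  | 0 => ⊥
  | N + 1 => fockTrunc N ⊔ fockDeg V N

theorem isSubRep_fockTrunc (N : ℕ) : IsSubRep (fockEnd V) (fockTrunc V N) := by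
  induction N with
  | zero => exact IsSubRep.bot
  | succ N ih => exact ih.sup (isSubRep_fockDeg N)

theorem fockTrunc_mono : Monotone (fockTrunc V) := monotone_nat_of_le_succ fun _ => le_sup_left

theorem fockDeg_le_fockTrunc {k N : ℕ} (h : k < N) : fockDeg V k ≤ fockTrunc V N :=
  le_sup_right.trans (fockTrunc_mono (Nat.succ_le_of_lt h) : fockTrunc V (k + 1) ≤ _)

instance (N : ℕ) : FiniteDimensional ℂ (fockTrunc V N) := (isSubRep_fockTrunc N).fin

end Degree

section Degree

set_option linter.unusedSectionVars false

open Filter Topology InnerProductSpace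

variable {V : Type*} [NormedAddCommGroup V] [InnerProductSpace ℂ V] [FiniteDimensional ℂ V]
  [MeasurableSpace V] [BorelSpace V]

attribute [local instance] InnerProductSpace.complexToReal

theorem inner_pow_mem_antiPoly (z : V) (k : ℕ) :
    (fun x : V => (inner ℂ x z : ℂ) ^ k) ∈ antiPoly V k := by
  induction k with
  | zero =>
    simp only [pow_zero]
    exact Submodule.subset_span rfl
  | succ k ih =>
    have h : (fun x : V => (inner ℂ x z : ℂ) ^ (k + 1)) =
        mulInner z (fun x : V => (inner ℂ x z : ℂ) ^ k) := by
      ext x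
      rw [mulInner_apply, pow_succ', smul_eq_mul]
    rw [h]
    exact Submodule.apply_mem_map₂ _ trivial ih

theorem inner_fockOf (f : entireSpace V) (g : Fock V) : inner ℂ (fockOf V f) g =
    ∫ x, star (f.1 x) * ((Real.exp (-‖x‖ ^ 2) : ℝ) : ℂ) * (g.1 : V → ℂ) x ∂(leb V) := by
  rw [← Fock.inner_val, L2.inner_def]
  refine integral_congr_ae ?_
  filter_upwards [fockOf_coe f] with x hx
  rw [hx, RCLike.inner_apply', map_mul, Complex.conj_ofReal]
  rfl

/-- The homogeneous parts are total. -/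
theorem eq_zero_of_inner_fockDeg {g : Fock V} (h : ∀ k, ∀ f ∈ fockDeg V k, inner ℂ f g = 0) :
    g = 0 := by
  refine Subtype.ext (eq_zero_of_inner_coherent g.2 fun z => ?_)
  have hpow : ∀ k, (fun x : V => (2 * inner ℂ x z : ℂ) ^ k / (k.factorial : ℂ)) ∈ antiPoly V k :=
    fun k => by
      have h1 : (fun x : V => (2 * inner ℂ x z : ℂ) ^ k / (k.factorial : ℂ)) =
          ((2 : ℂ) ^ k / (k.factorial : ℂ)) • fun x : V => (inner ℂ x z : ℂ) ^ k := by
        ext x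
        simp only [Pi.smul_apply, smul_eq_mul, mul_pow]
        ring
      rw [h1]
      exact Submodule.smul_mem _ _ (inner_pow_mem_antiPoly z k)
  let t : ℕ → entireSpace V := fun k => ⟨_, antiPoly_le_entireSpace k (hpow k)⟩
  let s : ℕ → entireSpace V := fun N => ∑ k ∈ Finset.range N, t k
  have hs : ∀ N x, (s N).1 x =
      ∑ k ∈ Finset.range N, (2 * inner ℂ x z : ℂ) ^ k / (k.factorial : ℂ) := fun N x => by
    simp only [s, t, AddSubmonoidClass.coe_finsetSum, Finset.sum_apply]
  have hs0 : ∀ N, inner ℂ (fockOf V (s N)) g = 0 := fun N => by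
    rw [map_sum, sum_inner]
    exact Finset.sum_eq_zero fun k _ => h k _ ⟨t k, hpow k, rfl⟩
  have hlim : Tendsto (fun N => inner ℂ (fockOf V (s N)) g) atTop
      (𝓝 (inner ℂ (coherent z) g.1)) := by
    rw [L2.inner_def]
    simp only [inner_fockOf]
    refine tendsto_integral_of_dominated_convergence
      (fun x => Real.exp (2 * ‖z‖ * ‖x‖) * Real.exp (-‖x‖ ^ 2) * ‖(g.1 : V → ℂ) x‖)
      (fun N => ?_) ?_ (fun N => ?_) ?_
    · have h1 := continuous_entireSpace (s N)
      exact AEStronglyMeasurable.mul (Continuous.aestronglyMeasurable (by fun_prop))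
        (Lp.aestronglyMeasurable g.1)
    · have h1 : MemLp (fun x : V => (Real.exp (2 * ‖z‖ * ‖x‖) : ℂ) *
          (Real.exp (-‖x‖ ^ 2) : ℝ)) 2 (leb V) :=
        memLp_mul_gaussian (by fun_prop) (C := 1) (c := 2 * ‖z‖) fun x => by
          rw [Complex.norm_real, Real.norm_of_nonneg (Real.exp_pos _).le, one_mul]
      refine (h1.norm.integrable_mul (Lp.memLp g.1).norm).congr (Eventually.of_forall fun x => ?_)
      simp only [Pi.mul_apply]
      rw [norm_mul, Complex.norm_real, Complex.norm_real, Real.norm_of_nonneg (Real.exp_pos _).le,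
        Real.norm_of_nonneg (Real.exp_pos _).le]
    · refine Eventually.of_forall fun x => ?_
      rw [norm_mul, norm_mul, norm_star, Complex.norm_real,
        Real.norm_of_nonneg (Real.exp_pos _).le]
      gcongr
      rw [hs]
      refine (norm_sum_le _ _).trans ?_
      refine le_trans ?_ (Real.sum_le_exp_of_nonneg (n := N) (by positivity))
      refine Finset.sum_le_sum fun k _ => ?_
      rw [norm_div, norm_pow, Complex.norm_natCast, norm_mul, Complex.norm_ofNat]
      have h1 : 2 * ‖(inner ℂ x z : ℂ)‖ ≤ 2 * ‖z‖ * ‖x‖ := by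
        nlinarith [norm_inner_le_norm (𝕜 := ℂ) x z]
      gcongr
    · filter_upwards [(isFock_coherent z).2] with x hx
      rw [hx, RCLike.inner_apply', map_mul, Complex.conj_ofReal]
      refine Tendsto.mul_const _ (Tendsto.mul_const _ ?_)
      have h1 : (starRingEnd ℂ) (star (Complex.exp (2 * inner ℂ z x))) =
          star (Complex.exp (2 * inner ℂ x z)) := by
        rw [← Complex.star_def, star_star, Complex.star_def, ← Complex.exp_conj, map_mul,
          inner_conj_symm, map_ofNat]
      rw [h1]
      refine Tendsto.star ?_
      simp only [hs]
      have h2 := (NormedSpace.expSeries_div_hasSum_exp (𝔸 := ℂ) (2 * inner ℂ x z)).tendsto_sum_nat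
      rwa [← Complex.exp_eq_exp_ℂ] at h2
  exact tendsto_nhds_unique hlim (by simp only [hs0]; exact tendsto_const_nhds)

variable (V) in
/-- Multiplication by `e^i`. -/
def rot : V ≃ₗᵢ[ℂ] V where
  toLinearEquiv := LinearEquiv.smulOfUnit (Units.mk0 (Complex.exp Complex.I) (Complex.exp_ne_zero _))
  norm_map' x := by
    change ‖Complex.exp Complex.I • x‖ = ‖x‖
    have := Complex.norm_exp_ofReal_mul_I 1
    rw [Complex.ofReal_one, one_mul] at this
    rw [norm_smul, this, one_mul]

theorem rot_apply (x : V) : rot V x = Complex.exp Complex.I • x := rfl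

theorem rot_central (u : V ≃ₗᵢ[ℂ] V) : u * rot V = rot V * u := by
  ext x
  exact u.map_smul _ x

theorem injective_exp_I_pow : Function.Injective fun k : ℕ => Complex.exp Complex.I ^ k := by
  intro k l h
  simp only [← Complex.exp_nat_mul] at h
  obtain ⟨n, hn⟩ := Complex.exp_eq_exp_iff_exists_int.1 h
  have h1 : (k : ℂ) = l + n * (2 * Real.pi) := by
    have h2 : (k : ℂ) * Complex.I = (l + n * (2 * Real.pi)) * Complex.I := by
      rw [hn]
      ring
    exact mul_right_cancel₀ Complex.I_ne_zero h2
  have h2 : (k : ℝ) = l + n * (2 * Real.pi) := by exact_mod_cast h1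
  rcases eq_or_ne n 0 with rfl | hn0
  · simpa using h2
  · refine absurd ⟨((k : ℚ) - l) / (2 * n), ?_⟩ irrational_pi
    have : (n : ℝ) ≠ 0 := by exact_mod_cast hn0
    push_cast
    field_simp
    linarith

theorem fnAct_rot {k : ℕ} {f : V → ℂ} (hf : f ∈ antiPoly V k) :
    fnAct (rot V) f = Complex.exp Complex.I ^ k • f := by
  refine antiPoly_induction (p := fun k f => fnAct (rot V) f = Complex.exp Complex.I ^ k • f) ?_
    (fun k => ?_) (fun k f g hf hg => ?_) (fun k c f hf => ?_) (fun k v f hf => ?_) hf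
  · ext x
    simp [fnAct_apply]
  · simp
  · rw [map_add, hf, hg, smul_add]
  · rw [map_smul, hf, smul_comm]
  · rw [fnAct_mulInner, hf, rot_apply, map_smul, map_smul, LinearMap.smul_apply, smul_smul, pow_succ]

theorem fockAct_rot {k : ℕ} {f : Fock V} (hf : f ∈ fockDeg V k) :
    fockAct (rot V) f = Complex.exp Complex.I ^ k • f := by
  obtain ⟨f, hf, rfl⟩ := hf
  rw [fockAct_fockOf, ← map_smul]
  congr 1
  exact Subtype.ext (fnAct_rot hf)

theorem norm_exp_I : ‖Complex.exp Complex.I‖ = 1 := by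
  have := Complex.norm_exp_ofReal_mul_I 1
  rwa [Complex.ofReal_one, one_mul] at this

theorem inner_fockAct_rot {k : ℕ} {f : Fock V} (hf : f ∈ fockDeg V k) (g : Fock V) :
    inner ℂ f (fockAct (rot V) g) = Complex.exp Complex.I ^ k * inner ℂ f g := by
  have h := inner_fockAct (rot V) f g
  rw [fockAct_rot hf, inner_smul_left] at h
  have h1 : Complex.exp Complex.I ^ k * (starRingEnd ℂ) (Complex.exp Complex.I ^ k) = 1 := by
    rw [Complex.mul_conj, Complex.normSq_eq_norm_sq, norm_pow, norm_exp_I]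
    simp
  rw [← h, ← mul_assoc, h1, one_mul]

theorem inner_fockDeg {k l : ℕ} (hkl : k ≠ l) {f g : Fock V} (hf : f ∈ fockDeg V k)
    (hg : g ∈ fockDeg V l) : inner ℂ f g = 0 := by
  have h := inner_fockAct_rot hf g
  rw [fockAct_rot hg, inner_smul_right] at h
  by_contra h0
  exact hkl (injective_exp_I_pow (mul_right_cancel₀ h0 h)).symm

theorem inner_fockDeg_fockTrunc {k N : ℕ} (hk : N ≤ k) {f g : Fock V} (hf : f ∈ fockDeg V k)
    (hg : g ∈ fockTrunc V N) : inner ℂ f g = 0 := by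
  induction N generalizing g with
  | zero => rw [(Submodule.mem_bot ℂ).1 hg, inner_zero_right]
  | succ N ih =>
    obtain ⟨x, hx, y, hy, rfl⟩ := Submodule.mem_sup.1 hg
    rw [inner_add_right, ih (by omega) hx, inner_fockDeg (by omega) hf hy, add_zero]

theorem mem_fockTrunc_of_inner {N : ℕ} {g : Fock V}
    (h : ∀ k, N ≤ k → ∀ f ∈ fockDeg V k, inner ℂ f g = 0) : g ∈ fockTrunc V N := by
  have h0 : g - (fockTrunc V N).starProjection g = 0 := by
    refine eq_zero_of_inner_fockDeg fun k f hf => ?_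
    rcases lt_or_ge k N with hk | hk
    · exact Submodule.inner_right_of_mem_orthogonal (fockDeg_le_fockTrunc hk hf)
        (Submodule.sub_starProjection_mem_orthogonal g)
    · rw [inner_sub_right, h k hk f hf,
        inner_fockDeg_fockTrunc hk hf (Submodule.starProjection_apply_mem _ g), sub_zero]
  rw [sub_eq_zero.1 h0]
  exact Submodule.starProjection_apply_mem _ g

theorem tendsto_fockTrunc (g : Fock V) :
    Tendsto (fun N => (fockTrunc V N).starProjection g) atTop (𝓝 g) := by
  refine Submodule.starProjection_tendsto_self _ fockTrunc_mono g (top_le_iff.2 ?_)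
  rw [Submodule.topologicalClosure_eq_top_iff, Submodule.eq_bot_iff]
  intro f hf
  refine eq_zero_of_inner_fockDeg fun k x hx => ?_
  exact (Submodule.mem_orthogonal _ _).1 hf x
    (Submodule.mem_iSup_of_mem (k + 1) (fockDeg_le_fockTrunc k.lt_succ_self hx))

theorem maxGenEigenspace_eq_bot {M : Type*} [AddCommGroup M] [Module ℂ M] {f : Module.End ℂ M}
    {μ : ℂ} (h : ¬ f.HasEigenvalue μ) {x : M} (hx : x ∈ f.maxGenEigenspace μ) : x = 0 := by
  obtain ⟨k, hk⟩ := (Module.End.mem_maxGenEigenspace _ _ _).1 hx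
  have h0 : f.eigenspace μ = ⊥ := by
    by_contra h1
    exact h (Module.End.hasEigenvalue_iff.2 h1)
  have hinj : Function.Injective ⇑(f - μ • (1 : Module.End ℂ M)) := by
    rw [← LinearMap.ker_eq_bot, ← h0, Module.End.eigenspace_def]
  have hk' : Function.Injective ⇑((f - μ • (1 : Module.End ℂ M)) ^ k) := by
    rw [Module.End.coe_pow]
    exact hinj.iterate k
  exact hk' (hk.trans (map_zero _).symm)

/-- The weight spaces of `H ⊗ W` are contained in finitely many degrees. -/
theorem exists_block_le_fockTrunc {ι : Type} [Fintype ι] [DecidableEq ι]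
    (ρ : (V ≃ₗᵢ[ℂ] V) →* Matrix ι ι ℂ) (μ : ℂ) :
    ∃ N, ∀ h ∈ block (fockEnd V) ρ (rot V) μ, ∀ i, h i ∈ fockTrunc V N := by
  set ζ := Complex.exp Complex.I with hζ
  have hζ0 : ζ ≠ 0 := Complex.exp_ne_zero _
  let τ₁ := twist (1 : (V ≃ₗᵢ[ℂ] V) →* Module.End ℂ ℂ) ρ
  let A : Module.End ℂ (ι → ℂ) := τ₁ (rot V)
  have hA : ∀ x, A x = 0 → x = 0 := fun x hx => by
    have h1 : τ₁ (rot V)⁻¹ (A x) = x := by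
      change (τ₁ (rot V)⁻¹ * τ₁ (rot V)) x = x
      rw [← map_mul, inv_mul_cancel, map_one]
      rfl
    rw [← h1, hx, map_zero]
  have hfin : {k : ℕ | (ζ ^ k • A).HasEigenvalue μ}.Finite := by
    have hS : {ν | A.HasEigenvalue ν}.Finite :=
      A.finite_spectrum.subset fun ν h => Module.End.HasEigenvalue.mem_spectrum h
    have key : ∀ k, (ζ ^ k • A).HasEigenvalue μ → μ ≠ 0 ∧ A.HasEigenvalue ((ζ ^ k)⁻¹ * μ) := by
      intro k hk
      obtain ⟨x, hx⟩ := hk.exists_hasEigenvector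
      have hx1 := hx.apply_eq_smul
      rw [LinearMap.smul_apply] at hx1
      have hx2 : A x = ((ζ ^ k)⁻¹ * μ) • x := by
        rw [mul_smul, ← hx1, smul_smul, inv_mul_cancel₀ (pow_ne_zero k hζ0), one_smul]
      refine ⟨fun h0 => hx.2 (hA x ?_), Module.End.hasEigenvalue_of_hasEigenvector
        (x := x) ⟨Module.End.mem_eigenspace_iff.2 hx2, hx.2⟩⟩
      rw [hx2, h0, mul_zero, zero_smul]
    refine Set.Finite.of_finite_image (f := fun k : ℕ => (ζ ^ k)⁻¹ * μ) (hS.subset ?_) ?_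
    · rintro _ ⟨k, hk, rfl⟩
      exact (key k hk).2
    intro k hk l _ hkl
    have h1 := mul_right_cancel₀ (key k hk).1 hkl
    exact injective_exp_I_pow (inv_injective h1)
  obtain ⟨N, hN⟩ := hfin.bddAbove
  refine ⟨N + 1, fun h hh i => mem_fockTrunc_of_inner fun k hk f hf => ?_⟩
  let a : (ι → Fock V) →ₗ[ℂ] (ι → ℂ) :=
    LinearMap.pi fun i => ((innerSL ℂ f).toLinearMap.comp (LinearMap.proj i))
  have ha : ∀ x j, a x j = inner ℂ f (x j) := fun x j => rfl
  have hmem : a h ∈ (ζ ^ k • A).maxGenEigenspace μ := by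
    refine map_mem_maxGenEigenspace (f := twist (fockEnd V) ρ (rot V)) a (fun x => ?_) hh
    ext j
    rw [ha, twist_apply, inner_sum, LinearMap.smul_apply, Pi.smul_apply, twist_apply,
      Finset.smul_sum]
    refine Finset.sum_congr rfl fun l _ => ?_
    rw [inner_smul_right, fockEnd_apply, inner_fockAct_rot hf, ha]
    simp only [smul_eq_mul, MonoidHom.one_apply, Module.End.one_apply]
    ring
  have h0 := maxGenEigenspace_eq_bot (fun hk' => by have := hN hk'; omega) hmem
  exact congrFun h0 i

theorem isSubRep_pi {G : Type*} [Group G] [TopologicalSpace G] {M : Type*} [AddCommGroup M]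
    [Module ℂ M] {τ : G →* Module.End ℂ M} {X : Submodule ℂ M} (hX : IsSubRep τ X) {ι : Type}
    [Fintype ι] [DecidableEq ι] {ρ : G →* Matrix ι ι ℂ} (hρ : Continuous ρ) :
    IsSubRep (twist τ ρ) (Submodule.pi Set.univ fun _ : ι => X) where
  fin := by
    have := hX.fin
    refine Module.Finite.iff_fg.2 (Submodule.fg_pi fun _ => Module.Finite.iff_fg.1 this)
  inv g x hx i _ := by
    rw [twist_apply]
    exact Submodule.sum_mem _ fun j _ => Submodule.smul_mem _ _ (hX.inv g _ (hx j trivial))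
  cont x hx φ := by
    have h : ∀ g, φ (twist τ ρ g x) =
        ∑ i, ∑ j, ρ g i j * φ (LinearMap.single ℂ (fun _ => M) i (τ g (x j))) := fun g => by
      have h1 : twist τ ρ g x = ∑ i, LinearMap.single ℂ (fun _ => M) i (twist τ ρ g x i) :=
        (Finset.univ_sum_single _).symm
      rw [h1, map_sum]
      refine Finset.sum_congr rfl fun i _ => ?_
      rw [twist_apply, map_sum, map_sum]
      exact Finset.sum_congr rfl fun j _ => by rw [map_smul, map_smul, smul_eq_mul]
    simp only [h]
    exact continuous_finsetSum _ fun i _ => continuous_finsetSum _ fun j _ =>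
      (hρ.matrix_elem i j).mul
        (hX.cont (x j) (hx j trivial) (φ.comp (LinearMap.single ℂ (fun _ => M) i)))

theorem isGraded_fock : IsGraded (fockEnd V) (rot V) where
  central := rot_central
  sub ρ hρ μ := by
    obtain ⟨N, hN⟩ := exists_block_le_fockTrunc ρ μ
    exact (isSubRep_pi (isSubRep_fockTrunc N) hρ).mono (fun h hh i _ => hN h hh i)
      fun g x hx => twist_mem_block rot_central ρ g hx

end Degree

/-! ## The map from the representation ring given by the vacuum projection -/

section Vacuum

set_option linter.unusedSectionVars false

open Filter Topology InnerProductSpace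

variable {V : Type*} [NormedAddCommGroup V] [InnerProductSpace ℂ V] [FiniteDimensional ℂ V]
  [MeasurableSpace V] [BorelSpace V]

attribute [local instance] InnerProductSpace.complexToReal

/-- The extension of the Bargmann–Fock representation to the algebra with unit adjoined. -/
def fockPlus : Unitization ℂ (WeylAlgebra V 1) →ₐ[ℂ] Module.End ℂ (Fock V) :=
  Unitization.lift
    { toFun := fun a => (fockRep V a).toLinearMap
      map_smul' := fun c a => by rw [map_smul]; rfl
      map_zero' := by rw [map_zero]; rfl
      map_add' := fun a b => by rw [map_add]; rfl
      map_mul' := fun a b => by rw [map_mul]; rfl }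

theorem fockPlus_apply (x : Unitization ℂ (WeylAlgebra V 1)) (f : Fock V) :
    fockPlus x f = x.fst • f + fockRep V x.snd f := rfl

theorem fockPlus_inr (a : WeylAlgebra V 1) (f : Fock V) :
    fockPlus (Unitization.inr a) f = fockRep V a f := by
  rw [fockPlus_apply, Unitization.fst_inr, Unitization.snd_inr, zero_smul, zero_add]

theorem covariant_fock : Covariant (unitAct (weylAct (V := V) 1)) (fockEnd V) fockPlus :=
  fun u x f => by
    rw [fockPlus_apply, fockPlus_apply, map_add, map_smul, unitAct_apply, unitMap_fst, unitMap_snd]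
    congr 1
    exact (fockRep_weylAct u x.snd f).symm

theorem matrix_eq_of_fock {ι κ : Type} [Fintype κ] [DecidableEq κ]
    {X Y : Matrix ι κ (Unitization ℂ (WeylAlgebra V 1))} (h0 : ∀ i j, (X i j).fst = (Y i j).fst)
    (h : ∀ x, matAct fockPlus X x = matAct fockPlus Y x) : X = Y := by
  have h1 : ∀ (Z : Matrix ι κ (Unitization ℂ (WeylAlgebra V 1))) i j f,
      matAct fockPlus Z (Pi.single j f) i = fockPlus (Z i j) f := fun Z i j f => by
    rw [matAct_apply, Finset.sum_eq_single j]
    · rw [Pi.single_eq_same]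
    · intro l _ hl
      rw [Pi.single_eq_of_ne hl, map_zero]
    · simp
  ext1 i j
  refine Unitization.ext (h0 i j) (fockRep_injective (ContinuousLinearMap.ext fun f => ?_))
  have h2 := congrFun (h (Pi.single j f)) i
  rw [h1, h1, fockPlus_apply, fockPlus_apply, h0] at h2
  exact add_left_cancel h2

theorem fst_mul_eq_zero {A : Type*} [NonUnitalCStarAlgebra A] {ι κ τ : Type} [Fintype κ]
    {X : Matrix ι κ (Unitization ℂ A)} {Y : Matrix κ τ (Unitization ℂ A)}
    (h : (∀ i j, (X i j).fst = 0) ∨ ∀ i j, (Y i j).fst = 0) (i : ι) (j : τ) :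
    ((X * Y) i j).fst = 0 := by
  have h1 : ((X * Y) i j).fst = ∑ k, (X i k).fst * (Y k j).fst := by
    rw [Matrix.mul_apply]
    exact (map_sum (Unitization.fstHom ℂ A) _ _).trans
      (Finset.sum_congr rfl fun k _ => Unitization.fst_mul _ _)
  rw [h1]
  rcases h with h | h <;> simp [h]

/-- Equivariance in the Fock representation implies invariance. -/
theorem invariant_of_matAct {ι κ : Type} [Fintype ι] [DecidableEq ι] [Fintype κ] [DecidableEq κ]
    {ρ : (V ≃ₗᵢ[ℂ] V) →* Matrix ι ι ℂ} {σ : (V ≃ₗᵢ[ℂ] V) →* Matrix κ κ ℂ}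
    {X : Matrix ι κ (Unitization ℂ (WeylAlgebra V 1))} (h0 : ∀ i j, (X i j).fst = 0)
    (h : ∀ u x, twist (fockEnd V) ρ u (matAct fockPlus X x) =
      matAct fockPlus X (twist (fockEnd V) σ u x)) :
    IsInvariant (unitAct (weylAct 1)) ρ σ X := fun u => by
  refine matrix_eq_of_fock (fun i j => ?_) fun x => ?_
  · rw [fst_mul_eq_zero (Or.inr fun i j => ?_), fst_mul_eq_zero (Or.inl h0)]
    rw [Matrix.map_apply, unitAct_apply, unitMap_fst, h0]
  · obtain ⟨y, rfl⟩ : ∃ y : κ → Fock V, (fun j => fockEnd V u (y j)) = x :=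
      ⟨fun j => fockAct u⁻¹ (x j), funext fun j => fockAct_inv_apply u (x j)⟩
    have hs : ∀ {ι κ : Type} [Fintype κ] (m : Matrix ι κ ℂ) (x : κ → Fock V) (i : ι),
        matAct fockPlus (scal (Unitization ℂ (WeylAlgebra V 1)) m) x i = ∑ j, m i j • x j :=
      fun m x i => Finset.sum_congr rfl fun j _ => by
        rw [scal, Matrix.map_apply, AlgHom.commutes, Module.algebraMap_end_apply]
    rw [matAct_mul, matAct_mul]
    have h1 : matAct fockPlus (X.map (unitAct (weylAct 1) u)) (fun j => fockEnd V u (y j)) =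
        fun i => fockEnd V u (matAct fockPlus X y i) := by
      ext1 i
      rw [matAct_apply, matAct_apply, map_sum]
      exact Finset.sum_congr rfl fun j _ => (covariant_fock u _ _).symm
    have h2 : matAct fockPlus (scal (Unitization ℂ (WeylAlgebra V 1)) (σ u))
        (fun j => fockEnd V u (y j)) = twist (fockEnd V) σ u y := funext fun i => hs _ _ i
    rw [h1, h2, ← h u]
    exact funext fun i => hs _ _ i

variable (V) in
/-- The normalized vacuum vector. -/
def vac : Fock V := ((‖coh (0 : V)‖⁻¹ : ℝ) : ℂ) • coh 0

theorem coh_zero_ne : coh (0 : V) ≠ 0 := fun h => by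
  have h1 := inner_coherent (isFock_vacuum (V := V)) 0
  have h2 : (coherent (0 : V)) = 0 := congrArg Subtype.val h
  rw [h2, inner_zero_right, star_one, mul_one] at h1
  exact gaussMass_pos.ne (by exact_mod_cast h1)

theorem inner_vac : inner ℂ (vac V) (vac V) = 1 := by
  have h : ‖vac V‖ = 1 := by
    rw [vac, norm_smul, Complex.norm_real, norm_inv, norm_norm,
      inv_mul_cancel₀ (norm_ne_zero_iff.2 coh_zero_ne)]
  rw [inner_self_eq_norm_sq_to_K, h]
  simp

theorem fockAct_vac (u : V ≃ₗᵢ[ℂ] V) : fockAct u (vac V) = vac V := by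
  rw [vac, map_smul]
  congr 1
  refine Subtype.ext ?_
  rw [fockAct_val]
  refine Lp.ext ?_
  have h := coherent_zero_coe (V := V)
  filter_upwards [l2Act_coe u (coherent 0), h,
    (measurePreserving_unitary u.symm).quasiMeasurePreserving.ae_eq h] with x h1 h2 h3
  refine h1.trans (Eq.trans h3 (Eq.trans ?_ h2.symm))
  simp

theorem inner_vac_fockAct (u : V ≃ₗᵢ[ℂ] V) (f : Fock V) :
    inner ℂ (vac V) (fockAct u f) = inner ℂ (vac V) f := by
  conv_lhs => rw [← fockAct_vac u]
  exact inner_fockAct u _ f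

variable (V) in
/-- The projection onto the vacuum vector. -/
def vacProj : Unitization ℂ (WeylAlgebra V 1) := Unitization.inr (weylRankOne (vac V) (vac V))

theorem vacProj_idem : vacProj V * vacProj V = vacProj V := by
  rw [vacProj, ← Unitization.inr_mul]
  congr 1
  refine fockRep_injective (ContinuousLinearMap.ext fun f => ?_)
  rw [map_mul, mul_apply_eq_comp, fockRep_weylRankOne, rankOne_apply, rankOne_apply,
    inner_smul_right, inner_vac, mul_one]

theorem vacProj_invariant (u : V ≃ₗᵢ[ℂ] V) : unitAct (weylAct 1) u (vacProj V) = vacProj V := by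
  refine Unitization.ext ?_ ?_
  · rw [unitAct_apply, unitMap_fst]
  · rw [unitAct_apply, unitMap_snd, vacProj, Unitization.snd_inr, weylAct_weylRankOne, fockAct_vac]

/-- The tensor product of a representation and the vacuum projection. -/
abbrev vacCycle (σ : Rep (V ≃ₗᵢ[ℂ] V)) : Cycle (unitAct (weylAct (V := V) 1)) :=
  repCycle vacProj_idem vacProj_invariant σ

theorem fst_vacCycle (σ : Rep (V ≃ₗᵢ[ℂ] V)) (i j : (vacCycle σ).ι) :
    ((vacCycle σ).e i j).fst = 0 := by
  change ((1 : Matrix σ.ι σ.ι ℂ) i j • vacProj V).fst = 0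
  rw [Unitization.fst_smul, vacProj, Unitization.fst_inr, smul_zero]

variable (V) in
/-- The homomorphism `R[U] → K_0^U(C*(V, ω))` given by the vacuum projection. -/
def vacK : RRing (V ≃ₗᵢ[ℂ] V) →+ NK0 (weylAct (V := V) 1) :=
  (repK vacProj_idem vacProj_invariant).codRestrict (NK0 (weylAct (V := V) 1)) fun r => by
    have h : (augmentation (weylAct (V := V) 1)).comp (repK vacProj_idem vacProj_invariant) = 0 :=
      RRing.hom_ext fun σ => by
        rw [AddMonoidHom.comp_apply, repK_cls]
        exact (NK0.ofIdempotent (vacCycle σ) (fst_vacCycle σ)).2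
    exact DFunLike.congr_fun h r

theorem vacK_cls (σ : Rep (V ≃ₗᵢ[ℂ] V)) :
    vacK V (RRing.cls σ) = NK0.ofIdempotent (vacCycle σ) (fst_vacCycle σ) :=
  Subtype.ext (repK_cls _ _ σ)

theorem matAct_vac {ι : Type} [Fintype ι] [DecidableEq ι] (x : ι → Fock V) :
    matAct fockPlus (ampl (vacProj V) (1 : Matrix ι ι ℂ)) x =
      fun i => (inner ℂ (vac V) (x i) : ℂ) • vac V := by
  ext1 i
  rw [matAct_ampl, vacProj, fockPlus_inr, fockRep_weylRankOne, rankOne_apply]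

variable (V) in
/-- The vector `x ⊗ Ω`. -/
def vacIncl (ι : Type) : (ι → ℂ) →ₗ[ℂ] (ι → Fock V) :=
  LinearMap.pi fun i => (LinearMap.toSpanSingleton ℂ (Fock V) (vac V)).comp (LinearMap.proj i)

theorem vacIncl_apply {ι : Type} (x : ι → ℂ) (i : ι) : vacIncl V ι x i = x i • vac V := rfl

variable (V) in
/-- The components of a vector along the vacuum. -/
def vacCoord (ι : Type) : (ι → Fock V) →ₗ[ℂ] (ι → ℂ) :=
  LinearMap.pi fun i => (innerSL ℂ (vac V)).toLinearMap.comp (LinearMap.proj i)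

theorem vacCoord_apply {ι : Type} (x : ι → Fock V) (i : ι) :
    vacCoord V ι x i = inner ℂ (vac V) (x i) := rfl

theorem vacCoord_vacIncl {ι : Type} (x : ι → ℂ) : vacCoord V ι (vacIncl V ι x) = x := by
  ext i
  rw [vacCoord_apply, vacIncl_apply, inner_smul_right, inner_vac, mul_one]

section

variable {ι : Type} [Fintype ι] [DecidableEq ι] (ρ : (V ≃ₗᵢ[ℂ] V) →* Matrix ι ι ℂ)

theorem vacIncl_twist (u : V ≃ₗᵢ[ℂ] V) (x : ι → ℂ) :
    vacIncl V ι (ρ u *ᵥ x) = twist (fockEnd V) ρ u (vacIncl V ι x) := by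
  ext1 i
  rw [vacIncl_apply, twist_apply, Matrix.mulVec, dotProduct, Finset.sum_smul]
  refine Finset.sum_congr rfl fun j _ => ?_
  rw [vacIncl_apply, map_smul, fockEnd_apply, fockAct_vac, smul_smul]

theorem vacCoord_twist (u : V ≃ₗᵢ[ℂ] V) (x : ι → Fock V) :
    vacCoord V ι (twist (fockEnd V) ρ u x) = ρ u *ᵥ vacCoord V ι x := by
  ext1 i
  rw [vacCoord_apply, twist_apply, inner_sum, Matrix.mulVec, dotProduct]
  refine Finset.sum_congr rfl fun j _ => ?_
  rw [inner_smul_right, fockEnd_apply, inner_vac_fockAct, vacCoord_apply]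

theorem twist_one_apply {G : Type*} [Group G] {ι : Type} [Fintype ι] [DecidableEq ι]
    (ρ : G →* Matrix ι ι ℂ) (g : G) (x : ι → ℂ) :
    twist (1 : G →* Module.End ℂ ℂ) ρ g x = ρ g *ᵥ x := by
  ext i
  simp [twist_apply, Matrix.mulVec, dotProduct]

end

theorem weightK_repK (μ : ℂ) (r : RRing (V ≃ₗᵢ[ℂ] V)) :
    weightK isGraded_fock covariant_fock μ (repK vacProj_idem vacProj_invariant r) =
      repWeight rot_central μ r := by
  have h : (weightK isGraded_fock covariant_fock μ).comp (repK vacProj_idem vacProj_invariant) =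
      repWeight (rot_central (V := V)) μ := RRing.hom_ext fun σ => by
    rw [AddMonoidHom.comp_apply, repK_cls, weightK_cls, repWeight_cls]
    refine repCls_eq_of_maps _ _ (vacCoord V σ.ι) (vacIncl V σ.ι) ?_ ?_ ?_
      (fun y _ => vacCoord_vacIncl y) ?_
    · intro x hx
      exact map_mem_maxGenEigenspace _ (fun y => (vacCoord_twist σ.ρ _ y).trans
        (twist_one_apply _ _ _).symm) hx.1
    · intro x hx
      refine ⟨map_mem_maxGenEigenspace _ (fun y => (congrArg _ (twist_one_apply _ _ _)).trans
        (vacIncl_twist σ.ρ _ y)) hx, ?_⟩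
      refine (matAct_vac _).trans (funext fun i => ?_)
      exact congrArg (fun y : σ.ι → ℂ => y i • vac V) (vacCoord_vacIncl x)
    · intro x hx
      exact (matAct_vac _).symm.trans hx.2
    · intro u x _
      exact (vacCoord_twist σ.ρ _ x).trans (twist_one_apply _ _ _).symm
  exact DFunLike.congr_fun h r

theorem vacK_injective : Function.Injective (vacK V) := by
  intro r s h
  refine eq_of_repWeight_eq rot_central fun μ => ?_
  rw [← weightK_repK, ← weightK_repK]
  exact congrArg _ (congrArg Subtype.val h)

end Vacuum

section FockRange

set_option linter.unusedSectionVars false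

open Filter Topology InnerProductSpace

variable {V : Type*} [NormedAddCommGroup V] [InnerProductSpace ℂ V] [FiniteDimensional ℂ V]
  [MeasurableSpace V] [BorelSpace V]

attribute [local instance] InnerProductSpace.complexToReal

theorem matAct_of_fst {ι κ : Type} [Fintype κ]
    {X : Matrix ι κ (Unitization ℂ (WeylAlgebra V 1))} (h0 : ∀ i j, (X i j).fst = 0)
    (h : κ → Fock V) (i : ι) : matAct fockPlus X h i = ∑ j, fockRep V (X i j).snd (h j) :=
  Finset.sum_congr rfl fun j _ => by rw [fockPlus_apply, h0, zero_smul, zero_add]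

/-- An idempotent with finite-dimensional range is equivalent to the tensor product of its range
and the vacuum projection. -/
theorem equivalent_vacCycle {c : Cycle (unitAct (weylAct (V := V) 1))}
    (h0 : ∀ i j, (c.e i j).fst = 0) {σ : Rep (V ≃ₗᵢ[ℂ] V)} (S : (σ.ι → ℂ) →ₗ[ℂ] (c.ι → Fock V))
    (hinj : Function.Injective S) (hS : ∀ x, matAct fockPlus c.e (S x) = S x)
    (hS' : ∀ h, matAct fockPlus c.e h = h → h ∈ LinearMap.range S)
    (heq : ∀ u x, S (σ.ρ u *ᵥ x) = twist (fockEnd V) c.ρ u (S x)) :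
    c.Equivalent (vacCycle σ) := by
  have hee : ∀ h, matAct fockPlus c.e (matAct fockPlus c.e h) = matAct fockPlus c.e h := fun h => by
    rw [← matAct_mul, c.idem]
  let E : (c.ι → Fock V) →L[ℂ] (c.ι → Fock V) := ContinuousLinearMap.pi fun i =>
    ∑ j, (fockRep V (c.e i j).snd).comp (ContinuousLinearMap.proj j)
  have hE : ∀ h, E h = matAct fockPlus c.e h := fun h => funext fun i => by
    rw [matAct_of_fst h0, ContinuousLinearMap.pi_apply, _root_.sum_apply]
    rfl
  let S' := LinearEquiv.ofInjective S hinj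
  have : FiniteDimensional ℂ (LinearMap.range S) := S'.finiteDimensional
  let R : (c.ι → Fock V) →L[ℂ] (σ.ι → ℂ) :=
    (LinearMap.toContinuousLinearMap S'.symm.toLinearMap).comp
      (E.codRestrict (LinearMap.range S) fun h => by
        rw [hE]
        exact hS' _ (hee h))
  have hSR : ∀ h, S (R h) = matAct fockPlus c.e h := fun h => by
    rw [← hE]
    exact congrArg Subtype.val (S'.apply_symm_apply ⟨E h, _⟩)
  have hRS : ∀ x, R (S x) = x := fun x => hinj (by rw [hSR, hS])
  let y : σ.ι → c.ι → Fock V := fun s i => (toDual ℂ (Fock V)).symm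
    (((ContinuousLinearMap.proj s).comp R).comp (ContinuousLinearMap.single ℂ (fun _ => Fock V) i))
  have hy : ∀ s i f, inner ℂ (y s i) f = R (Pi.single i f) s := fun s i f =>
    toDual_symm_apply
  let X : Matrix c.ι σ.ι (Unitization ℂ (WeylAlgebra V 1)) := Matrix.of fun i s =>
    Unitization.inr (weylRankOne (S (Pi.single s 1) i) (vac V))
  let Y : Matrix σ.ι c.ι (Unitization ℂ (WeylAlgebra V 1)) := Matrix.of fun s i =>
    Unitization.inr (weylRankOne (vac V) (y s i))
  have hX0 : ∀ i s, (X i s).fst = 0 := fun i s => Unitization.fst_inr _ _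
  have hY0 : ∀ s i, (Y s i).fst = 0 := fun s i => Unitization.fst_inr _ _
  have hX : ∀ h, matAct fockPlus X h = S (vacCoord V σ.ι h) := fun h => by
    ext1 i
    rw [matAct_apply, ← Finset.univ_sum_single (vacCoord V σ.ι h), map_sum, Finset.sum_apply]
    refine Finset.sum_congr rfl fun s _ => ?_
    have h1 : Pi.single s (vacCoord V σ.ι h s) =
        (vacCoord V σ.ι h s) • (Pi.single s 1 : σ.ι → ℂ) := by
      rw [← Pi.single_smul, smul_eq_mul, mul_one]
    refine (fockPlus_inr _ _).trans ?_
    rw [fockRep_weylRankOne, rankOne_apply, h1, map_smul]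
    rfl
  have hY : ∀ h, matAct fockPlus Y h = vacIncl V σ.ι (R h) := fun h => by
    ext1 s
    rw [matAct_apply, vacIncl_apply, ← Finset.univ_sum_single h, map_sum, Finset.sum_apply,
      Finset.sum_smul, Finset.univ_sum_single h]
    refine Finset.sum_congr rfl fun i _ => ?_
    refine (fockPlus_inr _ _).trans ?_
    rw [fockRep_weylRankOne, rankOne_apply, hy]
  have hR : ∀ u h, R (twist (fockEnd V) c.ρ u h) = σ.ρ u *ᵥ R h := fun u h => hinj (by
    rw [hSR, heq, hSR]
    exact (covariant_fock.twist_matAct (c.invariant u) h).symm)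
  refine ⟨X, Y, invariant_of_matAct (σ := σ.ρ) hX0 fun u h => ?_,
    invariant_of_matAct (ρ := σ.ρ) hY0 fun u h => ?_, ?_, ?_⟩
  · rw [hX, hX, vacCoord_twist, heq]
  · rw [hY, hY, hR, vacIncl_twist]
  · refine matrix_eq_of_fock (fun i j => ?_) fun h => ?_
    · exact (fst_mul_eq_zero (Or.inl hX0) i j).trans (h0 i j).symm
    · refine (matAct_mul fockPlus X Y h).trans ?_
      rw [hY, hX, vacCoord_vacIncl, hSR]
  · refine matrix_eq_of_fock (κ := σ.ι) (fun i j => ?_) fun h => ?_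
    · exact (fst_mul_eq_zero (Or.inl hY0) i j).trans (fst_vacCycle σ i j).symm
    · refine (matAct_mul fockPlus Y X h).trans ((congrArg _ (hX h)).trans ((hY _).trans ?_))
      rw [hRS]
      exact (matAct_vac h).symm

/-- Idempotents with range in finitely many degrees come from the representation ring. -/
theorem exists_cls_eq_repK {c : Cycle (unitAct (weylAct (V := V) 1))}
    (h0 : ∀ i j, (c.e i j).fst = 0) {N : ℕ}
    (hN : ∀ h, matAct fockPlus c.e h = h → ∀ i, h i ∈ fockTrunc V N) :
    ∃ r, K0.cls c = repK vacProj_idem vacProj_invariant r := by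
  have hX : IsSubRep (twist (fockEnd V) c.ρ)
      (LinearMap.eqLocus (matAct fockPlus c.e) LinearMap.id) :=
    (isSubRep_pi (isSubRep_fockTrunc N) c.continuous_ρ).mono (fun h hh i _ => hN h hh i)
      fun u h hh => by
        change matAct fockPlus c.e _ = _
        rw [← covariant_fock.twist_matAct (c.invariant u)]
        exact congrArg _ hh
  obtain ⟨T, hT⟩ := exists_subRep_equiv hX
  refine ⟨RRing.cls (subRep hX), ?_⟩
  rw [repK_cls]
  refine K0.cls_eq_of_equivalent (equivalent_vacCycle h0
    ((Submodule.subtype _).comp T.toLinearMap) (Subtype.val_injective.comp T.injective)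
    (fun x => (T x).2) (fun h hh => ⟨T.symm ⟨h, hh⟩, ?_⟩) hT)
  exact congrArg Subtype.val (T.apply_symm_apply _)

theorem Fock.sum_val {ι : Type} [Fintype ι] (f : ι → Fock V) : (∑ i, f i).1 = ∑ i, (f i).1 :=
  map_sum (Fock.subtypeL (V := V)) f Finset.univ

theorem matAct_eq_self_iff {c : Cycle (unitAct (weylAct (V := V) 1))}
    (hc : ∀ i j, (c.e i j).fst = 0) {h : c.ι → Fock V} :
    matAct fockPlus c.e h = h ↔ (fun i => (h i).1) ∈ fockRange c := by
  have h2 : ∀ i, (matAct fockPlus c.e h i).1 =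
      ∑ j, Generated.incl (moyalOperators V 1) (c.e i j).snd (h j).1 := fun i => by
    rw [matAct_of_fst hc, Fock.sum_val]
    exact Finset.sum_congr rfl fun j _ => fockRep_val _ _
  refine ⟨fun hh => ⟨fun i => (h i).2, fun i => ?_⟩, fun hh => funext fun i => Subtype.ext ?_⟩
  · rw [← h2, hh]
  · rw [h2]
    exact hh.2 i

theorem isBargmannFock_of_comp_vacK {Φ : NK0 (weylAct (V := V) 1) → RRing (V ≃ₗᵢ[ℂ] V)}
    (h : ∀ r, Φ (vacK V r) = r) : IsBargmannFock Φ := by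
  intro c hc σ T hT
  have h1 : NK0.ofIdempotent c hc = vacK V (RRing.cls σ) := by
    rw [vacK_cls]
    let S : (σ.ι → ℂ) →ₗ[ℂ] (c.ι → Fock V) :=
      { toFun := fun x i => ⟨(T x).1 i, (T x).2.1 i⟩
        map_add' := fun x y => funext fun i => Subtype.ext (by rw [map_add]; rfl)
        map_smul' := fun r x => funext fun i => Subtype.ext (by rw [map_smul]; rfl) }
    refine Subtype.ext (K0.cls_eq_of_equivalent (equivalent_vacCycle hc S ?_ ?_ ?_ ?_))
    · intro x y hxy
      refine T.injective (Subtype.ext (funext fun i => ?_))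
      exact congrArg Subtype.val (congrFun hxy i)
    · exact fun x => (matAct_eq_self_iff hc).2 (T x).2
    · intro k hk
      refine ⟨T.symm ⟨_, (matAct_eq_self_iff hc).1 hk⟩, funext fun i => Subtype.ext ?_⟩
      change (T (T.symm _)).1 i = _
      rw [T.apply_symm_apply]
    · intro u x
      refine funext fun i => Subtype.ext ((hT u x i).trans ?_)
      exact (Fock.sum_val fun j => c.ρ u i j • fockEnd V u (S x j)).symm
  rw [h1, h]

theorem IsBargmannFock.comp_vacK {Ψ : NK0 (weylAct (V := V) 1) →+ RRing (V ≃ₗᵢ[ℂ] V)}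
    (h : IsBargmannFock Ψ) (r : RRing (V ≃ₗᵢ[ℂ] V)) : Ψ (vacK V r) = r := by
  have key : Ψ.comp (vacK V) = AddMonoidHom.id _ := RRing.hom_ext fun σ => by
    rw [AddMonoidHom.comp_apply, vacK_cls]
    have hF : ∀ x : σ.ι → ℂ, (fun i => (vacIncl V σ.ι x i).1) ∈ fockRange (vacCycle σ) := fun x =>
      (matAct_eq_self_iff (fst_vacCycle σ)).1 ((matAct_vac _).trans (funext fun i =>
        congrArg (fun y : σ.ι → ℂ => y i • vac V) (vacCoord_vacIncl x)))
    let T₀ : (σ.ι → ℂ) →ₗ[ℂ] fockRange (vacCycle σ) :=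
      { toFun := fun x => ⟨_, hF x⟩
        map_add' := fun x y => Subtype.ext (funext fun i =>
          congrArg (fun z : σ.ι → Fock V => (z i).1) (map_add (vacIncl V σ.ι) x y))
        map_smul' := fun r x => Subtype.ext (funext fun i =>
          congrArg (fun z : σ.ι → Fock V => (z i).1) (map_smul (vacIncl V σ.ι) r x)) }
    have hT₀ : Function.Bijective T₀ := by
      constructor
      · intro x y hxy
        rw [← vacCoord_vacIncl (V := V) x, ← vacCoord_vacIncl (V := V) y]
        refine congrArg _ (funext fun i => Subtype.ext ?_)
        exact congrFun (congrArg Subtype.val hxy) i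
      · rintro ⟨k, hk⟩
        let k' : σ.ι → Fock V := fun i => ⟨k i, hk.1 i⟩
        refine ⟨vacCoord V σ.ι k', Subtype.ext (funext fun i => ?_)⟩
        exact congrArg (fun z : σ.ι → Fock V => (z i).1) ((matAct_vac k').symm.trans
          ((matAct_eq_self_iff (fst_vacCycle σ) (h := k')).2 hk))
    refine h (vacCycle σ) (fst_vacCycle σ) σ (LinearEquiv.ofBijective T₀ hT₀) fun u x i => ?_
    refine (congrArg Subtype.val (congrFun (vacIncl_twist σ.ρ u x) i)).trans ?_
    exact Fock.sum_val fun j => σ.ρ u i j • fockEnd V u (vacIncl V σ.ι x j)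
  exact DFunLike.congr_fun key r

end FockRange

/-! ## The Bargmann–Fock isomorphism -/

section Split

variable {G : Type*} [Group G] [TopologicalSpace G]
variable {B : Type*} [Ring B] [Algebra ℂ B] {β : G →* (B →ₐ[ℂ] B)}

/-- Additivity over orthogonal idempotents. -/
theorem K0.cls_add {ι : Type} [Fintype ι] [DecidableEq ι] {r : G →* Matrix ι ι ℂ}
    (hr : Continuous r) {e f : Matrix ι ι B} (he : e * e = e) (hf : f * f = f) (hef : e * f = 0)
    (hfe : f * e = 0) (hei : IsInvariant β r r e) (hfi : IsInvariant β r r f)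
    (h : (e + f) * (e + f) = e + f) :
    K0.cls (⟨ι, r, hr, e + f, h, hei.add hfi⟩ : Cycle β) =
      K0.cls ⟨ι, r, hr, e, he, hei⟩ + K0.cls ⟨ι, r, hr, f, hf, hfi⟩ := by
  rw [← K0.cls_sum]
  refine K0.cls_eq_of_equivalent ⟨fromCols e f, fromRows e f, fun g => ?_, fun g => ?_, ?_, ?_⟩
  · change scal B (r g) * (fromCols e f).map (β g) =
      fromCols e f * scal B (fromBlocks (r g) 0 0 (r g))
    have h1 : (fromCols e f).map (β g) = fromCols (e.map (β g)) (f.map (β g)) := by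
      ext i (j | j) <;> rfl
    have h2 : scal B (fromBlocks (r g) 0 0 (r g)) =
        fromBlocks (scal B (r g)) 0 0 (scal B (r g)) := by
      rw [scal, fromBlocks_map, Matrix.map_zero _ (map_zero _)]
      rfl
    rw [h1, h2, mul_fromCols, fromCols_mul_fromBlocks, hei g, hfi g]
    simp
  · change scal B (fromBlocks (r g) 0 0 (r g)) * (fromRows e f).map (β g) =
      fromRows e f * scal B (r g)
    have h1 : (fromRows e f).map (β g) = fromRows (e.map (β g)) (f.map (β g)) := by
      ext (i | i) j <;> rfl
    have h2 : scal B (fromBlocks (r g) 0 0 (r g)) =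
        fromBlocks (scal B (r g)) 0 0 (scal B (r g)) := by
      rw [scal, fromBlocks_map, Matrix.map_zero _ (map_zero _)]
      rfl
    rw [h1, h2, fromBlocks_mul_fromRows, fromRows_mul, hei g, hfi g]
    simp
  · change fromCols e f * fromRows e f = e + f
    rw [fromCols_mul_fromRows, he, hf]
  · change fromRows e f * fromCols e f = fromBlocks e 0 0 f
    rw [fromRows_mul_fromCols, he, hf, hef, hfe]

end Split

section Surjective

set_option linter.unusedSectionVars false

open Filter Topology InnerProductSpace

variable {V : Type*} [NormedAddCommGroup V] [InnerProductSpace ℂ V] [FiniteDimensional ℂ V]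
  [MeasurableSpace V] [BorelSpace V]

attribute [local instance] InnerProductSpace.complexToReal
attribute [local instance] Matrix.linftyOpNormedAddCommGroup Matrix.linftyOpNormedRing

theorem rankOne_mul_starProjection {E : Type*} [NormedAddCommGroup E] [InnerProductSpace ℂ E]
    (U : Submodule ℂ E) [U.HasOrthogonalProjection] (h k : E) :
    rankOne ℂ h k * U.starProjection = rankOne ℂ h (U.starProjection k) := by
  refine ContinuousLinearMap.ext fun f => ?_
  rw [mul_apply_eq_comp, rankOne_apply, rankOne_apply, U.inner_starProjection_left_eq_right]

/-- Compressions of a compact operator converge to it. -/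
theorem tendsto_compression {E : Type*} [NormedAddCommGroup E] [InnerProductSpace ℂ E]
    (U : ℕ → Submodule ℂ E) [∀ N, (U N).HasOrthogonalProjection]
    (hU : ∀ x, Tendsto (fun N => (U N).starProjection x) atTop (𝓝 x)) {T : E →L[ℂ] E}
    (hT : T ∈ rankOneSpan E) :
    Tendsto (fun N => (U N).starProjection * T * (U N).starProjection) atTop (𝓝 T) := by
  have hn : ∀ N (S : E →L[ℂ] E), ‖(U N).starProjection * S * (U N).starProjection‖ ≤ ‖S‖ := by
    intro N S
    have h1 := (U N).starProjection_norm_le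
    calc _ ≤ ‖(U N).starProjection‖ * ‖S‖ * ‖(U N).starProjection‖ :=
          (norm_mul_le _ _).trans (mul_le_mul_of_nonneg_right (norm_mul_le _ _) (norm_nonneg _))
      _ ≤ 1 * ‖S‖ * 1 := by gcongr
      _ = ‖S‖ := by ring
  refine rankOneSpan_induction (p := fun T => Tendsto
    (fun N => (U N).starProjection * T * (U N).starProjection) atTop (𝓝 T))
    (fun h k => ?_) ?_ (fun S T hS hT => ?_) (fun c T hT => ?_) ?_ hT
  · simp only [mul_rankOne, rankOne_mul_starProjection]
    have h1 : Tendsto (fun N => ((U N).starProjection h, (U N).starProjection k)) atTop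
      (𝓝 (h, k)) := (hU h).prodMk_nhds (hU k)
    have h2 := (continuous_rankOne.tendsto (h, k)).comp h1
    exact h2
  · simp only [mul_zero, zero_mul]
    exact tendsto_const_nhds
  · simp only [mul_add, add_mul]
    exact hS.add hT
  · simp only [mul_smul_comm, smul_mul_assoc]
    exact hT.const_smul c
  · refine isClosed_of_closure_subset fun T hT => ?_
    refine Metric.tendsto_atTop.2 fun ε hε => ?_
    obtain ⟨S, hS, hTS⟩ := Metric.mem_closure_iff.1 hT (ε / 3) (by positivity)
    obtain ⟨N, hN⟩ := Metric.tendsto_atTop.1 hS (ε / 3) (by positivity)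
    refine ⟨N, fun n hn' => ?_⟩
    have h1 := hn n (T - S)
    have h2 := hN n hn'
    rw [dist_eq_norm] at h2 hTS ⊢
    have h3 : (U n).starProjection * T * (U n).starProjection - T =
        (U n).starProjection * (T - S) * (U n).starProjection +
          ((U n).starProjection * S * (U n).starProjection - S) - (T - S) := by
      rw [mul_sub, sub_mul]
      abel
    rw [h3]
    refine (norm_sub_le _ _).trans_lt ?_
    linarith [norm_add_le ((U n).starProjection * (T - S) * (U n).starProjection)
      ((U n).starProjection * S * (U n).starProjection - S)]

theorem exists_fockProj (N : ℕ) : ∃ p, fockRep V p = (fockTrunc V N).starProjection := by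
  let b := stdOrthonormalBasis ℂ (fockTrunc V N)
  refine ⟨∑ i, weylRankOne (b i : Fock V) (b i), ?_⟩
  rw [map_sum, b.starProjection_eq_sum_rankOne]
  simp only [fockRep_weylRankOne]

variable (V) in
/-- The projection onto the part of the Fock space of degree less than `N`. -/
def fockProj (N : ℕ) : WeylAlgebra V 1 := (exists_fockProj N).choose

theorem fockRep_fockProj (N : ℕ) : fockRep V (fockProj V N) = (fockTrunc V N).starProjection :=
  (exists_fockProj N).choose_spec

theorem fockProj_idem (N : ℕ) : fockProj V N * fockProj V N = fockProj V N := by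
  refine fockRep_injective ?_
  rw [map_mul, fockRep_fockProj]
  exact (fockTrunc V N).isIdempotentElem_starProjection

theorem norm_fockProj_le (N : ℕ) : ‖fockProj V N‖ ≤ 1 := by
  rw [← norm_fockRep, fockRep_fockProj]
  exact Submodule.starProjection_norm_le _

theorem weylAct_fockProj (u : V ≃ₗᵢ[ℂ] V) (N : ℕ) :
    weylAct 1 u (fockProj V N) = fockProj V N := by
  refine fockRep_injective (ContinuousLinearMap.ext fun f => ?_)
  rw [← fockAct_inv_apply u f, fockRep_weylAct, fockRep_fockProj]
  set g := fockAct u⁻¹ f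
  refine (Submodule.eq_starProjection_of_mem_of_inner_eq_zero (K := fockTrunc V N) ?_
    fun w hw => ?_).symm
  · exact (isSubRep_fockTrunc N).inv u _ (Submodule.starProjection_apply_mem _ g)
  · rw [← map_sub, ← fockAct_inv_apply u w, inner_fockAct]
    exact Submodule.starProjection_inner_eq_zero g _ ((isSubRep_fockTrunc N).inv u⁻¹ w hw)

theorem tendsto_fockProj (a : WeylAlgebra V 1) :
    Tendsto (fun N => fockProj V N * a * fockProj V N) atTop (𝓝 a) := by
  rw [tendsto_iff_norm_sub_tendsto_zero]
  have h := tendsto_iff_norm_sub_tendsto_zero.1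
    (tendsto_compression (fockTrunc V) tendsto_fockTrunc (fockRep_mem_rankOneSpan a))
  refine h.congr fun N => ?_
  rw [← norm_fockRep, map_sub, map_mul, map_mul, fockRep_fockProj]

/-- The scalar part, as an endomorphism of the algebra with unit adjoined. -/
def scalarPart (A : Type*) [NonUnitalCStarAlgebra A] : Unitization ℂ A →ₐ[ℂ] Unitization ℂ A :=
  (Algebra.ofId ℂ (Unitization ℂ A)).comp (Unitization.fstHom ℂ A)

theorem scalarPart_apply {A : Type*} [NonUnitalCStarAlgebra A] (x : Unitization ℂ A) :
    scalarPart A x = algebraMap ℂ _ x.fst := rfl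

theorem sub_scalarPart {A : Type*} [NonUnitalCStarAlgebra A] (x : Unitization ℂ A) :
    x - scalarPart A x = Unitization.inr x.snd := by
  rw [scalarPart_apply, Unitization.algebraMap_eq_inl, sub_eq_iff_eq_add']
  exact (Unitization.inl_fst_add_inr_snd_eq x).symm

theorem scalarPart_act {G A : Type*} [Group G] [TopologicalSpace G] [NonUnitalCStarAlgebra A]
    {α : G →* (A →⋆ₙₐ[ℂ] A)} (g : G) (x : Unitization ℂ A) :
    scalarPart A (unitAct α g x) = unitAct α g (scalarPart A x) := by
  rw [scalarPart_apply, scalarPart_apply, AlgHom.commutes, unitAct_apply, unitMap_fst]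

/-- The endomorphism of `K_0^G(A⁺)` given by the scalar part. -/
def scalarK {G A : Type*} [Group G] [TopologicalSpace G] [NonUnitalCStarAlgebra A]
    (α : G →* (A →⋆ₙₐ[ℂ] A)) : K0 (unitAct α) →+ K0 (unitAct α) :=
  K0.map (scalarPart A) scalarPart_act

theorem exists_idempotent_commuting {R : Type*} [NormedRing R] [CompleteSpace R]
    (h1 : ‖(1 : R)‖ ≤ 1) (S : Subring R) (hS : IsClosed (S : Set R)) {e f : R} (he : e * e = e)
    (heS : e ∈ S) (hfS : f ∈ S) {P : ℕ → R} (hPS : ∀ N, P N ∈ S) (hP : ∀ N, P N * P N = P N)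
    (hPn : ∀ N, ‖P N‖ ≤ 1) (hPf : ∀ N, P N * f = f * P N)
    (hx : Tendsto (fun N => ‖f + P N * (e - f) * P N - e‖) atTop (𝓝 0)) {ε : ℝ} (hε : 0 < ε) :
    ∃ N, ∃ q ∈ S, q * q = q ∧ P N * q = q * P N ∧ ‖q - e‖ ≤ ε ∧
      ‖(1 - P N) * q - (1 - P N) * f‖ ≤ ε := by
  set M := ‖e‖
  have hM : 0 ≤ M := norm_nonneg _
  set L := 4 * (1 + 2 * (M + 1)) * (2 * M + 2) with hL
  have hL0 : 0 ≤ L := by positivity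
  set δ := min (min 1 (1 / (8 * (2 * M + 2)))) (ε / (2 * L + 2)) with hδ
  have hδ0 : 0 < δ := by positivity
  have hδ1 : δ ≤ 1 := (min_le_left _ _).trans (min_le_left _ _)
  have hδ2 : (2 * M + 2) * δ ≤ 1 / 8 := by
    calc (2 * M + 2) * δ ≤ (2 * M + 2) * (1 / (8 * (2 * M + 2))) := by
          gcongr
          exact (min_le_left _ _).trans (min_le_right _ _)
      _ = 1 / 8 := by field_simp
  have hδ3 : (2 * L + 2) * δ ≤ ε := by
    calc (2 * L + 2) * δ ≤ (2 * L + 2) * (ε / (2 * L + 2)) := by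
          gcongr
          exact min_le_right _ _
      _ = ε := by field_simp
  obtain ⟨N, hN⟩ := (hx.eventually (Iio_mem_nhds hδ0)).exists
  set x := f + P N * (e - f) * P N with hxdef
  replace hN : ‖x - e‖ ≤ δ := hN.le
  have hxM : ‖x‖ ≤ M + 1 := by
    have := norm_add_le e (x - e)
    rw [add_sub_cancel] at this
    linarith
  have hxx : ‖x * x - x‖ ≤ (2 * M + 2) * δ := by
    have h2 : x * x - x = (x - e) * x + e * (x - e) - (x - e) := by
      rw [sub_mul, mul_sub, he]
      abel
    rw [h2]
    calc _ ≤ ‖(x - e) * x‖ + ‖e * (x - e)‖ + ‖x - e‖ :=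
          (norm_sub_le _ _).trans (by gcongr; exact norm_add_le _ _)
      _ ≤ ‖x - e‖ * ‖x‖ + ‖e‖ * ‖x - e‖ + ‖x - e‖ := by
          gcongr <;> exact norm_mul_le _ _
      _ ≤ δ * (M + 1) + M * δ + δ := by gcongr
      _ = (2 * M + 2) * δ := by ring
  have hxP : P N * x = x * P N := by
    have h2 : P N * (P N * (e - f) * P N) = P N * (e - f) * P N := by
      rw [← mul_assoc, ← mul_assoc, hP]
    have h3 : P N * (e - f) * P N * P N = P N * (e - f) * P N := by rw [mul_assoc, hP]
    rw [hxdef, mul_add, add_mul, hPf, h2, h3]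
  have hcl : IsClosed ((S ⊓ Subring.centralizer {P N} : Subring R) : Set R) := by
    refine hS.inter ?_
    have : ((Subring.centralizer {P N} : Subring R) : Set R) = {y | P N * y = y * P N} := by
      ext y
      refine Subring.mem_centralizer_iff.trans ?_
      simp
    rw [this]
    exact isClosed_eq (by fun_prop) (by fun_prop)
  obtain ⟨q, hq, hqq, hqx⟩ := exists_idempotent_near h1 _ hcl (x := x)
    ⟨S.add_mem hfS (S.mul_mem (S.mul_mem (hPS N) (S.sub_mem heS hfS)) (hPS N)),
      Subring.mem_centralizer_iff.2 (by simpa using hxP)⟩ hδ2 hxx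
  have hqx' : ‖q - x‖ ≤ L * δ := by
    refine hqx.trans ?_
    rw [hL, mul_assoc _ _ δ]
    gcongr
  refine ⟨N, q, hq.1, hqq, by simpa using Subring.mem_centralizer_iff.1 hq.2, ?_, ?_⟩
  · have := norm_add_le (q - x) (x - e)
    rw [sub_add_sub_cancel] at this
    nlinarith
  · have h2 : (1 - P N) * q - (1 - P N) * f = (1 - P N) * (q - x) := by
      have h3 : (1 - P N) * x = (1 - P N) * f := by
        rw [hxdef, mul_add, sub_mul 1 (P N) (P N * _ * _), one_mul, ← mul_assoc, ← mul_assoc, hP,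
          sub_self, add_zero]
      rw [mul_sub, h3]
    rw [h2]
    have h4 : ‖1 - P N‖ ≤ 2 := (norm_sub_le _ _).trans (by linarith [hPn N])
    calc _ ≤ ‖1 - P N‖ * ‖q - x‖ := norm_mul_le _ _
      _ ≤ 2 * (L * δ) := by gcongr
      _ ≤ ε := by nlinarith

theorem cls_eq_compression_add {G A : Type*} [Group G] [TopologicalSpace G] [NonUnitalCStarAlgebra A]
    {α : G →* (A →⋆ₙₐ[ℂ] A)} {ι : Type} [Fintype ι] [DecidableEq ι] {r : G →* Matrix ι ι ℂ}
    (hr : Continuous r) {P q : Matrix ι ι (Unitization ℂ A)} (hP : P * P = P) (hq : q * q = q)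
    (hPq : P * q = q * P) (hPi : IsInvariant (unitAct α) r r P)
    (hqi : IsInvariant (unitAct α) r r q) :
    ∃ (h1 : P * q * (P * q) = P * q) (h2 : (1 - P) * q * ((1 - P) * q) = (1 - P) * q)
      (h3 : IsInvariant (unitAct α) r r (P * q)) (h4 : IsInvariant (unitAct α) r r ((1 - P) * q)),
      K0.cls (⟨ι, r, hr, q, hq, hqi⟩ : Cycle (unitAct α)) =
        K0.cls ⟨ι, r, hr, P * q, h1, h3⟩ + K0.cls ⟨ι, r, hr, (1 - P) * q, h2, h4⟩ := by
  have hQ : (1 - P) * (1 - P) = 1 - P := (show IsIdempotentElem P from hP).one_sub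
  have hQq : (1 - P) * q = q * (1 - P) := by rw [sub_mul, mul_sub, one_mul, mul_one, hPq]
  have key : ∀ {X Y : Matrix ι ι (Unitization ℂ A)}, Y * q = q * Y →
      X * q * (Y * q) = X * Y * q := fun {X Y} h => by
    rw [mul_assoc, ← mul_assoc q, ← h, mul_assoc Y, hq, mul_assoc]
  have hPQ : P * (1 - P) = 0 := by rw [mul_sub, mul_one, hP, sub_self]
  have hQP : (1 - P) * P = 0 := by rw [sub_mul, one_mul, hP, sub_self]
  have h3 : IsInvariant (unitAct α) r r (P * q) := hPi.mul hqi
  have h4 : IsInvariant (unitAct α) r r ((1 - P) * q) :=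
    ((invariantSubring (unitAct α) r).mul_mem
      ((invariantSubring (unitAct α) r).sub_mem (Subring.one_mem _) hPi) hqi)
  have h1 : P * q * (P * q) = P * q := by rw [key hPq, hP]
  have h2 : (1 - P) * q * ((1 - P) * q) = (1 - P) * q := by rw [key hQq, hQ]
  refine ⟨h1, h2, h3, h4, ?_⟩
  have hsum : P * q + (1 - P) * q = q := by rw [← add_mul, add_sub_cancel, one_mul]
  rw [← K0.cls_add hr h1 h2 (by rw [key hQq, hPQ, zero_mul]) (by rw [key hPq, hQP, zero_mul]) h3 h4
    (by rw [hsum, hq])]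
  congr 1
  simp only [hsum]

/-- Modulo its scalar part, every class comes from the representation ring. -/
theorem cls_sub_mem_range (c : Cycle (unitAct (weylAct (V := V) 1))) :
    K0.cls c - scalarK (weylAct (V := V) 1) (K0.cls c) ∈
      (repK (vacProj_idem (V := V)) vacProj_invariant).range := by
  obtain ⟨ι, r, hr, e, he, hei⟩ := c
  let f : Matrix ι ι (Unitization ℂ (WeylAlgebra V 1)) := e.map (scalarPart _)
  have hf : f = scal _ (e.map fun b => b.fst) := rfl
  have hff : f * f = f := by
    change e.map (scalarPart _) * e.map (scalarPart _) = e.map (scalarPart _)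
    rw [← Matrix.map_mul, he]
  have hfi : IsInvariant (unitAct (weylAct (V := V) 1)) r r f := fun g =>
    Cycle.map_invariant (scalarPart_act g) (hei g)
  have hfc : scalarK (weylAct (V := V) 1) (K0.cls ⟨ι, r, hr, e, he, hei⟩) =
      K0.cls ⟨ι, r, hr, f, hff, hfi⟩ := K0.map_cls _ _ _
  rw [hfc]
  let P : ℕ → Matrix ι ι (Unitization ℂ (WeylAlgebra V 1)) :=
    fun N => ampl (Unitization.inr (fockProj V N)) 1
  have hPP : ∀ N, P N * P N = P N := fun N => by
    refine (ampl_mul _ _).trans ?_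
    rw [← Unitization.inr_mul, fockProj_idem, mul_one]
  have hPi : ∀ N, IsInvariant (unitAct (weylAct (V := V) 1)) r r (P N) := fun N u =>
    ampl_invariant (by
      rw [unitAct_apply]
      exact Unitization.ext (by rw [unitMap_fst]) (by
        rw [unitMap_snd, Unitization.snd_inr, weylAct_fockProj])) (by rw [one_mul, mul_one])
  have hPf : ∀ N, P N * f = f * P N := fun N => by
    rw [hf, scal_eq_ampl]
    refine (ampl_mul _ _).trans ((ampl_mul _ _).trans ?_).symm
    rw [one_mul, mul_one, one_mul, mul_one]
  have hPd : ∀ N, P N = Matrix.diagonal fun _ => Unitization.inr (fockProj V N) := fun N => by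
    ext1 i j
    rcases eq_or_ne i j with rfl | hij
    · simp [P, ampl]
    · simp [P, ampl, hij]
  have hPn : ∀ N, ‖P N‖ ≤ 1 := fun N => by
    rw [hPd, Matrix.linfty_opNorm_diagonal]
    refine (pi_norm_le_iff_of_nonneg zero_le_one).2 fun _ => ?_
    rw [Unitization.norm_inr]
    exact norm_fockProj_le N
  have hP0 : ∀ N i j, (P N i j).fst = 0 := fun N i j => by
    change ((1 : Matrix ι ι ℂ) i j • (Unitization.inr (fockProj V N) :
      Unitization ℂ (WeylAlgebra V 1))).fst = 0
    rw [Unitization.fst_smul, Unitization.fst_inr, smul_zero]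
  have hx : Tendsto (fun N => ‖f + P N * (e - f) * P N - e‖) atTop (𝓝 0) := by
    refine tendsto_matrix_norm fun i j => ?_
    have h1 : ∀ N, (f + P N * (e - f) * P N) i j = f i j + Unitization.inr
        (fockProj V N * (e i j).snd * fockProj V N) := fun N => by
      have h2 : (e - f) i j = Unitization.inr (e i j).snd := sub_scalarPart _
      rw [Matrix.add_apply, hPd, Matrix.mul_diagonal, Matrix.diagonal_mul, h2,
        Unitization.inr_mul, Unitization.inr_mul]
    have h3 : e i j = f i j + Unitization.inr (e i j).snd := by
      rw [← sub_scalarPart]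
      exact (add_sub_cancel _ _).symm
    simp only [h1]
    rw [h3]
    refine tendsto_const_nhds.add ?_
    have h4 := (Unitization.isometry_inr (𝕜 := ℂ) (A := WeylAlgebra V 1)).continuous.tendsto
      (e i j).snd
    rw [← h3]
    exact h4.comp (tendsto_fockProj (e i j).snd)
  set K := 2 * (‖e‖ + ‖f‖ + 1) with hK
  have hK2 : 2 ≤ K := by linarith [norm_nonneg e, norm_nonneg f]
  have hKε : K ^ 2 * (1 / (K ^ 2 + 1)) < 1 := by
    rw [mul_one_div, div_lt_one (by positivity)]
    linarith
  have hε1 : 1 / (K ^ 2 + 1) ≤ 1 := by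
    rw [div_le_one (by positivity)]
    nlinarith
  obtain ⟨N, q, hqi, hqq, hPq, hqe, hqf⟩ := exists_idempotent_commuting matrix_norm_one_le
    (invariantSubring (unitAct (weylAct (V := V) 1)) r) (isClosed_invariantSubring r) he hei hfi
    hPi hPP hPn hPf hx (ε := 1 / (K ^ 2 + 1)) (by positivity)
  have hqn : ‖q‖ ≤ ‖e‖ + 1 := by
    have := norm_add_le e (q - e)
    rw [add_sub_cancel] at this
    linarith
  obtain ⟨a1, a2, a3, a4, ha⟩ := cls_eq_compression_add hr (hPP N) hqq hPq (hPi N) hqi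
  obtain ⟨b1, b2, b3, b4, hb⟩ := cls_eq_compression_add hr (hPP N) hff (hPf N) (hPi N) hfi
  have hQ : ∀ y : Matrix ι ι (Unitization ℂ (WeylAlgebra V 1)), ‖(1 - P N) * y‖ ≤ 2 * ‖y‖ :=
    fun y => (norm_mul_le _ _).trans (by
      gcongr
      exact (norm_sub_le _ _).trans
        (by linarith [hPn N, matrix_norm_one_le (ι := ι) (R := Unitization ℂ (WeylAlgebra V 1))]))
  have hcl1 := K0.cls_eq_of_equivalent (Cycle.equivalent_of_close hr he hqq hei hqi (K := K)
    (by linarith [norm_nonneg e, norm_nonneg f]) (by linarith [norm_nonneg e, norm_nonneg f])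
    (by
      rw [norm_sub_rev]
      exact (mul_le_mul_of_nonneg_left hqe (by positivity)).trans_lt hKε))
  have hcl2 := K0.cls_eq_of_equivalent (Cycle.equivalent_of_close hr a2 b2 a4 b4 (K := K)
    ((hQ q).trans (by linarith [norm_nonneg e, norm_nonneg f]))
    ((hQ f).trans (by linarith [norm_nonneg e, norm_nonneg f]))
    ((mul_le_mul_of_nonneg_left hqf (by positivity)).trans_lt hKε))
  have hfin : ∀ {y : Matrix ι ι (Unitization ℂ (WeylAlgebra V 1))} (h : ι → Fock V),
      matAct fockPlus (P N * y) h = h → ∀ i, h i ∈ fockTrunc V N := fun h hh i => by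
    rw [← hh, matAct_mul, matAct_ampl, fockPlus_inr, fockRep_fockProj]
    exact Submodule.starProjection_apply_mem _ _
  obtain ⟨r1, hr1⟩ := exists_cls_eq_repK (V := V) (c := ⟨ι, r, hr, P N * q, a1, a3⟩)
    (fst_mul_eq_zero (Or.inl (hP0 N))) hfin
  obtain ⟨r2, hr2⟩ := exists_cls_eq_repK (V := V) (c := ⟨ι, r, hr, P N * f, b1, b3⟩)
    (fst_mul_eq_zero (Or.inl (hP0 N))) hfin
  rw [hcl1, ha, hb, hr1, hr2, hcl2, add_sub_add_right_eq_sub, ← map_sub]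
  exact ⟨_, rfl⟩

theorem vacK_surjective : Function.Surjective (vacK V) := by
  rintro ⟨x, hx⟩
  have h1 : ∀ y : K0 (unitAct (weylAct (V := V) 1)), y - scalarK (weylAct (V := V) 1) y ∈
      (repK (vacProj_idem (V := V)) vacProj_invariant).range := by
    intro y
    let R := (repK (vacProj_idem (V := V)) vacProj_invariant).range
    have h2 : (QuotientAddGroup.mk' R).comp
        (AddMonoidHom.id _ - scalarK (weylAct (V := V) 1)) = 0 := K0.hom_ext fun c =>
      (QuotientAddGroup.eq_zero_iff _).2 (cls_sub_mem_range c)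
    exact (QuotientAddGroup.eq_zero_iff _).1 (DFunLike.congr_fun h2 y)
  have h3 : scalarK (weylAct (V := V) 1) x = 0 := by
    have h4 : scalarK (weylAct (V := V) 1) x = K0.map
        (Algebra.ofId ℂ (Unitization ℂ (WeylAlgebra V 1)))
        (fun g b => ((unitAct (weylAct (V := V) 1) g).commutes b).symm)
        (augmentation (weylAct (V := V) 1) x) := (K0.map_map _ _ _ _ _ _).symm
    rw [h4, show augmentation (weylAct (V := V) 1) x = 0 from hx, map_zero]
  obtain ⟨r, hr⟩ := h1 x
  rw [h3, sub_zero] at hr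
  exact ⟨r, Subtype.ext hr⟩

variable (V) in
/-- The Bargmann–Fock isomorphism. -/
def fockEquiv : NK0 (weylAct (V := V) 1) ≃+ RRing (V ≃ₗᵢ[ℂ] V) :=
  (AddEquiv.ofBijective (vacK V) ⟨vacK_injective, vacK_surjective⟩).symm

theorem fockEquiv_vacK (r : RRing (V ≃ₗᵢ[ℂ] V)) : fockEquiv V (vacK V r) = r :=
  (AddEquiv.ofBijective (vacK V) ⟨vacK_injective, vacK_surjective⟩).symm_apply_apply r

end Surjective

/-! ## The Koszul complex -/

section Koszul

set_option linter.unusedSectionVars false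

open Filter Topology InnerProductSpace TensorProduct

variable {V : Type*} [NormedAddCommGroup V] [InnerProductSpace ℂ V] [FiniteDimensional ℂ V]
  [MeasurableSpace V] [BorelSpace V]

attribute [local instance] InnerProductSpace.complexToReal

variable (V) in
/-- Polynomials in the coordinates of an orthonormal basis. -/
abbrev Poly : Type := MvPolynomial (Fin (Module.finrank ℂ V)) ℂ

variable (V) in
/-- The Koszul complex `Sym V ⊗ Λ V`. -/
abbrev Kos : Type _ := Poly V ⊗[ℂ] Lam V

/-- The linear polynomial given by a vector. -/
def linPoly : V →ₗ[ℂ] Poly V :=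
  ∑ i, ((innerSL ℂ (stdOrthonormalBasis ℂ V i) : V →L[ℂ] ℂ) : V →ₗ[ℂ] ℂ).smulRight
    (MvPolynomial.X i : Poly V)

theorem linPoly_apply (v : V) : linPoly v =
    ∑ i, (inner ℂ (stdOrthonormalBasis ℂ V i) v : ℂ) • (MvPolynomial.X i : Poly V) := by
  simp [linPoly]

theorem linPoly_basis (i : Fin (Module.finrank ℂ V)) :
    linPoly (stdOrthonormalBasis ℂ V i) = MvPolynomial.X i := by
  rw [linPoly_apply, Finset.sum_eq_single i]
  · simp
  · intro j _ h
    rw [(stdOrthonormalBasis ℂ V).inner_eq_zero h, zero_smul]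
  · simp

/-- Multiplication by a vector in the symmetric algebra. -/
def symMul (v : V) : Module.End ℂ (Kos V) :=
  TensorProduct.map (LinearMap.mulLeft ℂ (linPoly v)) LinearMap.id

/-- Multiplication by a vector in the exterior algebra. -/
def extMul (v : V) : Module.End ℂ (Kos V) :=
  TensorProduct.map LinearMap.id (LinearMap.mulLeft ℂ (ExteriorAlgebra.ι ℂ v))

theorem symMul_tmul (v : V) (p : Poly V) (w : Lam V) :
    symMul v (p ⊗ₜ w) = (linPoly v * p) ⊗ₜ[ℂ] w := rfl

theorem extMul_tmul (v : V) (p : Poly V) (w : Lam V) :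
    extMul v (p ⊗ₜ w) = p ⊗ₜ[ℂ] (ExteriorAlgebra.ι ℂ v * w) := rfl

/-- The contraction by a vector. -/
def contraction (v : V) : Module.End ℂ (Lam V) :=
  clifford v - LinearMap.mulLeft ℂ (ExteriorAlgebra.ι ℂ v)

theorem contraction_apply (v : V) (w : Lam V) :
    contraction v w = clifford v w - ExteriorAlgebra.ι ℂ v * w := rfl

theorem contraction_one (v : V) : contraction v 1 = 0 := by
  rw [contraction_apply, clifford_one, mul_one, sub_self]

theorem ι_mul_ι_mul (v w : V) (x : Lam V) : ExteriorAlgebra.ι ℂ v * (ExteriorAlgebra.ι ℂ w * x) =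
    -(ExteriorAlgebra.ι ℂ w * (ExteriorAlgebra.ι ℂ v * x)) := by
  rw [← mul_assoc, ← mul_assoc, ← neg_mul]
  congr 1
  exact eq_neg_of_add_eq_zero_left (ExteriorAlgebra.ι_add_mul_swap v w)

theorem contraction_ι_mul (z v : V) (x : Lam V) :
    contraction z (ExteriorAlgebra.ι ℂ v * x) =
      (inner ℂ z v : ℂ) • x - ExteriorAlgebra.ι ℂ v * contraction z x := by
  rw [contraction_apply, contraction_apply, clifford_ι_mul, ι_mul_ι_mul z v, mul_sub]
  abel

variable (V) in
/-- The sum of the Koszul differential and the exterior differential. -/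
def koszul : Module.End ℂ (Kos V) :=
  ∑ i, (TensorProduct.map (MvPolynomial.pderiv i : Derivation ℂ (Poly V) (Poly V)).toLinearMap
      (LinearMap.mulLeft ℂ (ExteriorAlgebra.ι ℂ (stdOrthonormalBasis ℂ V i))) +
    TensorProduct.map (LinearMap.mulLeft ℂ (MvPolynomial.X i))
      (contraction (stdOrthonormalBasis ℂ V i)))

theorem koszul_tmul (p : Poly V) (w : Lam V) : koszul V (p ⊗ₜ w) =
    ∑ i, (MvPolynomial.pderiv i p ⊗ₜ[ℂ] (ExteriorAlgebra.ι ℂ (stdOrthonormalBasis ℂ V i) * w) +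
      (MvPolynomial.X i * p) ⊗ₜ[ℂ] contraction (stdOrthonormalBasis ℂ V i) w) := by
  rw [koszul, LinearMap.sum_apply]
  rfl

variable (V) in
/-- The vacuum vector of the Koszul complex. -/
def kosOne : Kos V := 1 ⊗ₜ 1

theorem koszul_kosOne : koszul V (kosOne V) = 0 := by
  rw [kosOne, koszul_tmul]
  refine Finset.sum_eq_zero fun i _ => ?_
  rw [contraction_one, tmul_zero, Derivation.map_one_eq_zero, zero_tmul, add_zero]

theorem pderiv_linPoly (i : Fin (Module.finrank ℂ V)) (v : V) :
    MvPolynomial.pderiv i (linPoly v) =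
      MvPolynomial.C (inner ℂ (stdOrthonormalBasis ℂ V i) v) := by
  rw [linPoly_apply, map_sum, Finset.sum_eq_single i]
  · rw [Derivation.map_smul, MvPolynomial.pderiv_X_self, MvPolynomial.C_eq_smul_one]
  · intro j _ h
    rw [Derivation.map_smul, MvPolynomial.pderiv_X_of_ne h, smul_zero]
  · simp

theorem koszul_symMul (v : V) (t : Kos V) :
    koszul V (symMul v t) = symMul v (koszul V t) + extMul v t := by
  induction t using TensorProduct.induction_on with
  | zero => simp only [map_zero, add_zero]
  | add x y hx hy => simp only [map_add, hx, hy]; abel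
  | tmul p w =>
    have h : ∑ i, (inner ℂ (stdOrthonormalBasis ℂ V i) v : ℂ) •
        ExteriorAlgebra.ι ℂ (stdOrthonormalBasis ℂ V i) = ExteriorAlgebra.ι ℂ v := by
      simp only [← map_smul, ← map_sum]
      rw [(stdOrthonormalBasis ℂ V).sum_repr' v]
    rw [symMul_tmul, koszul_tmul, koszul_tmul, extMul_tmul, ← h, Finset.sum_mul, tmul_sum, map_sum,
      ← Finset.sum_add_distrib]
    refine Finset.sum_congr rfl fun i _ => ?_
    rw [map_add, symMul_tmul, symMul_tmul, Derivation.leibniz, pderiv_linPoly, add_tmul,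
      smul_eq_mul, smul_eq_mul, mul_comm p, ← MvPolynomial.smul_eq_C_mul, smul_mul_assoc,
      smul_tmul, mul_left_comm]
    abel

theorem koszul_extMul (v : V) (t : Kos V) :
    koszul V (extMul v t) = symMul v t - extMul v (koszul V t) := by
  induction t using TensorProduct.induction_on with
  | zero => simp only [map_zero, sub_zero]
  | add x y hx hy => simp only [map_add, hx, hy]; abel
  | tmul p w =>
    rw [symMul_tmul, extMul_tmul, koszul_tmul, koszul_tmul, linPoly_apply, Finset.sum_mul, sum_tmul,
      map_sum, ← Finset.sum_sub_distrib]
    refine Finset.sum_congr rfl fun i _ => ?_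
    rw [map_add, extMul_tmul, extMul_tmul, contraction_ι_mul, ι_mul_ι_mul _ v, tmul_neg, tmul_sub,
      tmul_smul, smul_mul_assoc, smul_tmul']
    abel

theorem kos_induction {q : Kos V → Prop} (one : q (kosOne V))
    (add : ∀ s t, q s → q t → q (s + t)) (smul : ∀ (c : ℂ) t, q t → q (c • t))
    (sym : ∀ v t, q t → q (symMul v t)) (ext : ∀ v t, q t → q (extMul v t)) (t : Kos V) : q t := by
  induction t using TensorProduct.induction_on with
  | zero =>
    rw [← zero_smul ℂ (kosOne V)]
    exact smul 0 _ one
  | add x y hx hy => exact add x y hx hy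
  | tmul p w =>
    induction p using MvPolynomial.induction_on with
    | C a =>
      rw [MvPolynomial.C_eq_smul_one, ← smul_tmul']
      refine smul a _ ?_
      refine lam_induction (p := fun w => q ((1 : Poly V) ⊗ₜ[ℂ] w)) one (fun x y hx hy => ?_)
        (fun c x hx => ?_) (fun v x hx => ext v _ hx) w
      · rw [tmul_add]
        exact add _ _ hx hy
      · rw [tmul_smul]
        exact smul c _ hx
    | add p p' hp hp' =>
      rw [add_tmul]
      exact add _ _ hp hp'
    | mul_X p i hp =>
      rw [mul_comm, ← linPoly_basis]
      exact sym _ _ hp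

/-- The action of the unitary group on polynomials. -/
def polyAct (u : V ≃ₗᵢ[ℂ] V) : Poly V →ₐ[ℂ] Poly V :=
  MvPolynomial.aeval fun i => linPoly (u (stdOrthonormalBasis ℂ V i))

theorem polyAct_linPoly (u : V ≃ₗᵢ[ℂ] V) (v : V) : polyAct u (linPoly v) = linPoly (u v) := by
  rw [linPoly_apply, map_sum]
  simp only [map_smul, polyAct, MvPolynomial.aeval_X]
  simp only [← map_smul, ← map_sum]
  rw [(stdOrthonormalBasis ℂ V).sum_repr' v]

/-- The action of the unitary group on the Koszul complex. -/
def kosAct (u : V ≃ₗᵢ[ℂ] V) : Module.End ℂ (Kos V) :=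
  TensorProduct.map (polyAct u).toLinearMap (lamAct u)

theorem kosAct_tmul (u : V ≃ₗᵢ[ℂ] V) (p : Poly V) (w : Lam V) :
    kosAct u (p ⊗ₜ w) = polyAct u p ⊗ₜ[ℂ] lamAct u w := rfl

theorem kosAct_kosOne (u : V ≃ₗᵢ[ℂ] V) : kosAct u (kosOne V) = kosOne V := by
  rw [kosOne, kosAct_tmul, map_one, lamAct_one]

theorem kosAct_symMul (u : V ≃ₗᵢ[ℂ] V) (v : V) (t : Kos V) :
    kosAct u (symMul v t) = symMul (u v) (kosAct u t) := by
  induction t using TensorProduct.induction_on with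
  | zero => simp only [map_zero]
  | add x y hx hy => simp only [map_add, hx, hy]
  | tmul p w => rw [symMul_tmul, kosAct_tmul, map_mul, polyAct_linPoly, kosAct_tmul, symMul_tmul]

theorem kosAct_extMul (u : V ≃ₗᵢ[ℂ] V) (v : V) (t : Kos V) :
    kosAct u (extMul v t) = extMul (u v) (kosAct u t) := by
  induction t using TensorProduct.induction_on with
  | zero => simp only [map_zero]
  | add x y hx hy => simp only [map_add, hx, hy]
  | tmul p w => rw [extMul_tmul, kosAct_tmul, lamAct_ι_mul, kosAct_tmul, extMul_tmul]

theorem kosAct_koszul (u : V ≃ₗᵢ[ℂ] V) (t : Kos V) :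
    kosAct u (koszul V t) = koszul V (kosAct u t) := by
  refine kos_induction (q := fun t => kosAct u (koszul V t) = koszul V (kosAct u t)) ?_
    (fun s t hs ht => ?_) (fun c t ht => ?_) (fun v t ht => ?_) (fun v t ht => ?_) t
  · rw [koszul_kosOne, kosAct_kosOne, koszul_kosOne, map_zero]
  · simp only [map_add, hs, ht]
  · simp only [map_smul, ht]
  · rw [koszul_symMul, map_add, kosAct_symMul, kosAct_symMul, koszul_symMul, kosAct_extMul, ht]
  · rw [koszul_extMul, map_sub, kosAct_symMul, kosAct_extMul, kosAct_extMul, koszul_extMul, ht]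

variable (V) in
/-- The part of degree `n` of the Koszul complex. -/
def kosDeg : ℕ → Submodule ℂ (Kos V)
  | 0 => Submodule.span ℂ {kosOne V}
  | n + 1 => LinearMap.eqLocus (koszul V * koszul V) (((n + 1 : ℕ) : ℂ) • 1) ⊓
      LinearMap.eqLocus (kosAct (rot V)) (Complex.exp Complex.I ^ (n + 1) • 1)

theorem koszul_koszul {n : ℕ} {t : Kos V} (ht : t ∈ kosDeg V n) :
    koszul V (koszul V t) = (n : ℂ) • t := by
  cases n with
  | zero =>
    obtain ⟨c, rfl⟩ := Submodule.mem_span_singleton.1 ht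
    rw [map_smul, koszul_kosOne, smul_zero, map_zero, Nat.cast_zero, zero_smul]
  | succ n => exact ht.1

theorem kosAct_rot {n : ℕ} {t : Kos V} (ht : t ∈ kosDeg V n) :
    kosAct (rot V) t = Complex.exp Complex.I ^ n • t := by
  cases n with
  | zero =>
    obtain ⟨c, rfl⟩ := Submodule.mem_span_singleton.1 ht
    rw [map_smul, kosAct_kosOne, pow_zero, one_smul]
  | succ n => exact ht.2

theorem koszul_mem_kosDeg {n : ℕ} {t : Kos V} (ht : t ∈ kosDeg V (n + 1)) :
    koszul V t ∈ kosDeg V (n + 1) := by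
  have h1 := koszul_koszul ht
  have h2 := kosAct_rot ht
  refine ⟨?_, ?_⟩
  · change koszul V (koszul V (koszul V t)) = ((n + 1 : ℕ) : ℂ) • koszul V t
    rw [h1, map_smul]
  · change kosAct (rot V) (koszul V t) = Complex.exp Complex.I ^ (n + 1) • koszul V t
    rw [kosAct_koszul, h2, map_smul]

theorem symMul_mem_kosDeg (v : V) {n : ℕ} {t : Kos V} (ht : t ∈ kosDeg V n) :
    symMul v t ∈ kosDeg V (n + 1) := by
  have h1 := koszul_koszul ht
  have h2 := kosAct_rot ht
  refine ⟨?_, ?_⟩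
  · change koszul V (koszul V (symMul v t)) = ((n + 1 : ℕ) : ℂ) • symMul v t
    rw [koszul_symMul, map_add, koszul_symMul, koszul_extMul, h1, map_smul]
    push_cast
    module
  · change kosAct (rot V) (symMul v t) = Complex.exp Complex.I ^ (n + 1) • symMul v t
    rw [kosAct_symMul, h2, rot_apply, pow_succ]
    have h3 : symMul (Complex.exp Complex.I • v) = Complex.exp Complex.I • symMul v := by
      refine TensorProduct.ext' fun p w => ?_
      rw [LinearMap.smul_apply, symMul_tmul, symMul_tmul, map_smul, smul_mul_assoc, smul_tmul']
    rw [h3, LinearMap.smul_apply, map_smul, smul_smul, mul_comm]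

theorem extMul_mem_kosDeg (v : V) {n : ℕ} {t : Kos V} (ht : t ∈ kosDeg V n) :
    extMul v t ∈ kosDeg V (n + 1) := by
  have h1 := koszul_koszul ht
  have h2 := kosAct_rot ht
  refine ⟨?_, ?_⟩
  · change koszul V (koszul V (extMul v t)) = ((n + 1 : ℕ) : ℂ) • extMul v t
    rw [koszul_extMul, map_sub, koszul_symMul, koszul_extMul, h1, map_smul]
    push_cast
    module
  · change kosAct (rot V) (extMul v t) = Complex.exp Complex.I ^ (n + 1) • extMul v t
    rw [kosAct_extMul, h2, rot_apply, pow_succ]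
    have h3 : extMul (Complex.exp Complex.I • v) = Complex.exp Complex.I • extMul v := by
      refine TensorProduct.ext' fun p w => ?_
      rw [LinearMap.smul_apply, extMul_tmul, extMul_tmul, map_smul, smul_mul_assoc, tmul_smul]
    rw [h3, LinearMap.smul_apply, map_smul, smul_smul, mul_comm]

theorem iSup_kosDeg : ⨆ n, kosDeg V n = ⊤ := by
  have h1 : ∀ T : Module.End ℂ (Kos V), (∀ n, ∀ t ∈ kosDeg V n, T t ∈ kosDeg V (n + 1)) →
      ∀ t ∈ ⨆ n, kosDeg V n, T t ∈ ⨆ n, kosDeg V n := fun T hT t ht => by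
    have h2 : (⨆ n, kosDeg V n) ≤ (⨆ n, kosDeg V n).comap T :=
      iSup_le fun n t ht => Submodule.mem_iSup_of_mem (n + 1) (hT n t ht)
    exact h2 ht
  refine eq_top_iff.2 fun t _ => ?_
  exact kos_induction (q := fun t => t ∈ ⨆ n, kosDeg V n)
    (Submodule.mem_iSup_of_mem 0 (Submodule.mem_span_singleton_self _)) (fun _ _ => add_mem)
    (fun c _ => Submodule.smul_mem _ c) (fun v => h1 _ fun n _ => symMul_mem_kosDeg v)
    (fun v => h1 _ fun n _ => extMul_mem_kosDeg v) t

theorem koszul_map_projEven (t : Kos V) : koszul V (TensorProduct.map LinearMap.id (projEven V) t) =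
    TensorProduct.map LinearMap.id (projOdd V) (koszul V t) := by
  have h1 : ∀ (v : V) (w : Lam V), ExteriorAlgebra.ι ℂ v * projEven V w =
      projOdd V (ExteriorAlgebra.ι ℂ v * w) := fun v w => by
    simp only [projEven, projOdd, LinearMap.smul_apply, LinearMap.add_apply, LinearMap.sub_apply,
      Module.End.one_apply, grading_ι_mul, mul_smul_comm, mul_add, sub_neg_eq_add]
  have h2 : ∀ (v : V) (w : Lam V), contraction v (projEven V w) =
      projOdd V (contraction v w) := fun v w => by
    rw [contraction_apply, contraction_apply, map_sub, h1]
    congr 1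
    simp only [projEven, projOdd, LinearMap.smul_apply, LinearMap.add_apply, LinearMap.sub_apply,
      Module.End.one_apply, grading_clifford, map_smul, map_add, sub_neg_eq_add]
  induction t using TensorProduct.induction_on with
  | zero => simp only [map_zero]
  | add x y hx hy => simp only [map_add, hx, hy]
  | tmul p w =>
    rw [map_tmul, koszul_tmul, koszul_tmul, map_sum]
    refine Finset.sum_congr rfl fun i _ => ?_
    rw [map_add, map_tmul, map_tmul, LinearMap.id_apply, LinearMap.id_apply, LinearMap.id_apply,
      h1, h2]

theorem projEven_eq : projEven V = 1 - projOdd V := by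
  rw [projEven, projOdd]
  module

theorem koszul_map_projOdd (t : Kos V) : koszul V (TensorProduct.map LinearMap.id (projOdd V) t) =
    TensorProduct.map LinearMap.id (projEven V) (koszul V t) := by
  have h : ∀ t : Kos V, TensorProduct.map LinearMap.id (projEven V) t =
      t - TensorProduct.map LinearMap.id (projOdd V) t := fun t => by
    rw [projEven_eq, sub_eq_add_neg, TensorProduct.map_add_right, ← neg_one_smul ℂ (projOdd V),
      TensorProduct.map_smul_right, LinearMap.add_apply, LinearMap.smul_apply, neg_one_smul,
      ← sub_eq_add_neg]
    congr 1
    exact DFunLike.congr_fun (TensorProduct.map_id (R := ℂ) (M := Poly V) (N := Lam V)) t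
  have h1 := koszul_map_projEven t
  rw [h, map_sub, sub_eq_iff_eq_add] at h1
  rw [h]
  exact eq_sub_of_add_eq' h1.symm

end Koszul

/-! ## The Koszul complex in the Fock space -/

section KoszulFock

set_option linter.unusedSectionVars false

open Filter Topology InnerProductSpace TensorProduct

variable {V : Type*} [NormedAddCommGroup V] [InnerProductSpace ℂ V] [FiniteDimensional ℂ V]
  [MeasurableSpace V] [BorelSpace V]

attribute [local instance] InnerProductSpace.complexToReal

variable (V) in
/-- Polynomials as antiholomorphic functions. -/
def polyEval : Poly V →ₐ[ℂ] (V → ℂ) :=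
  MvPolynomial.aeval fun i x => (inner ℂ x (stdOrthonormalBasis ℂ V i) : ℂ)

theorem polyEval_X (i : Fin (Module.finrank ℂ V)) (x : V) :
    polyEval V (MvPolynomial.X i) x = inner ℂ x (stdOrthonormalBasis ℂ V i) := by
  rw [polyEval, MvPolynomial.aeval_X]

theorem polyEval_linPoly (v x : V) : polyEval V (linPoly v) x = inner ℂ x v := by
  rw [linPoly_apply, map_sum, Finset.sum_apply,
    ← (stdOrthonormalBasis ℂ V).sum_inner_mul_inner x v]
  refine Finset.sum_congr rfl fun i _ => ?_
  rw [map_smul, Pi.smul_apply, polyEval_X, smul_eq_mul, mul_comm]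

theorem polyEval_linPoly_mul (v : V) (p : Poly V) :
    polyEval V (linPoly v * p) = mulInner v (polyEval V p) := by
  ext x
  rw [map_mul, Pi.mul_apply, polyEval_linPoly]
  rfl

theorem polyEval_mem (p : Poly V) : polyEval V p ∈ entireSpace V := by
  induction p using MvPolynomial.induction_on with
  | C a =>
    rw [MvPolynomial.C_eq_smul_one, map_smul, map_one]
    exact Submodule.smul_mem _ _ (antiPoly_le_entireSpace 0 (Submodule.subset_span rfl))
  | add p q hp hq =>
    rw [map_add]
    exact add_mem hp hq
  | mul_X p i hp =>
    rw [mul_comm, ← linPoly_basis, polyEval_linPoly_mul]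
    exact mulInner_mem_entireSpace _ hp

theorem polyEval_injective : Function.Injective (polyEval V) := by
  rw [injective_iff_map_eq_zero]
  intro p hp
  refine MvPolynomial.funext fun a => ?_
  let x : V := ∑ i, star (a i) • stdOrthonormalBasis ℂ V i
  have hx : ∀ i, inner ℂ x (stdOrthonormalBasis ℂ V i) = a i := fun i => by
    rw [(stdOrthonormalBasis ℂ V).orthonormal.inner_left_fintype]
    exact star_star _
  have h : (Pi.evalAlgHom ℂ (fun _ : V => ℂ) x).comp (polyEval V) = MvPolynomial.aeval a :=
    MvPolynomial.algHom_ext fun i => by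
      rw [AlgHom.comp_apply, MvPolynomial.aeval_X, Pi.evalAlgHom_apply, polyEval_X, hx]
  have h2 := DFunLike.congr_fun h p
  rw [AlgHom.comp_apply, hp, map_zero] at h2
  rw [map_zero, ← MvPolynomial.coe_aeval_eq_eval]
  exact h2.symm

variable (V) in
/-- Polynomials as elements of the Fock space. -/
def polyFock : Poly V →ₗ[ℂ] Fock V :=
  (fockOf V).comp ((polyEval V).toLinearMap.codRestrict (entireSpace V) polyEval_mem)

theorem polyFock_apply (p : Poly V) : polyFock V p = fockOf V ⟨polyEval V p, polyEval_mem p⟩ := rfl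

theorem polyFock_injective : Function.Injective (polyFock V) := fun _ _ h =>
  polyEval_injective (congrArg Subtype.val (fockOf_injective h))

theorem polyFock_polyAct (u : V ≃ₗᵢ[ℂ] V) (p : Poly V) :
    polyFock V (polyAct u p) = fockAct u (polyFock V p) := by
  rw [polyFock_apply, polyFock_apply, fockAct_fockOf]
  congr 1
  refine Subtype.ext (funext fun x => ?_)
  have h : (Pi.evalAlgHom ℂ (fun _ : V => ℂ) x).comp ((polyEval V).comp (polyAct u)) =
      (Pi.evalAlgHom ℂ (fun _ : V => ℂ) (u.symm x)).comp (polyEval V) :=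
    MvPolynomial.algHom_ext fun i => by
      rw [AlgHom.comp_apply, AlgHom.comp_apply, AlgHom.comp_apply, polyAct, MvPolynomial.aeval_X,
        Pi.evalAlgHom_apply, Pi.evalAlgHom_apply, polyEval_linPoly, polyEval_X,
        ← u.inner_map_map (u.symm x), u.apply_symm_apply]
  exact DFunLike.congr_fun h p

theorem fockTrunc_le_range (N : ℕ) : fockTrunc V N ≤ LinearMap.range (polyFock V) := by
  induction N with
  | zero => exact bot_le
  | succ N ih =>
    refine sup_le ih ?_
    rintro _ ⟨f, hf, rfl⟩
    have h : ∃ p, polyEval V p = f.1 := by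
      refine antiPoly_induction (p := fun _ f => ∃ p, polyEval V p = f) ⟨1, map_one _⟩
        (fun _ => ⟨0, map_zero _⟩) ?_ ?_ ?_ hf
      · rintro _ _ _ ⟨p, rfl⟩ ⟨q, rfl⟩
        exact ⟨p + q, map_add _ _ _⟩
      · rintro _ c _ ⟨p, rfl⟩
        exact ⟨c • p, map_smul _ _ _⟩
      · rintro _ v _ ⟨p, rfl⟩
        exact ⟨linPoly v * p, polyEval_linPoly_mul v p⟩
    obtain ⟨p, hp⟩ := h
    exact ⟨p, congrArg (fockOf V) (Subtype.ext hp)⟩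

variable (V) in
/-- The Koszul complex as a subspace of `H ⊗ Λ`. -/
def kosFock : Kos V →ₗ[ℂ] (LamIndex V → Fock V) :=
  LinearMap.pi fun i => (polyFock V).comp ((Finsupp.lapply i).comp
    (TensorProduct.equivFinsuppOfBasisRight (Module.finBasis ℂ (Lam V))).toLinearMap)

theorem kosFock_apply (t : Kos V) (i : LamIndex V) : kosFock V t i =
    polyFock V (TensorProduct.equivFinsuppOfBasisRight (Module.finBasis ℂ (Lam V)) t i) := rfl

theorem kosFock_tmul (p : Poly V) (w : Lam V) (i : LamIndex V) :
    kosFock V (p ⊗ₜ w) i = (Module.finBasis ℂ (Lam V)).repr w i • polyFock V p := by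
  rw [kosFock_apply, TensorProduct.equivFinsuppOfBasisRight_apply_tmul_apply, map_smul]

theorem kosFock_injective : Function.Injective (kosFock V) := fun _ _ h =>
  (TensorProduct.equivFinsuppOfBasisRight (Module.finBasis ℂ (Lam V))).injective
    (Finsupp.ext fun i => polyFock_injective (congrFun h i))

theorem mem_range_kosFock {x : LamIndex V → Fock V}
    (hx : ∀ i, x i ∈ LinearMap.range (polyFock V)) : ∃ t, kosFock V t = x := by
  choose p hp using hx
  refine ⟨(TensorProduct.equivFinsuppOfBasisRight (Module.finBasis ℂ (Lam V))).symm
    (Finsupp.equivFunOnFinite.symm p), funext fun i => ?_⟩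
  rw [kosFock_apply, LinearEquiv.apply_symm_apply]
  exact hp i

theorem repr_lamMatrix (q : Module.End ℂ (Lam V)) (w : Lam V) (i : LamIndex V) :
    (Module.finBasis ℂ (Lam V)).repr (q w) i =
      ∑ j, lamMatrix q i j * (Module.finBasis ℂ (Lam V)).repr w j :=
  (congrFun (LinearMap.toMatrix_mulVec_repr (Module.finBasis ℂ (Lam V))
    (Module.finBasis ℂ (Lam V)) q w) i).symm

variable (V) in
/-- The matrix form of the representation on `Λ`. -/
def lamRho : (V ≃ₗᵢ[ℂ] V) →* Matrix (LamIndex V) (LamIndex V) ℂ :=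
  (lamMatrix (V := V)).toAlgHom.toRingHom.toMonoidHom.comp lamAct

theorem kosFock_kosAct (u : V ≃ₗᵢ[ℂ] V) (t : Kos V) :
    kosFock V (kosAct u t) = twist (fockEnd V) (lamRho V) u (kosFock V t) := by
  induction t using TensorProduct.induction_on with
  | zero => rw [map_zero, map_zero, map_zero]
  | add x y hx hy => rw [map_add, map_add, map_add, hx, hy, map_add]
  | tmul p w =>
    refine funext fun i => ?_
    rw [kosAct_tmul, kosFock_tmul, repr_lamMatrix, polyFock_polyAct, Finset.sum_smul]
    refine Eq.trans ?_ (twist_apply _ _ _ _ _).symm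
    refine Finset.sum_congr rfl fun j _ => ?_
    rw [kosFock_tmul, map_smul, mul_smul]
    rfl

variable (V) in
/-- The Fock space as a module over `C₀(V)⁺`, through the value at the origin. -/
def fockZero : Unitization ℂ C₀(V, ℂ) →ₐ[ℂ] Module.End ℂ (Fock V) :=
  (Algebra.ofId ℂ (Module.End ℂ (Fock V))).comp (evalPlus 0)

theorem fockZero_apply (b : Unitization ℂ C₀(V, ℂ)) (f : Fock V) :
    fockZero V b f = evalPlus 0 b • f := rfl

theorem covariant_fockZero : Covariant (unitAct (c0Act (V := V))) (fockEnd V) (fockZero V) :=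
  fun u b f => by
    rw [fockZero_apply, fockZero_apply, map_smul]
    congr 1
    rw [evalPlus_apply, evalPlus_apply, unitAct_apply, unitMap_fst, unitMap_snd]
    congr 1
    exact congrArg b.snd (map_zero u.symm).symm

theorem matAct_fockZero {e : Matrix (LamIndex V) (LamIndex V) (Unitization ℂ C₀(V, ℂ))}
    {q : Module.End ℂ (Lam V)} (h : e.map (evalPlus 0) = lamMatrix q) (t : Kos V) :
    matAct (fockZero V) e (kosFock V t) = kosFock V (TensorProduct.map LinearMap.id q t) := by
  induction t using TensorProduct.induction_on with
  | zero => simp only [map_zero]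
  | add x y hx hy => simp only [map_add, hx, hy]
  | tmul p w =>
    refine funext fun i => ?_
    rw [map_tmul, LinearMap.id_apply, kosFock_tmul, repr_lamMatrix, Finset.sum_smul, matAct_apply]
    refine Finset.sum_congr rfl fun j _ => ?_
    rw [kosFock_tmul, fockZero_apply, mul_smul, ← h]
    rfl

theorem bottFunction_zero : bottFunction (0 : V) = projEven V := by
  have h : clifford (0 : V) = 0 := left_eq_add.1 ((congrArg clifford (add_zero (0 : V)).symm).trans
    (clifford_add 0 0))
  simp [bottFunction, h]

theorem matAct_bott (t : Kos V) : matAct (fockZero V) (bottIdempotent (V := V)).e (kosFock V t) =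
    kosFock V (TensorProduct.map LinearMap.id (projEven V) t) := by
  refine matAct_fockZero ?_ t
  rw [← bottFunction_zero]
  exact map_evalPlus_functionMatrix 0 (bottCoeff_apply · · 0)

theorem matAct_odd (t : Kos V) : matAct (fockZero V) (oddIdempotent (V := V)).e (kosFock V t) =
    kosFock V (TensorProduct.map LinearMap.id (projOdd V) t) :=
  matAct_fockZero (map_evalPlus_functionMatrix 0 (by simp)) t

theorem mem_of_mem_maxGenEigenspace {M : Type*} [AddCommGroup M] [Module ℂ M]
    {f : Module.End ℂ M} {ζ : ℕ → ℂ} (hζ : Function.Injective ζ) {W : ℕ → Submodule ℂ M}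
    (hW : ∀ n, W n ≤ f.maxGenEigenspace (ζ n)) {μ : ℂ} {x : M} (hx : x ∈ f.maxGenEigenspace μ)
    (hxW : x ∈ ⨆ n, W n) (h0 : x ≠ 0) : ∃ n, μ = ζ n ∧ x ∈ W n := by
  have hd := Submodule.disjoint_def.1 (f.independent_maxGenEigenspace μ)
  have hle : ∀ n, μ ≠ ζ n → W n ≤ ⨆ ν, ⨆ (_ : ν ≠ μ), f.maxGenEigenspace ν := fun n hn =>
    (hW n).trans (le_iSup₂_of_le (ζ n) hn.symm le_rfl)
  by_cases hμ : ∃ n, μ = ζ n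
  · obtain ⟨n, rfl⟩ := hμ
    refine ⟨n, rfl, ?_⟩
    rw [iSup_split_single W n] at hxW
    obtain ⟨a, ha, b, hb, rfl⟩ := Submodule.mem_sup.1 hxW
    have hb0 : b = 0 := by
      refine hd b ?_ ((iSup₂_le fun m hm => hle m fun h => hm (hζ h).symm) hb)
      have := sub_mem hx (hW n ha)
      rwa [add_sub_cancel_left] at this
    rwa [hb0, add_zero]
  · push Not at hμ
    exact absurd (hd x hx ((iSup_le fun n => hle n (hμ n)) hxW)) h0

theorem kosFock_mem_block {n : ℕ} {t : Kos V} (ht : t ∈ kosDeg V n) :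
    kosFock V t ∈ block (fockEnd V) (lamRho V) (rot V)
      (Complex.exp Complex.I ^ n) := by
  refine Module.End.mem_maxGenEigenspace _ _ _ |>.2 ⟨1, ?_⟩
  rw [pow_one, LinearMap.sub_apply, LinearMap.smul_apply, ← kosFock_kosAct, kosAct_rot ht, map_smul]
  exact sub_self _

theorem exists_kosDeg {μ : ℂ} {x : LamIndex V → Fock V}
    (hx : x ∈ block (fockEnd V) (lamRho V) (rot V) μ) (h0 : x ≠ 0) :
    ∃ n, μ = Complex.exp Complex.I ^ n ∧ ∃ t ∈ kosDeg V n, kosFock V t = x := by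
  obtain ⟨N, hN⟩ := exists_block_le_fockTrunc (lamRho V) μ
  obtain ⟨t, rfl⟩ := mem_range_kosFock fun i => fockTrunc_le_range N (hN x hx i)
  refine mem_of_mem_maxGenEigenspace injective_exp_I_pow
    (W := fun n => (kosDeg V n).map (kosFock V)) (fun n => ?_) hx ?_ h0
  · rintro _ ⟨t, ht, rfl⟩
    exact kosFock_mem_block ht
  · rw [← Submodule.map_iSup, iSup_kosDeg]
    exact ⟨t, trivial, rfl⟩

theorem repCls_eq_zero {G M : Type*} [Group G] [TopologicalSpace G] [AddCommGroup M] [Module ℂ M]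
    {τ : G →* Module.End ℂ M} {X : Submodule ℂ M} (hX : IsSubRep τ X) (h : ∀ x ∈ X, x = 0) :
    repCls hX = 0 :=
  (repCls_eq_of_eq hX IsSubRep.bot (eq_bot_iff.2 h)).trans repCls_bot

theorem twist_trivial {G : Type*} [Group G] [TopologicalSpace G] (g : G) :
    twist (1 : G →* Module.End ℂ ℂ) (Rep.trivial (G := G)).ρ g = 1 := by
  refine LinearMap.ext fun x => funext fun i => ?_
  refine (twist_apply _ _ _ _ _).trans ?_
  change ∑ j : Unit, (1 : Matrix Unit Unit ℂ) i j • x j = x i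
  rw [Fintype.sum_unique]
  change (1 : Matrix Unit Unit ℂ) () () • x () = x ()
  rw [Matrix.one_apply_eq, one_smul]

theorem weightCls_bott (μ : ℂ) :
    weightCls isGraded_fock covariant_fockZero μ (bottIdempotent (V := V)) =
      weightCls isGraded_fock covariant_fockZero μ (oddIdempotent (V := V)) +
        repWeight rot_central μ (RRing.cls Rep.trivial) := by
  obtain ⟨X, hX, hcX, hbX, hE⟩ : ∃ (X : Submodule ℂ (LamIndex V → Fock V))
      (hX : IsSubRep (twist (fockEnd V) (lamRho V)) X),
      weightCls isGraded_fock covariant_fockZero μ (bottIdempotent (V := V)) = repCls hX ∧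
      (∀ x ∈ X, x ∈ block (fockEnd V) (lamRho V) (rot V) μ) ∧
      ∀ {t}, kosFock V t ∈ X ↔ kosFock V t ∈ block (fockEnd V) (lamRho V) (rot V) μ ∧
        TensorProduct.map LinearMap.id (projEven V) t = t :=
    ⟨_, isSubRep_weightRange isGraded_fock covariant_fockZero μ bottIdempotent, rfl,
      fun _ hx => hx.1, fun {t} => and_congr_right fun _ =>
        (Eq.congr_left (matAct_bott t)).trans kosFock_injective.eq_iff⟩
  obtain ⟨Y, hY, hcY, hbY, hO⟩ : ∃ (X : Submodule ℂ (LamIndex V → Fock V))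
      (hX : IsSubRep (twist (fockEnd V) (lamRho V)) X),
      weightCls isGraded_fock covariant_fockZero μ (oddIdempotent (V := V)) = repCls hX ∧
      (∀ x ∈ X, x ∈ block (fockEnd V) (lamRho V) (rot V) μ) ∧
      ∀ {t}, kosFock V t ∈ X ↔ kosFock V t ∈ block (fockEnd V) (lamRho V) (rot V) μ ∧
        TensorProduct.map LinearMap.id (projOdd V) t = t :=
    ⟨_, isSubRep_weightRange isGraded_fock covariant_fockZero μ oddIdempotent, rfl,
      fun _ hx => hx.1, fun {t} => and_congr_right fun _ =>
        (Eq.congr_left (matAct_odd t)).trans kosFock_injective.eq_iff⟩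
  rw [hcX, hcY]
  obtain ⟨p, hp⟩ := (kosFock V).exists_leftInverse_of_injective
    (LinearMap.ker_eq_bot.2 kosFock_injective)
  have hp' : ∀ t, p (kosFock V t) = t := fun t => DFunLike.congr_fun hp t
  rw [repWeight_cls]
  by_cases hμ : μ = 1
  · subst hμ
    have key : ∀ x ∈ block (fockEnd V) (lamRho V) (rot V) 1,
        ∃ c : ℂ, x = kosFock V (c • kosOne V) := by
      intro x hx
      by_cases h0 : x = 0
      · exact ⟨0, by rw [zero_smul, map_zero, h0]⟩
      obtain ⟨n, hn, t, ht, rfl⟩ := exists_kosDeg hx h0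
      have hn0 : (0 : ℕ) = n := injective_exp_I_pow ((pow_zero _).trans hn)
      subst hn0
      obtain ⟨c, rfl⟩ := Submodule.mem_span_singleton.1 ht
      exact ⟨c, rfl⟩
    have h1 : TensorProduct.map LinearMap.id (projEven V) (kosOne V) = kosOne V := by
      rw [kosOne, map_tmul, projEven, LinearMap.smul_apply, LinearMap.add_apply, Module.End.one_apply,
        grading_one, ← two_smul ℂ (1 : Lam V), smul_smul]
      norm_num
    have h2 : TensorProduct.map LinearMap.id (projOdd V) (kosOne V) = 0 := by
      rw [kosOne, map_tmul, projOdd, LinearMap.smul_apply, LinearMap.sub_apply, Module.End.one_apply,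
        grading_one, sub_self, smul_zero, tmul_zero]
    have h3 : kosOne V ≠ 0 := fun h => by
      refine one_ne_zero (α := Lam V) ((Module.finBasis ℂ (Lam V)).repr.map_eq_zero_iff.1
        (Finsupp.ext fun i => ?_))
      have h4 := congrFun (congrArg (kosFock V) h) i
      rw [kosOne, kosFock_tmul, map_zero] at h4
      exact (smul_eq_zero.1 h4).resolve_right fun h5 =>
        one_ne_zero (polyFock_injective (h5.trans (map_zero _).symm))
    obtain ⟨φ, hφ⟩ := Module.Projective.exists_dual_eq_one ℂ h3
    rw [repCls_eq_zero hY ?_, zero_add]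
    · refine repCls_eq_of_maps _ _ (LinearMap.pi fun _ => φ.comp p)
        ((LinearMap.toSpanSingleton ℂ _ (kosFock V (kosOne V))).comp (LinearMap.proj ()))
        ?_ ?_ ?_ ?_ ?_
      · intro x hx
        refine Module.End.mem_maxGenEigenspace _ _ _ |>.2 ⟨1, ?_⟩
        rw [twist_trivial, one_smul, sub_self, pow_one]
        rfl
      · intro y hy
        change y () • kosFock V (kosOne V) ∈ _
        rw [← map_smul]
        refine hE.2 ⟨?_, by rw [map_smul, h1]⟩
        rw [← pow_zero (Complex.exp Complex.I)]
        exact kosFock_mem_block (Submodule.smul_mem _ _ (Submodule.mem_span_singleton_self _))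
      · intro x hx
        obtain ⟨c, rfl⟩ := key x (hbX x hx)
        change φ (p (kosFock V (c • kosOne V))) • kosFock V (kosOne V) = _
        rw [hp', map_smul, hφ, map_smul, smul_eq_mul, mul_one]
      · intro y hy
        refine funext fun i => ?_
        change φ (p (y () • kosFock V (kosOne V))) = y ()
        rw [map_smul, hp', map_smul, hφ, smul_eq_mul, mul_one]
      · intro u x hx
        obtain ⟨c, rfl⟩ := key x (hbX x hx)
        rw [twist_trivial, Module.End.one_apply]
        refine congrArg _ ((kosFock_kosAct u _).symm.trans ?_)
        rw [map_smul, kosAct_kosOne]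
    · intro x hx
      obtain ⟨c, rfl⟩ := key x (hbY x hx)
      have h4 := (hO.1 hx).2
      rw [map_smul, h2, smul_zero] at h4
      rw [← h4, map_zero]
  · rw [repCls_eq_zero ((isGraded_one rot_central).sub Rep.trivial.ρ Rep.trivial.continuous_ρ μ)
      ?_, add_zero]
    · by_cases hn : ∃ n : ℕ, μ = Complex.exp Complex.I ^ n
      · obtain ⟨n, rfl⟩ := hn
        obtain ⟨n, rfl⟩ : ∃ m, n = m + 1 := Nat.exists_eq_succ_of_ne_zero fun h => hμ (by
          rw [h, pow_zero])
        have key : ∀ x ∈ block (fockEnd V) (lamRho V) (rot V)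
            (Complex.exp Complex.I ^ (n + 1)), ∃ t ∈ kosDeg V (n + 1), kosFock V t = x := by
          intro x hx
          by_cases h0 : x = 0
          · exact ⟨0, zero_mem _, by rw [map_zero, h0]⟩
          obtain ⟨m, hm, t, ht⟩ := exists_kosDeg hx h0
          exact ⟨t, injective_exp_I_pow hm ▸ ht⟩
        let D := (kosFock V).comp ((koszul V).comp p)
        have hD : ∀ t, D (kosFock V t) = kosFock V (koszul V t) := fun t =>
          congrArg (fun t => kosFock V (koszul V t)) (hp' t)
        have hn0 : ((n + 1 : ℕ) : ℂ) ≠ 0 := Nat.cast_ne_zero.2 n.succ_ne_zero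
        have hDD : ∀ t ∈ kosDeg V (n + 1), D (D (kosFock V t)) = ((n + 1 : ℕ) : ℂ) • kosFock V t :=
          fun t ht => by rw [hD, hD, koszul_koszul ht, map_smul]
        refine repCls_eq_of_maps _ _ D ((((n + 1 : ℕ) : ℂ)⁻¹) • D) ?_ ?_ ?_ ?_ ?_
        · intro x hx
          obtain ⟨t, ht, rfl⟩ := key x (hbX x hx)
          rw [hD]
          refine hO.2 ⟨kosFock_mem_block (koszul_mem_kosDeg ht), ?_⟩
          rw [← koszul_map_projEven, (hE.1 hx).2]
        · intro x hx
          obtain ⟨t, ht, rfl⟩ := key x (hbY x hx)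
          refine Submodule.smul_mem _ _ ?_
          rw [hD]
          refine hE.2 ⟨kosFock_mem_block (koszul_mem_kosDeg ht), ?_⟩
          rw [← koszul_map_projOdd, (hO.1 hx).2]
        · intro x hx
          obtain ⟨t, ht, rfl⟩ := key x (hbX x hx)
          rw [LinearMap.smul_apply, hDD t ht, inv_smul_smul₀ hn0]
        · intro x hx
          obtain ⟨t, ht, rfl⟩ := key x (hbY x hx)
          rw [LinearMap.smul_apply, map_smul, hDD t ht, inv_smul_smul₀ hn0]
        · intro u x hx
          obtain ⟨t, ht, rfl⟩ := key x (hbX x hx)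
          have h5 := kosFock_kosAct u (koszul V t)
          rw [kosAct_koszul] at h5
          refine (congrArg D (kosFock_kosAct u t).symm).trans ?_
          rw [hD, h5, hD]
      · have h0 : ∀ x ∈ block (fockEnd V) (lamRho V) (rot V) μ, x = 0 := by
          intro x hx
          by_contra h0
          obtain ⟨n, h, -⟩ := exists_kosDeg hx h0
          exact hn ⟨n, h⟩
        rw [repCls_eq_zero hX fun x hx => h0 x (hbX x hx),
          repCls_eq_zero hY fun x hx => h0 x (hbY x hx)]
    · intro x hx
      obtain ⟨k, hk⟩ := Module.End.mem_maxGenEigenspace _ _ _ |>.1 hx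
      have h1 : (1 : Module.End ℂ ((Rep.trivial (G := V ≃ₗᵢ[ℂ] V)).ι → ℂ)) - μ • 1 =
          (1 - μ) • 1 :=
        ((sub_smul (1 : ℂ) μ _).trans (congrArg (· - _) (one_smul ℂ _))).symm
      rw [twist_trivial, h1, smul_pow, one_pow, LinearMap.smul_apply, Module.End.one_apply] at hk
      exact (smul_eq_zero.1 hk).resolve_left (pow_ne_zero k (sub_ne_zero.2 (Ne.symm hμ)))

end KoszulFock

/-! ## The image of the Bott generator -/

section Comparison

set_option linter.unusedSectionVars false

open Filter Topology InnerProductSpace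

variable {V : Type*} [NormedAddCommGroup V] [InnerProductSpace ℂ V] [FiniteDimensional ℂ V]
  [MeasurableSpace V] [BorelSpace V]

attribute [local instance] InnerProductSpace.complexToReal

/-- Two finite-dimensional representations that embed into each other, one of them equivariantly,
are isomorphic. -/
theorem repCls_eq_of_injective {G M M' : Type*} [Group G] [TopologicalSpace G] [AddCommGroup M]
    [Module ℂ M] [AddCommGroup M'] [Module ℂ M'] {τ : G →* Module.End ℂ M}
    {τ' : G →* Module.End ℂ M'} {X : Submodule ℂ M} {Y : Submodule ℂ M'} (hX : IsSubRep τ X)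
    (hY : IsSubRep τ' Y) (a : M →ₗ[ℂ] M') (b : M' →ₗ[ℂ] M) (ha : ∀ x ∈ X, a x ∈ Y)
    (hb : ∀ y ∈ Y, b y ∈ X) (ha0 : ∀ x ∈ X, a x = 0 → x = 0) (hb0 : ∀ y ∈ Y, b y = 0 → y = 0)
    (hg : ∀ g, ∀ x ∈ X, a (τ g x) = τ' g (a x)) : repCls hX = repCls hY := by
  have := hX.fin
  have := hY.fin
  have h1 : Function.Injective (a.restrict ha) := by
    rw [injective_iff_map_eq_zero]
    exact fun x hx => Subtype.ext (ha0 x x.2 (congrArg Subtype.val hx))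
  have h2 : Function.Injective (b.restrict hb) := by
    rw [injective_iff_map_eq_zero]
    exact fun x hx => Subtype.ext (hb0 x x.2 (congrArg Subtype.val hx))
  exact repCls_congr hX hY (LinearMap.linearEquivOfInjective (a.restrict ha) h1
    (le_antisymm (LinearMap.finrank_le_finrank_of_injective h1)
      (LinearMap.finrank_le_finrank_of_injective h2))) fun g x => hg g x x.2

theorem eventually_norm_le {E F S : Type*} [NormedAddCommGroup E] [NormedSpace ℂ E]
    [FiniteDimensional ℂ E] [NormedAddCommGroup F] [NormedSpace ℂ F] {l : Filter S}
    (T : S → E →ₗ[ℂ] F) (h : ∀ x, Tendsto (fun s => T s x) l (𝓝 0)) :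
    ∀ᶠ s in l, ∀ x, ‖T s x‖ ≤ 2⁻¹ * ‖x‖ := by
  let b := Module.finBasis ℂ E
  let c : Fin (Module.finrank ℂ E) → ℝ := fun i => ‖LinearMap.toContinuousLinearMap (b.coord i)‖
  have h1 : Tendsto (fun s => ∑ i, c i * ‖T s (b i)‖) l (𝓝 0) := by
    have h2 := tendsto_finsetSum Finset.univ fun i _ => ((h (b i)).norm.const_mul (c i))
    simpa using h2
  filter_upwards [h1.eventually (Iio_mem_nhds (show (0 : ℝ) < 2⁻¹ by norm_num))] with s hs x
  calc ‖T s x‖ = ‖∑ i, b.repr x i • T s (b i)‖ := by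
        conv_lhs => rw [← b.sum_repr x, map_sum]
        simp only [map_smul]
    _ ≤ ∑ i, c i * ‖T s (b i)‖ * ‖x‖ := by
        refine (norm_sum_le _ _).trans (Finset.sum_le_sum fun i _ => ?_)
        rw [norm_smul, mul_right_comm]
        gcongr
        exact (LinearMap.toContinuousLinearMap (b.coord i)).le_opNorm x
    _ = (∑ i, c i * ‖T s (b i)‖) * ‖x‖ := (Finset.sum_mul _ _ _).symm
    _ ≤ 2⁻¹ * ‖x‖ := by
        gcongr

/-- The parameter of the deformation tends to zero. -/
def toZero : Filter (Set.Ioc (0 : ℝ) 1) := Filter.comap Subtype.val (𝓝 0)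

instance : toZero.NeBot := by
  refine Filter.comap_neBot fun t ht => ?_
  obtain ⟨ε, hε, h⟩ := Metric.mem_nhds_iff.1 ht
  refine ⟨⟨min (ε / 2) 1, by positivity, min_le_right _ _⟩, h ?_⟩
  rw [Metric.mem_ball, Real.dist_0_eq_abs, abs_of_pos (by positivity)]
  exact (min_le_left _ _).trans_lt (by linarith)

theorem tendsto_fockPlus (b : Unitization ℂ (SectionAlgebra V)) (f : Fock V) :
    Tendsto (fun s => fockPlus (unitMap (evalOne V) (unitMap (dilSection s) b)) f) toZero
      (𝓝 (fockZero V (unitMap (evalZero V) b) f)) := by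
  simp only [fockPlus_apply, fockZero_apply, evalPlus_apply, unitMap_fst, unitMap_snd, add_smul]
  refine tendsto_const_nhds.add (Metric.tendsto_nhds.2 fun ε hε => ?_)
  obtain ⟨δ, hδ, h⟩ := tendsto_evalOne_dilSection b.snd f.1 (half_pos hε)
  have h1 : ∀ᶠ s : Set.Ioc (0 : ℝ) 1 in toZero, (s : ℝ) < δ :=
    Filter.tendsto_comap.eventually (Iio_mem_nhds hδ)
  filter_upwards [h1] with s hs
  rw [dist_eq_norm]
  exact (h s hs).trans_lt (half_lt_self hε)

theorem evalOne_unit_act (u : V ≃ₗᵢ[ℂ] V) (b : Unitization ℂ (SectionAlgebra V)) :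
    unitMap (evalOne V) (unitAct sectionAct u b) =
      unitAct (weylAct (V := V) 1) u (unitMap (evalOne V) b) := unitMap_act evalOne_act u b

theorem evalZero_unit_act (u : V ≃ₗᵢ[ℂ] V) (b : Unitization ℂ (SectionAlgebra V)) :
    unitMap (evalZero V) (unitAct sectionAct u b) =
      unitAct (c0Act (V := V)) u (unitMap (evalZero V) b) := unitMap_act evalZero_act u b

/-- The values at `0` and `1` of a class of the field have the same weights. -/
theorem weightCls_evalOne (μ : ℂ) (c : Cycle (unitAct (sectionAct (V := V)))) :
    weightCls isGraded_fock (covariant_fock.comp (unitMap (evalOne V)) evalOne_unit_act) μ c =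
      weightCls isGraded_fock
        (covariant_fockZero.comp (unitMap (evalZero V)) evalZero_unit_act) μ c := by
  set π₁ := (fockPlus (V := V)).comp (unitMap (evalOne V))
  set π₀ := (fockZero V).comp (unitMap (evalZero V))
  have hπ₁ : Covariant (unitAct (sectionAct (V := V))) (fockEnd V) π₁ :=
    covariant_fock.comp (unitMap (evalOne V)) evalOne_unit_act
  have hπ₀ : Covariant (unitAct (sectionAct (V := V))) (fockEnd V) π₀ :=
    covariant_fockZero.comp (unitMap (evalZero V)) evalZero_unit_act
  let B := block (fockEnd V) c.ρ (rot V) μ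
  have hB : FiniteDimensional ℂ B := (isGraded_fock.sub c.ρ c.continuous_ρ μ).fin
  let E : Set.Ioc (0 : ℝ) 1 → (c.ι → Fock V) →ₗ[ℂ] (c.ι → Fock V) := fun s =>
    matAct π₁ (c.e.map (unitMap (dilSection s)))
  let F : (c.ι → Fock V) →ₗ[ℂ] (c.ι → Fock V) := matAct π₀ c.e
  have hlim : ∀ x : B, Tendsto (fun s => ((E s - F).comp B.subtype) x) toZero (𝓝 0) := fun x => by
    have h1 : Tendsto (fun s => E s x.1) toZero (𝓝 (F x.1)) :=
      tendsto_pi_nhds.2 fun i => tendsto_finsetSum _ fun j _ => tendsto_fockPlus (c.e i j) (x.1 j)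
    have h2 := h1.sub_const (F x.1)
    rw [sub_self] at h2
    exact h2
  obtain ⟨s, hs⟩ := (eventually_norm_le _ hlim).exists
  have hs' : ∀ x ∈ B, ‖E s x - F x‖ ≤ 2⁻¹ * ‖x‖ := fun x hx => hs ⟨x, hx⟩
  have key₁ : ∀ x ∈ B, E s x = x → F x = 0 → x = 0 := fun x hx h1 h0 => by
    have h2 := hs' x hx
    rw [h1, h0, sub_zero] at h2
    exact norm_le_zero_iff.1 (by linarith)
  have key₀ : ∀ x ∈ B, F x = x → E s x = 0 → x = 0 := fun x hx h1 h0 => by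
    have h2 := hs' x hx
    rw [h1, h0, zero_sub, norm_neg] at h2
    exact norm_le_zero_iff.1 (by linarith)
  have hEi := (sectionContraction.cycle s c).invariant
  have hEE : ∀ x, E s (E s x) = E s x := fun x => by
    have h1 := (matAct_mul π₁ (c.e.map (unitMap (dilSection s)))
      (c.e.map (unitMap (dilSection s))) x).symm
    refine h1.trans ?_
    rw [← Matrix.map_mul, c.idem]
  have hFF : ∀ x, F (F x) = F x := fun x =>
    (matAct_mul π₀ c.e c.e x).symm.trans (by rw [c.idem])
  rw [← weightCls_eq_of_equivalent _ _ μ (sectionContraction.equivalent s c)]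
  refine repCls_eq_of_injective (isSubRep_weightRange isGraded_fock hπ₁ μ
    (sectionContraction.cycle s c)) (isSubRep_weightRange isGraded_fock hπ₀ μ c) F (E s) ?_ ?_ ?_ ?_ ?_
  · exact fun x hx => ⟨matAct_mem_block hπ₀ c.invariant hx.1, hFF x⟩
  · exact fun x hx => ⟨matAct_mem_block hπ₁ hEi hx.1, hEE x⟩
  · exact fun x hx => key₁ x hx.1 hx.2
  · exact fun x hx => key₀ x hx.1 hx.2
  · exact fun u x _ => (hπ₀.twist_matAct (c.invariant u) x).symm

theorem weightK_evalOne (μ : ℂ) (y : NK0 (sectionAct (V := V))) :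
    weightK isGraded_fock covariant_fock μ (evalOneK V y).1 =
      weightK isGraded_fock covariant_fockZero μ (evalZeroK V y).1 := by
  have h1 : weightK isGraded_fock (covariant_fock.comp (unitMap (evalOne V)) evalOne_unit_act) μ =
      weightK isGraded_fock
        (covariant_fockZero.comp (unitMap (evalZero V)) evalZero_unit_act) μ :=
    K0.hom_ext fun c => by rw [weightK_cls, weightK_cls, weightCls_evalOne]
  refine (weightK_map isGraded_fock covariant_fock _ evalOne_unit_act μ y.1).trans ?_
  rw [h1]
  exact (weightK_map isGraded_fock covariant_fockZero _ evalZero_unit_act μ y.1).symm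

theorem fockEquiv_bott (h : Function.Bijective (evalZeroK V)) :
    fockEquiv V (deformationMap h (bott V)) = RRing.cls Rep.trivial := by
  obtain ⟨y, hy⟩ := h.2 (bott V)
  have h1 : deformationMap h (bott V) = evalOneK V y := by
    rw [← hy]
    exact congrArg (evalOneK V) ((AddEquiv.ofBijective (evalZeroK V) h).symm_apply_apply y)
  obtain ⟨r, hr⟩ := vacK_surjective (evalOneK V y)
  rw [h1, ← hr, fockEquiv_vacK]
  refine eq_of_repWeight_eq rot_central fun μ => ?_
  have h2 : weightK isGraded_fock covariant_fock μ (evalOneK V y).1 = repWeight rot_central μ r := by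
    rw [← hr]
    exact weightK_repK μ r
  rw [← h2, weightK_evalOne, hy]
  change weightK isGraded_fock covariant_fockZero μ
    (K0.cls bottIdempotent - K0.cls oddIdempotent) = _
  rw [map_sub, weightK_cls, weightK_cls, weightCls_bott, add_sub_cancel_left]

end Comparison

end

end WeylBott

theorem mainTheorem5 {V : Type*} [NormedAddCommGroup V] [InnerProductSpace ℂ V]
    [FiniteDimensional ℂ V] [MeasurableSpace V] [BorelSpace V] :
    ∃ h : Function.Bijective (WeylBott.evalZeroK V),
      ∃ Φ : WeylBott.NK0 (WeylBott.weylAct (V := V) 1) ≃+ WeylBott.RRing (V ≃ₗᵢ[ℂ] V),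
        WeylBott.IsBargmannFock Φ ∧
        (∀ Ψ : WeylBott.NK0 (WeylBott.weylAct (V := V) 1) →+ WeylBott.RRing (V ≃ₗᵢ[ℂ] V),
          WeylBott.IsBargmannFock Ψ → Ψ = Φ.toAddMonoidHom) ∧
        Φ (WeylBott.deformationMap h (WeylBott.bott V)) =
          WeylBott.RRing.cls WeylBott.Rep.trivial := by
  refine ⟨WeylBott.evalZeroK_bijective, WeylBott.fockEquiv V,
    WeylBott.isBargmannFock_of_comp_vacK WeylBott.fockEquiv_vacK, fun Ψ hΨ => ?_,
    WeylBott.fockEquiv_bott _⟩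
  refine AddMonoidHom.ext fun x => ?_
  obtain ⟨r, rfl⟩ := WeylBott.vacK_surjective x
  exact (hΨ.comp_vacK r).trans (WeylBott.fockEquiv_vacK r).symm
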